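/- **Setting.** For each integer $N\ge 0$ let $s=s(N)$ be a real number with $s(N)>N$, and assume that $c:=\lim_{N\to\infty}(s-N)\in[1,\infty]$ exists. The random polynomial of degree $N$ is the monic real polynomial $z^N+\sum_{n<N}b_nz^n$ whose coefficient vector $b\in\mathbb R^N$ has density proportional to $M(b)^{-s}$ with respect to Lebesgue measure, where $M$ is the Mahler measure. Put $\mathbb T=\{|z|=1\}$, $\mathbb O=\{|z|>1\}$, $\iota(z)=i\,\mathrm{sgn}(\mathrm{Im}\,z)$, $w(z)=\max\{1,|z|\}^{-s}$, and let $$\epsilon f(u)=\tfrac12\int_{\mathbb R}f(t)\,\mathrm{sgn}(t-u)\,dt\ \ (u\in\mathbb R),\qquad \epsilon f(u)=\iota(u)f(\overline u)\ \ (u\in\mathbb C\setminus\mathbb R).$$ **The kernel.** Let $$\langle f|g\rangle=\int_{\mathbb R}\int_{\mathbb R}w(x)w(y)f(x)g(y)\,\mathrm{sgn}(y-x)\,dx\,dy-2i\int_{\mathbb C}w(z)^2\,\overline{f(z)}g(z)\,\mathrm{sgn}(\mathrm{Im}\,z)\,dA(z),$$ where $dA$ is area measure. For even $N$ let $U=[\langle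 z^m|z^n\rangle]_{m,n=0}^{N-1}$; for odd $N$ let $U$ be this matrix bordered by a last column with entries $\sigma_m=\int_{\mathbb R}w(x)x^m\,dx$, a last row with entries $-\sigma_n$, and corner entry $0$. Let $[\mu_{m,n}]=U^{-1}$. Put $\varphi_m(u)=w(u)u^m$ and $\psi_m=\epsilon\varphi_m$ for $0\le m<N$ and, when $N$ is odd, $\varphi_N=0$ and $\psi_N=\tfrac12\chi_{\mathbb R}$ for the bordering index. The matrix kernel $\mathbf K_N(u,v)$ of the Pfaffian process of roots is $$\mathbf K_N(u,v)=\begin{bmatrix}-2\sum\mu_{m,n}\varphi_m(u)\varphi_n(v)&-2\sum\mu_{m,n}\varphi_m(u)\psi_n(v)\\-2\sum\mu_{m,n}\psi_m(u)\varphi_n(v)&-2\sum\mu_{m,n}\psi_m(u)\psi_n(v)+\tfrac12\mathrm{sgn}(u-v)\end{bmatrix},$$ where $\mathrm{sgn}(u-v)=0$ unless $u,v$ are both real. The phase-renormalised kernel $\widehat{\mathbf K}_N(u,v)$ is obtained by multiplying the $(1,1)$, $(1,2)$, $(2,1)$, $(2,2)$ entries of $\mathbf K_N(u,v)$ by $$\Big(\frac{|uv|}{uv}\Big)^N,\quad\Big(\frac{|uv|}{u\overline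 v}\Big)^N,\quad\Big(\frac{|uv|}{\overline uv}\Big)^N,\quad\Big(\frac{|uv|}{\overline u\,\overline v}\Big)^N$$ respectively. **The limit.** Let $\sqrt{z^2-1}$ be the branch holomorphic in $\mathbb C\setminus[-1,1]$ with $\sqrt{z^2-1}\sim z$ at $\infty$. For $c<\infty$ set $$B(u,v)=\frac1\pi\Big[c+\frac1{uv-1}\Big]\frac1{|uv|^c}\,\frac1{uv-1}\,\frac{v-u}{\sqrt{u^2-1}\sqrt{v^2-1}},\qquad \gamma_c=\frac1{\sqrt\pi}\frac{\Gamma(\frac{c+1}2)}{\Gamma(\frac c2)},$$ and for real $x,y$ with $|x|,|y|>1$ $$A_{\mathbb O}(x,y)=\int_{\mathrm{sgn}(x)\infty}^x\Big(\int_{\mathrm{sgn}(y)\infty}^yB(u,v)\,dv\Big)du+\gamma_c\Big(\mathrm{sgn}(x)\int_{\mathrm{sgn}(y)\infty}^y-\mathrm{sgn}(y)\int_{\mathrm{sgn}(x)\infty}^x\Big)\frac{du}{|u|^c\sqrt{u^2-1}}.$$ Let $DA$ and $AD$ denote the derivatives of $A$ in the first and in the second variable. For complex arguments in $\mathbb O$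 let $DA_{\mathbb O}D(u,v)=B(u,v)$ and, for real $y$, $$DA_{\mathbb O}(z,y)=\int_{\mathrm{sgn}(y)\infty}^yB(z,v)\,dv-\frac{\gamma_c\,\mathrm{sgn}(y)}{|z|^c\sqrt{z^2-1}}.$$ When $c=\infty$ set $A_{\mathbb O}$, $DA_{\mathbb O}$ and $DA_{\mathbb O}D$ identically equal to $0$. For real $x,y$ and non-real $z,w$ put $$\mathbf K[A](x,y)=\begin{bmatrix}DAD(x,y)&-DA(x,y)\\-AD(x,y)&A(x,y)+\frac12\mathrm{sgn}(x-y)\end{bmatrix},\qquad \mathbf K[A](z,y)=\begin{bmatrix}DAD(z,y)&-DA(z,y)\\\iota(z)DAD(\overline z,y)&-\iota(z)DA(\overline z,y)\end{bmatrix},$$ $$\mathbf K[A](y,z)=-\mathbf K[A](z,y)^{\mathsf T},\qquad \mathbf K[A](z,w)=\begin{bmatrix}DAD(z,w)&\iota(w)DAD(z,\overline w)\\\iota(z)DAD(\overline z,w)&\iota(z)\iota(w)DAD(\overline z,\overline w)\end{bmatrix}.$$ **Theorem.** As $N\to\infty$, $\widehat{\mathbf K}_N(u,v)\to\mathbf K[A_{\mathbb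 O}](u,v)$ locally uniformly in $\mathbb O\times\mathbb O$. Moreover, if $c<\infty$ and $S\subset\mathbb O$ is a Borel set of positive area that is bounded away from $\mathbb T$, then the expected number of roots in $S$ of the random polynomial of degree $N$ converges, as $N\to\infty$, to a (finite) positive number. -/

import Mathlib

open Filter Topology MeasureTheory Set

noncomputable section

namespace MahlerEnsemble

/- ## The random polynomials -/

/-- The monic real polynomial `z ^ N + ∑ b n z ^ n` of degree `N`, viewed in `ℂ[z]`. -/
def monicPoly {N : ℕ} (b : Fin N → ℝ) : Polynomial ℂ :=
  Polynomial.X ^ N + ∑ n : Fin N, Polynomial.C ((b n : ℝ) : ℂ) * Polynomial.X ^ (n : ℕ)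

/-- Unnormalised density of the coefficient vector: Mahler measure to the power `-s`. -/
def coeffDensity (s : ℝ) {N : ℕ} (b : Fin N → ℝ) : ENNReal :=
  ENNReal.ofReal ((monicPoly b).mahlerMeasure ^ (-s))

open Classical in
/-- Number of roots (with multiplicity) lying in the set `S`. -/
def rootCount {N : ℕ} (b : Fin N → ℝ) (S : Set ℂ) : ℕ :=
  (monicPoly b).roots.countP (fun z => z ∈ S)

/-- Expected number of roots in `S` of the random polynomial of degree `N` whose coefficient
vector has density proportional to `M ^ (-s)` with respect to Lebesgue measure on `ℝ ^ N`. -/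
def expectedRoots (N : ℕ) (s : ℝ) (S : Set ℂ) : ENNReal :=
  (∫⁻ b : Fin N → ℝ, (rootCount b S : ENNReal) * coeffDensity s b) /
    ∫⁻ b : Fin N → ℝ, coeffDensity s b

/- ## The matrix kernel at finite `N` -/

/-- `sgn`, as a complex number. -/
def sgn (x : ℝ) : ℂ := ((Real.sign x : ℝ) : ℂ)

/-- The function `ι(z) = i sgn (Im z)`. -/
def iota (z : ℂ) : ℂ := Complex.I * sgn z.im

/-- The weight `max {1, |z|} ^ (-s)`. -/
def weight (s : ℝ) (z : ℂ) : ℝ := (max 1 ‖z‖) ^ (-s)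

/-- The skew form coming from the real roots. -/
def skewReal (s : ℝ) (f g : ℂ → ℂ) : ℂ :=
  ∫ x : ℝ, ∫ y : ℝ, (weight s x : ℂ) * (weight s y : ℂ) * f x * g y * sgn (y - x)

/-- The skew form coming from the complex roots. -/
def skewComplex (s : ℝ) (f g : ℂ → ℂ) : ℂ :=
  -2 * Complex.I *
    ∫ z : ℂ, (weight s z : ℂ) ^ 2 * (starRingEnd ℂ) (f z) * g z * sgn z.im

/-- The sum of the two skew forms. -/
def skewForm (s : ℝ) (f g : ℂ → ℂ) : ℂ := skewReal s f g + skewComplex s f g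

/-- The operator `ε`: half of the integral against `sgn (t - u)` at a real point `u`, and
`ι(u) f(conj u)` at a non-real point. -/
def epsOp (f : ℂ → ℂ) (u : ℂ) : ℂ :=
  if u.im = 0 then (1 / 2) * ∫ t : ℝ, f t * sgn (t - u.re)
  else iota u * f ((starRingEnd ℂ) u)

/-- The skew Gram matrix of the monic polynomials `1, z, …, z ^ (N - 1)`. When `N` is odd it is
bordered by one more row and column (index `N`), which hold the integrals over `ℝ` of the weighted
monomials, so that its size is always even. -/
def gram (N : ℕ) (s : ℝ) : Matrix (Fin (N + N % 2)) (Fin (N + N % 2)) ℂ :=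
  Matrix.of fun i j =>
    if (i : ℕ) < N then
      if (j : ℕ) < N then skewForm s (fun z => z ^ (i : ℕ)) (fun z => z ^ (j : ℕ))
      else ∫ x : ℝ, (weight s x : ℂ) * (x : ℂ) ^ (i : ℕ)
    else
      if (j : ℕ) < N then - ∫ x : ℝ, (weight s x : ℂ) * (x : ℂ) ^ (j : ℕ)
      else 0

/-- Weighted monomials; the bordering index (`i = N`, only for odd `N`) carries the zero
function. -/
def phi (N : ℕ) (s : ℝ) (i : Fin (N + N % 2)) (u : ℂ) : ℂ :=
  if (i : ℕ) < N then (weight s u : ℂ) * u ^ (i : ℕ) else 0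

open Classical in
/-- The images of the weighted monomials under `ε`; the bordering index (only for odd `N`) carries
one half of the characteristic function of `ℝ`. -/
def epsPhi (N : ℕ) (s : ℝ) (i : Fin (N + N % 2)) (u : ℂ) : ℂ :=
  if (i : ℕ) < N then epsOp (phi N s i) u else if u.im = 0 then 1 / 2 else 0

/-- `-2 ∑ μ i j f i (u) g j (v)`, where `μ` is the inverse of the (bordered) Gram matrix. -/
def kernelSum (N : ℕ) (s : ℝ) (f g : Fin (N + N % 2) → ℂ → ℂ) (u v : ℂ) : ℂ :=
  -2 * ∑ i, ∑ j, (gram N s)⁻¹ i j * f i u * g j v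

/-- `(1/2) sgn (u - v)` if both points are real, and `0` otherwise. -/
def halfSgn (u v : ℂ) : ℂ :=
  if u.im = 0 ∧ v.im = 0 then (1 / 2) * sgn (u.re - v.re) else 0

/-- The matrix kernel `K_N` of the Pfaffian point process formed by the roots: the entries are
`ϰ`, `ϰ ε`, `ε ϰ` and `ε ϰ ε + (1/2) sgn`. -/
def kernel (N : ℕ) (s : ℝ) (u v : ℂ) : Matrix (Fin 2) (Fin 2) ℂ :=
  !![kernelSum N s (phi N s) (phi N s) u v, kernelSum N s (phi N s) (epsPhi N s) u v;
     kernelSum N s (epsPhi N s) (phi N s) u v,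
     kernelSum N s (epsPhi N s) (epsPhi N s) u v + halfSgn u v]

/-- The phase-renormalised kernel. -/
def kernelHat (N : ℕ) (s : ℝ) (u v : ℂ) : Matrix (Fin 2) (Fin 2) ℂ :=
  let r : ℂ := ((‖u * v‖ : ℝ) : ℂ)
  let u₁ : ℂ := (starRingEnd ℂ) u
  let v₁ : ℂ := (starRingEnd ℂ) v
  !![(r / (u * v)) ^ N * kernel N s u v 0 0, (r / (u * v₁)) ^ N * kernel N s u v 0 1;
     (r / (u₁ * v)) ^ N * kernel N s u v 1 0, (r / (u₁ * v₁)) ^ N * kernel N s u v 1 1]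

/- ## The limit kernel outside the unit disk -/

/-- The complement `𝕆` of the closed unit disk. -/
def outside : Set ℂ := {z | 1 < ‖z‖}

/-- The branch of `√(z² - 1)` holomorphic off `[-1, 1]` and asymptotic to `z` at infinity. -/
def sqrtOut (z : ℂ) : ℂ := z * (1 - (z ^ 2)⁻¹) ^ (1 / 2 : ℂ)

/-- The limit kernel `B(u, v)`. -/
def kerB (c : ℝ) (u v : ℂ) : ℂ :=
  (1 / (Real.pi : ℂ)) * ((c : ℂ) + 1 / (u * v - 1)) * (1 / ((‖u * v‖ ^ c : ℝ) : ℂ)) *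
    (1 / (u * v - 1)) * ((v - u) / (sqrtOut u * sqrtOut v))

/-- The integral of `f` from `sgn(y) ∞` to `y`. -/
def tailInt (f : ℝ → ℂ) (y : ℝ) : ℂ :=
  if 0 < y then - ∫ t in Ioi y, f t else ∫ t in Iio y, f t

/-- The constant `Γ((c+1)/2) / (√π Γ(c/2))`. -/
def gammaRatio (c : ℝ) : ℝ :=
  (1 / Real.sqrt Real.pi) * (Real.Gamma ((c + 1) / 2) / Real.Gamma (c / 2))

/-- The function `1 / (|z| ^ c √(z² - 1))`. -/
def tailFun (c : ℝ) (z : ℂ) : ℂ := 1 / (((‖z‖ ^ c : ℝ) : ℂ) * sqrtOut z)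

open Classical in
/-- `A_𝕆(x, y)` for real arguments outside `[-1, 1]`. -/
def AO (c : EReal) (x y : ℝ) : ℂ :=
  if c = ⊤ then 0 else
    tailInt (fun u => tailInt (fun v => kerB c.toReal u v) y) x +
      (gammaRatio c.toReal : ℂ) *
        (sgn x * tailInt (fun u => tailFun c.toReal u) y -
          sgn y * tailInt (fun u => tailFun c.toReal u) x)

open Classical in
/-- `D A_𝕆 (z, y)`, the extension to a complex first argument of the partial derivative of `A_𝕆`
in its first variable. -/
def DAO (c : EReal) (z : ℂ) (y : ℝ) : ℂ :=
  if c = ⊤ then 0 else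
    tailInt (fun v => kerB c.toReal z v) y - (gammaRatio c.toReal : ℂ) * sgn y * tailFun c.toReal z

open Classical in
/-- `D A_𝕆 D (u, v)`, the extension to complex arguments of the mixed partial derivative
of `A_𝕆`. -/
def DAOD (c : EReal) (u v : ℂ) : ℂ := if c = ⊤ then 0 else kerB c.toReal u v

/-- `K[A](x, y)` for two real arguments. -/
def matRealReal (A : ℝ → ℝ → ℂ) (x y : ℝ) : Matrix (Fin 2) (Fin 2) ℂ :=
  !![deriv (fun t => deriv (fun r => A t r) y) x, - deriv (fun t => A t y) x;
     - deriv (fun r => A x r) y, A x y + (1 / 2) * sgn (x - y)]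

/-- `K[A](z, y)` for a non-real `z` and a real `y`. -/
def matComplexReal (DA : ℂ → ℝ → ℂ) (DAD : ℂ → ℂ → ℂ) (z : ℂ) (y : ℝ) :
    Matrix (Fin 2) (Fin 2) ℂ :=
  !![DAD z y, - DA z y;
     iota z * DAD ((starRingEnd ℂ) z) y, - iota z * DA ((starRingEnd ℂ) z) y]

/-- `K[A](z, w)` for two non-real arguments. -/
def matComplexComplex (DAD : ℂ → ℂ → ℂ) (z w : ℂ) : Matrix (Fin 2) (Fin 2) ℂ :=
  !![DAD z w, iota w * DAD z ((starRingEnd ℂ) w);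
     iota z * DAD ((starRingEnd ℂ) z) w,
     iota z * iota w * DAD ((starRingEnd ℂ) z) ((starRingEnd ℂ) w)]

/-- The matrix kernel `K[A](u, v)` built from `A` on real arguments and from the extensions of its
derivatives `D A` and `D A D` to complex arguments. -/
def matKernel (A : ℝ → ℝ → ℂ) (DA : ℂ → ℝ → ℂ) (DAD : ℂ → ℂ → ℂ) (u v : ℂ) :
    Matrix (Fin 2) (Fin 2) ℂ :=
  if u.im = 0 then
    if v.im = 0 then matRealReal A u.re v.re
    else - (matComplexReal DA DAD v u.re).transpose
  else
    if v.im = 0 then matComplexReal DA DAD u v.re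
    else matComplexComplex DAD u v

/-- The limit kernel `K[A_𝕆]`. -/
def limitKernel (c : EReal) : ℂ → ℂ → Matrix (Fin 2) (Fin 2) ℂ :=
  matKernel (AO c) (DAO c) (DAOD c)

end MahlerEnsemble

end

/-! The kernel is computed exactly for finite N, and only then is the limit taken. The form pairs
only exponents of opposite parity, and there the real and the complex contribution add up to
4s/((m+1)(n-m)(s-n-1)) (`skewForm_even_odd`). Sorted by parity, the Gram matrix therefore consists
of a Cauchy block and its negative transpose. The border for odd N fits the same pattern: it is one
more Cauchy column, with node s-1. Lagrange interpolation inverts a Cauchy matrix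
(`cauchy_mul_inv`), and the nodes being consecutive even and odd integers, the entries of the
inverse are products of (1/2)_n/n! and (3/2)_n/n!.

Counting exponents down from N, the phase factors turn the m-th weighted monomial into |u|^{-(s-N)}
u^{-(N-m)}. For both parities of N the renormalised kernel becomes a bilinear form plus sign
functions times a linear form (`kernelHat_eq`). The linear part comes from the border when N is odd,
and when N is even from the constant, half a line integral, which ε adds to a power. The
coefficients converge by Euler's limit for the Gamma function and are bounded uniformly in N up to
the factor s-N+1, while on |u|, |v| ≥ ρ > 1 the monomials decay geometrically. Dominated convergence
for series gives the limit `limForm`; if s-N → ∞ the factor ρ^{-(s-N)} kills both forms.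

The limiting double series is summed through two functional equations for the generating function of
p_j q_k/(2j-2k+1) (`genOne_add`, `genTwo_add`), whose antisymmetric part is B; the linear series is
the binomial series of (1-x²)^{-1/2}. On the real line ε acts as minus the tail integral, term by
term, which identifies A and its derivatives (`limitKernel_eq`).

For the number of roots one has to know that the diagonal (1,2) entry of the kernel is the density
of the roots. The area formula, applied to (root, cofactor) ↦ coefficients, expresses that density
by moments of a random polynomial of lower degree with the same s, because the Mahler measure is
multiplicative. These moments are tied to the inverse Gram matrix as follows. Lagrange interpolation
of v^m at the roots of p, integrated over p by the same area formula, yields a linear system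
(`reproducing`, `moment_system`) saying that the moments of the coefficients are the entries of the
inverse times the total mass. The sign which a real root leaves behind is removed by expanding sgn
p(x) over the real roots of p (`sign_eval_eq_sum`). Hence `expectedRoots_eq`; dominated convergence
with majorants |z|^{-3} in the plane and |x|^{-3/2} on the line gives the limit, and B(z, z̄) is
explicit enough to show that it is positive. -/

open Filter Topology MeasureTheory Set

namespace MahlerEnsemble

/- ## The area formula with multiplicities -/

section Area

variable {E : Type*} [NormedAddCommGroup E] [NormedSpace ℝ E] [FiniteDimensional ℝ E]
  [MeasurableSpace E] [BorelSpace E]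

/-- Near a point with invertible derivative A, f differs from A by a map whose Lipschitz constant is
below 1/‖A⁻¹‖, which forces injectivity; countably many such pieces suffice in finite dimension. -/
theorem exists_partition_injOn (f : E → E) (f' : E → E →L[ℝ] E) (D : Set E)
    (hf : ∀ x ∈ D, HasFDerivAt f (f' x) x) (hdet : ∀ x ∈ D, (f' x).det ≠ 0) :
    ∃ t : ℕ → Set E, Pairwise (Function.onFun Disjoint t) ∧ (∀ n, MeasurableSet (t n)) ∧
      D ⊆ ⋃ n, t n ∧ ∀ n, InjOn f (D ∩ t n) := by
  classical
  rcases D.eq_empty_or_nonempty with rfl | hne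
  · refine ⟨fun n => ∅, fun i j _ => by simp [Function.onFun], fun n => MeasurableSet.empty,
      by simp, fun n => by simp⟩
  -- The partition lemma wants a tolerance for every linear map. Its value at singular maps is
  -- irrelevant, since the maps that occur are derivatives at points of D.
  have hr : ∀ A : E →L[ℝ] E, ∃ r : NNReal, r ≠ 0 ∧ ∀ h : A.det ≠ 0, Subsingleton E ∨
      r < ‖((A.toContinuousLinearEquivOfDetNeZero h).symm : E →L[ℝ] E)‖₊⁻¹ := by
    intro A
    by_cases h : A.det ≠ 0
    · rcases subsingleton_or_nontrivial E with hE | hE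
      · exact ⟨1, one_ne_zero, fun _ => Or.inl hE⟩
      · have hpos := (A.toContinuousLinearEquivOfDetNeZero h).nnnorm_symm_pos
        refine ⟨_, (half_pos (inv_pos.2 hpos)).ne', fun _ => Or.inr (NNReal.half_lt_self ?_)⟩
        exact (inv_pos.2 hpos).ne'
    · exact ⟨1, one_ne_zero, fun h' => absurd h' h⟩
  choose r hr0 hr1 using hr
  obtain ⟨t, A, h1, h2, h3, h4, h5⟩ :=
    exists_partition_approximatesLinearOn_of_hasFDerivWithinAt f D f'
      (fun x hx => (hf x hx).hasFDerivWithinAt) r hr0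
  refine ⟨t, h1, h2, h3, fun n => ?_⟩
  obtain ⟨y, hy, hA⟩ := h5 hne n
  have hd : (A n).det ≠ 0 := by rw [hA]; exact hdet y hy
  have h4' := h4 n
  rw [← ContinuousLinearMap.coe_toContinuousLinearEquivOfDetNeZero (A n) hd] at h4'
  have := h4'.injOn (hr1 (A n) hd)
  exact this

/-- A fibre meets a set of injectivity in at most one point. Written as an extension by zero along
an embedding, the fibre sum is visibly measurable in y. -/
theorem tsum_indicator_fiber_of_injOn {α β : Type*} (f : α → β) (A : Set α) (hA : InjOn f A)
    (g : α → ENNReal) (y : β) :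
    ∑' x, (A ∩ f ⁻¹' {y}).indicator g x =
      Function.extend (A.domRestrict f) (A.domRestrict g) 0 y := by
  classical
  by_cases h : ∃ x : A, A.domRestrict f x = y
  · obtain ⟨x, rfl⟩ := h
    rw [(injOn_iff_injective.1 hA).extend_apply, tsum_eq_single (x : α)]
    · simp [Set.indicator, x.2]
    · intro x' hx'
      refine Set.indicator_of_notMem (fun hx => hx' ?_) _
      exact hA hx.1 x.2 hx.2
  · rw [Function.extend_apply' _ _ _ h]
    refine ENNReal.tsum_eq_zero.2 fun x => Set.indicator_of_notMem (fun hx => h ?_) _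
    exact ⟨⟨x, hx.1⟩, hx.2⟩

/-- The change of variables formula on each piece of a countable partition into sets of injectivity,
summed over the pieces. Working with values in [0, ∞] spares all questions of summability. -/
theorem lintegral_area (μ : Measure E) [μ.IsAddHaarMeasure] {f : E → E} {f' : E → E →L[ℝ] E}
    {D : Set E} (hD : MeasurableSet D) (hf : ∀ x ∈ D, HasFDerivAt f (f' x) x)
    (hdet : ∀ x ∈ D, (f' x).det ≠ 0) {g : E → ENNReal} (hg : Measurable g) :
    Measurable (fun y => ∑' x, (D ∩ f ⁻¹' {y}).indicator g x) ∧
    ∫⁻ x in D, ENNReal.ofReal |(f' x).det| * g x ∂μ =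
      ∫⁻ y, ∑' x, (D ∩ f ⁻¹' {y}).indicator g x ∂μ := by
  classical
  obtain ⟨t, t1, t2, t3, t4⟩ := exists_partition_injOn f f' D hf hdet
  have hm : ∀ n, MeasurableSet (D ∩ t n) := fun n => hD.inter (t2 n)
  have hU : D = ⋃ n, D ∩ t n := by rw [← inter_iUnion]; exact (inter_eq_left.2 t3).symm
  have hdisj : Pairwise (Function.onFun Disjoint fun n => D ∩ t n) := fun i j hij =>
    (t1 hij).mono inter_subset_right inter_subset_right
  have key : ∀ y, ∑' x, (D ∩ f ⁻¹' {y}).indicator g x =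
      ∑' n, Function.extend ((D ∩ t n).domRestrict f) ((D ∩ t n).domRestrict g) 0 y := by
    intro y
    simp_rw [← tsum_indicator_fiber_of_injOn f _ (t4 _) g y]
    rw [ENNReal.tsum_comm]
    refine tsum_congr fun x => ?_
    by_cases hx : x ∈ D ∩ f ⁻¹' {y}
    · obtain ⟨n, hn⟩ := mem_iUnion.1 (t3 hx.1)
      rw [tsum_eq_single n, indicator_of_mem hx, indicator_of_mem (show x ∈ D ∩ t n ∩ f ⁻¹' {y} from ⟨⟨hx.1, hn⟩, hx.2⟩)]
      intro m hm
      refine indicator_of_notMem (fun h => ?_) _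
      exact Set.disjoint_left.1 (t1 hm) h.1.2 hn
    · rw [indicator_of_notMem hx]
      refine (ENNReal.tsum_eq_zero.2 fun n => indicator_of_notMem (fun h => hx ⟨h.1.1, h.2⟩) _).symm
  have hme : ∀ n, MeasurableEmbedding ((D ∩ t n).domRestrict f) := fun n =>
    measurableEmbedding_of_fderivWithin (hm n)
      (fun x hx => (hf x hx.1).hasFDerivWithinAt) (t4 n)
  have hmeas : ∀ n, Measurable
      (Function.extend ((D ∩ t n).domRestrict f) ((D ∩ t n).domRestrict g) 0) := fun n =>
    (hme n).measurable_extend (hg.comp measurable_subtype_coe) measurable_const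
  simp_rw [key]
  refine ⟨Measurable.tsum hmeas, ?_⟩
  rw [lintegral_tsum fun n => (hmeas n).aemeasurable]
  conv_lhs => rw [hU, lintegral_iUnion hm hdisj]
  refine tsum_congr fun n => ?_
  set h := Function.extend ((D ∩ t n).domRestrict f) ((D ∩ t n).domRestrict g) 0 with hh
  have h1 : ∫⁻ x in D ∩ t n, ENNReal.ofReal |(f' x).det| * g x ∂μ =
      ∫⁻ x in D ∩ t n, ENNReal.ofReal |(f' x).det| * h (f x) ∂μ := by
    refine setLIntegral_congr_fun (hm n) fun x hx => ?_
    have : h (f x) = g x := (injOn_iff_injective.1 (t4 n)).extend_apply _ _ (⟨x, hx⟩ : ↥(D ∩ t n))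
    simp only [this]
  have him : MeasurableSet (f '' (D ∩ t n)) := measurable_image_of_fderivWithin (hm n)
      (fun x hx => (hf x hx.1).hasFDerivWithinAt) (t4 n)
  rw [h1, ← lintegral_image_eq_lintegral_abs_det_fderiv_mul μ (hm n)
    (fun x hx => (hf x hx.1).hasFDerivWithinAt) (t4 n) h, ← lintegral_indicator him]
  refine lintegral_congr fun y => ?_
  by_cases hy : y ∈ f '' (D ∩ t n)
  · rw [indicator_of_mem hy]
  · rw [indicator_of_notMem hy, hh, Function.extend_apply']
    · rfl
    · rintro ⟨x, hx⟩; exact hy ⟨x, x.2, hx⟩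

end Area

theorem det_triangular {E F : Type*} [AddCommGroup E] [Module ℝ E] [FiniteDimensional ℝ E]
    [AddCommGroup F] [Module ℝ F] [FiniteDimensional ℝ F] (A : E →ₗ[ℝ] E) (B : F →ₗ[ℝ] E) :
    LinearMap.det (LinearMap.prod (LinearMap.coprod A B) (LinearMap.snd ℝ E F)) =
      LinearMap.det A := by
  classical
  let b := Module.finBasis ℝ E
  let c := Module.finBasis ℝ F
  rw [← LinearMap.det_toMatrix (b.prod c), ← LinearMap.det_toMatrix b]
  have : LinearMap.toMatrix (b.prod c) (b.prod c)
      (LinearMap.prod (LinearMap.coprod A B) (LinearMap.snd ℝ E F)) =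
      Matrix.fromBlocks (LinearMap.toMatrix b b A) (LinearMap.toMatrix c b B) 0 1 := by
    ext i j
    rcases i with i | i <;> rcases j with j | j <;>
      simp [LinearMap.toMatrix_apply, Matrix.one_apply, Finsupp.single_apply, eq_comm]
  rw [this, Matrix.det_fromBlocks_zero₂₁, Matrix.det_one, mul_one]

/-! ### Real monic polynomials, their coefficients and their factors. -/

open Polynomial in
/-- The monic real polynomial with lower coefficients `b`. -/
noncomputable def realPoly {n : ℕ} (b : Fin n → ℝ) : ℝ[X] :=
  X ^ n + ∑ i : Fin n, C (b i) * X ^ (i : ℕ)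

/-- The first `n` coefficients of a polynomial. -/
def lowCoeff (n : ℕ) (P : Polynomial ℝ) : Fin n → ℝ := fun i => P.coeff i

open Polynomial in
theorem monicPoly_eq_map {n : ℕ} (b : Fin n → ℝ) :
    monicPoly b = (realPoly b).map (algebraMap ℝ ℂ) := by
  simp [monicPoly, realPoly, Polynomial.map_sum]

open Polynomial in
theorem degree_sum_low {n : ℕ} (b : Fin n → ℝ) :
    (∑ i : Fin n, C (b i) * X ^ (i : ℕ) : ℝ[X]).degree < n := by
  refine (degree_sum_le _ _).trans_lt ((Finset.sup_lt_iff (WithBot.bot_lt_coe n)).2 fun i _ => ?_)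
  exact (degree_C_mul_X_pow_le _ _).trans_lt (Nat.cast_lt.2 i.2)

theorem realPoly_monic {n : ℕ} (b : Fin n → ℝ) : (realPoly b).Monic :=
  Polynomial.monic_X_pow_add (degree_sum_low b)

theorem realPoly_natDegree {n : ℕ} (b : Fin n → ℝ) : (realPoly b).natDegree = n :=
  Polynomial.natDegree_eq_of_degree_eq_some
    (by rw [realPoly, Polynomial.degree_add_eq_left_of_degree_lt] <;> simp [degree_sum_low])

theorem realPoly_coeff {n : ℕ} (b : Fin n → ℝ) (i : Fin n) : (realPoly b).coeff i = b i := by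
  simp only [realPoly, Polynomial.coeff_add, Polynomial.coeff_X_pow, Polynomial.finsetSum_coeff,
    Polynomial.coeff_C_mul, i.2.ne, if_false, zero_add]
  rw [Finset.sum_eq_single i]
  · simp
  · intro j _ hj
    simp [Fin.val_inj, hj.symm]
  · simp

theorem realPoly_lowCoeff {n : ℕ} {P : Polynomial ℝ} (hP : P.Monic) (hd : P.natDegree = n) :
    realPoly (lowCoeff n P) = P := by
  ext k
  rcases lt_trichotomy k n with h | h | h
  · exact realPoly_coeff (lowCoeff n P) ⟨k, h⟩
  · have h1 := (realPoly_monic (lowCoeff n P)).coeff_natDegree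
    have h2 := hP.coeff_natDegree
    rw [realPoly_natDegree] at h1
    rw [hd] at h2
    rw [h, h1, h2]
  · rw [Polynomial.coeff_eq_zero_of_natDegree_lt, Polynomial.coeff_eq_zero_of_natDegree_lt]
    · omega
    · rw [realPoly_natDegree]; exact h

theorem realPoly_eval {n : ℕ} (b : Fin n → ℝ) (x : ℝ) :
    (realPoly b).eval x = x ^ n + ∑ i, b i * x ^ (i : ℕ) := by
  simp [realPoly, Polynomial.eval_finsetSum]

theorem monicPoly_eval {n : ℕ} (b : Fin n → ℝ) (x : ℂ) :
    (monicPoly b).eval x = x ^ n + ∑ i, (b i : ℂ) * x ^ (i : ℕ) := by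
  simp [monicPoly, Polynomial.eval_finsetSum]

theorem realPoly_derivative_eval {n : ℕ} (b : Fin n → ℝ) (x : ℝ) :
    (realPoly b).derivative.eval x = n * x ^ (n - 1) + ∑ i, b i * (i * x ^ ((i : ℕ) - 1)) := by
  simp [realPoly, Polynomial.eval_finsetSum, Polynomial.derivative_X_pow]

theorem monicPoly_derivative_eval {n : ℕ} (b : Fin n → ℝ) (x : ℂ) :
    (monicPoly b).derivative.eval x =
      n * x ^ (n - 1) + ∑ i, (b i : ℂ) * (i * x ^ ((i : ℕ) - 1)) := by
  simp [monicPoly, Polynomial.eval_finsetSum, Polynomial.derivative_X_pow]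

theorem monicPoly_eval_ofReal {n : ℕ} (b : Fin n → ℝ) (x : ℝ) :
    (monicPoly b).eval (x : ℂ) = (((realPoly b).eval x : ℝ) : ℂ) := by
  simp [monicPoly_eval, realPoly_eval]

theorem continuous_realPoly_eval (n : ℕ) :
    Continuous fun x : ℝ × (Fin n → ℝ) => (realPoly x.2).eval x.1 := by
  simp_rw [realPoly_eval]; fun_prop

theorem continuous_realPoly_derivative_eval (n : ℕ) :
    Continuous fun x : ℝ × (Fin n → ℝ) => (realPoly x.2).derivative.eval x.1 := by
  simp_rw [realPoly_derivative_eval]; fun_prop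

theorem continuous_monicPoly_eval (n : ℕ) :
    Continuous fun x : ℂ × (Fin n → ℝ) => (monicPoly x.2).eval x.1 := by
  simp_rw [monicPoly_eval]; fun_prop

theorem continuous_monicPoly_derivative_eval (n : ℕ) :
    Continuous fun x : ℂ × (Fin n → ℝ) => (monicPoly x.2).derivative.eval x.1 := by
  simp_rw [monicPoly_derivative_eval]; fun_prop

/-- High coefficients of `P * q` are a unipotent affine function of the low coefficients of `q`. -/
theorem measurePreserving_highCoeff (n d : ℕ) {P : Polynomial ℝ} (hP : P.Monic)
    (hd : P.natDegree = d) :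
    MeasurePreserving (fun (q : Fin n → ℝ) (i : Fin n) => (P * realPoly q).coeff (i + d)) := by
  let M : Matrix (Fin n) (Fin n) ℝ := Matrix.of fun i j => (P * Polynomial.X ^ (j : ℕ)).coeff (i + d)
  -- Column j lists the coefficients of P X^j from degree d on. As P is monic of degree d, the
  -- diagonal consists of ones and everything below it vanishes.
  have hM : M.det = 1 := by
    rw [Matrix.det_of_isUpperTriangular]
    · refine Finset.prod_eq_one fun i _ => ?_
      simp only [M, Matrix.of_apply, add_comm (i : ℕ) d, Polynomial.coeff_mul_X_pow]
      rw [← hd]; exact hP.coeff_natDegree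
    · intro i j hij
      simp only [M, Matrix.of_apply]
      rw [Polynomial.coeff_mul_X_pow', if_pos (by simp at hij; omega)]
      refine Polynomial.coeff_eq_zero_of_natDegree_lt ?_
      simp at hij; omega
  -- The leading term X^n of the cofactor accounts for the translation, the lower coefficients for
  -- the linear part.
  have hT : (fun (q : Fin n → ℝ) (i : Fin n) => (P * realPoly q).coeff (i + d)) =
      (fun q => q + fun i : Fin n => (P * Polynomial.X ^ n).coeff (i + d)) ∘ Matrix.toLin' M := by
    funext q i
    simp only [realPoly, mul_add, Polynomial.coeff_add, Function.comp, Pi.add_apply,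
      Matrix.toLin'_apply, Matrix.mulVec, dotProduct, M, Matrix.of_apply, Finset.mul_sum,
      Polynomial.finsetSum_coeff]
    rw [add_comm]
    congr 1
    refine Finset.sum_congr rfl fun j _ => ?_
    rw [← mul_assoc, mul_comm P, mul_assoc, Polynomial.coeff_C_mul, mul_comm]
  rw [hT]
  refine (measurePreserving_add_right volume _).comp ⟨?_, ?_⟩
  · exact (LinearMap.continuous_of_finiteDimensional _).measurable
  · rw [Real.map_matrix_volume_pi_eq_smul_volume_pi (by rw [hM]; exact one_ne_zero), hM]
    simp

/-- Coefficients of `(X - a) q`. -/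
noncomputable def mulLin {n : ℕ} (a : ℝ) (q : Fin n → ℝ) : Fin (n + 1) → ℝ :=
  lowCoeff (n + 1) ((Polynomial.X - Polynomial.C a) * realPoly q)

theorem realPoly_mulLin {n : ℕ} (a : ℝ) (q : Fin n → ℝ) :
    realPoly (mulLin a q) = (Polynomial.X - Polynomial.C a) * realPoly q := by
  refine realPoly_lowCoeff ((Polynomial.monic_X_sub_C a).mul (realPoly_monic q)) ?_
  rw [(Polynomial.monic_X_sub_C a).natDegree_mul (realPoly_monic q), realPoly_natDegree,
    Polynomial.natDegree_X_sub_C, add_comm]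

open Polynomial in
/-- The real quadratic polynomial with roots `z` and its conjugate. -/
noncomputable def quadPoly (z : ℂ) : ℝ[X] := X ^ 2 - C (2 * z.re) * X + C (Complex.normSq z)

theorem quadPoly_eq (z : ℂ) : quadPoly z =
    Polynomial.X ^ 2 + (- Polynomial.C (2 * z.re) * Polynomial.X +
      Polynomial.C (Complex.normSq z)) := by
  simp only [quadPoly]; ring

theorem quadPoly_degree_aux (z : ℂ) : (- Polynomial.C (2 * z.re) * Polynomial.X +
      Polynomial.C (Complex.normSq z)).degree < ((2 : ℕ) : WithBot ℕ) := by
  rw [← Polynomial.C_neg]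
  exact (Polynomial.degree_linear_le).trans_lt (by norm_num)

theorem quadPoly_monic (z : ℂ) : (quadPoly z).Monic := by
  rw [quadPoly_eq]
  exact Polynomial.monic_X_pow_add (quadPoly_degree_aux z)

theorem quadPoly_natDegree (z : ℂ) : (quadPoly z).natDegree = 2 := by
  rw [quadPoly_eq]
  refine Polynomial.natDegree_eq_of_degree_eq_some ?_
  rw [Polynomial.degree_add_eq_left_of_degree_lt]
  · simp
  · rw [Polynomial.degree_X_pow]; exact quadPoly_degree_aux z

theorem quadPoly_map (z : ℂ) : (quadPoly z).map (algebraMap ℝ ℂ) =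
    (Polynomial.X - Polynomial.C z) * (Polynomial.X - Polynomial.C ((starRingEnd ℂ) z)) := by
  have h1 : (2 * z.re : ℂ) = z + (starRingEnd ℂ) z := by rw [Complex.add_conj]; push_cast; ring
  have h2 : (Complex.normSq z : ℂ) = z * (starRingEnd ℂ) z := (Complex.mul_conj z).symm
  simp only [quadPoly, Polynomial.map_add, Polynomial.map_sub, Polynomial.map_mul,
    Polynomial.map_pow, Polynomial.map_X, Polynomial.map_C]
  simp only [Complex.coe_algebraMap, Complex.ofReal_mul, Complex.ofReal_ofNat, h1, h2,
    Polynomial.C_add, Polynomial.C_mul]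
  ring

/-- Coefficients of `(X - z) (X - conj z) q`. -/
noncomputable def mulQuad {n : ℕ} (z : ℂ) (q : Fin n → ℝ) : Fin (n + 2) → ℝ :=
  lowCoeff (n + 2) (quadPoly z * realPoly q)

theorem realPoly_mulQuad {n : ℕ} (z : ℂ) (q : Fin n → ℝ) :
    realPoly (mulQuad z q) = quadPoly z * realPoly q := by
  refine realPoly_lowCoeff ((quadPoly_monic z).mul (realPoly_monic q)) ?_
  rw [(quadPoly_monic z).natDegree_mul (realPoly_monic q), realPoly_natDegree,
    quadPoly_natDegree, add_comm]

theorem monicPoly_mulQuad {n : ℕ} (z : ℂ) (q : Fin n → ℝ) :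
    monicPoly (mulQuad z q) = (Polynomial.X - Polynomial.C z) *
      (Polynomial.X - Polynomial.C ((starRingEnd ℂ) z)) * monicPoly q := by
  rw [monicPoly_eq_map, realPoly_mulQuad, Polynomial.map_mul, quadPoly_map, monicPoly_eq_map]

theorem monicPoly_mulLin {n : ℕ} (a : ℝ) (q : Fin n → ℝ) :
    monicPoly (mulLin a q) = (Polynomial.X - Polynomial.C (a : ℂ)) * monicPoly q := by
  rw [monicPoly_eq_map, realPoly_mulLin, Polynomial.map_mul, monicPoly_eq_map]
  simp

theorem det_prod_snd {E F : Type*} [NormedAddCommGroup E] [NormedSpace ℝ E]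
    [FiniteDimensional ℝ E] [NormedAddCommGroup F] [NormedSpace ℝ F] [FiniteDimensional ℝ F]
    (L : E × F →L[ℝ] E) :
    (L.prod (ContinuousLinearMap.snd ℝ E F)).det =
      (L.comp (ContinuousLinearMap.inl ℝ E F)).det := by
  rw [ContinuousLinearMap.det, ContinuousLinearMap.det, ← det_triangular
    ((L.comp (ContinuousLinearMap.inl ℝ E F)) : E →ₗ[ℝ] E)
    ((L.comp (ContinuousLinearMap.inr ℝ E F)) : F →ₗ[ℝ] E)]
  congr 1
  ext x <;> simp

/-- The area formula for (x, y) ↦ (h(x, y), y), whose derivative is block triangular, so that only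
the partial derivative in x enters. In the applications x is a root, y are the higher coefficients,
and h gives the low coefficients that make x a root. -/
theorem lintegral_area_fiber {X Y : Type*} [NormedAddCommGroup X] [NormedSpace ℝ X]
    [FiniteDimensional ℝ X] [MeasurableSpace X] [BorelSpace X] [NormedAddCommGroup Y]
    [NormedSpace ℝ Y] [FiniteDimensional ℝ Y] [MeasurableSpace Y] [BorelSpace Y]
    (μ : Measure X) [μ.IsAddHaarMeasure] (ν : Measure Y) [ν.IsAddHaarMeasure]
    {h : X × Y → X} {D : Set (X × Y)} (hD : MeasurableSet D) (hm : Measurable h)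
    (hd : ∀ x ∈ D, DifferentiableAt ℝ h x)
    (hdet : ∀ x ∈ D, ((fderiv ℝ h x).comp (ContinuousLinearMap.inl ℝ X Y)).det ≠ 0)
    {G : X → X × Y → ENNReal} (hG : Measurable (Function.uncurry G)) :
    Measurable (fun y : X × Y =>
      ∑' a, {a | (a, y.2) ∈ D ∧ h (a, y.2) = y.1}.indicator (fun a => G a y) a) ∧
    ∫⁻ x in D, ENNReal.ofReal |((fderiv ℝ h x).comp (ContinuousLinearMap.inl ℝ X Y)).det| *
        G x.1 (h x, x.2) ∂(μ.prod ν) =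
      ∫⁻ y, ∑' a, {a | (a, y.2) ∈ D ∧ h (a, y.2) = y.1}.indicator (fun a => G a y) a
        ∂(μ.prod ν) := by
  have : ProperSpace X := FiniteDimensional.proper ℝ X
  have : ProperSpace Y := FiniteDimensional.proper ℝ Y
  let f : X × Y → X × Y := fun x => (h x, x.2)
  have hmf : Measurable f := hm.prodMk measurable_snd
  have hf : ∀ x ∈ D, HasFDerivAt f ((fderiv ℝ h x).prod (ContinuousLinearMap.snd ℝ X Y)) x :=
    fun x hx => (hd x hx).hasFDerivAt.prodMk hasFDerivAt_snd
  have := lintegral_area (μ.prod ν) hD hf (fun x hx => by rw [det_prod_snd]; exact hdet x hx)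
    (g := fun x => G x.1 (f x)) (hG.comp (measurable_fst.prodMk hmf))
  have key : ∀ y : X × Y, ∑' x, (D ∩ f ⁻¹' {y}).indicator (fun x => G x.1 (f x)) x =
      ∑' a, {a | (a, y.2) ∈ D ∧ h (a, y.2) = y.1}.indicator (fun a => G a y) a := by
    intro y
    have hi : Function.Injective (fun a : X => (a, y.2)) := fun a b hab => (Prod.mk.inj hab).1
    rw [← hi.tsum_eq]
    · refine tsum_congr fun a => ?_
      by_cases ha : (a, y.2) ∈ D ∧ h (a, y.2) = y.1
      · have h1 : f (a, y.2) = y := Prod.ext ha.2 rfl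
        rw [indicator_of_mem (show (a, y.2) ∈ D ∩ f ⁻¹' {y} from ⟨ha.1, h1⟩),
          indicator_of_mem (by exact ha), h1]
      · rw [indicator_of_notMem, indicator_of_notMem (by exact ha)]
        rintro ⟨h1, h2⟩
        exact ha ⟨h1, congrArg Prod.fst (show f (a, y.2) = y from h2)⟩
    · intro x hx
      have hx' := Set.mem_of_indicator_ne_zero hx
      exact ⟨x.1, Prod.ext rfl (congrArg Prod.snd (show f x = y from hx'.2)).symm⟩
  simp_rw [key, det_prod_snd] at this
  exact this

/-! ### Change of variables from a root and its cofactor to the coefficients. -/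

/-- Prepending a real coefficient. -/
def consReal (n : ℕ) : ℝ × (Fin n → ℝ) ≃ᵐ (Fin (n + 1) → ℝ) :=
  (MeasurableEquiv.piFinSuccAbove (fun _ => ℝ) 0).symm

theorem consReal_apply {n : ℕ} (x : ℝ × (Fin n → ℝ)) : consReal n x = Fin.cons x.1 x.2 := by
  simp [consReal, MeasurableEquiv.piFinSuccAbove]
  rfl

theorem measurePreserving_consReal (n : ℕ) : MeasurePreserving (consReal n) :=
  (volume_preserving_piFinSuccAbove (fun _ : Fin (n + 1) => ℝ) 0).symm _

/-- Prepending two real coefficients, packed into a complex number. -/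
noncomputable def consComplex (n : ℕ) : ℂ × (Fin n → ℝ) ≃ᵐ (Fin (n + 2) → ℝ) :=
  ((Complex.measurableEquivRealProd.prodCongr (MeasurableEquiv.refl _)).trans
    MeasurableEquiv.prodAssoc).trans
    (((MeasurableEquiv.refl ℝ).prodCongr (consReal n)).trans (consReal (n + 1)))

theorem consComplex_apply {n : ℕ} (x : ℂ × (Fin n → ℝ)) :
    consComplex n x = Fin.cons x.1.re (Fin.cons x.1.im x.2) := by
  change consReal (n + 1) (x.1.re, consReal n (x.1.im, x.2)) = _
  rw [consReal_apply, consReal_apply]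

theorem measurePreserving_consComplex (n : ℕ) : MeasurePreserving (consComplex n) := by
  refine MeasurePreserving.trans (μb := (volume : Measure (ℝ × ℝ × (Fin n → ℝ))))
    (MeasurePreserving.trans (μb := (volume : Measure ((ℝ × ℝ) × (Fin n → ℝ)))) ?_ ?_)
    (MeasurePreserving.trans (μb := (volume : Measure (ℝ × (Fin (n + 1) → ℝ)))) ?_
    (measurePreserving_consReal (n + 1)))
  · exact Complex.volume_preserving_equiv_real_prod.prod (MeasurePreserving.id volume)
  · exact volume_preserving_prodAssoc
  · exact (MeasurePreserving.id volume).prod (measurePreserving_consReal n)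

theorem realPoly_cons_eval {n : ℕ} (c : ℝ) (b : Fin n → ℝ) (x : ℝ) :
    (realPoly (Fin.cons c b : Fin (n + 1) → ℝ)).eval x =
      c + (x ^ (n + 1) + ∑ i, b i * x ^ ((i : ℕ) + 1)) := by
  rw [realPoly_eval, Fin.sum_univ_succ]
  simp; ring

theorem monicPoly_cons_eval {n : ℕ} (c d : ℝ) (b : Fin n → ℝ) (x : ℂ) :
    (monicPoly (Fin.cons c (Fin.cons d b) : Fin (n + 2) → ℝ)).eval x =
      c + d * x + (x ^ (n + 2) + ∑ i, (b i : ℂ) * x ^ ((i : ℕ) + 2)) := by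
  rw [monicPoly_eval, Fin.sum_univ_succ, Fin.sum_univ_succ]
  simp; ring

/-- For given higher coefficients exactly one constant coefficient h makes a a root, and its
derivative in a is -p'(a). Passing from the higher coefficients of p = (X-a)q to those of q is
unipotent, and p'(a) = q(a). This is a Kac–Rice formula in coefficient space. -/
theorem lintegral_area_real (n : ℕ) {G : ℝ → (Fin (n + 1) → ℝ) → ENNReal}
    (hG : Measurable (Function.uncurry G)) :
    Measurable (fun p : Fin (n + 1) → ℝ => ∑' a, {a | (realPoly p).eval a = 0 ∧
      (realPoly p).derivative.eval a ≠ 0}.indicator (fun a => G a p) a) ∧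
    ∫⁻ a : ℝ, ∫⁻ q : Fin n → ℝ, ENNReal.ofReal |(realPoly q).eval a| * G a (mulLin a q) =
      ∫⁻ p : Fin (n + 1) → ℝ, ∑' a, {a | (realPoly p).eval a = 0 ∧
        (realPoly p).derivative.eval a ≠ 0}.indicator (fun a => G a p) a := by
  let h : ℝ × (Fin n → ℝ) → ℝ := fun x => -(x.1 ^ (n + 1) + ∑ i, x.2 i * x.1 ^ ((i : ℕ) + 1))
  have hdiff : Differentiable ℝ h := by fun_prop
  have hev : ∀ c b x, (realPoly (consReal n (c, b))).eval x = c - h (x, b) := by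
    intro c b x
    simp only [consReal_apply, realPoly_cons_eval, h]; ring
  have hdet : ∀ x c, ((fderiv ℝ h x).comp (ContinuousLinearMap.inl ℝ ℝ (Fin n → ℝ))).det =
      - (realPoly (consReal n (c, x.2))).derivative.eval x.1 := by
    intro x c
    have h1 : HasDerivAt (fun t => h (t, x.2)) (fderiv ℝ h x (1, 0)) x.1 :=
      HasFDerivAt.comp_hasDerivAt (f := fun t => (t, x.2)) x.1 (hdiff x).hasFDerivAt
        ((hasDerivAt_id' x.1).prodMk (hasDerivAt_const x.1 x.2))
    have h2 := (realPoly (consReal n (c, x.2))).hasDerivAt x.1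
    have h3 : HasDerivAt (fun t => c - h (t, x.2)) (- fderiv ℝ h x (1, 0)) x.1 :=
      h1.const_sub c
    rw [show (fun t => (realPoly (consReal n (c, x.2))).eval t) = fun t => c - h (t, x.2) from
      funext fun t => hev c x.2 t] at h2
    rw [← h3.unique h2, neg_neg, ContinuousLinearMap.det, LinearMap.det_ring]
    rfl
  have hcd : Continuous fun x : ℝ × (Fin n → ℝ) =>
      (realPoly (consReal n (h x, x.2))).derivative.eval x.1 := by
    have h1 : Continuous fun x : ℝ × (Fin n → ℝ) => (x.1, consReal n (h x, x.2)) := by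
      refine continuous_fst.prodMk ?_
      simp_rw [consReal_apply]
      exact (hdiff.continuous).finCons continuous_snd
    exact (continuous_realPoly_derivative_eval (n + 1)).comp h1
  let D : Set (ℝ × (Fin n → ℝ)) :=
    {x | (realPoly (consReal n (h x, x.2))).derivative.eval x.1 ≠ 0}
  have hD : MeasurableSet D := (isOpen_ne_fun hcd continuous_const).measurableSet
  obtain ⟨m1, m2⟩ := lintegral_area_fiber volume volume hD hdiff.continuous.measurable
    (fun x _ => hdiff x) (fun x hx => by rw [hdet x (h x)]; exact neg_ne_zero.2 hx)
    (G := fun a y => G a (consReal n y))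
    (hG.comp (measurable_fst.prodMk ((consReal n).measurable.comp measurable_snd)))
  have hfib : ∀ y : ℝ × (Fin n → ℝ), {a | (a, y.2) ∈ D ∧ h (a, y.2) = y.1} =
      {a | (realPoly (consReal n y)).eval a = 0 ∧
        (realPoly (consReal n y)).derivative.eval a ≠ 0} := by
    rintro ⟨c, b⟩
    ext a
    simp only [D, mem_ofPred_eq, hev]
    constructor
    · rintro ⟨h1, h2⟩; rw [h2] at h1; exact ⟨by rw [h2, sub_self], h1⟩
    · rintro ⟨h1, h2⟩; rw [sub_eq_zero] at h1; rw [h1] at h2; exact ⟨h2, h1.symm⟩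
  simp_rw [hfib] at m1 m2
  constructor
  · have := m1.comp (consReal n).symm.measurable
    simpa [Function.comp_def] using this
  · rw [← (measurePreserving_consReal n).lintegral_comp_emb (consReal n).measurableEmbedding,
      Measure.volume_eq_prod, ← m2]
    have hdet' := fun x => hdet x (h x)
    simp only [hdet', abs_neg]
    rw [← lintegral_indicator hD]
    -- Off D the Jacobian factor is zero, so the restriction to regular points can be dropped.
    have h0 : ∀ x : ℝ × (Fin n → ℝ), D.indicator (fun x : ℝ × (Fin n → ℝ) => ENNReal.ofReal
        |(realPoly (consReal n (h x, x.2))).derivative.eval x.1| *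
          G x.1 (consReal n (h x, x.2))) x = ENNReal.ofReal
        |(realPoly (consReal n (h x, x.2))).derivative.eval x.1| *
          G x.1 (consReal n (h x, x.2)) := by
      intro x
      by_cases hx : x ∈ D
      · rw [indicator_of_mem hx]
      · rw [indicator_of_notMem hx, not_not.1 (show ¬ _ ≠ _ from hx)]; simp
    simp_rw [h0]
    have hmc : Measurable fun x : ℝ × (Fin n → ℝ) => consReal n (h x, x.2) :=
      (consReal n).measurable.comp (hdiff.continuous.measurable.prodMk measurable_snd)
    have hmeas : Measurable fun x : ℝ × (Fin n → ℝ) => ENNReal.ofReal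
        |(realPoly (consReal n (h x, x.2))).derivative.eval x.1| *
          G x.1 (consReal n (h x, x.2)) :=
      (ENNReal.measurable_ofReal.comp hcd.abs.measurable).mul
        (hG.comp (measurable_fst.prodMk hmc))
    rw [lintegral_prod _ hmeas.aemeasurable]
    refine lintegral_congr fun a => ?_
    have hmp := measurePreserving_highCoeff n 1 (Polynomial.monic_X_sub_C a)
      (Polynomial.natDegree_X_sub_C a)
    rw [← hmp.lintegral_comp (f := fun b => ENNReal.ofReal
        |(realPoly (consReal n (h (a, b), b))).derivative.eval a| *
          G a (consReal n (h (a, b), b))) (hmeas.comp (measurable_const.prodMk measurable_id))]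
    refine lintegral_congr fun q => ?_
    have hc : mulLin a q = consReal n (mulLin a q 0, fun i : Fin n =>
        ((Polynomial.X - Polynomial.C a) * realPoly q).coeff (i + 1)) := by
      rw [consReal_apply]
      funext i
      refine Fin.cases rfl (fun i => ?_) i
      rfl
    have hroot := hev (mulLin a q 0) (fun i : Fin n =>
        ((Polynomial.X - Polynomial.C a) * realPoly q).coeff (i + 1)) a
    rw [← hc, realPoly_mulLin] at hroot
    simp only [Polynomial.eval_mul, Polynomial.eval_sub, Polynomial.eval_X, Polynomial.eval_C,
      sub_self, zero_mul] at hroot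
    rw [← sub_eq_zero.1 hroot.symm, ← hc, realPoly_mulLin]
    simp

/-- The values `(b₀, b₁)`, packed into a complex number, for which `z` is a root of the monic
polynomial with lower coefficients `b₀, b₁` followed by `b`. -/
noncomputable def lowPair {n : ℕ} (x : ℂ × (Fin n → ℝ)) : ℂ :=
  let g := x.1 ^ (n + 2) + ∑ i, (x.2 i : ℂ) * x.1 ^ ((i : ℕ) + 2)
  -- The imaginary part of b₀ + b₁z + g = 0 determines b₁, then the real part determines b₀. On the
  -- real line the quotient defaults to zero and means nothing.
  ((-g.re + g.im / x.1.im * x.1.re : ℝ) : ℂ) + ((-(g.im / x.1.im) : ℝ) : ℂ) * Complex.I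

theorem monicPoly_consComplex_eval {n : ℕ} (c z : ℂ) (b : Fin n → ℝ) (hz : z.im ≠ 0) :
    (monicPoly (consComplex n (c, b))).eval z =
      ((c - lowPair (z, b)).re : ℂ) + ((c - lowPair (z, b)).im : ℂ) * z := by
  rw [consComplex_apply, monicPoly_cons_eval]
  simp only [lowPair]
  set g := z ^ (n + 2) + ∑ i, (b i : ℂ) * z ^ ((i : ℕ) + 2)
  apply Complex.ext
  · simp; ring
  · simp; field_simp

theorem eq_zero_of_ofReal_add_ofReal_mul {a b : ℝ} {z : ℂ} (hz : z.im ≠ 0)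
    (h : (a : ℂ) + b * z = 0) : a = 0 ∧ b = 0 := by
  have h1 := congrArg Complex.im h
  simp [hz] at h1
  have h2 := congrArg Complex.re h
  simp [h1] at h2
  exact ⟨h2, h1⟩

theorem measurable_lowPair (n : ℕ) : Measurable (lowPair (n := n)) := by
  have hg : Measurable fun x : ℂ × (Fin n → ℝ) =>
      x.1 ^ (n + 2) + ∑ i, (x.2 i : ℂ) * x.1 ^ ((i : ℕ) + 2) := by
    refine Continuous.measurable ?_
    fun_prop
  have h1 := Complex.measurable_re.comp hg
  have h2 := Complex.measurable_im.comp hg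
  have h3 : Measurable fun x : ℂ × (Fin n → ℝ) => x.1.im := Complex.measurable_im.comp measurable_fst
  have h4 : Measurable fun x : ℂ × (Fin n → ℝ) => x.1.re := Complex.measurable_re.comp measurable_fst
  exact ((Complex.measurable_ofReal.comp (h1.neg.add ((h2.div h3).mul h4))).add
    ((Complex.measurable_ofReal.comp (h2.div h3).neg).mul measurable_const))

theorem differentiableAt_lowPair {n : ℕ} (x : ℂ × (Fin n → ℝ)) (hx : x.1.im ≠ 0) :
    DifferentiableAt ℝ lowPair x := by
  have hg : DifferentiableAt ℝ (fun x : ℂ × (Fin n → ℝ) =>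
      x.1 ^ (n + 2) + ∑ i, (x.2 i : ℂ) * x.1 ^ ((i : ℕ) + 2)) x := by
    have : ∀ i, DifferentiableAt ℝ (fun x : ℂ × (Fin n → ℝ) => (x.2 i : ℂ)) x := fun i =>
      (Complex.ofRealCLM.differentiableAt).comp (𝕜 := ℝ) x
        (g := Complex.ofRealCLM) (f := fun x : ℂ × (Fin n → ℝ) => x.2 i) (by fun_prop)
    fun_prop
  set g : ℂ × (Fin n → ℝ) → ℂ := fun x => x.1 ^ (n + 2) + ∑ i, (x.2 i : ℂ) * x.1 ^ ((i : ℕ) + 2)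
  have h1 : DifferentiableAt ℝ (fun x => (g x).re) x :=
    (Complex.reCLM.differentiableAt).comp x hg
  have h2 : DifferentiableAt ℝ (fun x => (g x).im) x :=
    (Complex.imCLM.differentiableAt).comp x hg
  have h3 : DifferentiableAt ℝ (fun x : ℂ × (Fin n → ℝ) => x.1.im) x :=
    (Complex.imCLM.differentiableAt).comp x differentiableAt_fst
  have h4 : DifferentiableAt ℝ (fun x : ℂ × (Fin n → ℝ) => x.1.re) x :=
    (Complex.reCLM.differentiableAt).comp x differentiableAt_fst
  have h7 : DifferentiableAt ℝ (fun x : ℂ × (Fin n → ℝ) => (g x).im / x.1.im) x := by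
    simp_rw [div_eq_mul_inv]
    exact h2.mul ((differentiableAt_inv hx).comp x h3)
  have h8 : DifferentiableAt ℝ
      (fun x : ℂ × (Fin n → ℝ) => -(g x).re + (g x).im / x.1.im * x.1.re) x :=
    h1.neg.add (h7.mul h4)
  have h5 : DifferentiableAt ℝ (fun x : ℂ × (Fin n → ℝ) =>
      ((-(g x).re + (g x).im / x.1.im * x.1.re : ℝ) : ℂ)) x :=
    (Complex.ofRealCLM.differentiableAt).comp x h8
  have h6 : DifferentiableAt ℝ (fun x : ℂ × (Fin n → ℝ) =>
      ((-((g x).im / x.1.im) : ℝ) : ℂ)) x :=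
    (Complex.ofRealCLM.differentiableAt).comp x h7.neg
  exact h5.add (h6.mul_const Complex.I)

/-- The map is c ↦ Re c + (Im c) z, through which the two packed low coefficients enter the value of
the polynomial at z. -/
theorem det_pairing (z : ℂ) : LinearMap.det
    ((Complex.ofRealCLM.comp Complex.reCLM + (Complex.imCLM.smulRight z) : ℂ →L[ℝ] ℂ) :
      ℂ →ₗ[ℝ] ℂ) = z.im := by
  rw [← LinearMap.det_toMatrix Complex.basisOneI, Matrix.det_fin_two]
  simp [LinearMap.toMatrix_apply, Complex.coe_basisOneI_repr]

/-- Freeze the coefficients at those belonging to the root z and let t vary: P(t) = J_t(ℓ(z) -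
ℓ(t)), where ℓ is `lowPair` and J_t(c) = Re c + (Im c) t. Differentiating at t = z, where the
argument vanishes, shows that J∘ℓ' is multiplication by -P'(z). Multiplication by w has real
determinant |w|², and det J = Im z. -/
theorem det_fderiv_lowPair {n : ℕ} (x : ℂ × (Fin n → ℝ)) (hx : x.1.im ≠ 0) :
    ((fderiv ℝ lowPair x).comp (ContinuousLinearMap.inl ℝ ℂ (Fin n → ℝ))).det =
      Complex.normSq ((monicPoly (consComplex n (lowPair x, x.2))).derivative.eval x.1) /
        x.1.im := by
  rw [eq_div_iff hx]
  set P := monicPoly (consComplex n (lowPair x, x.2))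
  set L := (fderiv ℝ lowPair x).comp (ContinuousLinearMap.inl ℝ ℂ (Fin n → ℝ))
  set J := (Complex.ofRealCLM.comp Complex.reCLM + (Complex.imCLM.smulRight x.1) : ℂ →L[ℝ] ℂ)
    with hJ
  have hL : HasFDerivAt (fun t => lowPair (t, x.2)) L x.1 :=
    HasFDerivAt.comp (f := fun t => (t, x.2)) x.1
      (differentiableAt_lowPair x hx).hasFDerivAt (hasFDerivAt_prodMk_left x.1 x.2)
  have hP : HasFDerivAt (fun t => P.eval t)
      ((ContinuousLinearMap.toSpanSingleton ℂ (P.derivative.eval x.1)).restrictScalars ℝ) x.1 :=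
    (P.hasDerivAt x.1).hasFDerivAt.restrictScalars ℝ
  have hs := hL.const_sub (lowPair x)
  have hre : HasFDerivAt (fun t => ((lowPair x - lowPair (t, x.2)).re : ℂ))
      ((Complex.ofRealCLM.comp Complex.reCLM).comp (-L)) x.1 :=
    ((Complex.ofRealCLM.comp Complex.reCLM).hasFDerivAt).comp x.1 hs
  have him : HasFDerivAt (fun t => ((lowPair x - lowPair (t, x.2)).im : ℂ))
      ((Complex.ofRealCLM.comp Complex.imCLM).comp (-L)) x.1 :=
    ((Complex.ofRealCLM.comp Complex.imCLM).hasFDerivAt).comp x.1 hs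
  have hQ := hre.add (him.mul (hasFDerivAt_id (𝕜 := ℝ) x.1))
  have heq : (fun t => P.eval t) =ᶠ[𝓝 x.1] fun t =>
      ((lowPair x - lowPair (t, x.2)).re : ℂ) + ((lowPair x - lowPair (t, x.2)).im : ℂ) * t := by
    have : ∀ᶠ t : ℂ in 𝓝 x.1, t.im ≠ 0 :=
      Complex.continuous_im.continuousAt.eventually_ne hx
    filter_upwards [this] with t ht
    exact monicPoly_consComplex_eval _ _ _ ht
  have hu := (hP.congr_of_eventuallyEq heq.symm).unique hQ
  have hcomp : (J : ℂ →ₗ[ℝ] ℂ) ∘ₗ (L : ℂ →ₗ[ℝ] ℂ) =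
      Algebra.lmul ℝ ℂ (-(P.derivative.eval x.1)) := by
    ext ζ
    have h1 := congrArg (fun A : ℂ →L[ℝ] ℂ => A ζ) hu
    simp at h1
    simp [hJ]
    linear_combination h1
  have hdet := congrArg LinearMap.det hcomp
  rw [LinearMap.det_comp, hJ, det_pairing, ← Algebra.norm_apply, Algebra.norm_complex_apply,
    Complex.normSq_neg] at hdet
  rw [← hdet, mul_comm]

/-- As for real roots, with two real coefficients eliminated: the Jacobian is |p'(z)|²/|Im z|, and
p'(z) = (z - z̄) q(z) turns it into 4|Im z||q(z)|². A root and its conjugate are both counted. -/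
theorem lintegral_area_complex (n : ℕ) {G : ℂ → (Fin (n + 2) → ℝ) → ENNReal}
    (hG : Measurable (Function.uncurry G)) :
    Measurable (fun p : Fin (n + 2) → ℝ => ∑' z, {z : ℂ | z.im ≠ 0 ∧ (monicPoly p).eval z = 0 ∧
      (monicPoly p).derivative.eval z ≠ 0}.indicator (fun z => G z p) z) ∧
    ∫⁻ z : ℂ, ∫⁻ q : Fin n → ℝ,
        ENNReal.ofReal (4 * |z.im| * Complex.normSq ((monicPoly q).eval z)) * G z (mulQuad z q) =
      ∫⁻ p : Fin (n + 2) → ℝ, ∑' z, {z : ℂ | z.im ≠ 0 ∧ (monicPoly p).eval z = 0 ∧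
        (monicPoly p).derivative.eval z ≠ 0}.indicator (fun z => G z p) z := by
  let d : ℂ × (Fin n → ℝ) → ℂ := fun x =>
    (monicPoly (consComplex n (lowPair x, x.2))).derivative.eval x.1
  have hmc : Measurable fun x : ℂ × (Fin n → ℝ) => consComplex n (lowPair x, x.2) :=
    (consComplex n).measurable.comp ((measurable_lowPair n).prodMk measurable_snd)
  have hmd : Measurable d :=
    (continuous_monicPoly_derivative_eval (n + 2)).measurable.comp (measurable_fst.prodMk hmc)
  have hmi : Measurable fun x : ℂ × (Fin n → ℝ) => x.1.im := Complex.measurable_im.comp measurable_fst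
  let D : Set (ℂ × (Fin n → ℝ)) := {x | x.1.im ≠ 0 ∧ d x ≠ 0}
  have hD : MeasurableSet D :=
    (hmi (measurableSet_singleton 0).compl).inter (hmd (measurableSet_singleton 0).compl)
  obtain ⟨m1, m2⟩ := lintegral_area_fiber volume volume hD (measurable_lowPair n)
    (fun x hx => differentiableAt_lowPair x hx.1) (fun x hx => by
      rw [det_fderiv_lowPair x hx.1]
      exact div_ne_zero (fun h => hx.2 (Complex.normSq_eq_zero.1 h)) hx.1)
    (G := fun z y => G z (consComplex n y))
    (hG.comp (measurable_fst.prodMk ((consComplex n).measurable.comp measurable_snd)))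
  have hfib : ∀ y : ℂ × (Fin n → ℝ), {z | (z, y.2) ∈ D ∧ lowPair (z, y.2) = y.1} =
      {z | z.im ≠ 0 ∧ (monicPoly (consComplex n y)).eval z = 0 ∧
        (monicPoly (consComplex n y)).derivative.eval z ≠ 0} := by
    rintro ⟨c, b⟩
    ext z
    simp only [D, d, mem_ofPred_eq]
    constructor
    · rintro ⟨⟨h0, h1⟩, h2⟩
      rw [h2] at h1
      exact ⟨h0, by rw [monicPoly_consComplex_eval _ _ _ h0, h2]; simp, h1⟩
    · rintro ⟨h0, h1, h2⟩
      rw [monicPoly_consComplex_eval _ _ _ h0] at h1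
      obtain ⟨h4, h3⟩ := eq_zero_of_ofReal_add_ofReal_mul h0 h1
      rw [Complex.sub_re] at h4
      rw [Complex.sub_im] at h3
      have h5 : lowPair (z, b) = c := by
        apply Complex.ext <;> linarith
      rw [h5]
      exact ⟨⟨h0, h2⟩, rfl⟩
  simp_rw [hfib] at m1 m2
  constructor
  · have := m1.comp (consComplex n).symm.measurable
    simpa [Function.comp_def] using this
  · rw [← (measurePreserving_consComplex n).lintegral_comp_emb (consComplex n).measurableEmbedding,
      Measure.volume_eq_prod, ← m2]
    have hmeas : Measurable fun x : ℂ × (Fin n → ℝ) => ENNReal.ofReal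
        (Complex.normSq (d x) / |x.1.im|) * G x.1 (consComplex n (lowPair x, x.2)) := by
      refine (ENNReal.measurable_ofReal.comp ?_).mul (hG.comp (measurable_fst.prodMk hmc))
      exact (Complex.continuous_normSq.measurable.comp hmd).div
        (continuous_abs.measurable.comp hmi)
    have h0 : ∫⁻ x in D, ENNReal.ofReal
        |((fderiv ℝ lowPair x).comp (ContinuousLinearMap.inl ℝ ℂ (Fin n → ℝ))).det| *
          G x.1 (consComplex n (lowPair x, x.2)) ∂(volume.prod volume) =
        ∫⁻ x, ENNReal.ofReal (Complex.normSq (d x) / |x.1.im|) *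
          G x.1 (consComplex n (lowPair x, x.2)) ∂(volume.prod volume) := by
      rw [← lintegral_indicator hD]
      refine lintegral_congr fun x => ?_
      by_cases hx : x ∈ D
      · rw [indicator_of_mem hx, det_fderiv_lowPair x hx.1, abs_div, abs_of_nonneg
          (Complex.normSq_nonneg _)]
      · rw [indicator_of_notMem hx]
        have : x.1.im = 0 ∨ d x = 0 := by
          by_contra hcon
          push Not at hcon
          exact hx hcon
        rcases this with h | h <;> simp [h]
    rw [h0, lintegral_prod _ hmeas.aemeasurable]
    refine lintegral_congr fun z => ?_
    by_cases hz : z.im = 0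
    · simp [hz]
    have hmp := measurePreserving_highCoeff n 2 (quadPoly_monic z) (quadPoly_natDegree z)
    rw [← hmp.lintegral_comp (f := fun b => ENNReal.ofReal
        (Complex.normSq (d (z, b)) / |z.im|) * G z (consComplex n (lowPair (z, b), b)))
        (hmeas.comp (measurable_const.prodMk measurable_id))]
    refine lintegral_congr fun q => ?_
    set b : Fin n → ℝ := fun i => (quadPoly z * realPoly q).coeff (i + 2) with hb
    have hc : mulQuad z q = consComplex n
        ((mulQuad z q 0 : ℂ) + (mulQuad z q 1 : ℂ) * Complex.I, b) := by
      rw [consComplex_apply]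
      funext i
      refine Fin.cases ?_ (fun i => Fin.cases ?_ (fun i => ?_) i) i
      · simp
      · simp
      · rfl
    have hroot := monicPoly_consComplex_eval
      ((mulQuad z q 0 : ℂ) + (mulQuad z q 1 : ℂ) * Complex.I) z b hz
    rw [← hc, monicPoly_mulQuad] at hroot
    simp only [Polynomial.eval_mul, Polynomial.eval_sub, Polynomial.eval_X, Polynomial.eval_C,
      sub_self, zero_mul] at hroot
    have h5 : lowPair (z, b) = (mulQuad z q 0 : ℂ) + (mulQuad z q 1 : ℂ) * Complex.I := by
      obtain ⟨h4, h3⟩ := eq_zero_of_ofReal_add_ofReal_mul hz hroot.symm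
      rw [Complex.sub_re] at h4
      rw [Complex.sub_im] at h3
      apply Complex.ext <;> linarith
    simp only [d]
    rw [h5, ← hc, monicPoly_mulQuad]
    congr 2
    simp only [Polynomial.derivative_mul, Polynomial.derivative_sub, Polynomial.derivative_X,
      Polynomial.derivative_C, Polynomial.eval_add, Polynomial.eval_mul, Polynomial.eval_sub,
      Polynomial.eval_X, Polynomial.eval_C, sub_self, zero_mul, sub_zero, add_zero,
      Polynomial.eval_one, one_mul]
    rw [Complex.normSq_mul, Complex.sub_conj]
    simp only [Complex.normSq_mul, Complex.normSq_I, mul_one, Complex.normSq_ofReal]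
    have : |z.im| ≠ 0 := abs_ne_zero.2 hz
    have h6 : z.im * z.im = |z.im| * |z.im| := (abs_mul_abs_self _).symm
    field_simp
    linear_combination (-4 * Complex.normSq (Polynomial.eval z (monicPoly q))) * h6

/- ## Signs at the real roots -/

/-- Adding a largest element m changes the sign of all earlier coefficients and the parity. To the
left of m the identity is then the negative of the previous one; to the right of m the product over
the earlier elements is one. -/
theorem prod_sign_eq_sum (R : Finset ℝ) (x : ℝ) (hx : x ∉ R) :
    ∏ y ∈ R, Real.sign (x - y) =
      ∑ y ∈ R, (∏ t ∈ R.erase y, Real.sign (y - t)) * Real.sign (x - y) +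
        (if Even R.card then 1 else 0) := by
  classical
  induction R using Finset.induction_on_max with
  | empty => simp
  | insert m R hm ih =>
    have hmR : m ∉ R := fun h => lt_irrefl _ (hm m h)
    have hxR : x ∉ R := fun h => hx (Finset.mem_insert_of_mem h)
    have hxm : x ≠ m := fun h => hx (h ▸ Finset.mem_insert_self m R)
    have h1 : ∏ t ∈ (insert m R).erase m, Real.sign (m - t) = 1 := by
      rw [Finset.erase_insert hmR]
      exact Finset.prod_eq_one fun t ht => Real.sign_of_pos (sub_pos.2 (hm t ht))
    have h2 : ∀ y ∈ R, ∏ t ∈ (insert m R).erase y, Real.sign (y - t) =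
        -∏ t ∈ R.erase y, Real.sign (y - t) := by
      intro y hy
      have hym : y ≠ m := (hm y hy).ne
      rw [Finset.erase_insert_of_ne hym.symm, Finset.prod_insert
        (fun h => hmR (Finset.mem_of_mem_erase h)), Real.sign_of_neg (sub_neg.2 (hm y hy))]
      ring
    rw [Finset.prod_insert hmR, Finset.sum_insert hmR, h1,
      Finset.sum_congr rfl fun y hy => by rw [h2 y hy, neg_mul], Finset.sum_neg_distrib,
      Finset.card_insert_of_notMem hmR]
    have ih' := ih hxR
    have hpar : (if Even (R.card + 1) then (1 : ℝ) else 0) = 1 - if Even R.card then 1 else 0 := by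
      by_cases h : Even R.card <;> simp [Nat.even_add_one, h]
    rw [hpar]
    rcases lt_or_gt_of_ne hxm with h | h
    · rw [Real.sign_of_neg (sub_neg.2 h)]
      linarith
    · rw [Real.sign_of_pos (sub_pos.2 h)]
      have h3 : ∏ y ∈ R, Real.sign (x - y) = 1 :=
        Finset.prod_eq_one fun t ht => Real.sign_of_pos (sub_pos.2 ((hm t ht).trans h))
      linarith

theorem pos_of_monic_of_no_root {g : Polynomial ℝ} (hg : g.Monic) (h0 : ∀ x, g.eval x ≠ 0)
    (x : ℝ) : 0 < g.eval x := by
  by_contra hneg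
  rcases Nat.eq_zero_or_pos g.natDegree with h | h
  · rw [hg.natDegree_eq_zero.1 h] at hneg
    simp at hneg
  · have ht := g.tendsto_atTop_of_leadingCoeff_nonneg (Polynomial.natDegree_pos_iff_degree_pos.1 h)
      (by rw [hg.leadingCoeff]; exact zero_le_one)
    obtain ⟨y, hy⟩ := (ht.eventually_ge_atTop 0).exists
    obtain ⟨t, ht⟩ := mem_range_of_exists_le_of_exists_ge g.continuous ⟨x, not_lt.1 hneg⟩ ⟨y, hy⟩
    exact h0 t ht

/-- In odd degree -g(-X) would again be monic without real root, so that g(0) and -g(0) would both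
be positive. -/
theorem even_natDegree_of_no_root {g : Polynomial ℝ} (hg : g.Monic) (h0 : ∀ x, g.eval x ≠ 0) :
    Even g.natDegree := by
  by_contra hodd
  rw [Nat.not_even_iff_odd] at hodd
  have hd : (-Polynomial.X : Polynomial ℝ).natDegree = 1 := by
    rw [Polynomial.natDegree_neg, Polynomial.natDegree_X]
  have hm : (-(g.comp (-Polynomial.X))).Monic := by
    rw [Polynomial.Monic, Polynomial.leadingCoeff_neg, Polynomial.leadingCoeff_comp (by rw [hd]; exact one_ne_zero), hg.leadingCoeff,
      Polynomial.leadingCoeff_neg, Polynomial.leadingCoeff_X, hodd.neg_one_pow]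
    ring
  have h1 := pos_of_monic_of_no_root hm (fun x => by
    simp only [Polynomial.eval_neg, Polynomial.eval_comp, Polynomial.eval_X, ne_eq, neg_eq_zero]
    exact h0 _) 0
  have h2 := pos_of_monic_of_no_root hg h0 0
  simp at h1
  exact lt_asymm h1 h2

/-! ### Simple roots and the sign of a polynomial on the line. -/

/-- The simple real roots. -/
noncomputable def simpleReal {n : ℕ} (p : Fin n → ℝ) : Finset ℝ :=
  (realPoly p).roots.toFinset.filter fun a => (realPoly p).derivative.eval a ≠ 0

theorem mem_simpleReal {n : ℕ} {p : Fin n → ℝ} {a : ℝ} : a ∈ simpleReal p ↔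
    (realPoly p).eval a = 0 ∧ (realPoly p).derivative.eval a ≠ 0 := by
  simp [simpleReal, (realPoly_monic p).ne_zero]

/-- The simple non-real roots. -/
noncomputable def simpleNonreal {n : ℕ} (p : Fin n → ℝ) : Finset ℂ :=
  (monicPoly p).roots.toFinset.filter fun z => z.im ≠ 0 ∧ (monicPoly p).derivative.eval z ≠ 0

theorem monicPoly_monic {n : ℕ} (p : Fin n → ℝ) : (monicPoly p).Monic := by
  rw [monicPoly_eq_map]; exact (realPoly_monic p).map _

theorem monicPoly_natDegree {n : ℕ} (p : Fin n → ℝ) : (monicPoly p).natDegree = n := by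
  rw [monicPoly_eq_map, (realPoly_monic p).natDegree_map, realPoly_natDegree]

theorem mem_simpleNonreal {n : ℕ} {p : Fin n → ℝ} {z : ℂ} : z ∈ simpleNonreal p ↔
    z.im ≠ 0 ∧ (monicPoly p).eval z = 0 ∧ (monicPoly p).derivative.eval z ≠ 0 := by
  simp [simpleNonreal, (monicPoly_monic p).ne_zero]
  tauto

/-- All complex roots are simple. -/
def SimpleRoots {n : ℕ} (p : Fin n → ℝ) : Prop :=
  ∀ z, (monicPoly p).eval z = 0 → (monicPoly p).derivative.eval z ≠ 0

theorem monicPoly_derivative_eval_ofReal {n : ℕ} (b : Fin n → ℝ) (x : ℝ) :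
    (monicPoly b).derivative.eval (x : ℂ) = (((realPoly b).derivative.eval x : ℝ) : ℂ) := by
  simp [monicPoly_derivative_eval, realPoly_derivative_eval]

theorem SimpleRoots.real {n : ℕ} {p : Fin n → ℝ} (h : SimpleRoots p) {a : ℝ}
    (ha : (realPoly p).eval a = 0) : (realPoly p).derivative.eval a ≠ 0 := by
  have := h a (by rw [monicPoly_eval_ofReal, ha]; rfl)
  rw [monicPoly_derivative_eval_ofReal] at this
  exact_mod_cast this

theorem exists_factor {n : ℕ} {p : Fin n → ℝ} (h : SimpleRoots p) :
    ∃ g : Polynomial ℝ, g.Monic ∧ (∀ x, g.eval x ≠ 0) ∧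
      realPoly p = (∏ a ∈ simpleReal p, (Polynomial.X - Polynomial.C a)) * g := by
  have hdvd : (∏ a ∈ simpleReal p, (Polynomial.X - Polynomial.C a)) ∣ realPoly p := by
    refine Finset.prod_dvd_of_coprime ?_ ?_
    · intro a _ b _ hab
      exact Polynomial.isCoprime_X_sub_C_of_isUnit_sub (sub_ne_zero.2 hab).isUnit
    · intro a ha
      exact Polynomial.dvd_iff_isRoot.2 (mem_simpleReal.1 ha).1
  obtain ⟨g, hg⟩ := hdvd
  have hpm : (∏ a ∈ simpleReal p, (Polynomial.X - Polynomial.C a)).Monic :=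
    Polynomial.monic_prod_of_monic _ _ fun a _ => Polynomial.monic_X_sub_C a
  refine ⟨g, ?_, fun x hx => ?_, hg⟩
  · have := realPoly_monic p
    rw [hg] at this
    exact hpm.of_mul_monic_left this
  · have hx0 : (realPoly p).eval x = 0 := by rw [hg, Polynomial.eval_mul, hx, mul_zero]
    have hmem : x ∈ simpleReal p := mem_simpleReal.2 ⟨hx0, h.real hx0⟩
    refine h.real hx0 ?_
    rw [hg, ← Finset.mul_prod_erase _ _ hmem]
    simp [Polynomial.derivative_mul, hx]

theorem sign_mul_real (x y : ℝ) : Real.sign (x * y) = Real.sign x * Real.sign y := by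
  rcases lt_trichotomy x 0 with hx | rfl | hx <;> rcases lt_trichotomy y 0 with hy | rfl | hy <;>
    simp [Real.sign_of_neg, Real.sign_of_pos, mul_pos_of_neg_of_neg, mul_neg_of_neg_of_pos,
      mul_neg_of_pos_of_neg, *]

theorem sign_prod_real {ι : Type*} (t : Finset ι) (f : ι → ℝ) :
    Real.sign (∏ i ∈ t, f i) = ∏ i ∈ t, Real.sign (f i) := by
  classical
  induction t using Finset.induction_on with
  | empty => simp
  | insert a t ha ih => rw [Finset.prod_insert ha, Finset.prod_insert ha, sign_mul_real, ih]

/-- Split off the real roots: the remaining factor is positive and of even degree, so it affects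
neither the signs nor the parity, and `prod_sign_eq_sum` applies. The point is that the
non-polynomial quantity sgn p(x) becomes a sum over real roots, to which the area formula can be
applied once more. -/
theorem sign_eval_eq_sum {n : ℕ} {p : Fin n → ℝ} (h : SimpleRoots p) (x : ℝ)
    (hx : (realPoly p).eval x ≠ 0) :
    Real.sign ((realPoly p).eval x) =
      ∑ y ∈ simpleReal p, Real.sign ((realPoly p).derivative.eval y) * Real.sign (x - y) +
        (if Even n then 1 else 0) := by
  classical
  obtain ⟨g, g1, g2, g3⟩ := exists_factor h
  have hpos := pos_of_monic_of_no_root g1 g2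
  have hd : ∀ y ∈ simpleReal p, Real.sign ((realPoly p).derivative.eval y) =
      ∏ t ∈ (simpleReal p).erase y, Real.sign (y - t) := by
    intro y hy
    rw [g3, ← Finset.mul_prod_erase _ _ hy]
    simp only [mul_assoc, Polynomial.derivative_mul, Polynomial.derivative_sub,
      Polynomial.derivative_X, Polynomial.derivative_C, sub_zero, one_mul, Polynomial.eval_add,
      Polynomial.eval_mul, Polynomial.eval_sub, Polynomial.eval_X, Polynomial.eval_C, sub_self,
      zero_mul, add_zero]
    rw [sign_mul_real, Real.sign_of_pos (hpos y), mul_one, Polynomial.eval_prod, sign_prod_real]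
    simp
  have hcard : Even (simpleReal p).card ↔ Even n := by
    have h1 := congrArg Polynomial.natDegree g3
    rw [realPoly_natDegree, Polynomial.Monic.natDegree_mul
      (Polynomial.monic_prod_of_monic _ _ fun a _ => Polynomial.monic_X_sub_C a) g1,
      Polynomial.natDegree_prod_of_monic _ _ (fun a _ => Polynomial.monic_X_sub_C a)] at h1
    simp at h1
    have h4 : Even n ↔ Even ((simpleReal p).card + g.natDegree) := by rw [← h1]
    rw [h4, Nat.even_add]
    simp [even_natDegree_of_no_root g1 g2]
  have hx' : x ∉ simpleReal p := fun hm => hx (mem_simpleReal.1 hm).1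
  rw [Finset.sum_congr rfl fun y hy => by rw [hd y hy]]
  simp only [← hcard]
  rw [← prod_sign_eq_sum _ x hx', g3, Polynomial.eval_mul, sign_mul_real,
    Real.sign_of_pos (hpos x), mul_one, Polynomial.eval_prod, sign_prod_real]
  simp

/-- To the right of all real roots `sign_eval_eq_sum` reads 1 = sum + 1. -/
theorem sum_sign_derivative {n : ℕ} {p : Fin n → ℝ} (h : SimpleRoots p) (hn : Even n) :
    ∑ y ∈ simpleReal p, Real.sign ((realPoly p).derivative.eval y) = 0 := by
  obtain ⟨x, hx1, hx2⟩ : ∃ x, 0 < (realPoly p).eval x ∧ ∀ y ∈ simpleReal p, y < x := by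
    have h1 : ∀ᶠ x in atTop, ∀ y ∈ simpleReal p, y < x :=
      (Finset.eventually_all _).2 fun y _ => eventually_gt_atTop y
    rcases Nat.eq_zero_or_pos n with rfl | hn0
    · obtain ⟨x, hx⟩ := h1.exists
      exact ⟨x, by simp [realPoly_eval], hx⟩
    have ht := (realPoly p).tendsto_atTop_of_leadingCoeff_nonneg
      (Polynomial.natDegree_pos_iff_degree_pos.1 (by rwa [realPoly_natDegree]))
      (by rw [(realPoly_monic p).leadingCoeff]; exact zero_le_one)
    exact ((ht.eventually_gt_atTop 0).and h1).exists
  have h2 := sign_eval_eq_sum h x hx1.ne'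
  rw [Real.sign_of_pos hx1, if_pos hn, Finset.sum_congr rfl fun y hy => by
    rw [Real.sign_of_pos (sub_pos.2 (hx2 y hy)), mul_one]] at h2
  linarith

/- ## Almost every polynomial has simple roots -/

/-- The polynomials with a multiple root in a given closed disc form a closed set, being the
projection of a closed set along a compact factor. -/
theorem measurableSet_simpleRoots (n : ℕ) : MeasurableSet {p : Fin n → ℝ | SimpleRoots p} := by
  have h1 : {p : Fin n → ℝ | SimpleRoots p}ᶜ = ⋃ m : ℕ, Prod.snd ''
      ({x : (Metric.closedBall (0 : ℂ) m) × (Fin n → ℝ) | (monicPoly x.2).eval (x.1 : ℂ) = 0 ∧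
        (monicPoly x.2).derivative.eval (x.1 : ℂ) = 0}) := by
    ext p
    simp only [SimpleRoots, mem_compl_iff, mem_ofPred_eq, mem_iUnion, mem_image, Prod.exists,
      Subtype.exists]
    push Not
    constructor
    · rintro ⟨z, hz1, hz2⟩
      obtain ⟨m, hm⟩ := exists_nat_ge ‖z‖
      exact ⟨m, z, by simpa using hm, p, ⟨hz1, hz2⟩, rfl⟩
    · rintro ⟨m, z, _, p', ⟨h1, h2⟩, rfl⟩
      exact ⟨z, h1, h2⟩
  rw [← MeasurableSet.compl_iff, h1]
  refine MeasurableSet.iUnion fun m => IsClosed.measurableSet ?_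
  have : CompactSpace (Metric.closedBall (0 : ℂ) m) :=
    isCompact_iff_compactSpace.1 (isCompact_closedBall _ _)
  refine isClosedMap_snd_of_compactSpace _ ?_
  have hc : Continuous fun x : (Metric.closedBall (0 : ℂ) m) × (Fin n → ℝ) => ((x.1 : ℂ), x.2) := by
    fun_prop
  exact (isClosed_eq ((continuous_monicPoly_eval n).comp hc) continuous_const).inter
    (isClosed_eq ((continuous_monicPoly_derivative_eval n).comp hc) continuous_const)

/-- Fix all coefficients except the constant one. The derivative does not involve it and is not zero
because the degree is positive, so only the finitely many constants cancelling a critical value can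
produce a multiple root. -/
theorem ae_simpleRoots (n : ℕ) : ∀ᵐ p : Fin (n + 1) → ℝ, SimpleRoots p := by
  rw [← (measurePreserving_consReal n).map_eq, ae_map_iff (consReal n).measurable.aemeasurable
    (measurableSet_simpleRoots _), Measure.volume_eq_prod]
  have hm : MeasurableSet {x : ℝ × (Fin n → ℝ) | SimpleRoots (consReal n x)} :=
    (consReal n).measurable (measurableSet_simpleRoots _)
  have hm' : MeasurableSet (Prod.swap ⁻¹' {x : ℝ × (Fin n → ℝ) | SimpleRoots (consReal n x)}) :=
    measurable_swap hm
  suffices h : ∀ᵐ x : (Fin n → ℝ) × ℝ ∂(volume.prod volume), SimpleRoots (consReal n x.swap) by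
    exact Measure.measurePreserving_swap.quasiMeasurePreserving.ae h
  refine (Measure.ae_prod_iff_ae_ae hm').2 (Eventually.of_forall fun b => ?_)
  let P := monicPoly (consReal n (0, b))
  have hP : P.derivative ≠ 0 := by
    intro h0
    have := Polynomial.derivative_eq_zero.1 h0
    rw [monicPoly_natDegree] at this
    omega
  have hev : ∀ c z, (monicPoly (consReal n (c, b))).eval z = c + P.eval z := by
    intro c z
    simp only [P, consReal_apply, monicPoly_eval, Fin.sum_univ_succ]
    simp; ring
  have hder : ∀ c, (monicPoly (consReal n (c, b))).derivative = P.derivative := by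
    intro c
    have : monicPoly (consReal n (c, b)) = Polynomial.C (c : ℂ) + P :=
      Polynomial.funext fun z => by rw [hev]; simp
    rw [this]; simp
  have hfin : Set.Finite {c : ℝ | ¬ SimpleRoots (consReal n (c, b))} := by
    refine (((P.derivative.roots.toFinset).image fun z => -(P.eval z).re).finite_toSet).subset ?_
    intro c hc
    simp only [mem_ofPred_eq, SimpleRoots] at hc
    push Not at hc
    obtain ⟨z, hz1, hz2⟩ := hc
    rw [hder] at hz2
    rw [hev] at hz1
    simp only [Finset.coe_image, mem_image, Finset.mem_coe, Multiset.mem_toFinset]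
    refine ⟨z, (Polynomial.mem_roots hP).2 hz2, ?_⟩
    have := congrArg Complex.re hz1
    simp at this
    linarith
  exact (hfin.measure_zero volume)

theorem continuous_coeff_realPoly (n j : ℕ) :
    Continuous fun q : Fin n → ℝ => (realPoly q).coeff j := by
  rcases lt_or_ge j n with h | h
  · have : (fun q : Fin n → ℝ => (realPoly q).coeff j) = fun q => q ⟨j, h⟩ :=
      funext fun q => realPoly_coeff q ⟨j, h⟩
    rw [this]; fun_prop
  · have : (fun q : Fin n → ℝ => (realPoly q).coeff j) = fun q => if j = n then 1 else 0 := by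
      funext q
      split_ifs with h1
      · have := (realPoly_monic q).coeff_natDegree
        rw [realPoly_natDegree] at this
        rw [h1, this]
      · refine Polynomial.coeff_eq_zero_of_natDegree_lt ?_
        rw [realPoly_natDegree]; omega
    rw [this]; fun_prop

theorem continuous_mulLin (n : ℕ) :
    Continuous fun x : ℝ × (Fin n → ℝ) => mulLin x.1 x.2 := by
  refine continuous_pi fun i => ?_
  simp only [mulLin, lowCoeff, Polynomial.coeff_mul]
  refine continuous_finsetSum _ fun k _ => Continuous.mul ?_
    ((continuous_coeff_realPoly n k.2).comp continuous_snd)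
  simp only [Polynomial.coeff_sub, Polynomial.coeff_C]
  split_ifs <;> fun_prop

theorem continuous_mulQuad (n : ℕ) :
    Continuous fun x : ℂ × (Fin n → ℝ) => mulQuad x.1 x.2 := by
  refine continuous_pi fun i => ?_
  simp only [mulQuad, lowCoeff, Polynomial.coeff_mul]
  refine continuous_finsetSum _ fun k _ => Continuous.mul ?_
    ((continuous_coeff_realPoly n k.2).comp continuous_snd)
  simp only [quadPoly, Polynomial.coeff_add, Polynomial.coeff_sub, Polynomial.coeff_C_mul,
    Polynomial.coeff_C]
  have h1 : Continuous fun x : ℂ × (Fin n → ℝ) => x.1.re := Complex.continuous_re.comp continuous_fst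
  have h2 : Continuous fun x : ℂ × (Fin n → ℝ) => Complex.normSq x.1 :=
    Complex.continuous_normSq.comp continuous_fst
  split_ifs <;> fun_prop

/- ## The density of the coefficients -/

/-- The Mahler measure to the power `-s`. -/
noncomputable def polyDensity (s : ℝ) {n : ℕ} (b : Fin n → ℝ) : ℝ :=
  (monicPoly b).mahlerMeasure ^ (-s)

theorem one_le_mahler {n : ℕ} (b : Fin n → ℝ) : 1 ≤ (monicPoly b).mahlerMeasure := by
  have := Polynomial.leadingCoeff_le_mahlerMeasure (monicPoly b)
  rwa [(monicPoly_monic b).leadingCoeff, norm_one] at this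

theorem polyDensity_pos (s : ℝ) {n : ℕ} (b : Fin n → ℝ) : 0 < polyDensity s b :=
  Real.rpow_pos_of_pos (zero_lt_one.trans_le (one_le_mahler b)) _

theorem measurable_mahler (n : ℕ) :
    Measurable fun b : Fin n → ℝ => (monicPoly b).mahlerMeasure := by
  simp_rw [fun b : Fin n → ℝ => Polynomial.mahlerMeasure_def_of_ne_zero (monicPoly_monic b).ne_zero,
    intervalIntegral.integral_of_le Real.two_pi_pos.le]
  refine Real.measurable_exp.comp (measurable_const.mul ?_)
  refine (StronglyMeasurable.integral_prod_right (ν := volume.restrict (Ioc 0 (2 * Real.pi)))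
    (f := fun (b : Fin n → ℝ) (x : ℝ) =>
      Real.log ‖(monicPoly b).eval (circleMap 0 1 x)‖) ?_).measurable
  refine Measurable.stronglyMeasurable (Real.measurable_log.comp (measurable_norm.comp ?_))
  have : Continuous fun x : (Fin n → ℝ) × ℝ => (circleMap 0 1 x.2, x.1) :=
    ((continuous_circleMap 0 1).comp continuous_snd).prodMk continuous_fst
  exact ((continuous_monicPoly_eval n).comp this).measurable

theorem measurable_polyDensity (s : ℝ) (n : ℕ) :
    Measurable fun b : Fin n → ℝ => polyDensity s b :=
  (measurable_mahler n).pow_const _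

/-- Multiplicativity of the Mahler measure: a root contributes its weight, and the cofactor has the
same type of density, with the same s in a lower degree. -/
theorem polyDensity_mulLin (s : ℝ) {n : ℕ} (a : ℝ) (q : Fin n → ℝ) :
    polyDensity s (mulLin a q) = weight s a * polyDensity s q := by
  rw [polyDensity, monicPoly_mulLin, Polynomial.mahlerMeasure_mul,
    Polynomial.mahlerMeasure_X_sub_C, Real.mul_rpow (le_max_of_le_left zero_le_one)
    (Polynomial.mahlerMeasure_nonneg _)]
  rfl

theorem polyDensity_mulQuad (s : ℝ) {n : ℕ} (z : ℂ) (q : Fin n → ℝ) :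
    polyDensity s (mulQuad z q) = weight s z ^ 2 * polyDensity s q := by
  rw [polyDensity, monicPoly_mulQuad, Polynomial.mahlerMeasure_mul, Polynomial.mahlerMeasure_mul,
    Polynomial.mahlerMeasure_X_sub_C, Polynomial.mahlerMeasure_X_sub_C, RCLike.norm_conj,
    Real.mul_rpow (by positivity) (Polynomial.mahlerMeasure_nonneg _),
    Real.mul_rpow (by positivity) (by positivity), ← sq]
  rfl

/-- The coefficients are at most binomial multiples of the Mahler measure. Hence the density decays
like ‖b‖^{-s}, and moments of order k exist as soon as n + k < s. -/
theorem one_add_norm_le {n : ℕ} (b : Fin n → ℝ) :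
    1 + ‖b‖ ≤ (1 + 2 ^ n) * (monicPoly b).mahlerMeasure := by
  have h1 := one_le_mahler b
  have h2 : ‖b‖ ≤ 2 ^ n * (monicPoly b).mahlerMeasure := by
    refine (pi_norm_le_iff_of_nonneg (by positivity)).2 fun i => ?_
    have h3 := Polynomial.norm_coeff_le_choose_mul_mahlerMeasure i (monicPoly b)
    rw [monicPoly_natDegree] at h3
    have h4 : (monicPoly b).coeff i = ((b i : ℝ) : ℂ) := by
      rw [monicPoly_eq_map, Polynomial.coeff_map, realPoly_coeff]; rfl
    rw [h4, Complex.norm_real] at h3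
    refine h3.trans (mul_le_mul_of_nonneg_right ?_ (by positivity))
    exact_mod_cast Nat.choose_le_two_pow n i
  linarith

theorem polyDensity_le {s : ℝ} (hs : 0 ≤ s) {n : ℕ} (b : Fin n → ℝ) :
    polyDensity s b ≤ (1 + 2 ^ n) ^ s * (1 + ‖b‖) ^ (-s) := by
  have h1 := one_add_norm_le b
  have h2 := one_le_mahler b
  have h3 : (0 : ℝ) < 1 + 2 ^ n := by positivity
  have h4 : 0 < 1 + ‖b‖ := by positivity
  have h5 : (1 + ‖b‖) / (1 + 2 ^ n) ≤ (monicPoly b).mahlerMeasure := by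
    rw [div_le_iff₀ h3]; linarith
  calc polyDensity s b ≤ ((1 + ‖b‖) / (1 + 2 ^ n)) ^ (-s) :=
        Real.rpow_le_rpow_of_nonpos (by positivity) h5 (neg_nonpos.2 hs)
    _ = _ := by
        rw [Real.div_rpow h4.le h3.le, Real.rpow_neg h3.le, div_inv_eq_mul, mul_comm]

theorem integrable_pow_mul_polyDensity {s : ℝ} {n k : ℕ} (hs : (n : ℝ) + k < s) :
    Integrable fun b : Fin n → ℝ => (1 + ‖b‖) ^ k * polyDensity s b := by
  have h0 : 0 ≤ s := le_trans (by positivity) hs.le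
  have h1 : Integrable fun b : Fin n → ℝ => (1 + 2 ^ n) ^ s * (1 + ‖b‖) ^ (-(s - k)) :=
    (integrable_one_add_norm (by simp; linarith)).const_mul _
  refine h1.mono' ?_ (Eventually.of_forall fun b => ?_)
  · exact (((continuous_const.add continuous_norm).pow k).measurable.mul
      (measurable_polyDensity s n)).aestronglyMeasurable
  · have hp : 0 < 1 + ‖b‖ := by positivity
    rw [Real.norm_of_nonneg (mul_nonneg (by positivity) (polyDensity_pos s b).le)]
    calc (1 + ‖b‖) ^ k * polyDensity s b
        ≤ (1 + ‖b‖) ^ k * ((1 + 2 ^ n) ^ s * (1 + ‖b‖) ^ (-s)) :=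
          mul_le_mul_of_nonneg_left (polyDensity_le h0 b) (by positivity)
      _ = (1 + 2 ^ n) ^ s * (1 + ‖b‖) ^ (-(s - k)) := by
          rw [show -(s - (k : ℝ)) = k + -s by ring, Real.rpow_add hp, Real.rpow_natCast]; ring

theorem abs_coeff_realPoly_le {n : ℕ} (q : Fin n → ℝ) (j : ℕ) :
    |(realPoly q).coeff j| ≤ 1 + ‖q‖ := by
  rcases lt_trichotomy j n with h | h | h
  · rw [realPoly_coeff q ⟨j, h⟩, ← Real.norm_eq_abs]
    exact (norm_le_pi_norm q _).trans (by linarith)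
  · have := (realPoly_monic q).coeff_natDegree
    rw [realPoly_natDegree] at this
    rw [h, this, abs_one]
    linarith [norm_nonneg q]
  · rw [Polynomial.coeff_eq_zero_of_natDegree_lt (by rw [realPoly_natDegree]; omega), abs_zero]
    positivity

theorem monicPoly_eval_eq_sum {n : ℕ} (q : Fin n → ℝ) (z : ℂ) :
    (monicPoly q).eval z = ∑ j ∈ Finset.range (n + 1), ((realPoly q).coeff j : ℂ) * z ^ j := by
  rw [Polynomial.eval_eq_sum_range, monicPoly_natDegree]
  refine Finset.sum_congr rfl fun j _ => ?_
  rw [monicPoly_eq_map, Polynomial.coeff_map]; rfl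

theorem integral_polyDensity_pos {s : ℝ} {n : ℕ} (hs : (n : ℝ) < s) :
    0 < ∫ b : Fin n → ℝ, polyDensity s b := by
  have hi : Integrable fun b : Fin n → ℝ => polyDensity s b := by
    simpa using integrable_pow_mul_polyDensity (k := 0) (by simpa using hs)
  rw [integral_pos_iff_support_of_nonneg (fun b => (polyDensity_pos s b).le) hi]
  have : Function.support (fun b : Fin n → ℝ => polyDensity s b) = univ :=
    eq_univ_of_forall fun b => (polyDensity_pos s b).ne'
  rw [this]
  exact isOpen_univ.measure_pos volume univ_nonempty

/- ## Signed sums over fibres -/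

section Signed

variable {X Z P : Type*} [MeasurableSpace X] [MeasurableSpace Z] [MeasurableSpace P]

/-- Transfers the area formulas from non-negative to signed functions by means of positive and
negative parts. Integrability is only required upstairs, where it can be checked by majorants; that
of the sum over roots follows. The hypothesis `h` abstracts what the real and the complex area
formula have in common. -/
theorem integral_fiber_real {μ : Measure X} {ρ : Measure P} {ω : X → ℝ} (hω : ∀ x, 0 ≤ ω x)
    {π : X → Z} {Ψ : X → P} {A : P → Finset Z}
    (h : ∀ G : Z → P → ENNReal, Measurable (Function.uncurry G) →
      Measurable (fun p => ∑' z, (A p : Set Z).indicator (fun z => G z p) z) ∧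
      ∫⁻ x, ENNReal.ofReal (ω x) * G (π x) (Ψ x) ∂μ =
        ∫⁻ p, ∑' z, (A p : Set Z).indicator (fun z => G z p) z ∂ρ)
    {Φ : Z → P → ℝ} (hΦ : Measurable (Function.uncurry Φ))
    (hi : Integrable (fun x => ω x * Φ (π x) (Ψ x)) μ) :
    Integrable (fun p => ∑ z ∈ A p, Φ z p) ρ ∧
      ∫ x, ω x * Φ (π x) (Ψ x) ∂μ = ∫ p, ∑ z ∈ A p, Φ z p ∂ρ := by
  classical
  have hsum : ∀ (G : Z → P → ENNReal) p,
      ∑' z, (A p : Set Z).indicator (fun z => G z p) z = ∑ z ∈ A p, G z p := fun G p => by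
    rw [← tsum_subtype]
    exact Finset.tsum_subtype' (A p) fun z => G z p
  simp_rw [hsum] at h
  obtain ⟨p1, p2⟩ := h (fun z p => ENNReal.ofReal (Φ z p)) (ENNReal.measurable_ofReal.comp hΦ)
  obtain ⟨n1, n2⟩ := h (fun z p => ENNReal.ofReal (-Φ z p)) (ENNReal.measurable_ofReal.comp hΦ.neg)
  have e1 : ∀ x, ENNReal.ofReal (ω x) * ENNReal.ofReal (Φ (π x) (Ψ x)) =
      ENNReal.ofReal (ω x * Φ (π x) (Ψ x)) := fun x => (ENNReal.ofReal_mul (hω x)).symm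
  have e2 : ∀ x, ENNReal.ofReal (ω x) * ENNReal.ofReal (-Φ (π x) (Ψ x)) =
      ENNReal.ofReal (-(ω x * Φ (π x) (Ψ x))) := fun x => by
    rw [← ENNReal.ofReal_mul (hω x), mul_neg]
  simp_rw [e1] at p2
  simp_rw [e2] at n2
  have f1 : ∫⁻ p, ∑ z ∈ A p, ENNReal.ofReal (Φ z p) ∂ρ ≠ ⊤ := by
    rw [← p2]; exact (hi.lintegral_lt_top).ne
  have f2 : ∫⁻ p, ∑ z ∈ A p, ENNReal.ofReal (-Φ z p) ∂ρ ≠ ⊤ := by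
    rw [← n2]; exact (hi.neg.lintegral_lt_top).ne
  have i1 := integrable_toReal_of_lintegral_ne_top p1.aemeasurable f1
  have i2 := integrable_toReal_of_lintegral_ne_top n1.aemeasurable f2
  have hdec : ∀ p, ∑ z ∈ A p, Φ z p = (∑ z ∈ A p, ENNReal.ofReal (Φ z p)).toReal -
      (∑ z ∈ A p, ENNReal.ofReal (-Φ z p)).toReal := by
    intro p
    rw [ENNReal.toReal_sum (fun _ _ => ENNReal.ofReal_ne_top),
      ENNReal.toReal_sum (fun _ _ => ENNReal.ofReal_ne_top), ← Finset.sum_sub_distrib]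
    refine Finset.sum_congr rfl fun z _ => ?_
    rw [ENNReal.toReal_ofReal', ENNReal.toReal_ofReal', max_zero_sub_eq_self]
  simp_rw [hdec]
  refine ⟨i1.sub i2, ?_⟩
  rw [integral_sub i1 i2, integral_toReal p1.aemeasurable
    (ae_lt_top p1 f1), integral_toReal n1.aemeasurable (ae_lt_top n1 f2), ← p2, ← n2]
  exact integral_eq_lintegral_pos_part_sub_lintegral_neg_part hi

theorem integral_fiber {μ : Measure X} {ρ : Measure P} {ω : X → ℝ} (hω : ∀ x, 0 ≤ ω x)
    {π : X → Z} {Ψ : X → P} {A : P → Finset Z}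
    (h : ∀ G : Z → P → ENNReal, Measurable (Function.uncurry G) →
      Measurable (fun p => ∑' z, (A p : Set Z).indicator (fun z => G z p) z) ∧
      ∫⁻ x, ENNReal.ofReal (ω x) * G (π x) (Ψ x) ∂μ =
        ∫⁻ p, ∑' z, (A p : Set Z).indicator (fun z => G z p) z ∂ρ)
    {Φ : Z → P → ℂ} (hΦ : Measurable (Function.uncurry Φ))
    (hi : Integrable (fun x => (ω x : ℂ) * Φ (π x) (Ψ x)) μ) :
    Integrable (fun p => ∑ z ∈ A p, Φ z p) ρ ∧
      ∫ x, (ω x : ℂ) * Φ (π x) (Ψ x) ∂μ = ∫ p, ∑ z ∈ A p, Φ z p ∂ρ := by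
  have hire : Integrable (fun x => ω x * (Φ (π x) (Ψ x)).re) μ := by
    simpa using hi.re
  have hiim : Integrable (fun x => ω x * (Φ (π x) (Ψ x)).im) μ := by
    simpa using hi.im
  obtain ⟨a1, a2⟩ := integral_fiber_real hω h (Φ := fun z p => (Φ z p).re)
    (Complex.measurable_re.comp hΦ) hire
  obtain ⟨b1, b2⟩ := integral_fiber_real hω h (Φ := fun z p => (Φ z p).im)
    (Complex.measurable_im.comp hΦ) hiim
  have hI : Integrable (fun p => ∑ z ∈ A p, Φ z p) ρ := by
    have := a1.ofReal (𝕜 := ℂ) |>.add ((b1.ofReal (𝕜 := ℂ)).mul_const Complex.I)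
    refine this.congr (Eventually.of_forall fun p => ?_)
    simp only [Pi.add_apply, Complex.coe_algebraMap]
    apply Complex.ext <;> simp
  refine ⟨hI, ?_⟩
  rw [← integral_re_add_im hi, ← integral_re_add_im hI]
  simp only [Complex.coe_algebraMap, RCLike.re_to_complex, RCLike.im_to_complex,
    Complex.re_ofReal_mul, Complex.im_ofReal_mul, Complex.re_sum, Complex.im_sum]
  rw [a2, b2]

end Signed

theorem fiber_real (n : ℕ) (G : ℝ → (Fin (n + 1) → ℝ) → ENNReal)
    (hG : Measurable (Function.uncurry G)) :
    Measurable (fun p : Fin (n + 1) → ℝ =>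
      ∑' a, (simpleReal p : Set ℝ).indicator (fun a => G a p) a) ∧
    ∫⁻ x : ℝ × (Fin n → ℝ), ENNReal.ofReal |(realPoly x.2).eval x.1| * G x.1 (mulLin x.1 x.2) =
      ∫⁻ p : Fin (n + 1) → ℝ, ∑' a, (simpleReal p : Set ℝ).indicator (fun a => G a p) a := by
  have hs : ∀ p : Fin (n + 1) → ℝ, (simpleReal p : Set ℝ) =
      {a | (realPoly p).eval a = 0 ∧ (realPoly p).derivative.eval a ≠ 0} := fun p => by
    ext a; simp [mem_simpleReal]
  simp_rw [hs]
  obtain ⟨h1, h2⟩ := lintegral_area_real n hG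
  refine ⟨h1, ?_⟩
  rw [← h2, Measure.volume_eq_prod, lintegral_prod]
  exact ((ENNReal.measurable_ofReal.comp (continuous_realPoly_eval n).abs.measurable).mul
    (hG.comp (measurable_fst.prodMk (continuous_mulLin n).measurable))).aemeasurable

theorem fiber_complex (n : ℕ) (G : ℂ → (Fin (n + 2) → ℝ) → ENNReal)
    (hG : Measurable (Function.uncurry G)) :
    Measurable (fun p : Fin (n + 2) → ℝ =>
      ∑' z, (simpleNonreal p : Set ℂ).indicator (fun z => G z p) z) ∧
    ∫⁻ x : ℂ × (Fin n → ℝ),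
        ENNReal.ofReal (4 * |x.1.im| * Complex.normSq ((monicPoly x.2).eval x.1)) *
          G x.1 (mulQuad x.1 x.2) =
      ∫⁻ p : Fin (n + 2) → ℝ, ∑' z, (simpleNonreal p : Set ℂ).indicator (fun z => G z p) z := by
  have hs : ∀ p : Fin (n + 2) → ℝ, (simpleNonreal p : Set ℂ) =
      {z | z.im ≠ 0 ∧ (monicPoly p).eval z = 0 ∧ (monicPoly p).derivative.eval z ≠ 0} := fun p => by
    ext a; simp [mem_simpleNonreal]
  simp_rw [hs]
  obtain ⟨h1, h2⟩ := lintegral_area_complex n hG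
  refine ⟨h1, ?_⟩
  rw [← h2, Measure.volume_eq_prod, lintegral_prod]
  refine ((ENNReal.measurable_ofReal.comp ?_).mul
    (hG.comp (measurable_fst.prodMk (continuous_mulQuad n).measurable))).aemeasurable
  refine (measurable_const.mul (continuous_abs.measurable.comp
    (Complex.measurable_im.comp measurable_fst))).mul ?_
  exact (Complex.continuous_normSq.comp (continuous_monicPoly_eval n)).measurable

/- ## Integrability -/

theorem weight_pos (s : ℝ) (z : ℂ) : 0 < weight s z :=
  Real.rpow_pos_of_pos (lt_max_of_lt_left zero_lt_one) _

theorem continuous_weight (s : ℝ) : Continuous fun z : ℂ => weight s z := by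
  refine (continuous_const.max continuous_norm).rpow_const fun z => Or.inl ?_
  exact (lt_max_of_lt_left zero_lt_one).ne'

theorem weight_le {s : ℝ} (hs : 0 ≤ s) (z : ℂ) : weight s z ≤ 2 ^ s * (1 + ‖z‖) ^ (-s) := by
  have h1 : (1 + ‖z‖) / 2 ≤ max 1 ‖z‖ := by
    rcases le_total 1 ‖z‖ with h | h
    · rw [max_eq_right h]; linarith
    · rw [max_eq_left h]; linarith
  have h4 : 0 < 1 + ‖z‖ := by positivity
  calc weight s z ≤ ((1 + ‖z‖) / 2) ^ (-s) :=
        Real.rpow_le_rpow_of_nonpos (by positivity) h1 (neg_nonpos.2 hs)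
    _ = _ := by
        rw [Real.div_rpow h4.le zero_le_two, Real.rpow_neg zero_le_two, div_inv_eq_mul, mul_comm]

theorem integrable_pow_mul_weight {s : ℝ} {m : ℕ} (hs : (m : ℝ) + 1 < s) :
    Integrable fun y : ℝ => (1 + |y|) ^ m * weight s y := by
  have h0 : 0 ≤ s := le_trans (by positivity) hs.le
  have h1 : Integrable fun y : ℝ => 2 ^ s * (1 + ‖y‖) ^ (-(s - m)) :=
    (integrable_one_add_norm (by simp; linarith)).const_mul _
  refine h1.mono' ?_ (Eventually.of_forall fun b => ?_)
  · exact (((continuous_const.add continuous_abs).pow m).mul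
      ((continuous_weight s).comp Complex.continuous_ofReal)).aestronglyMeasurable
  · have hp : 0 < 1 + |b| := by positivity
    rw [Real.norm_of_nonneg (mul_nonneg (by positivity) (weight_pos s b).le)]
    have := weight_le h0 (b : ℂ)
    rw [Complex.norm_real, Real.norm_eq_abs] at this
    calc (1 + |b|) ^ m * weight s b
        ≤ (1 + |b|) ^ m * (2 ^ s * (1 + |b|) ^ (-s)) :=
          mul_le_mul_of_nonneg_left this (by positivity)
      _ = 2 ^ s * (1 + ‖b‖) ^ (-(s - m)) := by
          rw [Real.norm_eq_abs, show -(s - (m : ℝ)) = m + -s by ring, Real.rpow_add hp,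
            Real.rpow_natCast]; ring

theorem integrable_pow_mul_weight_sq {s : ℝ} {m : ℕ} (hs : (m : ℝ) + 2 < 2 * s) :
    Integrable fun z : ℂ => (1 + ‖z‖) ^ m * weight s z ^ 2 := by
  have h00 : (0 : ℝ) ≤ m := by positivity
  have h0 : 0 ≤ s := by linarith
  have h1 : Integrable fun y : ℂ => (2 ^ s) ^ 2 * (1 + ‖y‖) ^ (-(2 * s - m)) :=
    (integrable_one_add_norm (by rw [Complex.finrank_real_complex]; push_cast; linarith)).const_mul _
  refine h1.mono' ?_ (Eventually.of_forall fun b => ?_)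
  · exact (((continuous_const.add continuous_norm).pow m).mul
      ((continuous_weight s).pow 2)).aestronglyMeasurable
  · have hp : 0 < 1 + ‖b‖ := by positivity
    rw [Real.norm_of_nonneg (by positivity)]
    have := pow_le_pow_left₀ (weight_pos s b).le (weight_le h0 b) 2
    calc (1 + ‖b‖) ^ m * weight s b ^ 2
        ≤ (1 + ‖b‖) ^ m * (2 ^ s * (1 + ‖b‖) ^ (-s)) ^ 2 :=
          mul_le_mul_of_nonneg_left this (by positivity)
      _ = (2 ^ s) ^ 2 * (1 + ‖b‖) ^ (-(2 * s - m)) := by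
          rw [show -(2 * s - (m : ℝ)) = m + (-s + -s) by ring, Real.rpow_add hp, Real.rpow_add hp,
            Real.rpow_natCast]; ring

theorem norm_monicPoly_eval_le {n : ℕ} (q : Fin n → ℝ) (z : ℂ) :
    ‖(monicPoly q).eval z‖ ≤ (1 + ‖q‖) * ((n + 1) * (1 + ‖z‖) ^ n) := by
  rw [monicPoly_eval_eq_sum]
  refine (norm_sum_le _ _).trans ?_
  have : ∀ j ∈ Finset.range (n + 1), ‖((realPoly q).coeff j : ℂ) * z ^ j‖ ≤
      (1 + ‖q‖) * (1 + ‖z‖) ^ n := by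
    intro j hj
    rw [norm_mul, Complex.norm_real, Real.norm_eq_abs, norm_pow]
    refine mul_le_mul (abs_coeff_realPoly_le q j) ?_ (by positivity) (by positivity)
    calc ‖z‖ ^ j ≤ (1 + ‖z‖) ^ j := pow_le_pow_left₀ (norm_nonneg _) (by linarith [norm_nonneg z]) _
      _ ≤ (1 + ‖z‖) ^ n := pow_le_pow_right₀ (by linarith [norm_nonneg z])
          (by simp at hj; omega)
  refine (Finset.sum_le_sum this).trans (le_of_eq ?_)
  simp; ring

/- ## Moments of the random polynomial -/

/-- The (unnormalised) second moment of the values of the random polynomial. -/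
noncomputable def mom2 (s : ℝ) (n : ℕ) (u v : ℂ) : ℂ :=
  ∫ q : Fin n → ℝ, (monicPoly q).eval u * (monicPoly q).eval v * polyDensity s q

/-- The (unnormalised) first moment of the values of the random polynomial. -/
noncomputable def mom1 (s : ℝ) (n : ℕ) (v : ℂ) : ℂ :=
  ∫ q : Fin n → ℝ, (monicPoly q).eval v * polyDensity s q

theorem measurable_monicPoly_eval {n : ℕ} (v : ℂ) :
    Measurable fun q : Fin n → ℝ => (monicPoly q).eval v :=
  ((continuous_monicPoly_eval n).comp (continuous_const.prodMk continuous_id)).measurable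

theorem integrable_eval_mul_polyDensity {s : ℝ} {n : ℕ} (hs : (n : ℝ) + 1 < s) (v : ℂ) :
    Integrable fun q : Fin n → ℝ => (monicPoly q).eval v * (polyDensity s q : ℂ) := by
  have h1 := (integrable_pow_mul_polyDensity (s := s) (n := n) (k := 1)
    (by exact_mod_cast hs)).const_mul ((n + 1) * (1 + ‖v‖) ^ n)
  refine h1.mono' ((measurable_monicPoly_eval v).mul (Complex.measurable_ofReal.comp
    (measurable_polyDensity s n))).aestronglyMeasurable (Eventually.of_forall fun q => ?_)
  rw [norm_mul, Complex.norm_real, Real.norm_of_nonneg (polyDensity_pos s q).le]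
  refine (mul_le_mul_of_nonneg_right (norm_monicPoly_eval_le q v)
    (polyDensity_pos s q).le).trans (le_of_eq ?_)
  ring

theorem derivative_mulLin_eval {n : ℕ} (a : ℝ) (q : Fin n → ℝ) :
    (realPoly (mulLin a q)).derivative.eval a = (realPoly q).eval a := by
  rw [realPoly_mulLin]; simp [Polynomial.derivative_mul]

theorem derivative_mulQuad_eval {n : ℕ} (z : ℂ) (q : Fin n → ℝ) :
    (monicPoly (mulQuad z q)).derivative.eval z =
      (z - (starRingEnd ℂ) z) * (monicPoly q).eval z := by
  rw [monicPoly_mulQuad]; simp [Polynomial.derivative_mul]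

theorem abs_mul_sign_real (x : ℝ) : |x| * Real.sign x = x := by
  rcases lt_trichotomy x 0 with h | rfl | h
  · rw [abs_of_neg h, Real.sign_of_neg h]; ring
  · simp
  · rw [abs_of_pos h, Real.sign_of_pos h]; ring

theorem abs_sign_le_one (x : ℝ) : |Real.sign x| ≤ 1 := by
  rcases Real.sign_apply_eq x with h | h | h <;> simp [h]

theorem measurable_sign_real : Measurable Real.sign := by
  unfold Real.sign
  exact Measurable.ite measurableSet_Iio measurable_const
    (Measurable.ite measurableSet_Ioi measurable_const measurable_const)

/-- For r = (X-y)q the Jacobian is |q(y)|, and r'(y) = q(y). The sign of r'(y) therefore removes the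
absolute value, and r(v) = (v-y)q(v) leaves a second moment of q. -/
theorem signed_root_sum {s : ℝ} {k : ℕ} (hs : (k : ℝ) + 2 < s) {χ : ℝ → ℝ} (hχ : Measurable χ)
    (hχ1 : ∀ y, |χ y| ≤ 1) (v : ℂ) :
    Integrable (fun r : Fin (k + 1) → ℝ =>
      ∑ y ∈ simpleReal r, (χ y : ℂ) * (Real.sign ((realPoly r).derivative.eval y) : ℂ) *
        ((monicPoly r).eval v * (polyDensity s r : ℂ))) ∧
    ∫ y : ℝ, (χ y : ℂ) * weight s y * ((v - y) * mom2 s k v y) =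
      ∫ r : Fin (k + 1) → ℝ,
        ∑ y ∈ simpleReal r, (χ y : ℂ) * (Real.sign ((realPoly r).derivative.eval y) : ℂ) *
          ((monicPoly r).eval v * (polyDensity s r : ℂ)) := by
  have hval : ∀ x : ℝ × (Fin k → ℝ), ((|(realPoly x.2).eval x.1| : ℝ) : ℂ) *
      ((χ x.1 : ℂ) * (Real.sign ((realPoly (mulLin x.1 x.2)).derivative.eval x.1) : ℂ) *
        ((monicPoly (mulLin x.1 x.2)).eval v * (polyDensity s (mulLin x.1 x.2) : ℂ))) =
      (χ x.1 : ℂ) * weight s x.1 * (v - x.1) *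
        ((monicPoly x.2).eval v * (monicPoly x.2).eval (x.1 : ℂ) * polyDensity s x.2) := by
    rintro ⟨y, q⟩
    simp only
    rw [derivative_mulLin_eval, polyDensity_mulLin, monicPoly_mulLin, monicPoly_eval_ofReal]
    conv_rhs => rw [← abs_mul_sign_real ((realPoly q).eval y)]
    simp only [Polynomial.eval_mul, Polynomial.eval_sub, Polynomial.eval_X, Polynomial.eval_C]
    push_cast
    ring
  have hmχ : Measurable fun x : ℝ × (Fin (k + 1) → ℝ) => (χ x.1 : ℂ) :=
    Complex.measurable_ofReal.comp (hχ.comp measurable_fst)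
  have hint : Integrable (fun x : ℝ × (Fin k → ℝ) => (χ x.1 : ℂ) * weight s x.1 * (v - x.1) *
      ((monicPoly x.2).eval v * (monicPoly x.2).eval (x.1 : ℂ) * polyDensity s x.2))
      (volume.prod volume) := by
    have hb := ((integrable_pow_mul_weight (s := s) (m := k + 1) (by push_cast; linarith)).mul_prod
      (integrable_pow_mul_polyDensity (s := s) (n := k) (k := 2) (by push_cast; linarith))).const_mul
      ((1 + ‖v‖) * ((k + 1) * (1 + ‖v‖) ^ k) * (k + 1))
    refine hb.mono' ?_ (Eventually.of_forall fun x => ?_)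
    · refine Measurable.aestronglyMeasurable ?_
      have m1 : Measurable fun x : ℝ × (Fin k → ℝ) => (x.1 : ℂ) :=
        Complex.measurable_ofReal.comp measurable_fst
      refine (((Complex.measurable_ofReal.comp (hχ.comp measurable_fst)).mul
        (Complex.measurable_ofReal.comp ((continuous_weight s).measurable.comp m1))).mul
        (measurable_const.sub m1)).mul ((((measurable_monicPoly_eval v).comp measurable_snd).mul
        ((continuous_monicPoly_eval k).measurable.comp (m1.prodMk measurable_snd))).mul
        (Complex.measurable_ofReal.comp ((measurable_polyDensity s k).comp measurable_snd)))
    · obtain ⟨y, q⟩ := x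
      simp only [norm_mul, Complex.norm_real, Real.norm_of_nonneg (polyDensity_pos s q).le,
        Real.norm_of_nonneg (weight_pos s _).le]
      have e1 : ‖v - (y : ℂ)‖ ≤ (1 + ‖v‖) * (1 + |y|) := by
        refine (norm_sub_le _ _).trans ?_
        rw [Complex.norm_real, Real.norm_eq_abs]
        nlinarith [norm_nonneg v, abs_nonneg y]
      have e2 := norm_monicPoly_eval_le q v
      have e3 := norm_monicPoly_eval_le q (y : ℂ)
      rw [Complex.norm_real, Real.norm_eq_abs] at e3
      have hw := (weight_pos s y).le
      have hF := (polyDensity_pos s q).le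
      calc ‖χ y‖ * weight s y * ‖v - (y : ℂ)‖ *
            (‖(monicPoly q).eval v‖ * ‖(monicPoly q).eval (y : ℂ)‖ * polyDensity s q)
          ≤ 1 * weight s y * ((1 + ‖v‖) * (1 + |y|)) *
            (((1 + ‖q‖) * ((k + 1) * (1 + ‖v‖) ^ k)) * ((1 + ‖q‖) * ((k + 1) * (1 + |y|) ^ k)) *
              polyDensity s q) := by
            gcongr
            exact hχ1 y
        _ = _ := by ring
  have hmeas : Measurable (Function.uncurry fun (y : ℝ) (r : Fin (k + 1) → ℝ) =>
      (χ y : ℂ) * (Real.sign ((realPoly r).derivative.eval y) : ℂ) *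
        ((monicPoly r).eval v * (polyDensity s r : ℂ))) := by
    refine (hmχ.mul (Complex.measurable_ofReal.comp (measurable_sign_real.comp
      (continuous_realPoly_derivative_eval (k + 1)).measurable))).mul
      (((measurable_monicPoly_eval v).comp measurable_snd).mul
        (Complex.measurable_ofReal.comp ((measurable_polyDensity s _).comp measurable_snd)))
  have := integral_fiber (μ := volume) (ω := fun x : ℝ × (Fin k → ℝ) => |(realPoly x.2).eval x.1|)
    (fun x => abs_nonneg _) (fiber_real k) hmeas (by simp_rw [hval]; exact hint)
  refine ⟨this.1, ?_⟩
  rw [← this.2]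
  simp_rw [hval]
  rw [Measure.volume_eq_prod, integral_prod _ hint]
  refine integral_congr_ae (Eventually.of_forall fun y => ?_)
  simp only [mom2]
  rw [integral_const_mul]
  ring

theorem ae_eval_ne_zero (n : ℕ) (v : ℂ) :
    ∀ᵐ p : Fin (n + 1) → ℝ, (monicPoly p).eval v ≠ 0 := by
  have hms : MeasurableSet {p : Fin (n + 1) → ℝ | (monicPoly p).eval v ≠ 0} :=
    measurable_monicPoly_eval v (measurableSet_singleton 0).compl
  rw [← (measurePreserving_consReal n).map_eq, ae_map_iff (consReal n).measurable.aemeasurable hms,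
    Measure.volume_eq_prod]
  have hm : MeasurableSet {x : ℝ × (Fin n → ℝ) | (monicPoly (consReal n x)).eval v ≠ 0} :=
    (consReal n).measurable hms
  suffices h : ∀ᵐ x : (Fin n → ℝ) × ℝ ∂(volume.prod volume),
      (monicPoly (consReal n x.swap)).eval v ≠ 0 by
    exact Measure.measurePreserving_swap.quasiMeasurePreserving.ae h
  refine (Measure.ae_prod_iff_ae_ae (measurable_swap hm)).2 (Eventually.of_forall fun b => ?_)
  have hfin : Set.Finite {c : ℝ | ¬ (monicPoly (consReal n (c, b))).eval v ≠ 0} := by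
    refine (Set.finite_singleton (-((monicPoly (consReal n (0, b))).eval v).re)).subset ?_
    intro c hc
    simp only [mem_ofPred_eq, not_not, consReal_apply, monicPoly_eval, Fin.sum_univ_succ] at hc
    have := congrArg Complex.re hc
    simp only [mem_singleton_iff, consReal_apply, monicPoly_eval, Fin.sum_univ_succ]
    simp at this ⊢
    linarith
  exact hfin.measure_zero volume

/-- Expand sgn r(a) over the real roots y of r and apply `signed_root_sum` with χ(y) = sgn(a-y); the
parity term of the expansion becomes a first moment. -/
theorem integral_sign_eval {s : ℝ} {k : ℕ} (hs : (k : ℝ) + 2 < s) (a : ℝ) (v : ℂ) :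
    ∫ r : Fin (k + 1) → ℝ, (Real.sign ((realPoly r).eval a) : ℂ) *
        ((monicPoly r).eval v * (polyDensity s r : ℂ)) =
      (∫ y : ℝ, (Real.sign (a - y) : ℂ) * weight s y * ((v - y) * mom2 s k v y)) +
        if Even (k + 1) then mom1 s (k + 1) v else 0 := by
  have hχ : Measurable fun y : ℝ => Real.sign (a - y) :=
    measurable_sign_real.comp (measurable_const.sub measurable_id)
  obtain ⟨h1, h2⟩ := signed_root_sum hs hχ (fun y => abs_sign_le_one _) v
  have h3 := integrable_eval_mul_polyDensity (s := s) (n := k + 1) (by push_cast; linarith) v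
  rw [h2]
  have h4 : (if Even (k + 1) then mom1 s (k + 1) v else 0) =
      ∫ r : Fin (k + 1) → ℝ, (if Even (k + 1) then (1 : ℂ) else 0) *
        ((monicPoly r).eval v * (polyDensity s r : ℂ)) := by
    rw [integral_const_mul, mom1]; split_ifs <;> simp
  rw [h4, ← integral_add h1 (h3.const_mul _)]
  refine integral_congr_ae ?_
  filter_upwards [ae_simpleRoots k, ae_eval_ne_zero k (a : ℂ)] with r hr1 hr2
  rw [monicPoly_eval_ofReal] at hr2
  rw [sign_eval_eq_sum hr1 a (by exact_mod_cast hr2), ← Finset.sum_mul, ← add_mul]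
  congr 1
  push_cast
  congr 1
  · exact Finset.sum_congr rfl fun y _ => mul_comm _ _
  · split_ifs <;> simp

/-- `signed_root_sum` with χ = 1: in even degree the signs of the derivative at the real roots
cancel. -/
theorem integral_weight_mom2_eq_zero {s : ℝ} {k : ℕ} (hs : (k : ℝ) + 2 < s) (hk : Even (k + 1))
    (v : ℂ) : ∫ y : ℝ, (weight s y : ℂ) * ((v - y) * mom2 s k v y) = 0 := by
  obtain ⟨_, h2⟩ := signed_root_sum hs (χ := fun _ => 1) measurable_const (fun y => by simp) v
  simp only [Complex.ofReal_one, one_mul] at h2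
  rw [h2]
  refine integral_eq_zero_of_ae ?_
  filter_upwards [ae_simpleRoots k] with r hr
  rw [← Finset.sum_mul, ← Complex.ofReal_sum, sum_sign_derivative hr hk]
  simp

/- ## All roots of a polynomial with simple roots -/

theorem SimpleRoots.nodup {n : ℕ} {p : Fin n → ℝ} (h : SimpleRoots p) :
    (monicPoly p).roots.Nodup := by
  rw [Multiset.nodup_iff_count_le_one]
  intro a
  rw [Polynomial.count_roots]
  by_contra hlt
  push Not at hlt
  have := (Polynomial.one_lt_rootMultiplicity_iff_isRoot (monicPoly_monic p).ne_zero).1 hlt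
  exact h a this.1 this.2

theorem SimpleRoots.roots_eq {n : ℕ} {p : Fin n → ℝ} (h : SimpleRoots p) :
    (monicPoly p).roots.toFinset =
      (simpleReal p).map ⟨Complex.ofReal, Complex.ofReal_injective⟩ ∪ simpleNonreal p := by
  ext z
  simp only [Multiset.mem_toFinset, Finset.mem_union, Finset.mem_map, mem_simpleReal,
    mem_simpleNonreal, Function.Embedding.coeFn_mk, Polynomial.mem_roots (monicPoly_monic p).ne_zero,
    Polynomial.IsRoot]
  constructor
  · intro hz
    by_cases him : z.im = 0
    · left
      have hz' : z = ((z.re : ℝ) : ℂ) := by apply Complex.ext <;> simp [him]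
      have h0 : (realPoly p).eval z.re = 0 := by
        rw [hz', monicPoly_eval_ofReal] at hz
        exact_mod_cast hz
      exact ⟨z.re, ⟨h0, h.real h0⟩, hz'.symm⟩
    · exact Or.inr ⟨him, hz, h z hz⟩
  · rintro (⟨a, ⟨ha, _⟩, rfl⟩ | ⟨_, hz, _⟩)
    · rw [monicPoly_eval_ofReal, ha]; rfl
    · exact hz

theorem disjoint_simple {n : ℕ} (p : Fin n → ℝ) :
    Disjoint ((simpleReal p).map ⟨Complex.ofReal, Complex.ofReal_injective⟩) (simpleNonreal p) := by
  rw [Finset.disjoint_left]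
  intro z hz hz'
  obtain ⟨a, _, rfl⟩ := Finset.mem_map.1 hz
  exact (mem_simpleNonreal.1 hz').1 (Complex.ofReal_im a)

theorem SimpleRoots.sum_roots {n : ℕ} {p : Fin n → ℝ} (h : SimpleRoots p) {M : Type*}
    [AddCommMonoid M] (f : ℂ → M) :
    ∑ z ∈ (monicPoly p).roots.toFinset, f z =
      ∑ a ∈ simpleReal p, f a + ∑ z ∈ simpleNonreal p, f z := by
  rw [h.roots_eq, Finset.sum_union (disjoint_simple p), Finset.sum_map]
  rfl

/-- Interpolation of X^m at n > m distinct nodes is exact, and the nodal polynomial is p itself. -/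
theorem SimpleRoots.lagrange {n m : ℕ} {p : Fin n → ℝ} (h : SimpleRoots p) (hm : m < n) {v : ℂ}
    (hv : (monicPoly p).eval v ≠ 0) :
    v ^ m = ∑ z ∈ (monicPoly p).roots.toFinset,
      z ^ m * ((monicPoly p).eval v / ((v - z) * (monicPoly p).derivative.eval z)) := by
  classical
  set R := (monicPoly p).roots.toFinset with hR
  have hcard : R.card = n := by
    rw [hR, Multiset.toFinset_card_of_nodup h.nodup, IsAlgClosed.card_roots_eq_natDegree,
      monicPoly_natDegree]
  have hnod : Lagrange.nodal R id = monicPoly p := by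
    rw [Lagrange.nodal_eq, hR]
    have h1 := (IsAlgClosed.splits (monicPoly p)).eq_prod_roots
    rw [(monicPoly_monic p).leadingCoeff, Polynomial.C_1, one_mul] at h1
    conv_rhs => rw [h1]
    rw [Finset.prod_eq_multiset_prod, Multiset.toFinset_val, h.nodup.dedup]
    rfl
  have hne : ∀ z ∈ R, v ≠ id z := by
    rintro z hz rfl
    exact hv (Polynomial.isRoot_of_mem_roots (Multiset.mem_toFinset.1 hz))
  have hint : (Polynomial.X ^ m : Polynomial ℂ) =
      Lagrange.interpolate R id fun z => (Polynomial.X ^ m : Polynomial ℂ).eval (id z) := by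
    refine Lagrange.eq_interpolate (Function.injective_id.injOn) ?_
    rw [Polynomial.degree_X_pow, hcard]
    exact_mod_cast hm
  have h2 := congrArg (Polynomial.eval v) hint
  rw [Lagrange.eval_interpolate_not_at_node _ hne, hnod] at h2
  simp only [Polynomial.eval_pow, Polynomial.eval_X, id] at h2
  rw [h2, Finset.mul_sum]
  refine Finset.sum_congr rfl fun z hz => ?_
  rw [Lagrange.nodalWeight_eq_eval_derivative_nodal hz, hnod]
  simp only [id]
  rw [div_eq_mul_inv, mul_inv]
  ring

/-- The Jacobian at a non-real root divided by p'(z) = (z - z̄)w, w being the value of the cofactor.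
What remains is exactly the factor in `skewComplex`. -/
theorem four_abs_mul_normSq_div (z w : ℂ) : ((4 * |z.im| * Complex.normSq w : ℝ) : ℂ) /
    ((z - (starRingEnd ℂ) z) * w) = -2 * Complex.I * sgn z.im * (starRingEnd ℂ) w := by
  rcases eq_or_ne w 0 with rfl | hw
  · simp
  rcases eq_or_ne z.im 0 with h0 | h0
  · simp [h0, sgn]
  have h1 : ((|z.im| : ℝ) : ℂ) * sgn z.im = z.im := by
    rw [sgn]; exact_mod_cast abs_mul_sign_real z.im
  have h1' : ((|z.im| : ℝ) : ℂ) = z.im * sgn z.im := by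
    rw [sgn]
    norm_cast
    rcases lt_or_gt_of_ne h0 with h | h
    · rw [abs_of_neg h, Real.sign_of_neg h]; ring
    · rw [abs_of_pos h, Real.sign_of_pos h]; ring
  have h2 : (z.im : ℂ) ≠ 0 := by exact_mod_cast h0
  rw [Complex.sub_conj, div_eq_iff (by simp [hw, h0]), Complex.ofReal_mul, Complex.ofReal_mul, h1',
    ← Complex.mul_conj w]
  push_cast
  linear_combination (4 * z.im * sgn z.im * w * (starRingEnd ℂ) w) * (Complex.I_sq)

theorem eval_monicPoly_conj {n : ℕ} (q : Fin n → ℝ) (z : ℂ) :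
    (monicPoly q).eval ((starRingEnd ℂ) z) = (starRingEnd ℂ) ((monicPoly q).eval z) := by
  simp [monicPoly_eval]

theorem normSq_eq_eval_mul {n : ℕ} (q : Fin n → ℝ) (z : ℂ) :
    (Complex.normSq ((monicPoly q).eval z) : ℂ) =
      (monicPoly q).eval z * (monicPoly q).eval ((starRingEnd ℂ) z) := by
  rw [eval_monicPoly_conj, Complex.mul_conj]

theorem ae_fst_ne {X Y : Type*} [MeasurableSpace X] [MeasurableSpace Y] (μ : Measure X)
    (ν : Measure Y) [SFinite ν] {t : X → Prop} (ht : ∀ᵐ x ∂μ, t x) :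
    ∀ᵐ x : X × Y ∂(μ.prod ν), t x.1 :=
  Measure.quasiMeasurePreserving_fst.ae ht

/-- Write p = (X-a)r. The Jacobian |r(a)| over p'(a) = r(a) leaves sgn r(a), and the factor v-a of
p(v) cancels against the denominator of Lagrange's formula. The cancellation fails at a = v, hence
the identity of integrands holds only almost everywhere. -/
theorem root_sum_real {s : ℝ} {k m : ℕ} (hs : (k : ℝ) + 2 < s) (hm : m < k + 2) (v : ℂ) :
    Integrable (fun p : Fin (k + 2) → ℝ => ∑ a ∈ simpleReal p, (a : ℂ) ^ m *
      ((monicPoly p).eval v / ((v - a) * (monicPoly p).derivative.eval (a : ℂ))) *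
        polyDensity s p) ∧
    ∫ a : ℝ, (weight s a : ℂ) * a ^ m * (∫ r : Fin (k + 1) → ℝ,
        (Real.sign ((realPoly r).eval a) : ℂ) * ((monicPoly r).eval v * (polyDensity s r : ℂ))) =
      ∫ p : Fin (k + 2) → ℝ, ∑ a ∈ simpleReal p, (a : ℂ) ^ m *
        ((monicPoly p).eval v / ((v - a) * (monicPoly p).derivative.eval (a : ℂ))) *
          polyDensity s p := by
  let Φ : ℝ → (Fin (k + 2) → ℝ) → ℂ := fun a p => (a : ℂ) ^ m *
      ((monicPoly p).eval v / ((v - a) * (monicPoly p).derivative.eval (a : ℂ))) * polyDensity s p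
  let Θ : ℝ × (Fin (k + 1) → ℝ) → ℂ := fun x => (weight s x.1 : ℂ) * x.1 ^ m *
    ((Real.sign ((realPoly x.2).eval x.1) : ℂ) * ((monicPoly x.2).eval v * polyDensity s x.2))
  have m1 : ∀ j, Measurable fun x : ℝ × (Fin j → ℝ) => (x.1 : ℂ) := fun j =>
    Complex.measurable_ofReal.comp measurable_fst
  have hval : ∀ᵐ x : ℝ × (Fin (k + 1) → ℝ) ∂(volume.prod volume),
      ((|(realPoly x.2).eval x.1| : ℝ) : ℂ) * Φ x.1 (mulLin x.1 x.2) = Θ x := by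
    have hne : ∀ᵐ a : ℝ, (a : ℂ) ≠ v := by
      filter_upwards [(Set.finite_singleton v.re).measure_zero volume |> compl_mem_ae_iff.2] with a ha h
      exact ha (by rw [← h]; simp)
    filter_upwards [ae_fst_ne volume (volume : Measure (Fin (k + 1) → ℝ)) hne] with x hx
    obtain ⟨a, r⟩ := x
    simp only [Φ, Θ] at hx ⊢
    rw [monicPoly_derivative_eval_ofReal, derivative_mulLin_eval, polyDensity_mulLin,
      monicPoly_mulLin]
    simp only [Polynomial.eval_mul, Polynomial.eval_sub, Polynomial.eval_X, Polynomial.eval_C]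
    have hv : v - a ≠ 0 := sub_ne_zero.2 hx.symm
    rcases eq_or_ne ((realPoly r).eval a) 0 with h0 | h0
    · simp [h0]
    · have h0' : (((realPoly r).eval a : ℝ) : ℂ) ≠ 0 := by exact_mod_cast h0
      have hsg : ((|(realPoly r).eval a| : ℝ) : ℂ) =
          (Real.sign ((realPoly r).eval a) : ℂ) * (((realPoly r).eval a : ℝ) : ℂ) := by
        norm_cast
        rcases lt_or_gt_of_ne h0 with h | h
        · rw [abs_of_neg h, Real.sign_of_neg h]; ring
        · rw [abs_of_pos h, Real.sign_of_pos h]; ring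
      rw [hsg]
      push_cast
      field_simp
  have hmΘ : Measurable Θ := by
    refine ((Complex.measurable_ofReal.comp ((continuous_weight s).measurable.comp (m1 _))).mul
      ((m1 _).pow_const m)).mul ((Complex.measurable_ofReal.comp (measurable_sign_real.comp
      (continuous_realPoly_eval _).measurable)).mul (((measurable_monicPoly_eval v).comp
      measurable_snd).mul (Complex.measurable_ofReal.comp
      ((measurable_polyDensity s _).comp measurable_snd))))
  have hintΘ : Integrable Θ (volume.prod volume) := by
    have hm' : (m : ℝ) + 1 < s := by
      have : (m : ℝ) + 1 ≤ k + 2 := by exact_mod_cast hm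
      linarith
    have hb := ((integrable_pow_mul_weight (s := s) (m := m) hm').mul_prod
      (integrable_pow_mul_polyDensity (s := s) (n := k + 1) (k := 1)
        (by push_cast; linarith))).const_mul (((k + 1 : ℕ) + 1) * (1 + ‖v‖) ^ (k + 1))
    refine hb.mono' hmΘ.aestronglyMeasurable (Eventually.of_forall fun x => ?_)
    obtain ⟨a, r⟩ := x
    simp only [Θ, norm_mul, norm_pow, Complex.norm_real,
      Real.norm_of_nonneg (polyDensity_pos s r).le, Real.norm_of_nonneg (weight_pos s _).le]
    have e2 := norm_monicPoly_eval_le r v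
    have hw := (weight_pos s a).le
    have hF := (polyDensity_pos s r).le
    calc weight s a * ‖a‖ ^ m * (‖Real.sign ((realPoly r).eval a)‖ *
          (‖(monicPoly r).eval v‖ * polyDensity s r))
        ≤ weight s a * (1 + |a|) ^ m * (1 *
          (((1 + ‖r‖) * (((k + 1 : ℕ) + 1) * (1 + ‖v‖) ^ (k + 1))) * polyDensity s r)) := by
          gcongr
          · rw [Real.norm_eq_abs]; linarith
          · exact abs_sign_le_one _
      _ = _ := by ring
  have hmeas : Measurable (Function.uncurry Φ) := by
    have c1 : Measurable fun x : ℝ × (Fin (k + 2) → ℝ) => (monicPoly x.2).derivative.eval (x.1 : ℂ) :=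
      (continuous_monicPoly_derivative_eval _).measurable.comp ((m1 _).prodMk measurable_snd)
    exact (((m1 _).pow_const m).mul (((measurable_monicPoly_eval v).comp measurable_snd).div
      ((measurable_const.sub (m1 _)).mul c1))).mul
        (Complex.measurable_ofReal.comp ((measurable_polyDensity s _).comp measurable_snd))
  have := integral_fiber (μ := volume)
    (ω := fun x : ℝ × (Fin (k + 1) → ℝ) => |(realPoly x.2).eval x.1|)
    (fun x => abs_nonneg _) (fiber_real (k + 1)) hmeas
    (hintΘ.congr (hval.mono fun x hx => hx.symm))
  refine ⟨this.1, ?_⟩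
  rw [← this.2, Measure.volume_eq_prod, integral_congr_ae hval, integral_prod _ hintΘ]
  refine integral_congr_ae (Eventually.of_forall fun y => ?_)
  simp only [Θ]
  rw [integral_const_mul]

/-- With p = (X-z)(X-z̄)q, the Jacobian over p'(z) leaves the conjugate of q(z), that is q(z̄), and
p(v)/(v-z) leaves (v-z̄)q(v): a second moment at the points v and z̄. -/
theorem root_sum_complex {s : ℝ} {k m : ℕ} (hs : (k : ℝ) + 2 < s) (hm : m < k + 2) (v : ℂ) :
    Integrable (fun p : Fin (k + 2) → ℝ => ∑ z ∈ simpleNonreal p, z ^ m *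
      ((monicPoly p).eval v / ((v - z) * (monicPoly p).derivative.eval z)) * polyDensity s p) ∧
    ∫ z : ℂ, -2 * Complex.I * sgn z.im * (weight s z : ℂ) ^ 2 * z ^ m *
        ((v - (starRingEnd ℂ) z) * mom2 s k v ((starRingEnd ℂ) z)) =
      ∫ p : Fin (k + 2) → ℝ, ∑ z ∈ simpleNonreal p, z ^ m *
        ((monicPoly p).eval v / ((v - z) * (monicPoly p).derivative.eval z)) *
          polyDensity s p := by
  let Φ : ℂ → (Fin (k + 2) → ℝ) → ℂ := fun z p => z ^ m *
      ((monicPoly p).eval v / ((v - z) * (monicPoly p).derivative.eval z)) * polyDensity s p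
  let Θ : ℂ × (Fin k → ℝ) → ℂ := fun x => -2 * Complex.I * sgn x.1.im * (weight s x.1 : ℂ) ^ 2 *
    x.1 ^ m * (v - (starRingEnd ℂ) x.1) *
    ((monicPoly x.2).eval v * (monicPoly x.2).eval ((starRingEnd ℂ) x.1) * polyDensity s x.2)
  have hval : ∀ᵐ x : ℂ × (Fin k → ℝ) ∂(volume.prod volume),
      ((4 * |x.1.im| * Complex.normSq ((monicPoly x.2).eval x.1) : ℝ) : ℂ) *
        Φ x.1 (mulQuad x.1 x.2) = Θ x := by
    have hne : ∀ᵐ a : ℂ, a ≠ v := by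
      have : ({v} : Set ℂ)ᶜ ∈ ae volume := compl_mem_ae_iff.2 (measure_singleton v)
      filter_upwards [this] with a ha using ha
    filter_upwards [ae_fst_ne volume (volume : Measure (Fin k → ℝ)) hne] with x hx
    obtain ⟨z, q⟩ := x
    simp only [Φ, Θ] at hx ⊢
    have hv : v - z ≠ 0 := sub_ne_zero.2 hx.symm
    rw [derivative_mulQuad_eval, polyDensity_mulQuad, monicPoly_mulQuad, eval_monicPoly_conj]
    simp only [Polynomial.eval_mul, Polynomial.eval_sub, Polynomial.eval_X, Polynomial.eval_C]
    have hk := four_abs_mul_normSq_div z ((monicPoly q).eval z)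
    have h1 : (v - z) * (v - (starRingEnd ℂ) z) * (monicPoly q).eval v /
        ((v - z) * ((z - (starRingEnd ℂ) z) * (monicPoly q).eval z)) =
        (v - (starRingEnd ℂ) z) * (monicPoly q).eval v /
          ((z - (starRingEnd ℂ) z) * (monicPoly q).eval z) := by
      rw [mul_assoc, mul_div_mul_left _ _ hv]
    rw [h1, show ∀ A B C D E : ℂ, A * (B * (C / D) * E) = (A / D) * (B * C * E)
      from fun A B C D E => by ring, hk]
    push_cast
    ring
  have m1 : ∀ j, Measurable fun x : ℂ × (Fin j → ℝ) => (starRingEnd ℂ) x.1 := fun j =>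
    (Complex.continuous_conj.comp continuous_fst).measurable
  have msgn : ∀ j, Measurable fun x : ℂ × (Fin j → ℝ) => sgn x.1.im := fun j =>
    Complex.measurable_ofReal.comp (measurable_sign_real.comp
      (Complex.measurable_im.comp measurable_fst))
  have hmΘ : Measurable Θ := by
    refine ((((measurable_const.mul (msgn _)).mul ((Complex.measurable_ofReal.comp
      ((continuous_weight s).measurable.comp measurable_fst)).pow_const 2)).mul
      (measurable_fst.pow_const m)).mul (measurable_const.sub (m1 _))).mul
      ((((measurable_monicPoly_eval v).comp measurable_snd).mul
      ((continuous_monicPoly_eval k).measurable.comp ((m1 _).prodMk measurable_snd))).mul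
      (Complex.measurable_ofReal.comp ((measurable_polyDensity s k).comp measurable_snd)))
  have hintΘ : Integrable Θ (volume.prod volume) := by
    have hm' : ((m + (k + 1) : ℕ) : ℝ) + 2 < 2 * s := by
      have : (m : ℝ) + 1 ≤ k + 2 := by exact_mod_cast hm
      push_cast
      linarith
    have hb := ((integrable_pow_mul_weight_sq (s := s) hm').mul_prod
      (integrable_pow_mul_polyDensity (s := s) (n := k) (k := 2)
        (by push_cast; linarith))).const_mul
        (2 * (1 + ‖v‖) * ((k + 1) * (1 + ‖v‖) ^ k) * (k + 1))
    refine hb.mono' hmΘ.aestronglyMeasurable (Eventually.of_forall fun x => ?_)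
    obtain ⟨z, q⟩ := x
    simp only [Θ, norm_mul, norm_pow, Complex.norm_real, norm_neg, Complex.norm_I, sgn,
      Real.norm_of_nonneg (polyDensity_pos s q).le, Real.norm_of_nonneg (weight_pos s _).le]
    have e1 : ‖v - (starRingEnd ℂ) z‖ ≤ (1 + ‖v‖) * (1 + ‖z‖) := by
      refine (norm_sub_le _ _).trans ?_
      rw [RCLike.norm_conj]
      nlinarith [norm_nonneg v, norm_nonneg z]
    have e2 := norm_monicPoly_eval_le q v
    have e3 := norm_monicPoly_eval_le q ((starRingEnd ℂ) z)
    rw [RCLike.norm_conj] at e3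
    have hw := (weight_pos s z).le
    have hF := (polyDensity_pos s q).le
    calc ‖(2 : ℂ)‖ * 1 * ‖Real.sign z.im‖ * weight s z ^ 2 * ‖z‖ ^ m * ‖v - (starRingEnd ℂ) z‖ *
          (‖(monicPoly q).eval v‖ * ‖(monicPoly q).eval ((starRingEnd ℂ) z)‖ * polyDensity s q)
        ≤ 2 * 1 * 1 * weight s z ^ 2 * (1 + ‖z‖) ^ m * ((1 + ‖v‖) * (1 + ‖z‖)) *
          (((1 + ‖q‖) * ((k + 1) * (1 + ‖v‖) ^ k)) * ((1 + ‖q‖) * ((k + 1) * (1 + ‖z‖) ^ k)) *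
            polyDensity s q) := by
          gcongr
          · simp
          · exact abs_sign_le_one _
          · linarith
      _ = _ := by ring
  have hmeas : Measurable (Function.uncurry Φ) := by
    exact ((measurable_fst.pow_const m).mul (((measurable_monicPoly_eval v).comp measurable_snd).div
      ((measurable_const.sub measurable_fst).mul
        (continuous_monicPoly_derivative_eval _).measurable))).mul
        (Complex.measurable_ofReal.comp ((measurable_polyDensity s _).comp measurable_snd))
  have := integral_fiber (μ := volume) (ω := fun x : ℂ × (Fin k → ℝ) =>
      4 * |x.1.im| * Complex.normSq ((monicPoly x.2).eval x.1))
    (fun x => mul_nonneg (by positivity) (Complex.normSq_nonneg _)) (fiber_complex k) hmeas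
    (hintΘ.congr (hval.mono fun x hx => hx.symm))
  refine ⟨this.1, ?_⟩
  rw [← this.2, Measure.volume_eq_prod, integral_congr_ae hval, integral_prod _ hintΘ]
  refine integral_congr_ae (Eventually.of_forall fun y => ?_)
  simp only [Θ, mom2]
  rw [integral_const_mul]
  ring

/-- The reproducing identity: the moments satisfy the linear system given by the skew forms. -/
theorem reproducing {s : ℝ} {k m : ℕ} (hs : (k : ℝ) + 2 < s) (hm : m < k + 2) (v : ℂ) :
    v ^ m * ((∫ p : Fin (k + 2) → ℝ, polyDensity s p : ℝ) : ℂ) =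
      (∫ a : ℝ, (weight s a : ℂ) * a ^ m *
        ((∫ y : ℝ, (Real.sign (a - y) : ℂ) * weight s y * ((v - y) * mom2 s k v y)) +
          if Even (k + 1) then mom1 s (k + 1) v else 0)) +
      ∫ z : ℂ, -2 * Complex.I * sgn z.im * (weight s z : ℂ) ^ 2 * z ^ m *
        ((v - (starRingEnd ℂ) z) * mom2 s k v ((starRingEnd ℂ) z)) := by
  obtain ⟨r1, r2⟩ := root_sum_real hs hm v
  obtain ⟨c1, c2⟩ := root_sum_complex hs hm v
  simp_rw [← integral_sign_eval hs]
  rw [r2, c2, ← integral_add r1 c1, ← integral_complex_ofReal, ← integral_const_mul]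
  refine integral_congr_ae ?_
  filter_upwards [ae_simpleRoots (k + 1), ae_eval_ne_zero (k + 1) v] with p h1 h2
  -- For almost every p this is Lagrange's formula with the real and the non-real roots separated.
  rw [h1.lagrange hm h2, h1.sum_roots, add_mul, Finset.sum_mul, Finset.sum_mul]

/- ## Coefficient form of the moment identities -/

/-- Second moments of the coefficients. -/
noncomputable def coeffMom2 (s : ℝ) (n i j : ℕ) : ℝ :=
  ∫ q : Fin n → ℝ, (realPoly q).coeff i * (realPoly q).coeff j * polyDensity s q

/-- First moments of the coefficients. -/
noncomputable def coeffMom1 (s : ℝ) (n j : ℕ) : ℝ :=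
  ∫ q : Fin n → ℝ, (realPoly q).coeff j * polyDensity s q

/-- Coefficients of `(v - y) * mom2 s n v y`, in the powers of `y` and `v`. -/
noncomputable def coeffSkew (s : ℝ) (n a b : ℕ) : ℝ :=
  (if b = 0 then 0 else coeffMom2 s n (b - 1) a) - (if a = 0 then 0 else coeffMom2 s n b (a - 1))

theorem mom2_eq_sum {s : ℝ} {n : ℕ} (hs : (n : ℝ) + 2 < s) (u v : ℂ) :
    mom2 s n u v = ∑ i ∈ Finset.range (n + 1), ∑ j ∈ Finset.range (n + 1),
      (coeffMom2 s n i j : ℂ) * (u ^ i * v ^ j) := by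
  have hint : ∀ i j, Integrable fun q : Fin n → ℝ =>
      (realPoly q).coeff i * (realPoly q).coeff j * polyDensity s q := by
    intro i j
    refine (integrable_pow_mul_polyDensity (s := s) (n := n) (k := 2) (by push_cast; linarith)).mono'
      ?_ (Eventually.of_forall fun q => ?_)
    · exact (((continuous_coeff_realPoly n i).mul (continuous_coeff_realPoly n j)).measurable.mul
        (measurable_polyDensity s n)).aestronglyMeasurable
    · rw [norm_mul, Real.norm_of_nonneg (polyDensity_pos s q).le, norm_mul, sq]
      exact mul_le_mul_of_nonneg_right (mul_le_mul (abs_coeff_realPoly_le q i)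
        (abs_coeff_realPoly_le q j) (abs_nonneg _) (by positivity)) (polyDensity_pos s q).le
  have hintC : ∀ i j, Integrable fun q : Fin n → ℝ =>
      (((realPoly q).coeff i * (realPoly q).coeff j * polyDensity s q : ℝ) : ℂ) * (u ^ i * v ^ j) :=
    fun i j => (hint i j).ofReal.mul_const _
  simp only [mom2, monicPoly_eval_eq_sum, coeffMom2]
  calc _ = ∫ q : Fin n → ℝ, ∑ i ∈ Finset.range (n + 1), ∑ j ∈ Finset.range (n + 1),
      (((realPoly q).coeff i * (realPoly q).coeff j * polyDensity s q : ℝ) : ℂ) *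
        (u ^ i * v ^ j) := by
        congr 1; funext q
        rw [Finset.sum_mul_sum, Finset.sum_mul]
        refine Finset.sum_congr rfl fun i _ => ?_
        rw [Finset.sum_mul]
        refine Finset.sum_congr rfl fun j _ => ?_
        push_cast; ring
    _ = _ := by
        rw [integral_finsetSum _ fun i _ => integrable_finsetSum _ fun j _ => hintC i j]
        refine Finset.sum_congr rfl fun i _ => ?_
        rw [integral_finsetSum _ fun j _ => hintC i j]
        refine Finset.sum_congr rfl fun j _ => ?_
        rw [integral_mul_const, integral_complex_ofReal]

theorem mom1_eq_sum {s : ℝ} {n : ℕ} (hs : (n : ℝ) + 1 < s) (v : ℂ) :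
    mom1 s n v = ∑ j ∈ Finset.range (n + 1), (coeffMom1 s n j : ℂ) * v ^ j := by
  have hint : ∀ j, Integrable fun q : Fin n → ℝ => (realPoly q).coeff j * polyDensity s q := by
    intro j
    refine (integrable_pow_mul_polyDensity (s := s) (n := n) (k := 1) (by push_cast; linarith)).mono'
      ?_ (Eventually.of_forall fun q => ?_)
    · exact ((continuous_coeff_realPoly n j).measurable.mul
        (measurable_polyDensity s n)).aestronglyMeasurable
    · rw [norm_mul, Real.norm_of_nonneg (polyDensity_pos s q).le, pow_one]
      exact mul_le_mul_of_nonneg_right (abs_coeff_realPoly_le q j) (polyDensity_pos s q).le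
  have hintC : ∀ j, Integrable fun q : Fin n → ℝ =>
      (((realPoly q).coeff j * polyDensity s q : ℝ) : ℂ) * v ^ j :=
    fun j => (hint j).ofReal.mul_const _
  simp only [mom1, monicPoly_eval_eq_sum, coeffMom1]
  calc _ = ∫ q : Fin n → ℝ, ∑ j ∈ Finset.range (n + 1),
      (((realPoly q).coeff j * polyDensity s q : ℝ) : ℂ) * v ^ j := by
        congr 1; funext q
        rw [Finset.sum_mul]
        refine Finset.sum_congr rfl fun j _ => ?_
        push_cast; ring
    _ = _ := by
        rw [integral_finsetSum _ fun j _ => hintC j]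
        refine Finset.sum_congr rfl fun j _ => ?_
        rw [integral_mul_const, integral_complex_ofReal]

theorem coeffMom2_eq_zero {s : ℝ} {n i j : ℕ} (h : n < i ∨ n < j) : coeffMom2 s n i j = 0 := by
  rw [coeffMom2]
  refine integral_eq_zero_of_ae (Eventually.of_forall fun q => ?_)
  rcases h with h | h
  · simp [Polynomial.coeff_eq_zero_of_natDegree_lt
      (show (realPoly q).natDegree < i by rw [realPoly_natDegree]; exact h)]
  · simp [Polynomial.coeff_eq_zero_of_natDegree_lt
      (show (realPoly q).natDegree < j by rw [realPoly_natDegree]; exact h)]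

theorem mom2_comm (s : ℝ) (n : ℕ) (u v : ℂ) : mom2 s n u v = mom2 s n v u := by
  simp only [mom2]; congr 1; funext q; ring

theorem sub_mul_mom2 {s : ℝ} {n : ℕ} (hs : (n : ℝ) + 2 < s) (v y : ℂ) :
    (v - y) * mom2 s n v y = ∑ a ∈ Finset.range (n + 2), ∑ b ∈ Finset.range (n + 2),
      (coeffSkew s n a b : ℂ) * (y ^ a * v ^ b) := by
  have h1 : v * mom2 s n v y = ∑ a ∈ Finset.range (n + 2), ∑ b ∈ Finset.range (n + 2),
      ((if b = 0 then 0 else coeffMom2 s n (b - 1) a : ℝ) : ℂ) * (y ^ a * v ^ b) := by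
    rw [Finset.sum_comm, Finset.sum_range_succ']
    simp only [Nat.add_eq_zero_iff, one_ne_zero, and_false, if_false, if_true, Nat.add_sub_cancel,
      Complex.ofReal_zero, zero_mul, Finset.sum_const_zero, add_zero]
    rw [mom2_eq_sum hs, Finset.mul_sum]
    refine Finset.sum_congr rfl fun i _ => ?_
    rw [Finset.sum_range_succ (fun x => (coeffMom2 s n i x : ℂ) * (y ^ x * v ^ (i + 1))),
      coeffMom2_eq_zero (Or.inr (Nat.lt_succ_self n)), Finset.mul_sum]
    simp only [Complex.ofReal_zero, zero_mul, add_zero]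
    refine Finset.sum_congr rfl fun j _ => ?_
    ring
  have h2 : y * mom2 s n v y = ∑ a ∈ Finset.range (n + 2), ∑ b ∈ Finset.range (n + 2),
      ((if a = 0 then 0 else coeffMom2 s n b (a - 1) : ℝ) : ℂ) * (y ^ a * v ^ b) := by
    rw [Finset.sum_range_succ']
    simp only [Nat.add_eq_zero_iff, one_ne_zero, and_false, if_false, if_true, Nat.add_sub_cancel,
      Complex.ofReal_zero, zero_mul, Finset.sum_const_zero, add_zero]
    rw [mom2_eq_sum hs, Finset.sum_comm, Finset.mul_sum]
    refine Finset.sum_congr rfl fun i _ => ?_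
    rw [Finset.sum_range_succ (fun x => (coeffMom2 s n x i : ℂ) * (y ^ (i + 1) * v ^ x)),
      coeffMom2_eq_zero (Or.inl (Nat.lt_succ_self n)), Finset.mul_sum]
    simp only [Complex.ofReal_zero, zero_mul, add_zero]
    refine Finset.sum_congr rfl fun j _ => ?_
    ring
  rw [sub_mul, h1, h2, ← Finset.sum_sub_distrib]
  refine Finset.sum_congr rfl fun a _ => ?_
  rw [← Finset.sum_sub_distrib]
  refine Finset.sum_congr rfl fun b _ => ?_
  rw [coeffSkew]; push_cast; ring

theorem coeff_eq_of_sum_pow_eq {n : ℕ} {a b : ℕ → ℂ}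
    (h : ∀ v : ℂ, ∑ j ∈ Finset.range n, a j * v ^ j = ∑ j ∈ Finset.range n, b j * v ^ j)
    {j : ℕ} (hj : j < n) : a j = b j := by
  have key : ∑ j ∈ Finset.range n, Polynomial.C (a j) * Polynomial.X ^ j =
      ∑ j ∈ Finset.range n, Polynomial.C (b j) * Polynomial.X ^ j :=
    Polynomial.funext fun v => by
      simpa [Polynomial.eval_finsetSum] using h v
  have h2 := congrArg (fun p => Polynomial.coeff p j) key
  simp only [Polynomial.finsetSum_coeff, Polynomial.coeff_C_mul, Polynomial.coeff_X_pow,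
    mul_ite, mul_one, mul_zero, Finset.sum_ite_eq, Finset.mem_range, hj, if_true] at h2
  exact h2

/-! ### The moment identities as linear systems for the Gram matrix. -/

/-- The integrals of the weighted monomials over the real line. -/
noncomputable def lineMom (s : ℝ) (m : ℕ) : ℂ := ∫ x : ℝ, (weight s x : ℂ) * (x : ℂ) ^ m

theorem integrable_weight_mul_pow {s : ℝ} {m : ℕ} (hs : (m : ℝ) + 1 < s) :
    Integrable fun x : ℝ => (weight s x : ℂ) * (x : ℂ) ^ m := by
  refine (integrable_pow_mul_weight hs).mono' ?_ (Eventually.of_forall fun x => ?_)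
  · exact (((Complex.continuous_ofReal.comp ((continuous_weight s).comp
      Complex.continuous_ofReal)).mul (Complex.continuous_ofReal.pow m))).aestronglyMeasurable
  · rw [norm_mul, norm_pow, Complex.norm_real, Complex.norm_real,
      Real.norm_of_nonneg (weight_pos s _).le, mul_comm]
    exact mul_le_mul_of_nonneg_right (pow_le_pow_left₀ (norm_nonneg _)
      (by rw [Real.norm_eq_abs]; linarith) m) (weight_pos s _).le

theorem norm_sgn_le_one (x : ℝ) : ‖sgn x‖ ≤ 1 := by
  rw [sgn, Complex.norm_real]; exact abs_sign_le_one x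

theorem measurable_sgn : Measurable sgn := Complex.measurable_ofReal.comp measurable_sign_real

theorem sgn_neg (x : ℝ) : sgn (-x) = -sgn x := by
  rw [sgn, Real.sign_neg, sgn]; push_cast; rfl

theorem integrable_skewReal {s : ℝ} {m n : ℕ} (hm : (m : ℝ) + 1 < s) (hn : (n : ℝ) + 1 < s) :
    Integrable (fun x : ℝ × ℝ => ((weight s x.1 : ℂ) * (x.1 : ℂ) ^ m) *
      ((weight s x.2 : ℂ) * (x.2 : ℂ) ^ n) * sgn (x.1 - x.2)) (volume.prod volume) :=
  ((integrable_weight_mul_pow hm).mul_prod (integrable_weight_mul_pow hn)).mul_bdd (c := 1)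
    (measurable_sgn.comp (measurable_fst.sub measurable_snd)).aestronglyMeasurable
    (Eventually.of_forall fun _ => norm_sgn_le_one _)

theorem skewReal_pow {s : ℝ} {m n : ℕ} (hm : (m : ℝ) + 1 < s) (hn : (n : ℝ) + 1 < s) :
    Integrable (fun x : ℝ => ((weight s x : ℂ) * (x : ℂ) ^ m) *
      ∫ y : ℝ, (weight s y : ℂ) * (y : ℂ) ^ n * sgn (x - y)) ∧
    skewReal s (fun z => z ^ m) (fun z => z ^ n) = - ∫ x : ℝ, ((weight s x : ℂ) * (x : ℂ) ^ m) *
      ∫ y : ℝ, (weight s y : ℂ) * (y : ℂ) ^ n * sgn (x - y) := by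
  constructor
  · have := (integrable_skewReal hm hn).integral_prod_left
    refine this.congr (Eventually.of_forall fun x => ?_)
    simp only [mul_assoc]
    rw [← integral_const_mul, ← integral_const_mul]
  · rw [skewReal, ← integral_neg]
    congr 1; funext x
    rw [← integral_const_mul, ← integral_neg]
    congr 1; funext y
    rw [← neg_sub x y, sgn_neg]
    ring

theorem integrable_skewComplex {s : ℝ} {m n : ℕ} (h : (m : ℝ) + n + 2 < 2 * s) :
    Integrable fun z : ℂ => (weight s z : ℂ) ^ 2 * (z ^ m * (starRingEnd ℂ) z ^ n) * sgn z.im := by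
  have h1 : Integrable fun z : ℂ => (weight s z : ℂ) ^ 2 * (z ^ m * (starRingEnd ℂ) z ^ n) := by
    refine (integrable_pow_mul_weight_sq (s := s) (m := m + n) (by push_cast; linarith)).mono' ?_
      (Eventually.of_forall fun z => ?_)
    · exact (((Complex.continuous_ofReal.comp (continuous_weight s)).pow 2).mul
        ((continuous_id.pow m).mul (Complex.continuous_conj.pow n))).aestronglyMeasurable
    · rw [norm_mul, norm_mul, norm_pow, norm_pow, norm_pow, RCLike.norm_conj, Complex.norm_real,
        Real.norm_of_nonneg (weight_pos s _).le, mul_comm, ← pow_add]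
      exact mul_le_mul_of_nonneg_right (pow_le_pow_left₀ (norm_nonneg _) (by linarith) _)
        (by positivity)
  exact h1.mul_bdd (c := 1) (measurable_sgn.comp Complex.measurable_im).aestronglyMeasurable
    (Eventually.of_forall fun _ => norm_sgn_le_one _)

theorem integral_comp_conj (f : ℂ → ℂ) : ∫ z, f ((starRingEnd ℂ) z) = ∫ z, f z :=
  (Complex.conjLIE.measurePreserving).integral_comp
    Complex.conjLIE.toHomeomorph.measurableEmbedding f

theorem weight_conj (s : ℝ) (z : ℂ) : weight s ((starRingEnd ℂ) z) = weight s z := by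
  simp [weight]

/-- Conjugating the variable moves the conjugation to the second monomial and flips the sign; in
this form it matches the moments at z̄ in `reproducing`. -/
theorem skewComplex_pow (s : ℝ) (m n : ℕ) :
    skewComplex s (fun z => z ^ m) (fun z => z ^ n) =
      2 * Complex.I * ∫ z : ℂ, (weight s z : ℂ) ^ 2 * (z ^ m * (starRingEnd ℂ) z ^ n) *
        sgn z.im := by
  rw [skewComplex, ← integral_comp_conj]
  rw [show (-2 * Complex.I : ℂ) = (2 * Complex.I) * (-1) by ring, mul_assoc, ← integral_const_mul]
  congr 2; funext z
  simp only [weight_conj, Complex.conj_im, sgn_neg, map_pow, Complex.conj_conj]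
  ring

/-- Compare coefficients of v^j in `reproducing`. With N = k + 2, this says that each row of the
Gram matrix with index below N, border column included, maps the vector formed by -`coeffSkew` and,
for odd N, `coeffMom1` to the total mass times a unit vector. -/
theorem moment_system {s : ℝ} {k m j : ℕ} (hs : (k : ℝ) + 2 < s) (hm : m < k + 2)
    (hj : j < k + 2) :
    (if m = j then ((∫ p : Fin (k + 2) → ℝ, polyDensity s p : ℝ) : ℂ) else 0) =
      -(∑ a ∈ Finset.range (k + 2), (coeffSkew s k a j : ℂ) *
          skewForm s (fun z => z ^ m) (fun z => z ^ a)) +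
        if Even (k + 1) then lineMom s m * coeffMom1 s (k + 1) j else 0 := by
  have hlt : ∀ a < k + 2, (a : ℝ) + 1 < s := fun a ha => by
    have : (a : ℝ) + 1 ≤ k + 2 := by exact_mod_cast ha
    linarith
  have hlt2 : ∀ a < k + 2, (m : ℝ) + a + 2 < 2 * s := fun a ha => by
    linarith [hlt a ha, hlt m hm]
  refine coeff_eq_of_sum_pow_eq (n := k + 2)
    (a := fun j => if m = j then ((∫ p : Fin (k + 2) → ℝ, polyDensity s p : ℝ) : ℂ) else 0)
    (b := fun j => -(∑ a ∈ Finset.range (k + 2), (coeffSkew s k a j : ℂ) *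
          skewForm s (fun z => z ^ m) (fun z => z ^ a)) +
        if Even (k + 1) then lineMom s m * coeffMom1 s (k + 1) j else 0) (fun v => ?_) hj
  simp only [ite_mul, zero_mul, Finset.sum_ite_eq, Finset.mem_range, hm, if_true]
  rw [mul_comm, reproducing hs hm v]
  let c : ℕ → ℂ := fun a => ∑ b ∈ Finset.range (k + 2), (coeffSkew s k a b : ℂ) * v ^ b
  have hc : ∀ y : ℂ, (v - y) * mom2 s k v y = ∑ a ∈ Finset.range (k + 2), c a * y ^ a := by
    intro y
    rw [sub_mul_mom2 hs]
    refine Finset.sum_congr rfl fun a _ => ?_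
    simp only [c, Finset.sum_mul]
    exact Finset.sum_congr rfl fun b _ => by ring
  simp only [hc]
  have hi : ∀ x : ℝ, ∀ a ∈ Finset.range (k + 2), Integrable fun y : ℝ =>
      c a * ((weight s y : ℂ) * (y : ℂ) ^ a * sgn (x - y)) := fun x a ha =>
    ((integrable_weight_mul_pow (hlt a (Finset.mem_range.1 ha))).mul_bdd (c := 1)
      (measurable_sgn.comp (measurable_const.sub measurable_id)).aestronglyMeasurable
      (Eventually.of_forall fun _ => norm_sgn_le_one _)).const_mul _
  have inner : ∀ x : ℝ, ∫ y : ℝ, (Real.sign (x - y) : ℂ) * weight s y *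
      (∑ a ∈ Finset.range (k + 2), c a * (y : ℂ) ^ a) =
      ∑ a ∈ Finset.range (k + 2), c a * ∫ y : ℝ, (weight s y : ℂ) * (y : ℂ) ^ a * sgn (x - y) := by
    intro x
    simp only [← integral_const_mul]
    rw [← integral_finsetSum _ (hi x)]
    congr 1; funext y
    rw [Finset.mul_sum]
    exact Finset.sum_congr rfl fun a _ => by rw [sgn]; ring
  have outer : ∫ a : ℝ, (weight s a : ℂ) * (a : ℂ) ^ m *
      ((∫ y : ℝ, (Real.sign (a - y) : ℂ) * weight s y *
        (∑ i ∈ Finset.range (k + 2), c i * (y : ℂ) ^ i)) +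
        if Even (k + 1) then mom1 s (k + 1) v else 0) =
      -(∑ a ∈ Finset.range (k + 2), c a * skewReal s (fun z => z ^ m) (fun z => z ^ a)) +
        lineMom s m * if Even (k + 1) then mom1 s (k + 1) v else 0 := by
    simp only [inner]
    have h1 : ∀ a ∈ Finset.range (k + 2), Integrable fun x : ℝ => c a *
        (((weight s x : ℂ) * (x : ℂ) ^ m) * ∫ y : ℝ, (weight s y : ℂ) * (y : ℂ) ^ a * sgn (x - y)) :=
      fun a ha => ((skewReal_pow (hlt m hm) (hlt a (Finset.mem_range.1 ha))).1).const_mul _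
    have h2 := (integrable_weight_mul_pow (hlt m hm)).mul_const
      (if Even (k + 1) then mom1 s (k + 1) v else 0)
    rw [lineMom, ← integral_mul_const, ← Finset.sum_neg_distrib]
    have h3 : ∑ a ∈ Finset.range (k + 2), -(c a * skewReal s (fun z => z ^ m) (fun z => z ^ a)) =
        ∑ a ∈ Finset.range (k + 2), ∫ x : ℝ, c a *
        (((weight s x : ℂ) * (x : ℂ) ^ m) *
          ∫ y : ℝ, (weight s y : ℂ) * (y : ℂ) ^ a * sgn (x - y)) := by
      refine Finset.sum_congr rfl fun a ha => ?_
      rw [integral_const_mul, (skewReal_pow (hlt m hm) (hlt a (Finset.mem_range.1 ha))).2]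
      ring
    rw [h3, ← integral_finsetSum _ h1, ← integral_add (integrable_finsetSum _ h1) h2]
    congr 1; funext x
    rw [mul_add, Finset.mul_sum]
    congr 1
    exact Finset.sum_congr rfl fun a _ => by ring
  have compl : ∫ z : ℂ, -2 * Complex.I * sgn z.im * (weight s z : ℂ) ^ 2 * z ^ m *
      (∑ a ∈ Finset.range (k + 2), c a * (starRingEnd ℂ) z ^ a) =
      -(∑ a ∈ Finset.range (k + 2), c a * skewComplex s (fun z => z ^ m) (fun z => z ^ a)) := by
    have h1 : ∀ a ∈ Finset.range (k + 2), Integrable fun z : ℂ => (-2 * Complex.I * c a) *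
        ((weight s z : ℂ) ^ 2 * (z ^ m * (starRingEnd ℂ) z ^ a) * sgn z.im) := fun a ha =>
      (integrable_skewComplex (hlt2 a (Finset.mem_range.1 ha))).const_mul _
    have h3 : -(∑ a ∈ Finset.range (k + 2),
        c a * skewComplex s (fun z => z ^ m) (fun z => z ^ a)) =
        ∑ a ∈ Finset.range (k + 2), ∫ z : ℂ, (-2 * Complex.I * c a) *
          ((weight s z : ℂ) ^ 2 * (z ^ m * (starRingEnd ℂ) z ^ a) * sgn z.im) := by
      rw [← Finset.sum_neg_distrib]
      refine Finset.sum_congr rfl fun a ha => ?_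
      rw [integral_const_mul, skewComplex_pow]
      ring
    rw [h3, ← integral_finsetSum _ h1]
    congr 1; funext z
    rw [Finset.mul_sum]
    exact Finset.sum_congr rfl fun a _ => by ring
  rw [outer, compl]
  simp only [add_mul, Finset.sum_add_distrib, neg_mul, Finset.sum_neg_distrib, ite_mul, zero_mul]
  have e1 : ∑ j ∈ Finset.range (k + 2), (∑ a ∈ Finset.range (k + 2), (coeffSkew s k a j : ℂ) *
      skewForm s (fun z => z ^ m) (fun z => z ^ a)) * v ^ j =
      ∑ a ∈ Finset.range (k + 2), c a * skewReal s (fun z => z ^ m) (fun z => z ^ a) +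
      ∑ a ∈ Finset.range (k + 2), c a * skewComplex s (fun z => z ^ m) (fun z => z ^ a) := by
    simp only [Finset.sum_mul]
    rw [Finset.sum_comm, ← Finset.sum_add_distrib]
    refine Finset.sum_congr rfl fun a _ => ?_
    simp only [c, Finset.sum_mul, skewForm]
    rw [← Finset.sum_add_distrib]
    exact Finset.sum_congr rfl fun b _ => by ring
  have e2 : ∑ j ∈ Finset.range (k + 2), (if Even (k + 1) then
      lineMom s m * (coeffMom1 s (k + 1) j : ℂ) * v ^ j else 0) =
      lineMom s m * if Even (k + 1) then mom1 s (k + 1) v else 0 := by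
    split_ifs with h
    · rw [mom1_eq_sum (by push_cast; linarith), Finset.mul_sum]
      exact Finset.sum_congr rfl fun b _ => by ring
    · simp
  rw [e1, e2]
  ring

/-- The coefficients of v^j in `integral_weight_mom2_eq_zero`; up to sign this is the border row of
the same linear system. -/
theorem border_system {s : ℝ} {k j : ℕ} (hs : (k : ℝ) + 2 < s) (hk : Even (k + 1))
    (hj : j < k + 2) :
    ∑ a ∈ Finset.range (k + 2), (coeffSkew s k a j : ℂ) * lineMom s a = 0 := by
  refine coeff_eq_of_sum_pow_eq (n := k + 2) (b := fun _ => 0)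
    (a := fun j => ∑ a ∈ Finset.range (k + 2), (coeffSkew s k a j : ℂ) * lineMom s a)
    (fun v => ?_) hj
  have hlt : ∀ a ∈ Finset.range (k + 2), (a : ℝ) + 1 < s := fun a ha => by
    have : (a : ℝ) + 1 ≤ k + 2 := by exact_mod_cast Finset.mem_range.1 ha
    linarith
  simp only [zero_mul, Finset.sum_const_zero, Finset.sum_mul]
  rw [← integral_weight_mom2_eq_zero hs hk v, Finset.sum_comm]
  simp only [sub_mul_mom2 hs, lineMom, ← integral_const_mul, ← integral_mul_const]
  have h1 : ∀ a ∈ Finset.range (k + 2), ∀ b ∈ Finset.range (k + 2), Integrable fun x : ℝ =>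
      (coeffSkew s k a b : ℂ) * ((weight s x : ℂ) * (x : ℂ) ^ a) * v ^ b := fun a ha b _ =>
    ((integrable_weight_mul_pow (hlt a ha)).const_mul _).mul_const _
  have h2 : ∀ a ∈ Finset.range (k + 2), ∑ b ∈ Finset.range (k + 2), ∫ x : ℝ,
      (coeffSkew s k a b : ℂ) * ((weight s x : ℂ) * (x : ℂ) ^ a) * v ^ b =
      ∫ x : ℝ, ∑ b ∈ Finset.range (k + 2),
        (coeffSkew s k a b : ℂ) * ((weight s x : ℂ) * (x : ℂ) ^ a) * v ^ b := fun a ha =>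
    (integral_finsetSum _ (h1 a ha)).symm
  rw [Finset.sum_congr rfl h2, ← integral_finsetSum _ fun a ha => integrable_finsetSum _ (h1 a ha)]
  congr 1; funext x
  rw [Finset.mul_sum]
  refine Finset.sum_congr rfl fun a _ => ?_
  rw [Finset.mul_sum]
  exact Finset.sum_congr rfl fun b _ => by ring

/- ## Explicit moments -/

theorem weight_ofReal_neg (s x : ℝ) : weight s ((-x : ℝ) : ℂ) = weight s (x : ℂ) := by
  simp [weight]

theorem weight_of_one_le {s x : ℝ} (hx : 1 ≤ x) : weight s (x : ℂ) = x ^ (-s) := by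
  rw [weight, Complex.norm_real, Real.norm_of_nonneg (by linarith), max_eq_right hx]

theorem weight_of_norm_le_one {s : ℝ} {z : ℂ} (hz : ‖z‖ ≤ 1) : weight s z = 1 := by
  rw [weight, max_eq_left hz, Real.one_rpow]

theorem weight_of_one_le_norm {s : ℝ} {z : ℂ} (hz : 1 ≤ ‖z‖) : weight s z = ‖z‖ ^ (-s) := by
  rw [weight, max_eq_right hz]

theorem integrable_weight_mul_pow_real {s : ℝ} {m : ℕ} (hs : (m : ℝ) + 1 < s) :
    Integrable fun x : ℝ => weight s x * x ^ m := by
  have h := (integrable_weight_mul_pow hs).re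
  refine h.congr (Eventually.of_forall fun x => ?_)
  change ((weight s x : ℂ) * (x : ℂ) ^ m).re = _
  rw [← Complex.ofReal_pow, ← Complex.ofReal_mul, Complex.ofReal_re]

/-- The integral of a weighted monomial over a right half-line. -/
noncomputable def tailMom (s : ℝ) (m : ℕ) (x : ℝ) : ℝ := ∫ t in Ioi x, weight s t * t ^ m

theorem tailMom_of_one_le {s : ℝ} {m : ℕ} (hs : (m : ℝ) + 1 < s) {x : ℝ} (hx : 1 ≤ x) :
    tailMom s m x = x ^ ((m : ℝ) + 1 - s) / (s - m - 1) := by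
  have h0 : 0 < x := by linarith
  have : tailMom s m x = ∫ t in Ioi x, t ^ ((m : ℝ) - s) := by
    refine setIntegral_congr_fun measurableSet_Ioi fun t ht => ?_
    have ht : x < t := ht
    have ht0 : 0 < t := by linarith
    rw [weight_of_one_le (by linarith), ← Real.rpow_natCast t m, ← Real.rpow_add ht0]
    congr 1; ring
  rw [this, integral_Ioi_rpow_of_lt (by linarith) h0]
  rw [show (m : ℝ) - s + 1 = (m : ℝ) + 1 - s by ring,
    show s - m - 1 = -((m : ℝ) + 1 - s) by ring, neg_div, div_neg]

theorem tailMom_of_le_one {s : ℝ} {m : ℕ} (hs : (m : ℝ) + 1 < s) {x : ℝ} (h0 : 0 ≤ x)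
    (hx : x ≤ 1) :
    tailMom s m x = (1 - x ^ (m + 1)) / (m + 1) + 1 / (s - m - 1) := by
  have hi := integrable_weight_mul_pow_real hs
  have h1 : tailMom s m x = (∫ t in Ioc x 1, weight s t * t ^ m) + tailMom s m 1 := by
    rw [tailMom, tailMom, ← setIntegral_union (Ioc_disjoint_Ioi le_rfl) measurableSet_Ioi
      hi.integrableOn hi.integrableOn, Ioc_union_Ioi_eq_Ioi hx]
  have h2 : ∫ t in Ioc x 1, weight s t * t ^ m = ∫ t in x..1, t ^ m := by
    rw [intervalIntegral.integral_of_le hx]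
    refine setIntegral_congr_fun measurableSet_Ioc fun t ht => ?_
    rw [weight_of_norm_le_one, one_mul]
    rw [Complex.norm_real, Real.norm_of_nonneg (by linarith [ht.1])]
    exact ht.2
  rw [h1, h2, tailMom_of_one_le hs le_rfl, integral_pow, Real.one_rpow, one_pow]

theorem integral_mul_sign_sub {g : ℝ → ℝ} (hg : Integrable g) (x : ℝ) :
    ∫ t, g t * Real.sign (t - x) = 2 * (∫ t in Ioi x, g t) - ∫ t, g t := by
  have hm : Integrable fun t => g t * Real.sign (t - x) :=
    hg.mul_bdd (c := 1) (measurable_sign_real.comp (measurable_id.sub_const x)).aestronglyMeasurable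
      (Eventually.of_forall fun t => abs_sign_le_one _)
  rw [← integral_add_compl measurableSet_Ioi hm (s := Ioi x),
    ← integral_add_compl measurableSet_Ioi hg (s := Ioi x), compl_Ioi]
  have h1 : ∫ t in Ioi x, g t * Real.sign (t - x) = ∫ t in Ioi x, g t := by
    refine setIntegral_congr_fun measurableSet_Ioi fun t ht => ?_
    have ht : x < t := ht
    simp only [Real.sign_of_pos (sub_pos.2 ht), mul_one]
  have h2 : ∫ t in Iic x, g t * Real.sign (t - x) = - ∫ t in Iic x, g t := by
    rw [integral_Iic_eq_integral_Iio, integral_Iic_eq_integral_Iio, ← integral_neg]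
    refine setIntegral_congr_fun measurableSet_Iio fun t ht => ?_
    have ht : t < x := ht
    simp only [Real.sign_of_neg (sub_neg.2 ht), mul_neg, mul_one]
  rw [h1, h2]; ring

theorem integral_Iic_weight (s : ℝ) (m : ℕ) (x : ℝ) :
    ∫ t in Iic (-x), weight s t * t ^ m = (-1) ^ m * tailMom s m x := by
  have h := integral_comp_neg_Iic (-x) fun t : ℝ => weight s t * t ^ m
  rw [neg_neg] at h
  rw [tailMom, ← h, ← integral_const_mul]
  refine setIntegral_congr_fun measurableSet_Iic fun t _ => ?_
  rw [weight_ofReal_neg, neg_pow t m]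
  have : ((-1 : ℝ) ^ m) * (-1) ^ m = 1 := by rw [← mul_pow]; norm_num
  linear_combination (-(weight s t * t ^ m)) * this

/-- The integral of a weighted monomial over the whole line. -/
theorem integral_weight_eq {s : ℝ} {m : ℕ} (hs : (m : ℝ) + 1 < s) :
    ∫ t : ℝ, weight s t * t ^ m = (1 + (-1) ^ m) * (s / ((m + 1) * (s - m - 1))) := by
  have hi := integrable_weight_mul_pow_real hs
  rw [← integral_add_compl measurableSet_Ioi hi (s := Ioi 0), compl_Ioi]
  have h1 := integral_Iic_weight s m 0
  rw [neg_zero] at h1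
  have h3 : ∫ t in Ioi (0 : ℝ), weight s t * t ^ m = tailMom s m 0 := rfl
  rw [h1, h3, tailMom_of_le_one hs le_rfl zero_le_one, zero_pow (Nat.succ_ne_zero m)]
  have h2 : s - m - 1 ≠ 0 := by linarith
  have h4 : (m : ℝ) + 1 ≠ 0 := by positivity
  field_simp
  ring

theorem lineMom_eq_ofReal (s : ℝ) (m : ℕ) :
    lineMom s m = ((∫ t : ℝ, weight s t * t ^ m : ℝ) : ℂ) := by
  rw [lineMom, ← integral_complex_ofReal]
  congr 1; funext x; push_cast; rfl

theorem lineMom_even {s : ℝ} {m : ℕ} (hs : (m : ℝ) + 1 < s) (hm : Even m) :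
    lineMom s m = ((2 * s / ((m + 1) * (s - m - 1)) : ℝ) : ℂ) := by
  rw [lineMom_eq_ofReal, integral_weight_eq hs, hm.neg_one_pow]
  congr 1; ring

theorem lineMom_odd {s : ℝ} {m : ℕ} (hs : (m : ℝ) + 1 < s) (hm : Odd m) :
    lineMom s m = 0 := by
  rw [lineMom_eq_ofReal, integral_weight_eq hs, hm.neg_one_pow]
  simp

/-- The integral of a weighted monomial against `sgn (t - x)`. -/
theorem integral_weight_sign_of_nonneg {s : ℝ} {m : ℕ} (hs : (m : ℝ) + 1 < s) (x : ℝ) :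
    ∫ t : ℝ, weight s t * t ^ m * Real.sign (t - x) =
      2 * tailMom s m x - ∫ t : ℝ, weight s t * t ^ m := by
  rw [integral_mul_sign_sub (integrable_weight_mul_pow_real hs)]; rfl

theorem tailMom_neg {s : ℝ} {m : ℕ} (hs : (m : ℝ) + 1 < s) (x : ℝ) :
    tailMom s m (-x) = (∫ t : ℝ, weight s t * t ^ m) - (-1) ^ m * tailMom s m x := by
  have hi := integrable_weight_mul_pow_real hs
  rw [← integral_add_compl measurableSet_Ioi hi (s := Ioi (-x)), compl_Ioi, integral_Iic_weight,
    tailMom]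
  ring

theorem integral_weight_sign_odd {s : ℝ} {m : ℕ} (hs : (m : ℝ) + 1 < s) (hm : Odd m) (x : ℝ) :
    ∫ t : ℝ, weight s t * t ^ m * Real.sign (t - x) = 2 * tailMom s m |x| := by
  have h0 : ∫ t : ℝ, weight s t * t ^ m = 0 := by
    rw [integral_weight_eq hs, hm.neg_one_pow]; ring
  rw [integral_weight_sign_of_nonneg hs, h0, sub_zero]
  rcases le_total 0 x with h | h
  · rw [abs_of_nonneg h]
  · have := tailMom_neg hs x
    rw [h0, hm.neg_one_pow] at this
    rw [abs_of_nonpos h, this]; ring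

theorem integral_weight_tailMom {s : ℝ} {m n : ℕ} (hm : Even m) (hn : (n : ℝ) + 1 < s)
    (hm1 : (m : ℝ) + 1 < s)
    (hi : Integrable fun x : ℝ => weight s x * x ^ m * tailMom s n |x|) :
    ∫ x : ℝ, weight s x * x ^ m * tailMom s n |x| =
      2 * (1 / ((m + 1) * (m + n + 2)) +
        (2 * s - n - 1) / ((s - n - 1) * (m + 1) * (2 * s - m - n - 2))) := by
  have e1 : ∀ x : ℝ, weight s x * x ^ m * tailMom s n |x| =
      (fun r : ℝ => weight s r * r ^ m * tailMom s n r) |x| := by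
    intro x
    simp only
    rw [hm.pow_abs]
    congr 2
    simp [weight]
  have h2 : ∫ x : ℝ, weight s x * x ^ m * tailMom s n |x| =
      2 * ∫ r in Ioi (0 : ℝ), weight s r * r ^ m * tailMom s n r := by
    simp_rw [e1]
    exact integral_comp_abs (f := fun r : ℝ => weight s r * r ^ m * tailMom s n r)
  have hi2 : IntegrableOn (fun r : ℝ => weight s r * r ^ m * tailMom s n r) (Ioi 0) := by
    refine (hi.integrableOn (s := Ioi 0)).congr_fun (fun x hx => ?_) measurableSet_Ioi
    have hx : 0 < x := hx
    simp only [abs_of_pos hx]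
  have h3 : ∫ r in Ioi (0 : ℝ), weight s r * r ^ m * tailMom s n r =
      (∫ r in Ioc (0 : ℝ) 1, weight s r * r ^ m * tailMom s n r) +
        ∫ r in Ioi (1 : ℝ), weight s r * r ^ m * tailMom s n r := by
    rw [← setIntegral_union (Ioc_disjoint_Ioi le_rfl) measurableSet_Ioi
      (hi2.mono_set Ioc_subset_Ioi_self) (hi2.mono_set (Ioi_subset_Ioi zero_le_one)),
      Ioc_union_Ioi_eq_Ioi zero_le_one]
  have h4 : ∫ r in Ioc (0 : ℝ) 1, weight s r * r ^ m * tailMom s n r =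
      ∫ r in (0 : ℝ)..1, ((1 / (n + 1) + 1 / (s - n - 1)) * r ^ m -
        1 / (n + 1) * r ^ (m + n + 1)) := by
    rw [intervalIntegral.integral_of_le zero_le_one]
    refine setIntegral_congr_fun measurableSet_Ioc fun r hr => ?_
    rw [weight_of_norm_le_one, tailMom_of_le_one hn hr.1.le hr.2]
    · have : (n : ℝ) + 1 ≠ 0 := by positivity
      field_simp
      ring
    · rw [Complex.norm_real, Real.norm_of_nonneg hr.1.le]
      exact hr.2
  have h5 : ∫ r in Ioi (1 : ℝ), weight s r * r ^ m * tailMom s n r =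
      ∫ r in Ioi (1 : ℝ), (1 / (s - n - 1)) * r ^ ((m : ℝ) + n + 1 - 2 * s) := by
    refine setIntegral_congr_fun measurableSet_Ioi fun r hr => ?_
    have hr : 1 < r := hr
    have hr0 : 0 < r := by linarith
    rw [weight_of_one_le hr.le, tailMom_of_one_le hn hr.le, ← Real.rpow_natCast r m,
      ← Real.rpow_add hr0, mul_div_assoc', ← Real.rpow_add hr0, div_eq_mul_one_div, mul_comm]
    congr 2; ring
  have hn1 : s - n - 1 ≠ 0 := by linarith
  have hmn : 2 * s - m - n - 2 ≠ 0 := by linarith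
  rw [h2, h3, h4, h5, intervalIntegral.integral_sub
      (Continuous.intervalIntegrable (by fun_prop) _ _)
      (Continuous.intervalIntegrable (by fun_prop) _ _),
    intervalIntegral.integral_const_mul, intervalIntegral.integral_const_mul, integral_pow,
    integral_pow, integral_const_mul, integral_Ioi_rpow_of_lt (by linarith) zero_lt_one,
    Real.one_rpow, one_pow, one_pow, zero_pow (Nat.succ_ne_zero m),
    zero_pow (Nat.succ_ne_zero (m + n + 1))]
  push_cast
  have hx : (m : ℝ) + n + 1 - 2 * s + 1 ≠ 0 := by intro h; apply hmn; linarith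
  have e : (m : ℝ) + n + 1 - 2 * s + 1 = -(2 * s - m - n - 2) := by ring
  rw [e]
  field_simp
  ring

theorem ofReal_integral_sign (s : ℝ) (n : ℕ) (x : ℝ) :
    ∫ y : ℝ, (weight s y : ℂ) * (y : ℂ) ^ n * sgn (x - y) =
      ((-∫ t : ℝ, weight s t * t ^ n * Real.sign (t - x) : ℝ) : ℂ) := by
  rw [← integral_neg, ← integral_complex_ofReal]
  congr 1; funext y
  rw [← neg_sub y x, sgn_neg, sgn]; push_cast; ring

theorem skewReal_even_odd {s : ℝ} {m n : ℕ} (hm : (m : ℝ) + 1 < s) (hn : (n : ℝ) + 1 < s)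
    (hme : Even m) (hno : Odd n) :
    skewReal s (fun z => z ^ m) (fun z => z ^ n) = ((4 * (1 / ((m + 1) * (m + n + 2)) +
        (2 * s - n - 1) / ((s - n - 1) * (m + 1) * (2 * s - m - n - 2))) : ℝ) : ℂ) := by
  obtain ⟨h1, h2⟩ := skewReal_pow hm hn
  have e : ∀ x : ℝ, ((weight s x : ℂ) * (x : ℂ) ^ m) *
      ∫ y : ℝ, (weight s y : ℂ) * (y : ℂ) ^ n * sgn (x - y) =
      (((-2) * (weight s x * x ^ m * tailMom s n |x|) : ℝ) : ℂ) := by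
    intro x
    rw [ofReal_integral_sign, integral_weight_sign_odd hn hno]
    push_cast; ring
  simp_rw [e] at h1 h2
  have hi : Integrable fun x : ℝ => weight s x * x ^ m * tailMom s n |x| := by
    have := h1.re.const_mul (-1 / 2)
    refine this.congr (Eventually.of_forall fun x => ?_)
    simp only [RCLike.re_to_complex]
    rw [Complex.ofReal_re]; ring
  rw [h2, integral_complex_ofReal, integral_const_mul, integral_weight_tailMom hme hn hm hi]
  push_cast; ring

theorem skewReal_swap {s : ℝ} {m n : ℕ} (hm : (m : ℝ) + 1 < s) (hn : (n : ℝ) + 1 < s) :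
    skewReal s (fun z => z ^ m) (fun z => z ^ n) = -skewReal s (fun z => z ^ n) (fun z => z ^ m) := by
  have h := integrable_skewReal hm hn
  have e1 : ∀ a b : ℕ, skewReal s (fun z => z ^ a) (fun z => z ^ b) =
      -∫ x : ℝ, ∫ y : ℝ, ((weight s x : ℂ) * (x : ℂ) ^ a) *
      ((weight s y : ℂ) * (y : ℂ) ^ b) * sgn (x - y) := by
    intro a b
    rw [skewReal, ← integral_neg]
    congr 1; funext x
    rw [← integral_neg]
    congr 1; funext y
    rw [← neg_sub x y, sgn_neg]; ring
  rw [e1, e1, integral_integral_swap h, ← integral_neg, neg_neg]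
  congr 1; funext x
  rw [← integral_neg]
  congr 1; funext y
  rw [← neg_sub x y, sgn_neg]; ring

/-- Reflecting both variables multiplies the integrand by (-1)^{m+n} and reverses sgn(y-x). -/
theorem skewReal_same {s : ℝ} {m n : ℕ} (h : Even (m + n)) :
    skewReal s (fun z => z ^ m) (fun z => z ^ n) = 0 := by
  have e : skewReal s (fun z => z ^ m) (fun z => z ^ n) =
      -skewReal s (fun z => z ^ m) (fun z => z ^ n) := by
    conv_lhs => rw [skewReal]
    rw [← integral_neg_eq_self (μ := volume), skewReal, ← integral_neg]
    congr 1; funext x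
    rw [← integral_neg_eq_self (μ := volume), ← integral_neg]
    congr 1; funext y
    rw [weight_ofReal_neg, weight_ofReal_neg, show -y - -x = -(y - x) by ring, sgn_neg]
    push_cast
    rw [neg_pow (x : ℂ) m, neg_pow (y : ℂ) n]
    have : ((-1 : ℂ) ^ m) * (-1) ^ n = 1 := by rw [← pow_add, h.neg_one_pow]
    linear_combination (-(weight s x * weight s y * (x : ℂ) ^ m * (y : ℂ) ^ n * sgn (y - x))) * this
  have : (2 : ℂ) * skewReal s (fun z => z ^ m) (fun z => z ^ n) = 0 := by
    linear_combination e
  simpa using this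

theorem integral_exp_sign (m n : ℕ) :
    ∫ θ in Ioo (-Real.pi) Real.pi, Complex.exp (((m : ℂ) - n) * Complex.I * θ) * sgn θ =
      if Even (m + n) then 0 else 4 * Complex.I / ((m : ℂ) - n) := by
  set c : ℂ := ((m : ℂ) - n) * Complex.I with hc
  have hcont : Continuous fun θ : ℝ => Complex.exp (c * θ) := by fun_prop
  have hi : IntegrableOn (fun θ : ℝ => Complex.exp (c * θ) * sgn θ)
      (Ioo (-Real.pi) Real.pi) := by
    refine Integrable.mul_bdd (c := 1) ?_ measurable_sgn.aestronglyMeasurable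
      (Eventually.of_forall fun _ => norm_sgn_le_one _)
    exact (hcont.integrableOn_Icc).mono_set Ioo_subset_Icc_self
  have hpi := Real.pi_pos
  have h1 : ∫ θ in Ioo (-Real.pi) Real.pi, Complex.exp (c * θ) * sgn θ =
      (∫ θ in (0 : ℝ)..Real.pi, Complex.exp (c * θ)) -
        ∫ θ in (-Real.pi)..0, Complex.exp (c * θ) := by
    rw [← integral_Ioc_eq_integral_Ioo] at *
    rw [← Ioc_union_Ioc_eq_Ioc (show -Real.pi ≤ 0 by linarith) hpi.le,
      setIntegral_union (Ioc_disjoint_Ioc_of_le le_rfl) measurableSet_Ioc,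
      intervalIntegral.integral_of_le hpi.le, intervalIntegral.integral_of_le (by linarith),
      sub_eq_add_neg, add_comm]
    · congr 1
      · refine setIntegral_congr_fun measurableSet_Ioc fun t ht => ?_
        simp only [sgn, Real.sign_of_pos ht.1, Complex.ofReal_one, mul_one]
      · rw [integral_Ioc_eq_integral_Ioo, integral_Ioc_eq_integral_Ioo, ← integral_neg]
        refine setIntegral_congr_fun measurableSet_Ioo fun t ht => ?_
        simp only [sgn, Real.sign_of_neg ht.2, Complex.ofReal_neg, Complex.ofReal_one, mul_neg,
          mul_one]
    · exact ((hcont.integrableOn_Icc (a := -Real.pi) (b := 0)).mono_set Ioc_subset_Icc_self).mul_bdd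
        (c := 1) measurable_sgn.aestronglyMeasurable
        (Eventually.of_forall fun _ => norm_sgn_le_one _)
    · exact ((hcont.integrableOn_Icc (a := 0) (b := Real.pi)).mono_set Ioc_subset_Icc_self).mul_bdd
        (c := 1) measurable_sgn.aestronglyMeasurable
        (Eventually.of_forall fun _ => norm_sgn_le_one _)
  have e1 : Complex.exp (c * Real.pi) = (-1) ^ (m + n) := by
    rw [hc, show ((m : ℂ) - n) * Complex.I * Real.pi =
      m * (Real.pi * Complex.I) + -(n * (Real.pi * Complex.I)) by ring, Complex.exp_add,
      Complex.exp_neg, Complex.exp_nat_mul, Complex.exp_nat_mul, Complex.exp_pi_mul_I, pow_add,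
      ← inv_pow]
    norm_num
  have e2 : Complex.exp (c * (-Real.pi : ℝ)) = (-1) ^ (m + n) := by
    rw [Complex.ofReal_neg, mul_neg, Complex.exp_neg, e1, ← inv_pow]
    norm_num
  rw [h1]
  by_cases hmn : m = n
  · subst hmn
    have : c = 0 := by rw [hc]; simp
    rw [this, if_pos ⟨m, rfl⟩]
    simp
  have hsub : (m : ℂ) - n ≠ 0 := sub_ne_zero.2 (by exact_mod_cast hmn)
  have hc0 : c ≠ 0 := mul_ne_zero hsub Complex.I_ne_zero
  rw [integral_exp_mul_complex hc0, integral_exp_mul_complex hc0, e1, e2]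
  simp only [Complex.ofReal_zero, mul_zero, Complex.exp_zero]
  split_ifs with h
  · rw [h.neg_one_pow]; simp
  · rw [(Nat.not_even_iff_odd.1 h).neg_one_pow, hc]
    field_simp
    rw [Complex.I_sq]; ring

theorem integral_weight_sq {s : ℝ} {k : ℕ} (h : (k : ℝ) + 2 < 2 * s) :
    ∫ r in Ioi (0 : ℝ), r * weight s r ^ 2 * r ^ k = 1 / (k + 2) + 1 / (2 * s - k - 2) := by
  have f1 : ∀ r ∈ Ioi (1 : ℝ), r * weight s r ^ 2 * r ^ k = r ^ ((k : ℝ) + 1 - 2 * s) := by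
    intro r hr
    have hr : 1 < r := hr
    have hr0 : 0 < r := by linarith
    rw [weight_of_one_le hr.le, ← Real.rpow_natCast r k, ← Real.rpow_natCast _ 2,
      ← Real.rpow_mul hr0.le]
    nth_rewrite 1 [← Real.rpow_one r]
    rw [← Real.rpow_add hr0, ← Real.rpow_add hr0]
    congr 1; push_cast; ring
  have f0 : ∀ r ∈ Ioc (0 : ℝ) 1, r * weight s r ^ 2 * r ^ k = r ^ (k + 1) := by
    intro r hr
    rw [weight_of_norm_le_one]
    · ring
    · rw [Complex.norm_real, Real.norm_of_nonneg hr.1.le]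
      exact hr.2
  rw [← Ioc_union_Ioi_eq_Ioi zero_le_one, setIntegral_union (Ioc_disjoint_Ioi le_rfl)
    measurableSet_Ioi, setIntegral_congr_fun measurableSet_Ioc f0,
    setIntegral_congr_fun measurableSet_Ioi f1, ← intervalIntegral.integral_of_le zero_le_one,
    integral_pow, integral_Ioi_rpow_of_lt (by linarith) zero_lt_one]
  · rw [Real.one_rpow, one_pow, zero_pow (Nat.succ_ne_zero _),
      show (k : ℝ) + 1 - 2 * s + 1 = -(2 * s - k - 2) by ring, neg_div_neg_eq]
    push_cast
    congr 2
    · ring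
    · ring
  · exact ((continuous_pow (k + 1)).integrableOn_Icc.mono_set Ioc_subset_Icc_self).congr_fun
      (fun r hr => (f0 r hr).symm) measurableSet_Ioc
  · exact (integrableOn_Ioi_rpow_of_lt (by linarith) zero_lt_one).congr_fun
      (fun r hr => (f1 r hr).symm) measurableSet_Ioi

/-- In polar coordinates the integral separates. The angular part vanishes for equal parity and is
4i/(m-n) otherwise; the radial part is split at the unit circle, where the weight changes. -/
theorem skewComplex_eq {s : ℝ} {m n : ℕ} (h : (m : ℝ) + n + 2 < 2 * s) :
    skewComplex s (fun z => z ^ m) (fun z => z ^ n) =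
      if Even (m + n) then 0 else
        8 / ((n : ℂ) - m) * ((1 / (m + n + 2) + 1 / (2 * s - m - n - 2) : ℝ) : ℂ) := by
  have key : ∫ z : ℂ, (weight s z : ℂ) ^ 2 * (z ^ m * (starRingEnd ℂ) z ^ n) * sgn z.im =
      ((1 / (m + n + 2) + 1 / (2 * s - m - n - 2) : ℝ) : ℂ) *
        if Even (m + n) then 0 else 4 * Complex.I / ((m : ℂ) - n) := by
    rw [← Complex.integral_comp_polarCoord_symm, ← integral_exp_sign, polarCoord_target]
    have h1 : ((1 / (m + n + 2) + 1 / (2 * s - m - n - 2) : ℝ) : ℂ) =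
        ∫ r in Ioi (0 : ℝ), ((r * weight s r ^ 2 * r ^ (m + n) : ℝ) : ℂ) := by
      rw [integral_complex_ofReal, integral_weight_sq (by push_cast; linarith)]
      push_cast; congr 2; ring
    rw [h1, ← setIntegral_prod_mul]
    refine setIntegral_congr_fun (measurableSet_Ioi.prod measurableSet_Ioo) fun p hp => ?_
    have hr : (0 : ℝ) < p.1 := hp.1
    have hθ : p.2 ∈ Ioo (-Real.pi) Real.pi := hp.2
    have hz : Complex.polarCoord.symm p = p.1 * Complex.exp (p.2 * Complex.I) := by
      rw [Complex.polarCoord_symm_apply, Complex.exp_mul_I]; simp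
    have hzc : (starRingEnd ℂ) (Complex.polarCoord.symm p) =
        p.1 * Complex.exp (-(p.2 * Complex.I)) := by
      rw [hz, map_mul, ← Complex.exp_conj]; simp
    have hw : weight s (Complex.polarCoord.symm p) = weight s (p.1 : ℂ) := by
      rw [weight, weight, hz, norm_mul, Complex.norm_exp_ofReal_mul_I, mul_one]
    have him : sgn (Complex.polarCoord.symm p).im = sgn p.2 := by
      have : (Complex.polarCoord.symm p).im = p.1 * Real.sin p.2 := by
        rw [hz, Complex.im_ofReal_mul, Complex.exp_ofReal_mul_I_im]
      rw [this, sgn, sgn]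
      congr 1
      rcases lt_trichotomy p.2 0 with h0 | h0 | h0
      · rw [Real.sign_of_neg h0, Real.sign_of_neg
          (mul_neg_of_pos_of_neg hr (Real.sin_neg_of_neg_of_neg_pi_lt h0 hθ.1))]
      · rw [h0]; simp
      · rw [Real.sign_of_pos h0, Real.sign_of_pos
          (mul_pos hr (Real.sin_pos_of_pos_of_lt_pi h0 hθ.2))]
    simp only [hw, him, hzc]
    rw [hz, mul_pow, mul_pow, ← Complex.exp_nat_mul, ← Complex.exp_nat_mul,
      show ((m : ℂ) - n) * Complex.I * p.2 = m * (p.2 * Complex.I) + n * (-(p.2 * Complex.I)) by ring,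
      Complex.exp_add, Complex.real_smul]
    push_cast
    ring
  rw [skewComplex_pow, key]
  split_ifs with he
  · ring
  · have hsub : (m : ℂ) - n ≠ 0 := by
      intro h0
      apply he
      have : m = n := by exact_mod_cast sub_eq_zero.1 h0
      exact ⟨m, by omega⟩
    have hsub2 : (n : ℂ) - m ≠ 0 := by rwa [← neg_sub, neg_ne_zero]
    rw [show (n : ℂ) - m = -((m : ℂ) - n) by ring, div_neg]
    field_simp
    rw [Complex.I_sq]; ring

/-- The real and the complex part both carry the denominators m+n+2 and 2s-m-n-2, and these
disappear in the sum. Apart from factors depending on m or on n alone, only 1/(n-m) couples the two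
exponents, which is why the Gram matrix can be inverted in closed form. -/
theorem skewForm_even_odd {s : ℝ} {m n : ℕ} (hm : (m : ℝ) + 1 < s) (hn : (n : ℝ) + 1 < s)
    (hme : Even m) (hno : Odd n) :
    skewForm s (fun z => z ^ m) (fun z => z ^ n) =
      ((4 * s / ((m + 1) * (n - m) * (s - n - 1)) : ℝ) : ℂ) := by
  have hne : (n : ℝ) - m ≠ 0 := by
    intro h0
    have h1 : n = m := by exact_mod_cast sub_eq_zero.1 h0
    exact (Nat.not_even_iff_odd.2 hno) (h1 ▸ hme)
  rw [skewForm, skewReal_even_odd hm hn hme hno, skewComplex_eq (by linarith),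
    if_neg (Nat.not_even_iff_odd.2 (hme.add_odd hno)),
    show (8 : ℂ) / ((n : ℂ) - m) = ((8 / ((n : ℝ) - m) : ℝ) : ℂ) by push_cast; rfl,
    ← Complex.ofReal_mul, ← Complex.ofReal_add]
  congr 1
  have h1 : s - n - 1 ≠ 0 := by linarith
  have h2 : 2 * s - m - n - 2 ≠ 0 := by linarith
  have h3 : (m : ℝ) + 1 ≠ 0 := by positivity
  have h4 : (m : ℝ) + n + 2 ≠ 0 := by positivity
  field_simp
  ring

theorem skewForm_swap {s : ℝ} {m n : ℕ} (hm : (m : ℝ) + 1 < s) (hn : (n : ℝ) + 1 < s) :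
    skewForm s (fun z => z ^ m) (fun z => z ^ n) =
      -skewForm s (fun z => z ^ n) (fun z => z ^ m) := by
  rw [skewForm, skewForm, skewReal_swap hm hn, skewComplex_eq (by linarith),
    skewComplex_eq (by linarith), add_comm m n]
  split_ifs
  · simp
  · rw [← neg_sub (m : ℂ) n, div_neg]; push_cast; ring

theorem skewForm_same {s : ℝ} {m n : ℕ} (hm : (m : ℝ) + 1 < s) (hn : (n : ℝ) + 1 < s)
    (h : Even (m + n)) : skewForm s (fun z => z ^ m) (fun z => z ^ n) = 0 := by
  rw [skewForm, skewReal_same h, skewComplex_eq (by linarith), if_pos h, add_zero]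

/- ## The inverse of the Gram matrix -/

/-- The quotient of the two node products in the partial fraction expansions of Lagrange
interpolation at `v 0, …, v (J - 1)`. -/
noncomputable def nodeQuot (J : ℕ) (v z : ℕ → ℝ) (a : ℕ) : ℝ :=
  (∏ k ∈ Finset.range J, (v a - z k)) / ∏ k ∈ (Finset.range J).erase a, (v a - v k)

theorem prod_erase_ne_zero {J : ℕ} {v : ℕ → ℝ} (hv : Set.InjOn v (Finset.range J)) {a : ℕ}
    (ha : a < J) : ∏ k ∈ (Finset.range J).erase a, (v a - v k) ≠ 0 := by
  refine Finset.prod_ne_zero_iff.2 fun k hk => sub_ne_zero.2 fun h => ?_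
  obtain ⟨h1, h2⟩ := Finset.mem_erase.1 hk
  exact h1 (hv (by simpa using h2) (by simpa using ha) h.symm)

/-- The partial fraction expansion at t: the product over k ≠ b of X - z_k has degree below J, so
interpolation at the nodes v reproduces it. -/
theorem sum_nodeQuot {J : ℕ} {v z : ℕ → ℝ} (hv : Set.InjOn v (Finset.range J)) {b : ℕ} {t : ℝ}
    (hb : b < J) (ht : ∀ a < J, t ≠ v a) (hz : ∀ a < J, v a ≠ z b) :
    ∑ a ∈ Finset.range J, nodeQuot J v z a / ((v a - z b) * (t - v a)) =
      (∏ k ∈ (Finset.range J).erase b, (t - z k)) / ∏ k ∈ Finset.range J, (t - v k) := by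
  classical
  have hbm : b ∈ Finset.range J := Finset.mem_range.2 hb
  have hdeg : (Lagrange.nodal ((Finset.range J).erase b) z).degree < (Finset.range J).card := by
    rw [Lagrange.degree_nodal, Nat.cast_lt]
    exact Finset.card_erase_lt_of_mem hbm
  have h1 := Lagrange.eq_interpolate_of_eval_eq (s := Finset.range J) (v := v)
    (f := Lagrange.nodal ((Finset.range J).erase b) z)
    (fun a => ∏ k ∈ (Finset.range J).erase b, (v a - z k)) hv hdeg
    (fun a _ => Lagrange.eval_nodal)
  have h2 := congrArg (Polynomial.eval t) h1
  rw [Lagrange.eval_interpolate_not_at_node _ fun i hi => ht i (Finset.mem_range.1 hi),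
    Lagrange.eval_nodal, Lagrange.eval_nodal] at h2
  have hne : ∏ k ∈ Finset.range J, (t - v k) ≠ 0 :=
    Finset.prod_ne_zero_iff.2 fun k hk => sub_ne_zero.2 (ht k (Finset.mem_range.1 hk))
  rw [h2, mul_div_cancel_left₀ _ hne]
  refine Finset.sum_congr rfl fun a ha => ?_
  have ha' := Finset.mem_range.1 ha
  rw [nodeQuot, Lagrange.nodalWeight, Finset.prod_inv_distrib, ← Finset.mul_prod_erase _ _ hbm]
  have h3 : v a - z b ≠ 0 := sub_ne_zero.2 (hz a ha')
  have h4 : t - v a ≠ 0 := sub_ne_zero.2 (ht a ha')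
  have h5 := prod_erase_ne_zero hv ha'
  field_simp

/-- A Cauchy matrix with row and column factors. -/
noncomputable def cauchy (J : ℕ) (x y d e : ℕ → ℝ) : Matrix (Fin J) (Fin J) ℝ :=
  Matrix.of fun a b => d a * e b / (y b - x a)

/-- The entries of the inverse of `cauchy`. -/
noncomputable def cauchyInvEntry (J : ℕ) (x y d e : ℕ → ℝ) (b a : ℕ) : ℝ :=
  -(nodeQuot J x y a * nodeQuot J y x b) / ((y b - x a) * (d a * e b))

/-- Each entry of the product is a partial fraction sum evaluated at t = x_a. The resulting
numerator, the product of x_a - x_k over k ≠ a', contains a zero factor unless a = a', and on the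
diagonal it cancels the node quotient of x_a. -/
theorem cauchy_mul_inv {J : ℕ} {x y d e : ℕ → ℝ} (hx : Set.InjOn x (Finset.range J))
    (hy : Set.InjOn y (Finset.range J)) (hxy : ∀ a < J, ∀ b < J, x a ≠ y b)
    (hd : ∀ a < J, d a ≠ 0) (he : ∀ b < J, e b ≠ 0) :
    cauchy J x y d e * (Matrix.of fun b a : Fin J => cauchyInvEntry J x y d e b a) = 1 := by
  ext a a'
  rw [Matrix.mul_apply]
  simp only [cauchy, cauchyInvEntry, Matrix.of_apply]
  have h1 := sum_nodeQuot (v := y) (z := x) (t := x a) hy a'.2 (fun b hb => hxy a a.2 b hb)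
    (fun b hb => (hxy a' a'.2 b hb).symm)
  rw [Finset.sum_range] at h1
  have h2 : ∑ b : Fin J, d a * e b / (y b - x a) *
      (-(nodeQuot J x y a' * nodeQuot J y x b) / ((y b - x a') * (d a' * e b))) =
      d a / d a' * nodeQuot J x y a' * ∑ b : Fin J,
        nodeQuot J y x b / ((y b - x a') * (x a - y b)) := by
    rw [Finset.mul_sum]
    refine Finset.sum_congr rfl fun b _ => ?_
    have e1 : y b - x a ≠ 0 := sub_ne_zero.2 (hxy a a.2 b b.2).symm
    have e2 : y b - x a' ≠ 0 := sub_ne_zero.2 (hxy a' a'.2 b b.2).symm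
    have e3 := hd a' a'.2
    have e4 := he b b.2
    rw [← neg_sub (y b : ℝ) (x a), mul_neg, div_neg]
    field_simp
  rw [h2, h1]
  by_cases haa : a = a'
  · subst haa
    rw [Matrix.one_apply_eq, div_self (hd a a.2), one_mul, nodeQuot]
    have e1 := prod_erase_ne_zero hx a.2
    have e2 : ∏ k ∈ Finset.range J, (x a - y k) ≠ 0 :=
      Finset.prod_ne_zero_iff.2 fun k hk => sub_ne_zero.2 (hxy a a.2 k (Finset.mem_range.1 hk))
    field_simp
  · have e1 : ∏ k ∈ (Finset.range J).erase (a' : ℕ), (x a - x k) = 0 :=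
      Finset.prod_eq_zero (i := (a : ℕ)) (Finset.mem_erase.2
        ⟨fun h => haa (Fin.ext h), Finset.mem_range.2 a.2⟩) (sub_self _)
    rw [Matrix.one_apply_ne haa, e1, zero_div, mul_zero]

/-- The even indices below `N + N % 2`, followed by the odd ones. -/
noncomputable def parityEquiv (N : ℕ) :
    Fin ((N + 1) / 2) ⊕ Fin ((N + 1) / 2) ≃ Fin (N + N % 2) :=
  Equiv.ofBijective
    (Sum.elim (fun a => ⟨2 * a, by omega⟩) (fun b => ⟨2 * b + 1, by omega⟩)) (by
      constructor
      · rintro (a | a) (b | b) h <;> simp only [Sum.elim_inl, Sum.elim_inr, Fin.mk.injEq] at h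
        · congr 1; exact Fin.ext (by omega)
        · omega
        · omega
        · congr 1; exact Fin.ext (by omega)
      · intro i
        rcases Nat.even_or_odd' (i : ℕ) with ⟨k, hk | hk⟩
        · exact ⟨Sum.inl ⟨k, by omega⟩, Fin.ext hk.symm⟩
        · exact ⟨Sum.inr ⟨k, by omega⟩, Fin.ext hk.symm⟩)

@[simp] theorem parityEquiv_inl (N : ℕ) (a : Fin ((N + 1) / 2)) :
    (parityEquiv N (Sum.inl a) : ℕ) = 2 * a := rfl

@[simp] theorem parityEquiv_inr (N : ℕ) (a : Fin ((N + 1) / 2)) :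
    (parityEquiv N (Sum.inr a) : ℕ) = 2 * a + 1 := rfl

/-- The nodes attached to the even indices. -/
noncomputable def evenNode (a : ℕ) : ℝ := 2 * a

/-- The nodes attached to the odd indices, including the border. -/
noncomputable def oddNode (N : ℕ) (s : ℝ) (b : ℕ) : ℝ := if 2 * b + 1 < N then 2 * b + 1 else s - 1

/-- The row factors of the Gram matrix. -/
noncomputable def rowFactor (s : ℝ) (a : ℕ) : ℝ := 4 * s / (2 * a + 1)

/-- The column factors of the Gram matrix. -/
noncomputable def colFactor (N : ℕ) (s : ℝ) (b : ℕ) : ℝ :=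
  if 2 * b + 1 < N then 1 / (s - 2 * b - 2) else 1 / 2

/-- The even-odd block of the Gram matrix. -/
noncomputable def gramBlock (N : ℕ) (s : ℝ) : Matrix (Fin ((N + 1) / 2)) (Fin ((N + 1) / 2)) ℝ :=
  cauchy ((N + 1) / 2) evenNode (oddNode N s) (rowFactor s) (colFactor N s)

/-- The entries of the inverse of `gramBlock`. -/
noncomputable def invEntry (N : ℕ) (s : ℝ) (b a : ℕ) : ℝ :=
  cauchyInvEntry ((N + 1) / 2) evenNode (oddNode N s) (rowFactor s) (colFactor N s) b a

/-- The inverse of `gramBlock`. -/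
noncomputable def gramBlockInv (N : ℕ) (s : ℝ) :
    Matrix (Fin ((N + 1) / 2)) (Fin ((N + 1) / 2)) ℝ :=
  Matrix.of fun b a => invEntry N s b a

theorem evenNode_injOn (J : ℕ) : Set.InjOn evenNode (Finset.range J) := by
  intro a _ b _ h
  simp only [evenNode] at h
  have : (a : ℝ) = b := by linarith
  exact_mod_cast this

theorem oddNode_injOn {N : ℕ} {s : ℝ} (hs : (N : ℝ) < s) :
    Set.InjOn (oddNode N s) (Finset.range ((N + 1) / 2)) := by
  intro a ha b hb h
  have ha : a < (N + 1) / 2 := by simpa using ha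
  have hb : b < (N + 1) / 2 := by simpa using hb
  simp only [oddNode] at h
  split_ifs at h with h1 h2 h2
  · have : (a : ℝ) = b := by linarith
    exact_mod_cast this
  · have : (2 * a + 1 : ℝ) + 1 ≤ N := by exact_mod_cast h1
    linarith
  · have : (2 * b + 1 : ℝ) + 1 ≤ N := by exact_mod_cast h2
    linarith
  · omega

theorem evenNode_ne_oddNode {N : ℕ} {s : ℝ} (hs : (N : ℝ) < s) :
    ∀ a < (N + 1) / 2, ∀ b < (N + 1) / 2, evenNode a ≠ oddNode N s b := by
  intro a ha b _ h
  simp only [evenNode, oddNode] at h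
  split_ifs at h with h1
  · have : 2 * a = 2 * b + 1 := by exact_mod_cast h
    omega
  · have : (2 * a : ℝ) + 1 ≤ N := by
      have : 2 * a + 1 ≤ N := by omega
      exact_mod_cast this
    linarith

theorem rowFactor_ne_zero {s : ℝ} (hs : 0 < s) (a : ℕ) : rowFactor s a ≠ 0 :=
  (div_pos (by linarith) (by positivity)).ne'

theorem colFactor_ne_zero {N : ℕ} {s : ℝ} (hs : (N : ℝ) < s) (b : ℕ) : colFactor N s b ≠ 0 := by
  rw [colFactor]
  split_ifs with h
  · have : (2 * b + 1 : ℝ) + 1 ≤ N := by exact_mod_cast h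
    exact one_div_ne_zero (by linarith)
  · norm_num

theorem gramBlock_mul_inv {N : ℕ} {s : ℝ} (hs : (N : ℝ) < s) :
    gramBlock N s * gramBlockInv N s = 1 :=
  cauchy_mul_inv (J := (N + 1) / 2) (evenNode_injOn _) (oddNode_injOn hs) (evenNode_ne_oddNode hs)
    (fun a _ => rowFactor_ne_zero (lt_of_le_of_lt (Nat.cast_nonneg N) hs) a)
    (fun b _ => colFactor_ne_zero hs b)

theorem gram_of_lt {N : ℕ} (s : ℝ) {i j : Fin (N + N % 2)} {m n : ℕ} (hi : (i : ℕ) = m)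
    (hj : (j : ℕ) = n) (hm : m < N) (hn : n < N) :
    gram N s i j = skewForm s (fun z => z ^ m) (fun z => z ^ n) := by
  subst hi hj
  rw [gram, Matrix.of_apply, if_pos hm, if_pos hn]

theorem gram_of_lt_of_le {N : ℕ} (s : ℝ) {i j : Fin (N + N % 2)} {m : ℕ} (hi : (i : ℕ) = m)
    (hm : m < N) (hj : N ≤ j) : gram N s i j = lineMom s m := by
  subst hi
  rw [gram, Matrix.of_apply, if_pos hm, if_neg hj.not_gt, lineMom]

theorem gram_of_le_of_lt {N : ℕ} (s : ℝ) {i j : Fin (N + N % 2)} {n : ℕ} (hi : N ≤ i)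
    (hj : (j : ℕ) = n) (hn : n < N) : gram N s i j = -lineMom s n := by
  subst hj
  rw [gram, Matrix.of_apply, if_neg hi.not_gt, if_pos hn, lineMom]

theorem gram_of_le {N : ℕ} (s : ℝ) {i j : Fin (N + N % 2)} (hi : N ≤ i) (hj : N ≤ j) :
    gram N s i j = 0 := by
  rw [gram, Matrix.of_apply, if_neg hi.not_gt, if_neg hj.not_gt]

/-- Entries of equal parity vanish by symmetry. For odd N the border index N is itself odd, so it
joins the odd half, and σ_n = 0 for odd n is what makes it fit there. -/
theorem gram_submatrix {N : ℕ} {s : ℝ} (hs : (N : ℝ) < s) :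
    (gram N s).submatrix (parityEquiv N) (parityEquiv N) =
      Matrix.fromBlocks 0 ((gramBlock N s).map Complex.ofReal)
        (-((gramBlock N s).map Complex.ofReal).transpose) 0 := by
  have hlt : ∀ m : ℕ, m < N → (m : ℝ) + 1 < s := fun m hm => by
    have : (m : ℝ) + 1 ≤ N := by exact_mod_cast hm
    linarith
  have key : ∀ a b : Fin ((N + 1) / 2), gram N s (parityEquiv N (Sum.inl a))
      (parityEquiv N (Sum.inr b)) = ((gramBlock N s a b : ℝ) : ℂ) := by
    intro a b
    have ha : 2 * (a : ℕ) < N := by omega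
    have e : gramBlock N s a b = rowFactor s a * colFactor N s b / (oddNode N s b - evenNode a) := rfl
    rw [e]
    by_cases hb : 2 * (b : ℕ) + 1 < N
    · rw [gram_of_lt s (parityEquiv_inl N a) (parityEquiv_inr N b) ha hb,
        skewForm_even_odd (hlt _ ha) (hlt _ hb) (even_two_mul _) ⟨_, rfl⟩, oddNode, colFactor,
        if_pos hb, if_pos hb, rowFactor, evenNode]
      congr 1
      push_cast
      rw [show s - (2 * (b : ℕ) + 1) - 1 = s - 2 * (b : ℕ) - 2 by ring]
      have h1 : s - 2 * ((b : ℕ) : ℝ) - 2 ≠ 0 := by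
        have := hlt _ hb; push_cast at this; linarith
      have h2 : (2 * (b : ℕ) + 1 : ℝ) - 2 * (a : ℕ) ≠ 0 := by
        intro h
        have : 2 * (b : ℕ) + 1 = 2 * (a : ℕ) := by exact_mod_cast sub_eq_zero.1 h
        omega
      field_simp
    -- The border column: 2s/((2a+1)(s-2a-1)) is the Cauchy entry at the node s-1 with column factor
    -- 1/2.
    · rw [gram_of_lt_of_le s (parityEquiv_inl N a) ha
        (by rw [parityEquiv_inr]; exact not_lt.1 hb), lineMom_even (hlt _ ha) (even_two_mul (a : ℕ)),
        oddNode, colFactor, if_neg hb, if_neg hb, rowFactor, evenNode]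
      congr 1
      push_cast
      have h1 : s - 1 - 2 * ((a : ℕ) : ℝ) ≠ 0 := by
        have := hlt _ ha; push_cast at this; linarith
      rw [show s - 2 * ((a : ℕ) : ℝ) - 1 = s - 1 - 2 * ((a : ℕ) : ℝ) by ring]
      field_simp
      ring
  have anti : ∀ i j : Fin (N + N % 2), gram N s i j = -gram N s j i := by
    intro i j
    rcases lt_or_ge (i : ℕ) N with h1 | h1 <;> rcases lt_or_ge (j : ℕ) N with h2 | h2
    · rw [gram_of_lt s rfl rfl h1 h2, gram_of_lt s rfl rfl h2 h1]
      exact skewForm_swap (hlt _ h1) (hlt _ h2)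
    · rw [gram_of_lt_of_le s rfl h1 h2, gram_of_le_of_lt s h2 rfl h1, neg_neg]
    · rw [gram_of_lt_of_le s rfl h2 h1, gram_of_le_of_lt s h1 rfl h2]
    · rw [gram_of_le s h1 h2, gram_of_le s h2 h1, neg_zero]
  ext i j
  rcases i with a | a <;> rcases j with b | b
  · simp only [Matrix.submatrix_apply, Matrix.fromBlocks_apply₁₁, Matrix.zero_apply]
    rw [gram_of_lt s (parityEquiv_inl N a) (parityEquiv_inl N b) (by omega) (by omega),
      skewForm_same (hlt _ (by omega)) (hlt _ (by omega)) ((even_two_mul _).add (even_two_mul _))]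
  · simp only [Matrix.submatrix_apply, Matrix.fromBlocks_apply₁₂, Matrix.map_apply, key]
  · simp only [Matrix.submatrix_apply, Matrix.fromBlocks_apply₂₁, Matrix.neg_apply,
      Matrix.transpose_apply, Matrix.map_apply, ← key]
    exact anti _ _
  · simp only [Matrix.submatrix_apply, Matrix.fromBlocks_apply₂₂, Matrix.zero_apply]
    have hodd : Odd (2 * (a : ℕ) + 1) := ⟨_, rfl⟩
    have hodd' : Odd (2 * (b : ℕ) + 1) := ⟨_, rfl⟩
    rcases lt_or_ge (2 * (a : ℕ) + 1) N with h1 | h1 <;>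
      rcases lt_or_ge (2 * (b : ℕ) + 1) N with h2 | h2
    · rw [gram_of_lt s (parityEquiv_inr N a) (parityEquiv_inr N b) h1 h2]
      exact skewForm_same (hlt _ h1) (hlt _ h2) (hodd.add_odd hodd')
    · rw [gram_of_lt_of_le s (parityEquiv_inr N a) h1 h2]
      exact lineMom_odd (hlt _ h1) hodd
    · rw [gram_of_le_of_lt s h1 (parityEquiv_inr N b) h2, neg_eq_zero]
      exact lineMom_odd (hlt _ h2) hodd'
    · exact gram_of_le s h1 h2

/-- The inverse of the Gram matrix, in block form. -/
noncomputable def gramInv (N : ℕ) (s : ℝ) : Matrix (Fin (N + N % 2)) (Fin (N + N % 2)) ℂ :=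
  (Matrix.fromBlocks 0 (-((gramBlockInv N s).map Complex.ofReal).transpose)
    ((gramBlockInv N s).map Complex.ofReal) 0).submatrix
      (parityEquiv N).symm (parityEquiv N).symm

theorem gram_mul_gramInv {N : ℕ} {s : ℝ} (hs : (N : ℝ) < s) : gram N s * gramInv N s = 1 := by
  have h1 := gramBlock_mul_inv hs
  set C := gramBlock N s
  set W := gramBlockInv N s with hW
  have e1 : C.map Complex.ofReal * W.map Complex.ofReal = 1 := by
    change C.map Complex.ofRealHom * W.map Complex.ofRealHom = 1
    rw [← Matrix.map_mul, h1]
    exact Matrix.map_one _ (map_zero _) (map_one _)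
  have e2 : W.map Complex.ofReal * C.map Complex.ofReal = 1 := mul_eq_one_comm.1 e1
  have hg : gram N s = ((gram N s).submatrix (parityEquiv N) (parityEquiv N)).submatrix
      (parityEquiv N).symm (parityEquiv N).symm := by
    rw [Matrix.submatrix_submatrix]; simp
  rw [hg, gram_submatrix hs, gramInv, Matrix.submatrix_mul_equiv, Matrix.fromBlocks_multiply]
  simp only [Matrix.zero_mul, Matrix.mul_zero, zero_add, add_zero, Matrix.neg_mul, Matrix.mul_neg,
    neg_neg]
  rw [← Matrix.transpose_mul, ← hW, e1, e2, Matrix.transpose_one, neg_zero, Matrix.fromBlocks_one,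
    Matrix.submatrix_one_equiv]

theorem gram_inv {N : ℕ} {s : ℝ} (hs : (N : ℝ) < s) : (gram N s)⁻¹ = gramInv N s :=
  Matrix.inv_eq_right_inv (gram_mul_gramInv hs)

theorem kernelSum_eq {N : ℕ} {s : ℝ} (hs : (N : ℝ) < s) {f g : Fin (N + N % 2) → ℂ → ℂ}
    {u v : ℂ} {F G : ℕ → ℂ} (hF : ∀ i, f i u = F i) (hG : ∀ i, g i v = G i) :
    kernelSum N s f g u v = 2 * ∑ a ∈ Finset.range ((N + 1) / 2),
      ∑ b ∈ Finset.range ((N + 1) / 2), (invEntry N s b a : ℂ) *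
        (F (2 * a) * G (2 * b + 1) - F (2 * b + 1) * G (2 * a)) := by
  simp only [kernelSum, gram_inv hs, hF, hG, gramInv, Matrix.submatrix_apply]
  rw [← Equiv.sum_comp (parityEquiv N)]
  simp only [Equiv.symm_apply_apply]
  have h : ∀ i : Fin ((N + 1) / 2) ⊕ Fin ((N + 1) / 2), ∀ M : Matrix
      (Fin ((N + 1) / 2) ⊕ Fin ((N + 1) / 2)) (Fin ((N + 1) / 2) ⊕ Fin ((N + 1) / 2)) ℂ,
      ∑ j, M i ((parityEquiv N).symm j) * F (parityEquiv N i) * G j =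
      ∑ j, M i j * F (parityEquiv N i) * G (parityEquiv N j) := by
    intro i M
    rw [← Equiv.sum_comp (parityEquiv N)]
    simp only [Equiv.symm_apply_apply]
  simp only [h, Fintype.sum_sum_type, parityEquiv_inl, parityEquiv_inr, Matrix.fromBlocks_apply₁₁,
    Matrix.fromBlocks_apply₁₂, Matrix.fromBlocks_apply₂₁, Matrix.fromBlocks_apply₂₂,
    Matrix.zero_apply, zero_mul, Finset.sum_const_zero, zero_add, add_zero, Matrix.neg_apply,
    Matrix.transpose_apply, Matrix.map_apply, gramBlockInv, Matrix.of_apply]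
  rw [Finset.sum_range]
  simp only [Finset.sum_range]
  rw [Finset.sum_comm (f := fun (x i : Fin ((N + 1) / 2)) => ((invEntry N s x i : ℝ) : ℂ) *
    F (2 * x + 1) * G (2 * i)), ← Finset.sum_add_distrib, Finset.mul_sum, Finset.mul_sum]
  refine Finset.sum_congr rfl fun a _ => ?_
  rw [← Finset.sum_add_distrib, Finset.mul_sum, Finset.mul_sum]
  refine Finset.sum_congr rfl fun b _ => ?_
  ring

/- ## Closed forms for the inverse Gram matrix -/

theorem prod_erase_range_add {f : ℕ → ℝ} (a m : ℕ) :
    ∏ k ∈ (Finset.range (a + 1 + m)).erase a, f k =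
      (∏ i ∈ Finset.range a, f (a - 1 - i)) * ∏ i ∈ Finset.range m, f (a + 1 + i) := by
  have h1 : ∏ k ∈ (Finset.range (a + 1 + m)).erase a, f k =
      ∏ k ∈ (Finset.range (a + 1 + m)).erase a, if k = a then 1 else f k :=
    Finset.prod_congr rfl fun k hk => by rw [if_neg (Finset.mem_erase.1 hk).1]
  rw [h1, Finset.prod_erase (f := fun k => if k = a then 1 else f k) _ (if_pos rfl), Finset.prod_range_add, Finset.prod_range_succ,
    if_pos rfl, mul_one, Finset.prod_range_reflect f a]
  congr 1
  · exact Finset.prod_congr rfl fun k hk => by rw [if_neg (Finset.mem_range.1 hk).ne]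
  · exact Finset.prod_congr rfl fun k _ => by rw [if_neg (by omega)]

/-- Ordering the nodes by their distance from a makes the factors on either side odd integers over
even integers, which are those of the normalised Pochhammer symbols. -/
theorem nodeQuot_eq (v z : ℕ → ℝ) (a m : ℕ) :
    nodeQuot (a + 1 + m) v z a = (v a - z a) *
      (∏ i ∈ Finset.range a, (v a - z (a - 1 - i)) / (v a - v (a - 1 - i))) *
      ∏ i ∈ Finset.range m, (v a - z (a + 1 + i)) / (v a - v (a + 1 + i)) := by
  rw [nodeQuot, prod_erase_range_add (f := fun k => v a - v k), Finset.prod_range_add,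
    Finset.prod_range_succ, ← Finset.prod_range_reflect (fun k => v a - z k) a,
    Finset.prod_div_distrib, Finset.prod_div_distrib]
  rw [mul_div_mul_comm, mul_div_right_comm]
  ring

/-- The normalised Pochhammer symbols `(3/2)_n / n!`. -/
noncomputable def pochP (n : ℕ) : ℝ := ∏ i ∈ Finset.range n, ((2 * i + 3 : ℝ) / (2 * i + 2))

/-- The normalised Pochhammer symbols `(1/2)_n / n!`. -/
noncomputable def pochQ (n : ℕ) : ℝ := ∏ i ∈ Finset.range n, ((2 * i + 1 : ℝ) / (2 * i + 2))

/-- The products `∏ (c + 2 j) / (c + 2 j + 1)`. -/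
noncomputable def ratioProd (J : ℕ) (c : ℝ) : ℝ :=
  ∏ j ∈ Finset.range J, ((c + 2 * j) / (c + 2 * j + 1))

theorem pochQ_succ (n : ℕ) : pochQ (n + 1) = pochQ n * ((2 * n + 1) / (2 * n + 2)) :=
  Finset.prod_range_succ _ _

theorem pochP_eq (n : ℕ) : pochP n = (2 * n + 1) * pochQ n := by
  induction n with
  | zero => simp [pochP, pochQ]
  | succ n ih =>
    rw [pochP, Finset.prod_range_succ, ← pochP, ih, pochQ_succ]
    push_cast
    field_simp
    ring

theorem pochP_pos (n : ℕ) : 0 < pochP n := Finset.prod_pos fun i _ => by positivity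

theorem pochQ_pos (n : ℕ) : 0 < pochQ n := Finset.prod_pos fun i _ => by positivity

theorem cast_pred_sub {a i : ℕ} (h : i < a) : ((a - 1 - i : ℕ) : ℝ) = a - 1 - i := by
  rw [Nat.cast_sub (by omega), Nat.cast_sub (by omega)]; simp

theorem prod_evenNode_low {N : ℕ} {s : ℝ} {a : ℕ} (ha : 2 * a ≤ N) :
    ∏ i ∈ Finset.range a, (evenNode a - oddNode N s (a - 1 - i)) /
      (evenNode a - evenNode (a - 1 - i)) = pochQ a := by
  refine Finset.prod_congr rfl fun i hi => ?_
  have hi := Finset.mem_range.1 hi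
  rw [oddNode, if_pos (by omega), evenNode, evenNode, cast_pred_sub hi]
  congr 1 <;> ring

theorem prod_oddNode_low {N : ℕ} {s : ℝ} {b : ℕ} (hb : 2 * b + 1 < N) :
    ∏ i ∈ Finset.range b, (oddNode N s b - evenNode (b - 1 - i)) /
      (oddNode N s b - oddNode N s (b - 1 - i)) = pochP b := by
  refine Finset.prod_congr rfl fun i hi => ?_
  have hi := Finset.mem_range.1 hi
  rw [oddNode, oddNode, if_pos (by omega), if_pos (by omega), evenNode, cast_pred_sub hi]
  congr 1 <;> ring

theorem prod_evenNode_high {N : ℕ} {s : ℝ} {a m : ℕ} (h : 2 * (a + m) + 1 < N) :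
    ∏ i ∈ Finset.range m, (evenNode a - oddNode N s (a + 1 + i)) /
      (evenNode a - evenNode (a + 1 + i)) = pochP m := by
  refine Finset.prod_congr rfl fun i hi => ?_
  have hi := Finset.mem_range.1 hi
  rw [oddNode, if_pos (by omega), evenNode, evenNode, ← neg_div_neg_eq]
  push_cast
  congr 1 <;> ring

theorem prod_oddNode_high {N : ℕ} {s : ℝ} {b m : ℕ} (h : 2 * (b + m) + 1 < N) :
    ∏ i ∈ Finset.range m, (oddNode N s b - evenNode (b + 1 + i)) /
      (oddNode N s b - oddNode N s (b + 1 + i)) = pochQ m := by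
  refine Finset.prod_congr rfl fun i hi => ?_
  have hi := Finset.mem_range.1 hi
  rw [oddNode, oddNode, if_pos (by omega), if_pos (by omega), evenNode, ← neg_div_neg_eq]
  push_cast
  congr 1 <;> ring

theorem nodeQuot_even_even {N : ℕ} {s : ℝ} {a m : ℕ} (h : N = 2 * (a + 1 + m)) :
    nodeQuot (a + 1 + m) evenNode (oddNode N s) a = -(pochQ a * pochP m) := by
  rw [nodeQuot_eq, prod_evenNode_low (by omega), prod_evenNode_high (by omega), oddNode,
    if_pos (by omega), evenNode]
  ring

theorem nodeQuot_even_odd {N : ℕ} {s : ℝ} {b m : ℕ} (h : N = 2 * (b + 1 + m)) :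
    nodeQuot (b + 1 + m) (oddNode N s) evenNode b = pochP b * pochQ m := by
  rw [nodeQuot_eq, prod_oddNode_low (by omega), prod_oddNode_high (by omega), oddNode,
    if_pos (by omega), evenNode]
  ring

theorem nodeQuot_odd_even {N : ℕ} {s : ℝ} {a m : ℕ} (h : N = 2 * (a + m) + 1) :
    nodeQuot (a + 1 + m) evenNode (oddNode N s) a = -(pochQ a * pochQ m * (s - 1 - 2 * a)) := by
  rw [nodeQuot_eq, prod_evenNode_low (by omega)]
  rcases m with _ | m
  · rw [oddNode, if_neg (by omega), evenNode]
    simp only [Finset.range_zero, Finset.prod_empty, pochQ]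
    ring
  -- The topmost odd node is the border node s-1. It contributes (s-1-2a)/(2m+2), and P(m)/(2m+2) =
  -- Q(m+1).
  · rw [Finset.prod_range_succ, prod_evenNode_high (by omega), oddNode, oddNode, if_pos (by omega),
      if_neg (by omega), evenNode, evenNode, pochQ_succ, pochP_eq]
    push_cast
    rw [show (2 * a - 2 * (a + 1 + m) : ℝ) = -(2 * m + 2) by ring, div_neg]
    field_simp
    ring

theorem nodeQuot_odd_odd {N : ℕ} {s : ℝ} {b m : ℕ} (h : N = 2 * (b + 1 + m) + 1) :
    nodeQuot (b + 1 + (m + 1)) (oddNode N s) evenNode b = pochP b * pochP m / (s - 2 * b - 2) := by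
  rw [nodeQuot_eq, prod_oddNode_low (by omega), Finset.prod_range_succ,
    prod_oddNode_high (by omega), oddNode, oddNode, if_pos (by omega),
      if_neg (by omega), evenNode, evenNode, pochP_eq m]
  push_cast
  rw [show (2 * b + 1 - (s - 1) : ℝ) = -(s - 2 * b - 2) by ring, div_neg,
    show (2 * b + 1 - 2 * (b + 1 + m) : ℝ) = -(2 * m + 1) by ring]
  ring

/-- Numerators and denominators of the two products are shifted against each other, so their
quotient telescopes. -/
theorem ratioProd_shift (J : ℕ) (c : ℝ) :
    c * ∏ i ∈ Finset.range J, ((c + 2 * i + 2) / (c + 2 * i + 1)) =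
      ratioProd J c * (c + 2 * J) := by
  induction J with
  | zero => simp [ratioProd]
  | succ J ih =>
    rw [Finset.prod_range_succ, ← mul_assoc, ih, ratioProd, ratioProd, Finset.prod_range_succ]
    push_cast
    ring

theorem nodeQuot_odd_border {N J : ℕ} {s : ℝ} (h : N = 2 * J + 1) :
    nodeQuot (J + 1) (oddNode N s) evenNode J = ratioProd J (s - N) * (s - 1) := by
  have := nodeQuot_eq (oddNode N s) evenNode J 0
  rw [add_zero] at this
  rw [this, Finset.range_zero, Finset.prod_empty, mul_one, oddNode, if_neg (by omega), evenNode]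
  have hN : (N : ℝ) = 2 * J + 1 := by rw [h]; push_cast; ring
  have e : (s - 1 - 2 * J : ℝ) = s - N := by rw [hN]; ring
  rw [e, show s - 1 = s - N + 2 * J by rw [hN]; ring, ← ratioProd_shift]
  congr 1
  refine Finset.prod_congr rfl fun i hi => ?_
  have hi := Finset.mem_range.1 hi
  rw [oddNode, if_pos (by omega), evenNode, cast_pred_sub hi]
  congr 1 <;> ring

/-- The coefficients of the bilinear part of the kernel. -/
noncomputable def bilCoeff (N : ℕ) (s : ℝ) (j k : ℕ) : ℝ :=
  pochP ((N - 2 - 2 * j) / 2) * pochP ((N - 1 - 2 * k) / 2) * (s - N + 2 * k) * pochP j * pochQ k /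
    (2 * s * (2 * j - 2 * k + 1))

/-- The coefficients of the linear part of the kernel. -/
noncomputable def linCoeff (N : ℕ) (s : ℝ) (k : ℕ) : ℝ :=
  (if Even N then 1 / 2 else (s - 1) / (2 * s)) * ratioProd (N / 2) (s - N) *
    (pochP ((N - 1 - 2 * k) / 2) * pochQ k)

theorem two_sub_ne (j k : ℕ) : (2 * j - 2 * k + 1 : ℝ) ≠ 0 := by
  intro h
  have : 2 * j + 1 = 2 * k := by
    have : (2 * j + 1 : ℝ) = 2 * k := by linarith
    exact_mod_cast this
  omega

/-- Indices are counted down from the largest exponents, as these are the ones with a limit: s-N+2k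
and the Pochhammer symbols at j and k do not grow with N. -/
theorem invEntry_even {N J : ℕ} {s : ℝ} (h : N = 2 * J) (hs : (N : ℝ) < s) {j k : ℕ} (hj : j < J)
    (hk : k < J) : 2 * invEntry N s (J - 1 - k) (J - 1 - j) = bilCoeff N s j k := by
  obtain ⟨a, rfl⟩ : ∃ a, J = a + 1 + j := ⟨J - 1 - j, by omega⟩
  obtain ⟨b, hb⟩ : ∃ b, a + 1 + j = b + 1 + k := ⟨a + 1 + j - 1 - k, by omega⟩
  have hN2 : (N + 1) / 2 = a + 1 + j := by omega
  rw [show a + 1 + j - 1 - k = b by omega, show a + 1 + j - 1 - j = a by omega, invEntry,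
    cauchyInvEntry, hN2, nodeQuot_even_even h, hb, nodeQuot_even_odd (by omega), bilCoeff,
    show (N - 2 - 2 * j) / 2 = a by omega, show (N - 1 - 2 * k) / 2 = b by omega, oddNode,
    if_pos (by omega), colFactor, if_pos (by omega), rowFactor, evenNode, pochP_eq a]
  have hN : (N : ℝ) = 2 * (b + 1 + k) := by rw [h, hb]; push_cast; ring
  have hab : (a : ℝ) = b + k - j := by
    have : (a : ℝ) + 1 + j = b + 1 + k := by exact_mod_cast hb
    linarith
  have h1 := two_sub_ne j k
  have h0 : s ≠ 0 := (lt_of_le_of_lt (Nat.cast_nonneg N) hs).ne'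
  have hbp : (0 : ℝ) ≤ k := Nat.cast_nonneg k
  have h2 : s - 2 * b - 2 ≠ 0 := by linarith
  have e : s - N + 2 * k = s - 2 * b - 2 := by rw [hN]; ring
  have e2 : (2 * b + 1 - 2 * a : ℝ) = 2 * j - 2 * k + 1 := by rw [hab]; ring
  rw [e, e2]
  field_simp
  ring

/-- For odd N the top exponent N-1 is even, so k now runs through the even exponents and j through
the odd ones. The exchange of roles costs a sign, which the antisymmetry of `bilForm` absorbs. -/
theorem invEntry_odd {N J : ℕ} {s : ℝ} (h : N = 2 * J + 1) (hs : (N : ℝ) < s) {j k : ℕ} (hj : j < J)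
    (hk : k < J + 1) : 2 * invEntry N s (J - 1 - j) (J - k) = -bilCoeff N s j k := by
  obtain ⟨b, rfl⟩ : ∃ b, J = b + 1 + j := ⟨J - 1 - j, by omega⟩
  obtain ⟨a, ha⟩ : ∃ a, b + 1 + j = a + k := ⟨b + 1 + j - k, by omega⟩
  have hN2 : (N + 1) / 2 = b + 1 + (j + 1) := by omega
  have hN3 : b + 1 + (j + 1) = a + 1 + k := by omega
  rw [show b + 1 + j - k = a by omega, show b + 1 + j - 1 - j = b by omega, invEntry,
    cauchyInvEntry, hN2, nodeQuot_odd_odd h, hN3, nodeQuot_odd_even (by omega), bilCoeff,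
    show (N - 2 - 2 * j) / 2 = b by omega, show (N - 1 - 2 * k) / 2 = a by omega, oddNode,
    if_pos (by omega), colFactor, if_pos (by omega), rowFactor, evenNode, pochP_eq a]
  have hN : (N : ℝ) = 2 * (a + k) + 1 := by rw [h, ha]; push_cast; ring
  have hab : (a : ℝ) = b + 1 + j - k := by
    have : (b : ℝ) + 1 + j = a + k := by exact_mod_cast ha
    linarith
  have h1 := two_sub_ne j k
  have h0 : s ≠ 0 := (lt_of_le_of_lt (Nat.cast_nonneg N) hs).ne'
  have hjp : (0 : ℝ) ≤ j := Nat.cast_nonneg j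
  have h2 : s - 2 * b - 2 ≠ 0 := by
    have : (N : ℝ) = 2 * (b + 1 + j) + 1 := by rw [h]; push_cast; ring
    linarith
  have e : s - N + 2 * k = s - 1 - 2 * a := by rw [hN]; ring
  have e2 : (2 * b + 1 - 2 * a : ℝ) = -(2 * j - 2 * k + 1) := by rw [hab]; ring
  rw [e, e2]
  field_simp
  ring

/-- The row of the inverse belonging to the border node. Here j is absent, so only a linear form in
the monomials remains. -/
theorem invEntry_border {N J : ℕ} {s : ℝ} (h : N = 2 * J + 1) (hs : (N : ℝ) < s) {k : ℕ}
    (hk : k < J + 1) : invEntry N s J (J - k) = linCoeff N s k := by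
  obtain ⟨a, rfl⟩ : ∃ a, J = a + k := ⟨J - k, by omega⟩
  have hN2 : (N + 1) / 2 = a + k + 1 := by omega
  rw [show a + k - k = a by omega, invEntry, cauchyInvEntry, hN2,
    nodeQuot_odd_border h, show a + k + 1 = a + 1 + k by omega, nodeQuot_odd_even h, linCoeff,
    show (N - 1 - 2 * k) / 2 = a by omega, show N / 2 = a + k by omega, oddNode,
    if_neg (by omega), colFactor, if_neg (by omega), rowFactor, evenNode, pochP_eq a,
    if_neg (by rw [h]; simp)]
  have hN : (N : ℝ) = 2 * (a + k) + 1 := by rw [h]; push_cast; ring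
  have h0 : s ≠ 0 := (lt_of_le_of_lt (Nat.cast_nonneg N) hs).ne'
  have hkp : (0 : ℝ) ≤ k := Nat.cast_nonneg k
  have h2 : s - 1 - 2 * a ≠ 0 := by linarith
  field_simp
  ring

/- ## The kernel as a bilinear form and a linear form -/

/-- The bilinear part of the kernel. -/
noncomputable def bilForm (N : ℕ) (s : ℝ) (F G : ℕ → ℂ) : ℂ :=
  ∑ j ∈ Finset.range (N / 2), ∑ k ∈ Finset.range ((N + 1) / 2), (bilCoeff N s j k : ℂ) *
    (F (N - 2 - 2 * j) * G (N - 1 - 2 * k) - F (N - 1 - 2 * k) * G (N - 2 - 2 * j))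

/-- The linear part of the kernel. -/
noncomputable def linForm (N : ℕ) (s : ℝ) (F : ℕ → ℂ) : ℂ :=
  ∑ k ∈ Finset.range ((N + 1) / 2), (linCoeff N s k : ℂ) * F (N - 1 - 2 * k)

theorem kernelSum_even {N : ℕ} {s : ℝ} (hN : Even N) (hs : (N : ℝ) < s)
    {f g : Fin (N + N % 2) → ℂ → ℂ}
    {u v : ℂ} {F G : ℕ → ℂ} (hF : ∀ i, f i u = F i) (hG : ∀ i, g i v = G i) :
    kernelSum N s f g u v = bilForm N s F G := by
  obtain ⟨J, hJ⟩ := hN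
  have hJ : N = 2 * J := by omega
  rw [kernelSum_eq hs hF hG, bilForm, show (N + 1) / 2 = J by omega, show N / 2 = J by omega,
    ← Finset.sum_range_reflect, Finset.mul_sum]
  refine Finset.sum_congr rfl fun j hj => ?_
  rw [← Finset.sum_range_reflect, Finset.mul_sum]
  refine Finset.sum_congr rfl fun k hk => ?_
  have hj := Finset.mem_range.1 hj
  have hk := Finset.mem_range.1 hk
  rw [← invEntry_even hJ hs hj hk, show 2 * (J - 1 - j) = N - 2 - 2 * j by omega,
    show 2 * (J - 1 - k) + 1 = N - 1 - 2 * k by omega]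
  push_cast; ring

theorem kernelSum_odd {N : ℕ} {s : ℝ} (hN : Odd N) (hs : (N : ℝ) < s)
    {f g : Fin (N + N % 2) → ℂ → ℂ}
    {u v : ℂ} {F G : ℕ → ℂ} (hF : ∀ i, f i u = F i) (hG : ∀ i, g i v = G i) :
    kernelSum N s f g u v =
      bilForm N s F G + 2 * (linForm N s F * G N - F N * linForm N s G) := by
  obtain ⟨J, hJ⟩ := hN
  rw [kernelSum_eq hs hF hG, bilForm, linForm, linForm, show (N + 1) / 2 = J + 1 by omega,
    show N / 2 = J by omega, Finset.sum_comm, Finset.sum_range_succ, mul_add]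
  congr 1
  · rw [← Finset.sum_range_reflect, Finset.mul_sum]
    refine Finset.sum_congr rfl fun j hj => ?_
    rw [← Finset.sum_range_reflect, Finset.mul_sum]
    refine Finset.sum_congr rfl fun k hk => ?_
    have hj := Finset.mem_range.1 hj
    have hk := Finset.mem_range.1 hk
    have := invEntry_odd hJ hs hj hk
    have h2 : bilCoeff N s j k = -(2 * invEntry N s (J - 1 - j) (J - k)) := by rw [this, neg_neg]
    rw [h2, Nat.add_sub_cancel, show 2 * (J - k) = N - 1 - 2 * k by omega,
      show 2 * (J - 1 - j) + 1 = N - 2 - 2 * j by omega]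
    push_cast; ring
  · rw [← Finset.sum_range_reflect, Finset.sum_mul, Finset.mul_sum _ _ (F N),
      ← Finset.sum_sub_distrib]
    congr 1
    refine Finset.sum_congr rfl fun k hk => ?_
    have hk := Finset.mem_range.1 hk
    rw [Nat.add_sub_cancel, invEntry_border hJ hs hk, ← hJ, show 2 * (J - k) = N - 1 - 2 * k by omega]
    ring

theorem bilForm_swap (N : ℕ) (s : ℝ) (F G : ℕ → ℂ) : bilForm N s F G = -bilForm N s G F := by
  rw [bilForm, bilForm, ← Finset.sum_neg_distrib]
  refine Finset.sum_congr rfl fun j _ => ?_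
  rw [← Finset.sum_neg_distrib]
  refine Finset.sum_congr rfl fun k _ => ?_
  ring

theorem bilForm_sub_right (N : ℕ) (s : ℝ) (F G H : ℕ → ℂ) (c : ℂ) :
    bilForm N s F (fun m => G m - c * H m) = bilForm N s F G - c * bilForm N s F H := by
  simp only [bilForm, Finset.mul_sum, ← Finset.sum_sub_distrib]
  refine Finset.sum_congr rfl fun j _ => Finset.sum_congr rfl fun k _ => ?_
  ring

theorem bilForm_sub_left (N : ℕ) (s : ℝ) (F G H : ℕ → ℂ) (c : ℂ) :
    bilForm N s (fun m => F m - c * H m) G = bilForm N s F G - c * bilForm N s H G := by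
  rw [bilForm_swap, bilForm_sub_right, bilForm_swap N s G F, bilForm_swap N s G H]; ring

theorem linForm_sub (N : ℕ) (s : ℝ) (F H : ℕ → ℂ) (c : ℂ) :
    linForm N s (fun m => F m - c * H m) = linForm N s F - c * linForm N s H := by
  simp only [linForm, Finset.mul_sum, ← Finset.sum_sub_distrib]
  refine Finset.sum_congr rfl fun j _ => ?_
  ring

theorem bilForm_congr {N : ℕ} {s : ℝ} {F G F' G' : ℕ → ℂ} (hF : ∀ m < N, F m = F' m)
    (hG : ∀ m < N, G m = G' m) : bilForm N s F G = bilForm N s F' G' := by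
  refine Finset.sum_congr rfl fun j hj => Finset.sum_congr rfl fun k hk => ?_
  have hj := Finset.mem_range.1 hj
  have hk := Finset.mem_range.1 hk
  rw [hF _ (by omega), hF _ (by omega), hG _ (by omega), hG _ (by omega)]

theorem linForm_congr {N : ℕ} {s : ℝ} {F F' : ℕ → ℂ} (hF : ∀ m < N, F m = F' m) :
    linForm N s F = linForm N s F' := by
  refine Finset.sum_congr rfl fun k hk => ?_
  have hk := Finset.mem_range.1 hk
  rw [hF _ (by omega)]

theorem pow_lt_of_lt {N m : ℕ} {s : ℝ} (hs : (N : ℝ) < s) (hm : m < N) : (m : ℝ) + 1 < s := by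
  have : (m : ℝ) + 1 ≤ N := by exact_mod_cast hm
  linarith

/-- For even N the vector of line integrals is a multiple of a Cauchy column at the additional node
t = s-1, so the partial fraction identity evaluates its product with the inverse. The answer agrees
with the border row of odd N up to the prefactor 1/2 against (s-1)/(2s). -/
theorem sum_invEntry_even {N J : ℕ} {s : ℝ} (h : N = 2 * J) (hs : (N : ℝ) < s) {k : ℕ}
    (hk : k < J) :
    ∑ a ∈ Finset.range J, invEntry N s (J - 1 - k) a * (2 * s / ((2 * a + 1) * (s - 2 * a - 1))) =
      linCoeff N s k := by
  obtain ⟨b, rfl⟩ : ∃ b, J = b + 1 + k := ⟨J - 1 - k, by omega⟩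
  have hN : (N : ℝ) = 2 * (b + 1 + k) := by rw [h]; push_cast; ring
  have h0 : s ≠ 0 := (lt_of_le_of_lt (Nat.cast_nonneg N) hs).ne'
  have hN2 : (N + 1) / 2 = b + 1 + k := by omega
  have hy : ∀ i < b + 1 + k, oddNode N s i = 2 * i + 1 := fun i hi => by
    rw [oddNode, if_pos (by omega)]
  have hlt : ∀ i < b + 1 + k, 2 * (i : ℝ) + 2 < s := fun i hi => by
    have : (i : ℝ) + 1 ≤ b + 1 + k := by exact_mod_cast hi
    linarith
  have hxy := evenNode_ne_oddNode hs
  rw [hN2] at hxy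
  rw [show b + 1 + k - 1 - k = b by omega]
  have key := sum_nodeQuot (v := evenNode) (z := oddNode N s) (b := b) (t := s - 1)
    (evenNode_injOn (b + 1 + k)) (by omega)
    (fun a ha => by
      have := hlt a ha
      rw [evenNode]; intro h; linarith)
    (fun a ha => hxy a ha b (by omega))
  have e1 : ∀ a ∈ Finset.range (b + 1 + k),
      invEntry N s b a * (2 * s / ((2 * a + 1) * (s - 2 * a - 1))) =
      (nodeQuot (b + 1 + k) (oddNode N s) evenNode b * ((s - 1) - oddNode N s b) / 2) *
        (nodeQuot (b + 1 + k) evenNode (oddNode N s) a /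
          ((evenNode a - oddNode N s b) * (s - 1 - evenNode a))) := by
    intro a ha
    have ha := Finset.mem_range.1 ha
    have h1 : evenNode a - oddNode N s b ≠ 0 := sub_ne_zero.2 (hxy a ha b (by omega))
    have h2 : s - 1 - evenNode a ≠ 0 := by
      have := hlt a ha
      rw [evenNode]; intro h; linarith
    have h3 : s - 2 * b - 2 ≠ 0 := by
      have := hlt b (by omega)
      linarith
    rw [invEntry, cauchyInvEntry, hN2, rowFactor, colFactor, if_pos (by omega),
      show s - 2 * (a : ℝ) - 1 = s - 1 - evenNode a by rw [evenNode]; ring,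
      show s - 1 - oddNode N s b = s - 2 * b - 2 by rw [hy b (by omega)]; ring,
      show oddNode N s b - evenNode a = -(evenNode a - oddNode N s b) by ring]
    field_simp
    norm_num
  rw [Finset.sum_congr rfl e1, ← Finset.mul_sum, key, nodeQuot_even_odd h, linCoeff,
    if_pos ⟨b + 1 + k, by omega⟩, show (N - 1 - 2 * k) / 2 = b by omega,
    show N / 2 = b + 1 + k by omega]
  have e2 : ((s - 1) - oddNode N s b) * ∏ i ∈ (Finset.range (b + 1 + k)).erase b,
      (s - 1 - oddNode N s i) = ∏ i ∈ Finset.range (b + 1 + k), (s - 1 - oddNode N s i) :=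
    Finset.mul_prod_erase _ (fun i => s - 1 - oddNode N s i) (Finset.mem_range.2 (by omega))
  have e3 : (∏ i ∈ Finset.range (b + 1 + k), (s - 1 - oddNode N s i)) /
      ∏ i ∈ Finset.range (b + 1 + k), (s - 1 - evenNode i) = ratioProd (b + 1 + k) (s - N) := by
    rw [← Finset.prod_div_distrib, ratioProd, ← Finset.prod_range_reflect]
    refine Finset.prod_congr rfl fun i hi => ?_
    have hi := Finset.mem_range.1 hi
    rw [hy _ (by omega), evenNode, cast_pred_sub hi, hN]
    push_cast
    congr 1 <;> ring
  rw [← e3, ← e2]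
  ring

/-- Contracting the inverse Gram matrix with the line integrals produces the linear form. Thus the
constants which ε adds on the real line play for even N the part of the border. -/
theorem bilForm_lineMom_even {N : ℕ} {s : ℝ} (hN : Even N) (hs : (N : ℝ) < s) (F : ℕ → ℂ) :
    bilForm N s F (lineMom s) = -2 * linForm N s F := by
  obtain ⟨J, hJ⟩ := hN
  have hJ : N = 2 * J := by omega
  rw [bilForm, linForm, Finset.sum_comm, Finset.mul_sum]
  refine Finset.sum_congr rfl fun k hk => ?_
  have hk := Finset.mem_range.1 hk
  rw [← sum_invEntry_even hJ hs (show k < J by omega), show N / 2 = J by omega,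
    ← Finset.sum_range_reflect (fun a => invEntry N s (J - 1 - k) a * _)]
  push_cast
  rw [Finset.sum_mul, Finset.mul_sum]
  refine Finset.sum_congr rfl fun j hj => ?_
  have hj := Finset.mem_range.1 hj
  rw [lineMom_odd (pow_lt_of_lt hs (by omega)) (show Odd (N - 1 - 2 * k) from ⟨J - 1 - k, by omega⟩),
    lineMom_even (pow_lt_of_lt hs (by omega)) (show Even (N - 2 - 2 * j) from ⟨J - 1 - j, by omega⟩),
    ← invEntry_even hJ hs hj (by omega), show N - 2 - 2 * j = 2 * (J - 1 - j) by omega]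
  push_cast
  ring

theorem linForm_lineMom_even {N : ℕ} {s : ℝ} (hN : Even N) (hs : (N : ℝ) < s) :
    linForm N s (lineMom s) = 0 := by
  obtain ⟨J, hJ⟩ := hN
  refine Finset.sum_eq_zero fun k hk => ?_
  have hk := Finset.mem_range.1 hk
  rw [lineMom_odd (pow_lt_of_lt hs (by omega)) (show Odd (N - 1 - 2 * k) from ⟨J - 1 - k, by omega⟩),
    mul_zero]

/-- For odd N the line integrals are the last column of the Cauchy block, so the inverse sends them
to a unit vector. -/
theorem sum_invEntry_odd {N J : ℕ} {s : ℝ} (h : N = 2 * J + 1) (hs : (N : ℝ) < s) {b : ℕ}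
    (hb : b < J + 1) :
    ∑ a ∈ Finset.range (J + 1), invEntry N s b a * (2 * s / ((2 * a + 1) * (s - 2 * a - 1))) =
      if b = J then 1 else 0 := by
  have hN2 : (N + 1) / 2 = J + 1 := by omega
  have h1 : gramBlockInv N s * gramBlock N s = 1 := mul_eq_one_comm.1 (gramBlock_mul_inv hs)
  have h2 := congrFun (congrFun h1 ⟨b, by omega⟩) ⟨J, by omega⟩
  rw [Matrix.mul_apply, Matrix.one_apply] at h2
  simp only [Fin.mk.injEq] at h2
  rw [← h2, ← hN2, Finset.sum_range]
  refine Finset.sum_congr rfl fun a _ => ?_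
  have e : gramBlock N s a ⟨J, by omega⟩ =
    rowFactor s a * colFactor N s J / (oddNode N s J - evenNode a) := rfl
  rw [e, colFactor, oddNode, if_neg (by omega), if_neg (by omega), rowFactor, evenNode]
  have : s - 1 - 2 * (a : ℕ) ≠ 0 := by
    have : (2 * (a : ℕ) : ℝ) + 1 ≤ N := by exact_mod_cast (by omega : 2 * (a : ℕ) + 1 ≤ N)
    linarith
  change invEntry N s b a * _ = invEntry N s b a * _
  rw [show s - 2 * ((a : ℕ) : ℝ) - 1 = s - 1 - 2 * (a : ℕ) by ring]
  field_simp
  ring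

theorem bilForm_lineMom_odd {N : ℕ} {s : ℝ} (hN : Odd N) (hs : (N : ℝ) < s) (F : ℕ → ℂ) :
    bilForm N s F (lineMom s) = 0 := by
  obtain ⟨J, hJ⟩ := hN
  refine Finset.sum_eq_zero fun j hj => ?_
  have hj := Finset.mem_range.1 hj
  have key := sum_invEntry_odd hJ hs (show J - 1 - j < J + 1 by omega)
  rw [if_neg (by omega), ← Finset.sum_range_reflect] at key
  have key2 := congrArg (fun x : ℝ => -2 * F (N - 2 - 2 * j) * (x : ℂ)) key
  simp only [Complex.ofReal_zero, mul_zero, Complex.ofReal_sum, Finset.mul_sum] at key2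
  rw [show (N + 1) / 2 = J + 1 by omega, ← key2]
  refine Finset.sum_congr rfl fun k hk => ?_
  have hk := Finset.mem_range.1 hk
  have h2 : bilCoeff N s j k = -(2 * invEntry N s (J - 1 - j) (J - k)) := by
    rw [invEntry_odd hJ hs (by omega) hk, neg_neg]
  rw [lineMom_odd (pow_lt_of_lt hs (by omega)) (show Odd (N - 2 - 2 * j) from ⟨J - 1 - j, by omega⟩),
    lineMom_even (pow_lt_of_lt hs (by omega)) (show Even (N - 1 - 2 * k) from ⟨J - k, by omega⟩),
    h2, show N - 1 - 2 * k = 2 * (J - k) by omega, Nat.add_sub_cancel]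
  push_cast
  ring

theorem linForm_lineMom_odd {N : ℕ} {s : ℝ} (hN : Odd N) (hs : (N : ℝ) < s) :
    linForm N s (lineMom s) = 1 := by
  obtain ⟨J, hJ⟩ := hN
  have key := sum_invEntry_odd hJ hs (show J < J + 1 by omega)
  rw [if_pos rfl, ← Finset.sum_range_reflect] at key
  have key2 := congrArg (fun x : ℝ => (x : ℂ)) key
  simp only [Complex.ofReal_one, Complex.ofReal_sum] at key2
  rw [linForm, show (N + 1) / 2 = J + 1 by omega, ← key2]
  refine Finset.sum_congr rfl fun k hk => ?_
  have hk := Finset.mem_range.1 hk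
  rw [lineMom_even (pow_lt_of_lt hs (by omega)) (show Even (N - 1 - 2 * k) from ⟨J - k, by omega⟩),
    ← invEntry_border hJ hs hk, show N - 1 - 2 * k = 2 * (J - k) by omega, Nat.add_sub_cancel]
  push_cast
  ring

/- ## The phase-renormalised kernel -/

/-- The renormalised weighted monomials. -/
noncomputable def outExp (c : ℝ) (l : ℕ) (z : ℂ) : ℂ := ((‖z‖ ^ (-c) : ℝ) : ℂ) * z⁻¹ ^ l

/-- The renormalised images of the weighted monomials under `epsOp`, up to a constant on the
real line. -/
noncomputable def outEps (c : ℝ) (l : ℕ) (z : ℂ) : ℂ :=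
  if z.im = 0 then outExp c l z * z / ((c + l - 1 : ℝ) : ℂ)
  else iota z * outExp c l ((starRingEnd ℂ) z)

/-- The sign of a real number, extended by zero to the non-real numbers. -/
noncomputable def lineSgn (z : ℂ) : ℂ := if z.im = 0 then sgn z.re else 0

/-- The bilinear part of the renormalised kernel. -/
noncomputable def bilHat (N : ℕ) (s : ℝ) (F G : ℕ → ℂ) : ℂ :=
  ∑ j ∈ Finset.range (N / 2), ∑ k ∈ Finset.range ((N + 1) / 2), (bilCoeff N s j k : ℂ) *
    (F (2 * j + 2) * G (2 * k + 1) - F (2 * k + 1) * G (2 * j + 2))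

/-- The linear part of the renormalised kernel. -/
noncomputable def linHat (N : ℕ) (s : ℝ) (F : ℕ → ℂ) : ℂ :=
  ∑ k ∈ Finset.range ((N + 1) / 2), (linCoeff N s k : ℂ) * F (2 * k + 1)

/-- The phase replaces the exponent m by l = N-m, so j enters through l = 2j+2 and k through l =
2k+1. Only l ≥ 1 occurs, which is all that the later bounds assume. -/
theorem mul_bilForm {N : ℕ} {s : ℝ} {F G F' G' : ℕ → ℂ} {a b : ℂ}
    (hF : ∀ m < N, a * F m = F' (N - m)) (hG : ∀ m < N, b * G m = G' (N - m)) :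
    a * b * bilForm N s F G = bilHat N s F' G' := by
  rw [bilForm, bilHat, Finset.mul_sum]
  refine Finset.sum_congr rfl fun j hj => ?_
  rw [Finset.mul_sum]
  refine Finset.sum_congr rfl fun k hk => ?_
  have hj := Finset.mem_range.1 hj
  have hk := Finset.mem_range.1 hk
  have e1 : N - (N - 2 - 2 * j) = 2 * j + 2 := by omega
  have e2 : N - (N - 1 - 2 * k) = 2 * k + 1 := by omega
  have h1 := hF (N - 2 - 2 * j) (by omega)
  have h2 := hF (N - 1 - 2 * k) (by omega)
  have h3 := hG (N - 2 - 2 * j) (by omega)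
  have h4 := hG (N - 1 - 2 * k) (by omega)
  rw [e1] at h1 h3
  rw [e2] at h2 h4
  rw [← h1, ← h2, ← h3, ← h4]
  ring

theorem mul_linForm {N : ℕ} {s : ℝ} {F F' : ℕ → ℂ} {a : ℂ}
    (hF : ∀ m < N, a * F m = F' (N - m)) : a * linForm N s F = linHat N s F' := by
  rw [linForm, linHat, Finset.mul_sum]
  refine Finset.sum_congr rfl fun k hk => ?_
  have hk := Finset.mem_range.1 hk
  have h1 := hF (N - 1 - 2 * k) (by omega)
  rw [show N - (N - 1 - 2 * k) = 2 * k + 1 by omega] at h1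
  rw [← h1]
  ring

/-- `epsOp` of the weighted monomials, without the constant on the real line. -/
noncomputable def rawEps (s : ℝ) (z : ℂ) (m : ℕ) : ℂ :=
  if z.im = 0 then z ^ (m + 1) * ((‖z‖ ^ (-s) : ℝ) : ℂ) / ((s - m - 1 : ℝ) : ℂ)
  else iota z * ((weight s ((starRingEnd ℂ) z) : ℂ) * (starRingEnd ℂ) z ^ m)

/-- On the real line outside the unit interval the integral of w(t)t^m towards the infinity of the
same sign is a pure power. Expressing the sign integral by it leaves half of the full line integral,
with the sign of the point. -/
theorem epsOp_phi {N : ℕ} {s : ℝ} (hs : (N : ℝ) < s) {i : Fin (N + N % 2)} (hi : (i : ℕ) < N)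
    {z : ℂ} (hz : 1 < ‖z‖) :
    epsOp (phi N s i) z = rawEps s z i - lineSgn z / 2 * lineMom s i := by
  have hlt := pow_lt_of_lt hs hi
  rw [epsOp, rawEps, lineSgn]
  split_ifs with h0
  swap
  · simp only [phi, if_pos hi]; ring
  obtain ⟨y, rfl⟩ : ∃ y : ℝ, (y : ℂ) = z := ⟨z.re, Complex.ext rfl (by simp [h0])⟩
  rw [Complex.norm_real, Real.norm_eq_abs] at hz
  simp only [phi, if_pos hi, Complex.ofReal_re, Complex.norm_real, Real.norm_eq_abs]
  have e1 : ∫ t : ℝ, (weight s t : ℂ) * (t : ℂ) ^ (i : ℕ) * sgn (t - y) =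
      ((∫ t : ℝ, weight s t * t ^ (i : ℕ) * Real.sign (t - y) : ℝ) : ℂ) := by
    rw [← integral_complex_ofReal]
    congr 1; funext t
    rw [sgn]; push_cast; ring
  rw [e1, integral_weight_sign_of_nonneg hlt, lineMom_eq_ofReal, sgn]
  rcases lt_or_ge 0 y with hy | hy
  · rw [abs_of_pos hy] at hz ⊢
    rw [Real.sign_of_pos hy, tailMom_of_one_le hlt hz.le,
      show ((i : ℕ) : ℝ) + 1 - s = ((i + 1 : ℕ) : ℝ) + -s by push_cast; ring, Real.rpow_add hy,
      Real.rpow_natCast]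
    push_cast; ring
  · rw [abs_of_nonpos hy] at hz ⊢
    have h1 := tailMom_neg hlt (-y)
    rw [neg_neg, tailMom_of_one_le hlt hz.le,
      show ((i : ℕ) : ℝ) + 1 - s = ((i + 1 : ℕ) : ℝ) + -s by push_cast; ring,
      Real.rpow_add (by linarith), Real.rpow_natCast, neg_pow y] at h1
    have h2 : ((-1 : ℝ) ^ (i : ℕ)) * (-1) ^ ((i : ℕ) + 1) = -1 := by
      rw [← pow_add, ← add_assoc, ← two_mul, pow_succ, pow_mul]; norm_num
    rw [Real.sign_of_neg (by linarith), h1, show (-1 : ℝ) ^ (i : ℕ) *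
      ((-1) ^ ((i : ℕ) + 1) * y ^ ((i : ℕ) + 1) * (-y) ^ (-s) / (s - (i : ℕ) - 1)) =
      ((-1 : ℝ) ^ (i : ℕ) * (-1) ^ ((i : ℕ) + 1)) *
      (y ^ ((i : ℕ) + 1) * (-y) ^ (-s) / (s - (i : ℕ) - 1)) by ring, h2]
    push_cast; ring

theorem phase_mul_weight {N m : ℕ} {s : ℝ} (hm : m < N) {z : ℂ} (hz : 1 < ‖z‖) :
    ((‖z‖ : ℂ) / z) ^ N * ((weight s z : ℂ) * z ^ m) = outExp (s - N) (N - m) z := by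
  have hz0 : 0 < ‖z‖ := by linarith
  have hz1 : z ≠ 0 := norm_pos_iff.1 hz0
  rw [outExp, weight_of_one_le_norm hz.le, show -(s - N) = -s + (N : ℕ) by ring,
    Real.rpow_add hz0, Real.rpow_natCast, div_pow, inv_pow]
  have : z ^ N = z ^ m * z ^ (N - m) := by rw [← pow_add]; congr 1; omega
  rw [this]
  push_cast
  field_simp

theorem phase_mul_rawEps {N m : ℕ} {s : ℝ} (hm : m < N) {z : ℂ} (hz : 1 < ‖z‖) :
    ((‖z‖ : ℂ) / (starRingEnd ℂ) z) ^ N * rawEps s z m = outEps (s - N) (N - m) z := by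
  rw [rawEps, outEps]
  split_ifs with h0
  · have hc : (starRingEnd ℂ) z = z := Complex.conj_eq_iff_im.2 h0
    rw [hc, ← phase_mul_weight hm hz, weight_of_one_le_norm hz.le,
      Nat.cast_sub hm.le, show s - N + ((N : ℝ) - m) - 1 = s - m - 1 by ring]
    ring
  · rw [← phase_mul_weight hm (by rwa [RCLike.norm_conj]), RCLike.norm_conj]
    ring

theorem lineSgn_cases {z : ℂ} (hz : 1 < ‖z‖) : (z.im ≠ 0 ∧ lineSgn z = 0) ∨
    (z.im = 0 ∧ 1 < z.re ∧ lineSgn z = 1 ∧ (‖z‖ : ℂ) / (starRingEnd ℂ) z = 1) ∨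
    (z.im = 0 ∧ z.re < -1 ∧ lineSgn z = -1 ∧ (‖z‖ : ℂ) / (starRingEnd ℂ) z = -1) := by
  by_cases h0 : z.im = 0
  · right
    obtain ⟨y, rfl⟩ : ∃ y : ℝ, (y : ℂ) = z := ⟨z.re, Complex.ext rfl (by simp [h0])⟩
    rw [Complex.norm_real, Real.norm_eq_abs] at hz
    rw [lineSgn, if_pos h0, sgn, Complex.conj_ofReal, Complex.norm_real, Real.norm_eq_abs,
      Complex.ofReal_re]
    rcases lt_abs.1 hz with h | h
    · left
      have hy : (y : ℂ) ≠ 0 := by exact_mod_cast (by linarith : (0 : ℝ) < y).ne'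
      refine ⟨h0, h, ?_, ?_⟩
      · rw [Real.sign_of_pos (by linarith)]; simp
      · rw [abs_of_pos (by linarith), div_self hy]
    · right
      have hy : (y : ℂ) ≠ 0 := by exact_mod_cast (by linarith : y < 0).ne
      refine ⟨h0, by linarith, ?_, ?_⟩
      · rw [Real.sign_of_neg (by linarith)]; simp
      · rw [abs_of_neg (by linarith), Complex.ofReal_neg, neg_div, div_self hy]
  · exact Or.inl ⟨h0, by rw [lineSgn, if_neg h0]⟩

/-- The values of `epsPhi` as a function of the exponent. -/
noncomputable def fullEps (N : ℕ) (s : ℝ) (z : ℂ) (m : ℕ) : ℂ :=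
  if m < N then rawEps s z m - lineSgn z / 2 * lineMom s m else lineSgn z ^ 2 / 2

theorem epsPhi_eq {N : ℕ} {s : ℝ} (hs : (N : ℝ) < s) {z : ℂ} (hz : 1 < ‖z‖)
    (i : Fin (N + N % 2)) : epsPhi N s i z = fullEps N s z i := by
  rw [epsPhi, fullEps]
  split_ifs with h1 h2
  · exact epsOp_phi hs h1 hz
  · rcases lineSgn_cases hz with ⟨h, _⟩ | ⟨_, _, h, _⟩ | ⟨_, _, h, _⟩
    · exact absurd h2 h
    · rw [h]; norm_num
    · rw [h]; norm_num
  · rw [lineSgn, if_neg h2]; norm_num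

/-- The values of `phi` as a function of the exponent. -/
noncomputable def fullPhi (N : ℕ) (s : ℝ) (z : ℂ) (m : ℕ) : ℂ :=
  if m < N then (weight s z : ℂ) * z ^ m else 0

theorem phi_eq {N : ℕ} {s : ℝ} {z : ℂ} (i : Fin (N + N % 2)) :
    phi N s i z = fullPhi N s z i := rfl

theorem bilForm_fullEps_right (N : ℕ) (s : ℝ) (F : ℕ → ℂ) (v : ℂ) :
    bilForm N s F (fullEps N s v) =
      bilForm N s F (rawEps s v) - lineSgn v / 2 * bilForm N s F (lineMom s) := by
  rw [← bilForm_sub_right]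
  exact bilForm_congr (fun _ _ => rfl) fun m hm => by rw [fullEps, if_pos hm]

theorem bilForm_fullEps_left (N : ℕ) (s : ℝ) (G : ℕ → ℂ) (v : ℂ) :
    bilForm N s (fullEps N s v) G =
      bilForm N s (rawEps s v) G - lineSgn v / 2 * bilForm N s (lineMom s) G := by
  rw [← bilForm_sub_left]
  exact bilForm_congr (fun m hm => by rw [fullEps, if_pos hm]) fun _ _ => rfl

theorem linForm_fullEps (N : ℕ) (s : ℝ) (v : ℂ) :
    linForm N s (fullEps N s v) =
      linForm N s (rawEps s v) - lineSgn v / 2 * linForm N s (lineMom s) := by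
  rw [← linForm_sub]
  exact linForm_congr fun m hm => by rw [fullEps, if_pos hm]

theorem fullPhi_of_lt {N m : ℕ} (s : ℝ) (z : ℂ) (hm : m < N) :
    fullPhi N s z m = (weight s z : ℂ) * z ^ m := if_pos hm

theorem phase_mul_fullPhi {N : ℕ} {s : ℝ} {z : ℂ} (hz : 1 < ‖z‖) : ∀ m < N,
    ((‖z‖ : ℂ) / z) ^ N * fullPhi N s z m = (fun l => outExp (s - N) l z) (N - m) := by
  intro m hm
  rw [fullPhi_of_lt s z hm, phase_mul_weight hm hz]

theorem lineSgn_phase_even {N : ℕ} (hN : Even N) {z : ℂ} (hz : 1 < ‖z‖) :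
    ((‖z‖ : ℂ) / (starRingEnd ℂ) z) ^ N * lineSgn z = lineSgn z := by
  rcases lineSgn_cases hz with ⟨_, h⟩ | ⟨_, _, h, h'⟩ | ⟨_, _, h, h'⟩
  · rw [h, mul_zero]
  · rw [h', one_pow, one_mul]
  · rw [h', hN.neg_one_pow, one_mul]

/-- For odd N the phase on the line is the sign itself. It converts the constant 1/2 of the border
function into half a sign, so that both parities end with the same linear term. -/
theorem lineSgn_phase_odd {N : ℕ} (hN : Odd N) {z : ℂ} (hz : 1 < ‖z‖) :
    ((‖z‖ : ℂ) / (starRingEnd ℂ) z) ^ N * lineSgn z ^ 2 = lineSgn z := by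
  rcases lineSgn_cases hz with ⟨_, h⟩ | ⟨_, _, h, h'⟩ | ⟨_, _, h, h'⟩
  · rw [h]; ring
  · rw [h', h]; norm_num
  · rw [h', h, hN.neg_one_pow]; norm_num

theorem hat_phi_phi {N : ℕ} {s : ℝ} (hs : (N : ℝ) < s) {u v : ℂ} (hu : 1 < ‖u‖) (hv : 1 < ‖v‖) :
    ((‖u‖ : ℂ) / u) ^ N * ((‖v‖ : ℂ) / v) ^ N * kernelSum N s (phi N s) (phi N s) u v =
      bilHat N s (fun l => outExp (s - N) l u) (fun l => outExp (s - N) l v) := by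
  rw [← mul_bilForm (s := s) (F' := fun l => outExp (s - N) l u)
    (G' := fun l => outExp (s - N) l v) (phase_mul_fullPhi hu) (phase_mul_fullPhi hv)]
  rcases Nat.even_or_odd N with hN | hN
  · rw [kernelSum_even hN hs (phi_eq (z := u)) (phi_eq (z := v))]
  · rw [kernelSum_odd hN hs (phi_eq (z := u)) (phi_eq (z := v)), fullPhi, if_neg (lt_irrefl N),
      fullPhi, if_neg (lt_irrefl N)]
    simp

theorem hat_phi_eps {N : ℕ} {s : ℝ} (hs : (N : ℝ) < s) {u v : ℂ} (hu : 1 < ‖u‖) (hv : 1 < ‖v‖) :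
    ((‖u‖ : ℂ) / u) ^ N * ((‖v‖ : ℂ) / (starRingEnd ℂ) v) ^ N *
        kernelSum N s (phi N s) (epsPhi N s) u v =
      bilHat N s (fun l => outExp (s - N) l u) (fun l => outEps (s - N) l v) +
        lineSgn v * linHat N s (fun l => outExp (s - N) l u) := by
  have h1 := mul_bilForm (s := s) (F' := fun l => outExp (s - N) l u)
    (phase_mul_fullPhi (N := N) (s := s) hu)
    (G' := fun l => outEps (s - N) l v) (fun m hm => phase_mul_rawEps hm hv)
  have h2 := mul_linForm (s := s) (F' := fun l => outExp (s - N) l u)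
    (phase_mul_fullPhi (N := N) (s := s) hu)
  rw [← h1, ← h2]
  rcases Nat.even_or_odd N with hN | hN
  · rw [kernelSum_even hN hs (phi_eq (z := u)) (epsPhi_eq hs hv), bilForm_fullEps_right,
      bilForm_lineMom_even hN hs]
    linear_combination ((‖u‖ : ℂ) / u) ^ N * linForm N s (fullPhi N s u) * lineSgn_phase_even hN hv
  · rw [kernelSum_odd hN hs (phi_eq (z := u)) (epsPhi_eq hs hv), bilForm_fullEps_right,
      bilForm_lineMom_odd hN hs, fullPhi, if_neg (lt_irrefl N), fullEps, if_neg (lt_irrefl N)]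
    linear_combination ((‖u‖ : ℂ) / u) ^ N * linForm N s (fullPhi N s u) * lineSgn_phase_odd hN hv

theorem hat_eps_phi {N : ℕ} {s : ℝ} (hs : (N : ℝ) < s) {u v : ℂ} (hu : 1 < ‖u‖) (hv : 1 < ‖v‖) :
    ((‖u‖ : ℂ) / (starRingEnd ℂ) u) ^ N * ((‖v‖ : ℂ) / v) ^ N *
        kernelSum N s (epsPhi N s) (phi N s) u v =
      bilHat N s (fun l => outEps (s - N) l u) (fun l => outExp (s - N) l v) -
        lineSgn u * linHat N s (fun l => outExp (s - N) l v) := by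
  have h1 := mul_bilForm (s := s) (F' := fun l => outEps (s - N) l u)
    (G' := fun l => outExp (s - N) l v)
    (fun m hm => phase_mul_rawEps hm hu) (phase_mul_fullPhi (N := N) (s := s) hv)
  have h2 := mul_linForm (s := s) (F' := fun l => outExp (s - N) l v)
    (phase_mul_fullPhi (N := N) (s := s) hv)
  rw [← h1, ← h2]
  rcases Nat.even_or_odd N with hN | hN
  · rw [kernelSum_even hN hs (epsPhi_eq hs hu) (phi_eq (z := v)), bilForm_fullEps_left,
      bilForm_swap N s (lineMom s), bilForm_lineMom_even hN hs]
    linear_combination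
      (-((‖v‖ : ℂ) / v) ^ N * linForm N s (fullPhi N s v)) * lineSgn_phase_even hN hu
  · rw [kernelSum_odd hN hs (epsPhi_eq hs hu) (phi_eq (z := v)), bilForm_fullEps_left,
      bilForm_swap N s (lineMom s), bilForm_lineMom_odd hN hs, fullPhi, if_neg (lt_irrefl N),
      fullEps, if_neg (lt_irrefl N)]
    linear_combination
      (-((‖v‖ : ℂ) / v) ^ N * linForm N s (fullPhi N s v)) * lineSgn_phase_odd hN hu

theorem hat_halfSgn_even {N : ℕ} (hN : Even N) {u v : ℂ} (hu : 1 < ‖u‖) (hv : 1 < ‖v‖) :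
    ((‖u‖ : ℂ) / (starRingEnd ℂ) u) ^ N * ((‖v‖ : ℂ) / (starRingEnd ℂ) v) ^ N * halfSgn u v =
      halfSgn u v := by
  rcases lineSgn_cases hu with ⟨h, _⟩ | ⟨_, _, _, h'⟩ | ⟨_, _, _, h'⟩
  · rw [halfSgn, if_neg (fun H => h H.1), mul_zero]
  all_goals
    rcases lineSgn_cases hv with ⟨g, _⟩ | ⟨_, _, _, g'⟩ | ⟨_, _, _, g'⟩
    · rw [halfSgn, if_neg (fun H => g H.2), mul_zero]
    all_goals rw [h', g']; simp [hN.neg_one_pow]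

/-- For odd N the constants of the two factors meet the border and leave (sgn v - sgn u)/2 for real
points, while the phase contributes sgn u sgn v. For points of equal sign nothing changes; for
opposite signs sgn(u-v) = sgn u, and the two corrections cancel. -/
theorem hat_halfSgn_odd {N : ℕ} (hN : Odd N) {u v : ℂ} (hu : 1 < ‖u‖) (hv : 1 < ‖v‖) :
    ((‖u‖ : ℂ) / (starRingEnd ℂ) u) ^ N * ((‖v‖ : ℂ) / (starRingEnd ℂ) v) ^ N *
      (lineSgn u ^ 2 * lineSgn v / 2 - lineSgn u * lineSgn v ^ 2 / 2 + halfSgn u v) =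
      halfSgn u v := by
  rcases lineSgn_cases hu with ⟨h, h1⟩ | ⟨h, h0, h1, h'⟩ | ⟨h, h0, h1, h'⟩
  · rw [halfSgn, if_neg (fun H => h H.1), h1]; ring
  all_goals
    rcases lineSgn_cases hv with ⟨g, g1⟩ | ⟨g, g0, g1, g'⟩ | ⟨g, g0, g1, g'⟩
    · rw [halfSgn, if_neg (fun H => g H.2), g1]; ring
    all_goals
      rw [h', g', h1, g1, halfSgn, if_pos ⟨h, g⟩]
      simp only [one_pow, hN.neg_one_pow]
  · ring
  · rw [sgn, Real.sign_of_pos (by linarith)]; push_cast; ring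
  · rw [sgn, Real.sign_of_neg (by linarith)]; push_cast; ring
  · ring

theorem hat_eps_eps {N : ℕ} {s : ℝ} (hs : (N : ℝ) < s) {u v : ℂ} (hu : 1 < ‖u‖) (hv : 1 < ‖v‖) :
    ((‖u‖ : ℂ) / (starRingEnd ℂ) u) ^ N * ((‖v‖ : ℂ) / (starRingEnd ℂ) v) ^ N *
        (kernelSum N s (epsPhi N s) (epsPhi N s) u v + halfSgn u v) =
      bilHat N s (fun l => outEps (s - N) l u) (fun l => outEps (s - N) l v) +
        (lineSgn v * linHat N s (fun l => outEps (s - N) l u) -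
        lineSgn u * linHat N s (fun l => outEps (s - N) l v)) + halfSgn u v := by
  have h1 := mul_bilForm (s := s) (F' := fun l => outEps (s - N) l u)
    (G' := fun l => outEps (s - N) l v)
    (fun m hm => phase_mul_rawEps hm hu) (fun m hm => phase_mul_rawEps hm hv)
  have h2 := mul_linForm (s := s) (F' := fun l => outEps (s - N) l u)
    (fun m hm => phase_mul_rawEps hm hu)
  have h3 := mul_linForm (s := s) (F' := fun l => outEps (s - N) l v)
    (fun m hm => phase_mul_rawEps hm hv)
  rw [← h1, ← h2, ← h3]
  rcases Nat.even_or_odd N with hN | hN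
  · rw [kernelSum_even hN hs (epsPhi_eq hs hu) (epsPhi_eq hs hv), bilForm_fullEps_right,
      bilForm_fullEps_left, bilForm_lineMom_even hN hs, bilForm_swap N s (lineMom s),
      bilForm_lineMom_even hN hs, linForm_fullEps, linForm_lineMom_even hN hs]
    linear_combination hat_halfSgn_even hN hu hv +
      ((‖u‖ : ℂ) / (starRingEnd ℂ) u) ^ N * linForm N s (rawEps s u) * lineSgn_phase_even hN hv -
      ((‖v‖ : ℂ) / (starRingEnd ℂ) v) ^ N * linForm N s (rawEps s v) * lineSgn_phase_even hN hu
  · have e : ∀ z, fullEps N s z N = lineSgn z ^ 2 / 2 := fun z => if_neg (lt_irrefl N)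
    rw [kernelSum_odd hN hs (epsPhi_eq hs hu) (epsPhi_eq hs hv), bilForm_fullEps_right,
      bilForm_fullEps_left, bilForm_lineMom_odd hN hs, bilForm_swap N s (lineMom s),
      bilForm_lineMom_odd hN hs, e, e, linForm_fullEps, linForm_lineMom_odd hN hs, linForm_fullEps,
      linForm_lineMom_odd hN hs]
    linear_combination hat_halfSgn_odd hN hu hv +
      ((‖u‖ : ℂ) / (starRingEnd ℂ) u) ^ N * linForm N s (rawEps s u) * lineSgn_phase_odd hN hv -
      ((‖v‖ : ℂ) / (starRingEnd ℂ) v) ^ N * linForm N s (rawEps s v) * lineSgn_phase_odd hN hu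

/-- The phase-renormalised kernel as a bilinear form plus a linear form. -/
theorem kernelHat_eq {N : ℕ} {s : ℝ} (hs : (N : ℝ) < s) {u v : ℂ} (hu : 1 < ‖u‖) (hv : 1 < ‖v‖) :
    kernelHat N s u v =
      !![bilHat N s (fun l => outExp (s - N) l u) (fun l => outExp (s - N) l v),
        bilHat N s (fun l => outExp (s - N) l u) (fun l => outEps (s - N) l v) +
          lineSgn v * linHat N s (fun l => outExp (s - N) l u);
        bilHat N s (fun l => outEps (s - N) l u) (fun l => outExp (s - N) l v) -
          lineSgn u * linHat N s (fun l => outExp (s - N) l v),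
        bilHat N s (fun l => outEps (s - N) l u) (fun l => outEps (s - N) l v) +
          (lineSgn v * linHat N s (fun l => outEps (s - N) l u) -
          lineSgn u * linHat N s (fun l => outEps (s - N) l v)) + halfSgn u v] := by
  have e : ∀ a b : ℂ, (((‖u * v‖ : ℝ) : ℂ) / (a * b)) ^ N =
      ((‖u‖ : ℂ) / a) ^ N * ((‖v‖ : ℂ) / b) ^ N := by
    intro a b
    rw [norm_mul, Complex.ofReal_mul, mul_div_mul_comm, mul_pow]
  rw [← hat_phi_phi hs hu hv, ← hat_phi_eps hs hu hv, ← hat_eps_phi hs hu hv,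
    ← hat_eps_eps hs hu hv]
  simp only [kernelHat, kernel, e]
  rfl

/- ## Asymptotics of the coefficients -/

theorem ratioProd_nonneg (J : ℕ) {c : ℝ} (hc : 0 ≤ c) : 0 ≤ ratioProd J c :=
  Finset.prod_nonneg fun j _ => by positivity

theorem ratioProd_mono (J : ℕ) {c d : ℝ} (hc : 0 ≤ c) (hcd : c ≤ d) :
    ratioProd J c ≤ ratioProd J d := by
  refine Finset.prod_le_prod (fun j _ => by positivity) fun j _ => ?_
  have hj : (0 : ℝ) ≤ j := Nat.cast_nonneg j
  rw [div_le_div_iff₀ (by linarith) (by linarith)]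
  nlinarith

/-- Telescoping of (x/(x+1))² ≤ x/(x+2) with x = c+2j. The bound has the correct order J^{-1/2} and
holds for every c > 0. -/
theorem ratioProd_sq_le (J : ℕ) {c : ℝ} (hc : 0 < c) :
    ratioProd J c ^ 2 ≤ c / (c + 2 * J) := by
  induction J with
  | zero => simp [ratioProd, div_self hc.ne']
  | succ J ih =>
    rw [ratioProd, Finset.prod_range_succ, ← ratioProd, mul_pow]
    have hJ : (0 : ℝ) ≤ J := Nat.cast_nonneg J
    calc ratioProd J c ^ 2 * ((c + 2 * J) / (c + 2 * J + 1)) ^ 2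
        ≤ c / (c + 2 * J) * ((c + 2 * J) / (c + 2 * J + 1)) ^ 2 :=
          mul_le_mul_of_nonneg_right ih (sq_nonneg _)
      _ = c * ((c + 2 * J) / (c + 2 * J + 1) ^ 2) := by
          have : c + 2 * J ≠ 0 := by positivity
          field_simp
      _ ≤ c * (1 / (c + 2 * J + 2)) := by
          refine mul_le_mul_of_nonneg_left ?_ hc.le
          rw [div_le_div_iff₀ (by positivity) (by positivity)]
          nlinarith
      _ = c / (c + 2 * (J + 1 : ℕ)) := by push_cast; rw [mul_one_div]; congr 1; ring

theorem pochQ_eq_ratioProd (n : ℕ) : pochQ n = ratioProd n 1 :=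
  Finset.prod_congr rfl fun i _ => by congr 1 <;> ring

theorem pochQ_le_one (n : ℕ) : pochQ n ≤ 1 :=
  Finset.prod_le_one (fun i _ => by positivity) fun i _ => by
    rw [div_le_one (by positivity)]; linarith

theorem sqrt_mul_pochQ_le (n : ℕ) : Real.sqrt (2 * n + 1) * pochQ n ≤ 1 := by
  have h := ratioProd_sq_le n zero_lt_one
  rw [← pochQ_eq_ratioProd] at h
  have h0 : (0 : ℝ) < 1 + 2 * n := by positivity
  rw [le_div_iff₀ h0] at h
  rw [← abs_of_nonneg (mul_nonneg (Real.sqrt_nonneg _) (pochQ_pos n).le), ← sq_le_one_iff_abs_le_one,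
    mul_pow, Real.sq_sqrt (by positivity)]
  linarith

theorem pochP_eq_sqrt (n : ℕ) :
    pochP n = Real.sqrt (2 * n + 1) * (Real.sqrt (2 * n + 1) * pochQ n) := by
  rw [← mul_assoc, Real.mul_self_sqrt (by positivity), pochP_eq]

theorem pochP_le_sqrt (n : ℕ) : pochP n ≤ Real.sqrt (2 * n + 1) := by
  rw [pochP_eq_sqrt]
  exact mul_le_of_le_one_right (Real.sqrt_nonneg _) (sqrt_mul_pochQ_le n)

theorem pochP_le (n : ℕ) : pochP n ≤ 2 * n + 1 := by
  rw [pochP_eq]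
  exact mul_le_of_le_one_right (by positivity) (pochQ_le_one n)

/-- The product is a quotient of the products in Euler's limit for Γ((c+1)/2) and Γ(c/2); the powers
of n in these limits differ by √n. -/
theorem tendsto_sqrt_mul_ratioProd {c : ℝ} (hc : 0 < c) :
    Tendsto (fun n : ℕ => Real.sqrt (2 * n + 1) * ratioProd n c) atTop
      (𝓝 (Real.sqrt 2 * (Real.Gamma ((c + 1) / 2) / Real.Gamma (c / 2)))) := by
  rw [← tendsto_add_atTop_iff_nat 1]
  have h1 := (Real.GammaSeq_tendsto_Gamma ((c + 1) / 2)).div (Real.GammaSeq_tendsto_Gamma (c / 2))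
    (Real.Gamma_pos_of_pos (by linarith)).ne'
  have h2 : Tendsto (fun n : ℕ => Real.sqrt (2 + 3 * ((n : ℝ))⁻¹)) atTop (𝓝 (Real.sqrt 2)) := by
    have : Tendsto (fun n : ℕ => 2 + 3 * ((n : ℝ))⁻¹) atTop (𝓝 (2 + 3 * 0)) :=
      (tendsto_inv_atTop_nhds_zero_nat.const_mul 3).const_add 2
    rw [mul_zero, add_zero] at this
    exact (Real.continuous_sqrt.tendsto 2).comp this
  refine (h2.mul h1).congr' ?_
  filter_upwards [eventually_gt_atTop 0] with n hn
  have hn' : (0 : ℝ) < n := by exact_mod_cast hn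
  have e1 : (n : ℝ) ^ ((c + 1) / 2) = (n : ℝ) ^ (c / 2) * Real.sqrt n := by
    rw [Real.sqrt_eq_rpow, ← Real.rpow_add hn']; congr 1; ring
  have e2 : Real.sqrt (2 * ((n + 1 : ℕ) : ℝ) + 1) =
      Real.sqrt (2 + 3 * (n : ℝ)⁻¹) * Real.sqrt n := by
    rw [← Real.sqrt_mul (by positivity)]
    congr 1; push_cast; field_simp; ring
  have e3 : ratioProd (n + 1) c = (∏ j ∈ Finset.range (n + 1), (c / 2 + j)) /
      ∏ j ∈ Finset.range (n + 1), ((c + 1) / 2 + j) := by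
    rw [ratioProd, ← Finset.prod_div_distrib]
    refine Finset.prod_congr rfl fun j _ => ?_
    rw [div_eq_div_iff (by positivity) (by positivity)]; ring
  have hp1 : ∏ j ∈ Finset.range (n + 1), (c / 2 + (j : ℝ)) ≠ 0 :=
    Finset.prod_ne_zero_iff.2 fun j _ => by positivity
  have hp2 : ∏ j ∈ Finset.range (n + 1), ((c + 1) / 2 + (j : ℝ)) ≠ 0 :=
    Finset.prod_ne_zero_iff.2 fun j _ => by positivity
  have hf : ((n.factorial : ℕ) : ℝ) ≠ 0 := by exact_mod_cast n.factorial_ne_zero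
  have hr : (n : ℝ) ^ (c / 2) ≠ 0 := (Real.rpow_pos_of_pos hn' _).ne'
  rw [e2, e3, Pi.div_apply, Real.GammaSeq, Real.GammaSeq, e1]
  field_simp

/-- The product increases with its parameter, so d(n) → c can be squeezed between fixed parameters
just below and just above c; continuity of the Gamma quotient closes the gap. -/
theorem tendsto_sqrt_mul_ratioProd_seq {c : ℝ} (hc : 0 < c) {d : ℕ → ℝ} {J : ℕ → ℕ}
    (hd : Tendsto d atTop (𝓝 c)) (hJ : Tendsto J atTop atTop) :
    Tendsto (fun n : ℕ => Real.sqrt (2 * J n + 1) * ratioProd (J n) (d n)) atTop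
      (𝓝 (Real.sqrt 2 * (Real.Gamma ((c + 1) / 2) / Real.Gamma (c / 2)))) := by
  have hcont : ContinuousAt
      (fun x : ℝ => Real.sqrt 2 * (Real.Gamma ((x + 1) / 2) / Real.Gamma (x / 2))) c := by
    have hG : ∀ x : ℝ, 0 < x → ContinuousAt Real.Gamma x := fun x hx =>
      (Real.differentiableAt_Gamma fun m => by
        have : (0 : ℝ) ≤ m := Nat.cast_nonneg m
        linarith).continuousAt
    refine continuousAt_const.mul (ContinuousAt.div ?_ ?_
      (Real.Gamma_pos_of_pos (by linarith)).ne')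
    · exact ContinuousAt.comp (f := fun x : ℝ => (x + 1) / 2) (hG _ (by linarith)) (by fun_prop)
    · exact ContinuousAt.comp (f := fun x : ℝ => x / 2) (hG _ (by linarith)) (by fun_prop)
  refine tendsto_order.2 ⟨fun a ha => ?_, fun a ha => ?_⟩
  · have h1 : ∀ᶠ x in 𝓝[<] c,
        a < Real.sqrt 2 * (Real.Gamma ((x + 1) / 2) / Real.Gamma (x / 2)) :=
      nhdsWithin_le_nhds (hcont.eventually (lt_mem_nhds ha))
    have h2 : ∀ᶠ x in 𝓝[<] c, 0 < x := nhdsWithin_le_nhds (lt_mem_nhds hc)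
    obtain ⟨x, ⟨hx1, hx2⟩, hx3⟩ := ((h1.and h2).and self_mem_nhdsWithin).exists
    have hx3 : x < c := hx3
    have h3 := ((tendsto_sqrt_mul_ratioProd hx2).comp hJ).eventually (lt_mem_nhds hx1)
    filter_upwards [h3, hd.eventually (lt_mem_nhds hx3)] with n hn hn2
    exact lt_of_lt_of_le hn (mul_le_mul_of_nonneg_left (ratioProd_mono _ hx2.le hn2.le)
      (Real.sqrt_nonneg _))
  · have h1 : ∀ᶠ x in 𝓝[>] c,
        Real.sqrt 2 * (Real.Gamma ((x + 1) / 2) / Real.Gamma (x / 2)) < a :=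
      nhdsWithin_le_nhds (hcont.eventually (gt_mem_nhds ha))
    obtain ⟨x, hx1, hx3⟩ := (h1.and self_mem_nhdsWithin).exists
    have hx3 : c < x := hx3
    have h3 := ((tendsto_sqrt_mul_ratioProd (hc.trans hx3)).comp hJ).eventually (gt_mem_nhds hx1)
    filter_upwards [h3, hd.eventually (gt_mem_nhds hx3), hd.eventually (lt_mem_nhds hc)]
      with n hn hn2 hn3
    exact lt_of_le_of_lt (mul_le_mul_of_nonneg_left (ratioProd_mono _ hn3.le hn2.le)
      (Real.sqrt_nonneg _)) hn

theorem tendsto_sqrt_mul_pochQ {J : ℕ → ℕ} (hJ : Tendsto J atTop atTop) :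
    Tendsto (fun n : ℕ => Real.sqrt (2 * J n + 1) * pochQ (J n)) atTop
      (𝓝 (Real.sqrt 2 / Real.sqrt Real.pi)) := by
  have h := tendsto_sqrt_mul_ratioProd_seq zero_lt_one (d := fun _ => 1) tendsto_const_nhds hJ
  simp only [← pochQ_eq_ratioProd] at h
  rw [show ((1 : ℝ) + 1) / 2 = 1 by norm_num, Real.Gamma_one, Real.Gamma_one_half_eq,
    mul_one_div] at h
  exact h

theorem tendsto_ratio_one {a b : ℕ → ℝ} {C : ℝ} (hb : Tendsto b atTop atTop)
    (h : ∀ᶠ n in atTop, |a n - b n| ≤ C) : Tendsto (fun n => a n / b n) atTop (𝓝 1) := by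
  have h1 : Tendsto (fun n => (a n - b n) * (b n)⁻¹) atTop (𝓝 0) := by
    have h2 : Tendsto (fun n => C * (b n)⁻¹) atTop (𝓝 (C * 0)) :=
      (tendsto_inv_atTop_zero.comp hb).const_mul C
    rw [mul_zero] at h2
    refine squeeze_zero_norm' ?_ h2
    filter_upwards [h, hb.eventually_gt_atTop 0] with n hn hn2
    rw [norm_mul, Real.norm_eq_abs, norm_inv, Real.norm_of_nonneg hn2.le]
    exact mul_le_mul_of_nonneg_right hn (inv_nonneg.2 hn2.le)
  have h3 := h1.add_const 1
  rw [zero_add] at h3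
  refine h3.congr' ?_
  filter_upwards [hb.eventually_gt_atTop 0] with n hn
  field_simp
  ring

/-- The limits of the bilinear coefficients. -/
noncomputable def bilLim (c : ℝ) (j k : ℕ) : ℝ :=
  1 / Real.pi * ((c + 2 * k) * pochP j * pochQ k / (2 * j - 2 * k + 1))

theorem tendsto_half_sub (i : ℕ) : Tendsto (fun N : ℕ => (N - i) / 2) atTop atTop :=
  tendsto_atTop_atTop.2 fun b => ⟨2 * b + i, fun a ha => by omega⟩

theorem half_sub_diff {N i : ℕ} (h : i ≤ N) : |(2 * (((N - i) / 2 : ℕ) : ℝ) + 1) - N| ≤ i + 1 := by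
  have h1 : 2 * ((N - i) / 2) + i ≤ N := by omega
  have h2 : N ≤ 2 * ((N - i) / 2) + i + 1 := by omega
  have h1' : (2 * (((N - i) / 2 : ℕ) : ℝ) + i) ≤ N := by exact_mod_cast h1
  have h2' : (N : ℝ) ≤ 2 * (((N - i) / 2 : ℕ) : ℝ) + i + 1 := by exact_mod_cast h2
  rw [abs_le]
  constructor <;> linarith [(Nat.cast_nonneg i : (0 : ℝ) ≤ i)]

theorem tendsto_half_ratio {s : ℕ → ℝ} {c : ℝ} (hs : Tendsto (fun N => s N - N) atTop (𝓝 c))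
    (i : ℕ) : Tendsto (fun N : ℕ => (2 * (((N - i) / 2 : ℕ) : ℝ) + 1) / s N) atTop (𝓝 1) := by
  have hs2 : Tendsto s atTop atTop := by
    have := (tendsto_natCast_atTop_atTop (R := ℝ)).atTop_add hs
    refine this.congr fun N => by ring
  have hb : ∀ᶠ N in atTop, |s N - N| ≤ |c| + 1 :=
    (hs.abs.eventually (gt_mem_nhds (lt_add_one |c|))).mono fun N h => le_of_lt h
  refine tendsto_ratio_one (C := i + 1 + (|c| + 1)) hs2 ?_
  filter_upwards [hb, eventually_ge_atTop i] with N hN hi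
  have := half_sub_diff hi
  calc _ = |((2 * (((N - i) / 2 : ℕ) : ℝ) + 1) - N) - (s N - N)| := by congr 1; ring
    _ ≤ _ := (abs_sub _ _).trans (add_le_add this hN)

/-- Each of the two Pochhammer symbols of order N/2 is asymptotic to √(2N/π). Together they cancel
the 2s in the denominator and leave the factor 1/π. -/
theorem tendsto_bilCoeff {s : ℕ → ℝ} {c : ℝ} (hs : Tendsto (fun N => s N - N) atTop (𝓝 c))
    (j k : ℕ) : Tendsto (fun N => bilCoeff N (s N) j k) atTop (𝓝 (bilLim c j k)) := by
  have hs2 : Tendsto s atTop atTop := by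
    have := (tendsto_natCast_atTop_atTop (R := ℝ)).atTop_add hs
    refine this.congr fun N => by ring
  have e1 : ∀ N j, N - 2 - 2 * j = N - (2 + 2 * j) := fun N j => by omega
  have e2 : ∀ N j, N - 1 - 2 * j = N - (1 + 2 * j) := fun N j => by omega
  have h1 := tendsto_sqrt_mul_pochQ (tendsto_half_sub (2 + 2 * j))
  have h2 := tendsto_sqrt_mul_pochQ (tendsto_half_sub (1 + 2 * k))
  have h3 := (Real.continuous_sqrt.tendsto _).comp (tendsto_half_ratio hs (2 + 2 * j))
  have h4 := (Real.continuous_sqrt.tendsto _).comp (tendsto_half_ratio hs (1 + 2 * k))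
  have h5 := (hs.add_const (2 * (k : ℝ))).mul_const
    (pochP j * pochQ k / (2 * (2 * j - 2 * k + 1)))
  have h6 := (((h1.mul h2).mul (h3.mul h4)).mul h5)
  have hlim : Real.sqrt 2 / Real.sqrt Real.pi * (Real.sqrt 2 / Real.sqrt Real.pi) *
      (Real.sqrt 1 * Real.sqrt 1) *
      ((c + 2 * (k : ℝ)) * (pochP j * pochQ k / (2 * (2 * j - 2 * k + 1)))) = bilLim c j k := by
    rw [Real.sqrt_one, div_mul_div_comm, Real.mul_self_sqrt (by norm_num),
      Real.mul_self_sqrt Real.pi_pos.le, bilLim]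
    have := two_sub_ne j k
    have := Real.pi_pos.ne'
    field_simp
  rw [hlim] at h6
  refine h6.congr' ?_
  filter_upwards [hs2.eventually_gt_atTop 0] with N hN
  simp only [Function.comp_apply]
  rw [Real.sqrt_div (by positivity), Real.sqrt_div (by positivity), bilCoeff, e1, e2,
    pochP_eq_sqrt ((N - (2 + 2 * j)) / 2), pochP_eq_sqrt ((N - (1 + 2 * k)) / 2)]
  have := two_sub_ne j k
  have h7 : Real.sqrt (s N) ≠ 0 := (Real.sqrt_pos.2 hN).ne'
  have h8 : s N = Real.sqrt (s N) * Real.sqrt (s N) := (Real.mul_self_sqrt hN.le).symm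
  rw [show ∀ x : ℝ, x / (2 * s N * (2 * j - 2 * k + 1)) =
    x / (2 * (Real.sqrt (s N) * Real.sqrt (s N)) * (2 * j - 2 * k + 1)) by
      intro x; rw [← h8]]
  field_simp

/-- The decay N^{-1/2} of the product against the growth N^{1/2} of the Pochhammer symbol; the
parity-dependent prefactor tends to 1/2 in both cases. -/
theorem tendsto_linCoeff {s : ℕ → ℝ} {c : ℝ} (hc : 0 < c)
    (hs : Tendsto (fun N => s N - N) atTop (𝓝 c))
    (k : ℕ) : Tendsto (fun N => linCoeff N (s N) k) atTop (𝓝 (gammaRatio c * pochQ k)) := by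
  have hs2 : Tendsto s atTop atTop := by
    have := (tendsto_natCast_atTop_atTop (R := ℝ)).atTop_add hs
    refine this.congr fun N => by ring
  have e2 : ∀ N j, N - 1 - 2 * j = N - (1 + 2 * j) := fun N j => by omega
  have h1 := tendsto_sqrt_mul_ratioProd_seq hc hs (tendsto_half_sub 0)
  have h2 := tendsto_sqrt_mul_pochQ (tendsto_half_sub (1 + 2 * k))
  have h3 := (Real.continuous_sqrt.tendsto _).comp
    ((tendsto_half_ratio hs (1 + 2 * k)).div (tendsto_half_ratio hs 0) one_ne_zero)
  have h4 : Tendsto (fun N => if Even N then (1 / 2 : ℝ) else (s N - 1) / (2 * s N)) atTop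
      (𝓝 (1 / 2)) := by
    refine Tendsto.if' tendsto_const_nhds ?_
    have h5 : Tendsto (fun N => 1 / 2 - 1 / 2 * (s N)⁻¹) atTop (𝓝 (1 / 2 - 1 / 2 * 0)) :=
      ((tendsto_inv_atTop_zero.comp hs2).const_mul _).const_sub _
    rw [mul_zero, sub_zero] at h5
    refine h5.congr' ?_
    filter_upwards [hs2.eventually_gt_atTop 0] with N hN
    field_simp
  have h6 := ((h4.mul h1).mul (h2.mul h3)).mul_const (pochQ k)
  have hlim : 1 / 2 * (Real.sqrt 2 * (Real.Gamma ((c + 1) / 2) / Real.Gamma (c / 2))) *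
      (Real.sqrt 2 / Real.sqrt Real.pi * Real.sqrt (1 / 1)) * pochQ k =
      gammaRatio c * pochQ k := by
    rw [gammaRatio, div_one, Real.sqrt_one]
    linear_combination (1 / 2 * (Real.Gamma ((c + 1) / 2) / Real.Gamma (c / 2)) *
      (1 / Real.sqrt Real.pi) * pochQ k) * Real.mul_self_sqrt (by norm_num : (0 : ℝ) ≤ 2)
  rw [hlim] at h6
  refine h6.congr' ?_
  filter_upwards [hs2.eventually_gt_atTop 0] with N hN
  simp only [Function.comp_apply, Pi.div_apply, Nat.sub_zero]
  rw [linCoeff, e2, pochP_eq_sqrt ((N - (1 + 2 * k)) / 2), div_div_div_cancel_right₀ hN.ne',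
    Real.sqrt_div (by positivity)]
  have h7 : Real.sqrt (2 * ((N / 2 : ℕ) : ℝ) + 1) ≠ 0 := (Real.sqrt_pos.2 (by positivity)).ne'
  field_simp

theorem abs_two_sub_ge (j k : ℕ) : (1 : ℝ) ≤ |2 * (j : ℝ) - 2 * k + 1| := by
  have h : (1 : ℤ) ≤ |2 * (j : ℤ) - 2 * k + 1| := Int.one_le_abs (by omega)
  exact_mod_cast h

theorem abs_bilCoeff_le {N : ℕ} {s : ℝ} (hs : (N : ℝ) < s) {j k : ℕ} (hj : j < N / 2)
    (hk : k < (N + 1) / 2) :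
    |bilCoeff N s j k| ≤ (s - N + 2 * k) * (2 * j + 1) := by
  have h0 : 0 < s := lt_of_le_of_lt (Nat.cast_nonneg N) hs
  have hc : 0 ≤ s - N + 2 * k := by
    have : (0 : ℝ) ≤ k := Nat.cast_nonneg k
    linarith
  have hp : ∀ a : ℕ, 2 * a + 1 ≤ N → pochP a ≤ Real.sqrt s := fun a ha =>
    (pochP_le_sqrt a).trans (Real.sqrt_le_sqrt (by
      have : (2 * a + 1 : ℝ) ≤ N := by exact_mod_cast ha
      linarith))
  have h1 := hp ((N - 2 - 2 * j) / 2) (by omega)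
  have h2 := hp ((N - 1 - 2 * k) / 2) (by omega)
  have h3 : pochP ((N - 2 - 2 * j) / 2) * pochP ((N - 1 - 2 * k) / 2) ≤ s := by
    calc _ ≤ Real.sqrt s * Real.sqrt s := mul_le_mul h1 h2 (pochP_pos _).le (Real.sqrt_nonneg _)
      _ = s := Real.mul_self_sqrt h0.le
  have h4 : pochP j * pochQ k ≤ 2 * j + 1 := by
    calc _ ≤ (2 * (j : ℝ) + 1) * 1 := mul_le_mul (pochP_le j) (pochQ_le_one k) (pochQ_pos k).le
          (by positivity)
      _ = _ := mul_one _
  have h5 := abs_two_sub_ge j k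
  rw [bilCoeff, abs_div, abs_mul (2 * s), abs_of_pos (by positivity : 0 < 2 * s),
    abs_of_nonneg (mul_nonneg (mul_nonneg (mul_nonneg (mul_nonneg (pochP_pos _).le (pochP_pos _).le)
      hc) (pochP_pos j).le) (pochQ_pos k).le), div_le_iff₀ (by positivity)]
  calc _ = (pochP ((N - 2 - 2 * j) / 2) * pochP ((N - 1 - 2 * k) / 2)) *
        ((s - N + 2 * k) * (pochP j * pochQ k)) := by ring
    _ ≤ s * ((s - N + 2 * k) * (2 * j + 1)) := mul_le_mul h3 (mul_le_mul_of_nonneg_left h4 hc)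
        (mul_nonneg hc (mul_nonneg (pochP_pos _).le (pochQ_pos _).le)) h0.le
    _ ≤ (s - N + 2 * k) * (2 * j + 1) * (2 * s * |2 * (j : ℝ) - 2 * k + 1|) := by
        have : 0 ≤ (s - N + 2 * k) * (2 * j + 1) * s := by positivity
        nlinarith

/-- With c = s-N the square of the large factors is at most cN/(c+2⌊N/2⌋) ≤ 2c. The second
inequality uses N ≤ 2⌊N/2⌋+1 and 2c ≥ 1. -/
theorem abs_linCoeff_le {N : ℕ} {s : ℝ} (hs : (N : ℝ) + 1 / 2 ≤ s) {k : ℕ}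
    (hk : k < (N + 1) / 2) : |linCoeff N s k| ≤ s - N + 1 := by
  have hN0 : (0 : ℝ) ≤ N := Nat.cast_nonneg N
  have h0 : 0 < s := by linarith
  have hN1 : 1 ≤ N := by omega
  have hN1' : (1 : ℝ) ≤ N := by exact_mod_cast hN1
  have hc : 0 < s - N := by linarith
  have hD := ratioProd_nonneg (N / 2) hc.le
  have hp0 := pochP_pos ((N - 1 - 2 * k) / 2)
  have h1 : (if Even N then (1 / 2 : ℝ) else (s - 1) / (2 * s)) ≤ 1 := by
    split_ifs
    · norm_num
    · rw [div_le_one (by positivity)]; linarith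
  have h1' : 0 ≤ (if Even N then (1 / 2 : ℝ) else (s - 1) / (2 * s)) := by
    split_ifs
    · norm_num
    · exact div_nonneg (by linarith) (by positivity)
  have h2 : ratioProd (N / 2) (s - N) * pochP ((N - 1 - 2 * k) / 2) ≤ s - N + 1 := by
    refine le_of_sq_le_sq ?_ (by linarith) |>.trans le_rfl
    have e1 := ratioProd_sq_le (N / 2) hc
    have e2 : pochP ((N - 1 - 2 * k) / 2) ^ 2 ≤ N := by
      have h3 := pochP_le_sqrt ((N - 1 - 2 * k) / 2)
      have h4 : 2 * (((N - 1 - 2 * k) / 2 : ℕ) : ℝ) + 1 ≤ N := by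
        exact_mod_cast (by omega : 2 * ((N - 1 - 2 * k) / 2) + 1 ≤ N)
      calc _ ≤ Real.sqrt (2 * (((N - 1 - 2 * k) / 2 : ℕ) : ℝ) + 1) ^ 2 :=
            pow_le_pow_left₀ hp0.le h3 2
        _ ≤ N := by rw [Real.sq_sqrt (by positivity)]; exact h4
    have e3 : (N : ℝ) - 1 ≤ 2 * ((N / 2 : ℕ) : ℝ) := by
      have : N ≤ 2 * (N / 2) + 1 := by omega
      have : (N : ℝ) ≤ 2 * ((N / 2 : ℕ) : ℝ) + 1 := by exact_mod_cast this
      linarith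
    rw [mul_pow]
    calc _ ≤ (s - N) / (s - N + 2 * ((N / 2 : ℕ) : ℝ)) * N :=
          mul_le_mul e1 e2 (sq_nonneg _) (by positivity)
      _ ≤ 2 * (s - N) := by
          rw [div_mul_eq_mul_div, div_le_iff₀ (by positivity)]
          nlinarith
      _ ≤ (s - N + 1) ^ 2 := by nlinarith
  rw [linCoeff, abs_of_nonneg (mul_nonneg (mul_nonneg h1' hD) (mul_nonneg hp0.le (pochQ_pos k).le))]
  calc _ = (if Even N then (1 / 2 : ℝ) else (s - 1) / (2 * s)) *
        ((ratioProd (N / 2) (s - N) * pochP ((N - 1 - 2 * k) / 2)) * pochQ k) := by ring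
    _ ≤ 1 * ((s - N + 1) * 1) := mul_le_mul h1 (mul_le_mul h2 (pochQ_le_one k) (pochQ_pos k).le
        (by linarith)) (mul_nonneg (mul_nonneg hD hp0.le) (pochQ_pos k).le) zero_le_one
    _ = _ := by ring

/- ## Limits of the forms -/

/-- The limit of the bilinear part. -/
noncomputable def bilInf (c : ℝ) (F G : ℕ → ℂ) : ℂ :=
  ∑' p : ℕ × ℕ, (bilLim c p.1 p.2 : ℂ) *
    (F (2 * p.1 + 2) * G (2 * p.2 + 1) - F (2 * p.2 + 1) * G (2 * p.1 + 2))

/-- The limit of the linear part. -/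
noncomputable def linInf (c : ℝ) (F : ℕ → ℂ) : ℂ :=
  ∑' k : ℕ, ((gammaRatio c * pochQ k : ℝ) : ℂ) * F (2 * k + 1)

/-- A summable majorant for the terms of the bilinear forms. -/
noncomputable def bilMaj (r : ℝ) (p : ℕ × ℕ) : ℝ :=
  ((2 * p.1 + 1) * r ^ (2 * p.1 + 2)) * ((2 * p.2 + 1) * r ^ (2 * p.2 + 1))

theorem bilMaj_nonneg {r : ℝ} (hr : 0 ≤ r) (p : ℕ × ℕ) : 0 ≤ bilMaj r p := by
  unfold bilMaj; positivity

theorem summable_linear_geometric {r : ℝ} (hr : 0 ≤ r) (hr1 : r < 1) (i : ℕ) :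
    Summable fun j : ℕ => (2 * j + 1 : ℝ) * r ^ (2 * j + i) := by
  have h1 : r ^ 2 < 1 := pow_lt_one₀ hr hr1 two_ne_zero
  have h2 : ‖r ^ 2‖ < 1 := by rwa [Real.norm_of_nonneg (sq_nonneg r)]
  have h3 := ((summable_pow_mul_geometric_of_norm_lt_one 1 h2).mul_left 2).add
    (summable_geometric_of_norm_lt_one h2)
  refine (h3.mul_right (r ^ i)).congr fun j => ?_
  rw [pow_add, pow_mul]; ring

theorem summable_bilMaj {r : ℝ} (hr : 0 ≤ r) (hr1 : r < 1) : Summable (bilMaj r) :=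
  (summable_linear_geometric hr hr1 2).mul_of_nonneg (summable_linear_geometric hr hr1 1)
    (fun _ => by positivity) (fun _ => by positivity)

theorem summable_linMaj {r : ℝ} (hr : 0 ≤ r) (hr1 : r < 1) :
    Summable fun k : ℕ => r ^ (2 * k + 1) := by
  have h1 : r ^ 2 < 1 := pow_lt_one₀ hr hr1 two_ne_zero
  refine ((summable_geometric_of_lt_one (sq_nonneg r) h1).mul_right r).congr fun j => ?_
  rw [pow_add, pow_mul, pow_one]

theorem norm_cross_le {F G : ℕ → ℂ} {A B r : ℝ} (hF : ∀ l, 1 ≤ l → ‖F l‖ ≤ A * r ^ l)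
    (hG : ∀ l, 1 ≤ l → ‖G l‖ ≤ B * r ^ l) (j k : ℕ) :
    ‖F (2 * j + 2) * G (2 * k + 1) - F (2 * k + 1) * G (2 * j + 2)‖ ≤
      2 * A * B * (r ^ (2 * j + 2) * r ^ (2 * k + 1)) := by
  have h1 := hF (2 * j + 2) (by omega)
  have h2 := hF (2 * k + 1) (by omega)
  have h3 := hG (2 * j + 2) (by omega)
  have h4 := hG (2 * k + 1) (by omega)
  refine (norm_sub_le _ _).trans ?_
  rw [norm_mul, norm_mul]
  have h5 := mul_le_mul h1 h4 (norm_nonneg _) ((norm_nonneg _).trans h1)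
  have h6 := mul_le_mul h2 h3 (norm_nonneg _) ((norm_nonneg _).trans h2)
  calc _ ≤ _ := add_le_add h5 h6
    _ = _ := by ring

theorem norm_mul_cross_le {F G : ℕ → ℂ} {A B r a M : ℝ} (hF : ∀ l, 1 ≤ l → ‖F l‖ ≤ A * r ^ l)
    (hG : ∀ l, 1 ≤ l → ‖G l‖ ≤ B * r ^ l) (hM : 0 ≤ M) (p : ℕ × ℕ)
    (ha : |a| ≤ M * ((2 * p.1 + 1) * (2 * p.2 + 1))) :
    ‖(a : ℂ) * (F (2 * p.1 + 2) * G (2 * p.2 + 1) - F (2 * p.2 + 1) * G (2 * p.1 + 2))‖ ≤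
      M * (2 * A * B) * bilMaj r p := by
  rw [norm_mul, Complex.norm_real, Real.norm_eq_abs]
  calc _ ≤ M * ((2 * p.1 + 1) * (2 * p.2 + 1)) *
        (2 * A * B * (r ^ (2 * p.1 + 2) * r ^ (2 * p.2 + 1))) :=
        mul_le_mul ha (norm_cross_le hF hG _ _) (norm_nonneg _) (by positivity)
    _ = _ := by rw [bilMaj]; ring

/-- The bilinear coefficients, extended by zero. -/
noncomputable def bilExt (N : ℕ) (s : ℝ) (p : ℕ × ℕ) : ℝ :=
  if p.1 < N / 2 ∧ p.2 < (N + 1) / 2 then bilCoeff N s p.1 p.2 else 0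

/-- The linear coefficients, extended by zero. -/
noncomputable def linExt (N : ℕ) (s : ℝ) (k : ℕ) : ℝ :=
  if k < (N + 1) / 2 then linCoeff N s k else 0

/-- Extension by zero makes the index set independent of N, as dominated convergence for series
requires. -/
theorem bilHat_eq_tsum (N : ℕ) (s : ℝ) (F G : ℕ → ℂ) :
    bilHat N s F G = ∑' p : ℕ × ℕ, (bilExt N s p : ℂ) *
      (F (2 * p.1 + 2) * G (2 * p.2 + 1) - F (2 * p.2 + 1) * G (2 * p.1 + 2)) := by
  rw [tsum_eq_sum (s := Finset.range (N / 2) ×ˢ Finset.range ((N + 1) / 2)), Finset.sum_product,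
    bilHat]
  · refine Finset.sum_congr rfl fun j hj => Finset.sum_congr rfl fun k hk => ?_
    rw [bilExt, if_pos ⟨Finset.mem_range.1 hj, Finset.mem_range.1 hk⟩]
  · intro p hp
    rw [bilExt, if_neg, Complex.ofReal_zero, zero_mul]
    intro h
    exact hp (Finset.mem_product.2 ⟨Finset.mem_range.2 h.1, Finset.mem_range.2 h.2⟩)

theorem linHat_eq_tsum (N : ℕ) (s : ℝ) (F : ℕ → ℂ) :
    linHat N s F = ∑' k : ℕ, (linExt N s k : ℂ) * F (2 * k + 1) := by
  rw [tsum_eq_sum (s := Finset.range ((N + 1) / 2)), linHat]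
  · refine Finset.sum_congr rfl fun k hk => ?_
    rw [linExt, if_pos (Finset.mem_range.1 hk)]
  · intro k hk
    rw [linExt, if_neg (fun h => hk (Finset.mem_range.2 h)), Complex.ofReal_zero, zero_mul]

theorem abs_bilExt_le {N : ℕ} {s : ℝ} (hs : (N : ℝ) < s) (p : ℕ × ℕ) :
    |bilExt N s p| ≤ (s - N + 1) * ((2 * p.1 + 1) * (2 * p.2 + 1)) := by
  rw [bilExt]
  have hc : 0 < s - N := by linarith
  split_ifs with h
  · refine (abs_bilCoeff_le hs h.1 h.2).trans ?_
    have h1 : (0 : ℝ) ≤ p.1 := Nat.cast_nonneg _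
    have h2 : (0 : ℝ) ≤ p.2 := Nat.cast_nonneg _
    have h3 : (s - N + 2 * p.2) ≤ (s - N + 1) * (2 * p.2 + 1) := by nlinarith
    calc _ ≤ (s - N + 1) * (2 * p.2 + 1) * (2 * p.1 + 1) :=
          mul_le_mul_of_nonneg_right h3 (by positivity)
      _ = _ := by ring
  · rw [abs_zero]; positivity

theorem abs_linExt_le {N : ℕ} {s : ℝ} (hs : (N : ℝ) + 1 / 2 ≤ s) (k : ℕ) :
    |linExt N s k| ≤ s - N + 1 := by
  rw [linExt]
  split_ifs with h
  · exact abs_linCoeff_le hs h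
  · rw [abs_zero]; linarith

theorem abs_bilLim_le {c : ℝ} (hc : 0 ≤ c) (p : ℕ × ℕ) :
    |bilLim c p.1 p.2| ≤ (c + 1) * ((2 * p.1 + 1) * (2 * p.2 + 1)) := by
  have h1 : (0 : ℝ) ≤ p.1 := Nat.cast_nonneg _
  have h2 : (0 : ℝ) ≤ p.2 := Nat.cast_nonneg _
  have h4 : pochP p.1 * pochQ p.2 ≤ 2 * p.1 + 1 := by
    calc _ ≤ (2 * (p.1 : ℝ) + 1) * 1 := mul_le_mul (pochP_le _) (pochQ_le_one _) (pochQ_pos _).le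
          (by positivity)
      _ = _ := mul_one _
  have h5 := abs_two_sub_ge p.1 p.2
  have h6 : |1 / Real.pi| ≤ 1 := by
    rw [abs_of_pos (by positivity), div_le_one Real.pi_pos]
    linarith [Real.pi_gt_three]
  rw [bilLim, abs_mul, abs_div ((c + _) * _ * _), mul_assoc (c + _), abs_of_nonneg (mul_nonneg (by positivity)
    (mul_nonneg (pochP_pos _).le (pochQ_pos _).le))]
  calc _ ≤ 1 * ((c + 2 * p.2) * (2 * p.1 + 1)) := by
        refine mul_le_mul h6 ?_ (div_nonneg (mul_nonneg (by positivity)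
          (mul_nonneg (pochP_pos _).le (pochQ_pos _).le)) (abs_nonneg _)) zero_le_one
        rw [div_le_iff₀ (by linarith)]
        calc _ ≤ (c + 2 * p.2) * (2 * (p.1 : ℝ) + 1) :=
              mul_le_mul_of_nonneg_left h4 (by positivity)
          _ ≤ _ := le_mul_of_one_le_right (by positivity) h5
    _ ≤ (c + 1) * (2 * p.2 + 1) * (2 * p.1 + 1) := by
        rw [one_mul]
        exact mul_le_mul_of_nonneg_right (by nlinarith) (by positivity)
    _ = _ := by ring

theorem summable_bilInf {c : ℝ} (hc : 0 ≤ c) {F G : ℕ → ℂ} {A B r : ℝ} (hr : 0 ≤ r) (hr1 : r < 1)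
    (hF : ∀ l, 1 ≤ l → ‖F l‖ ≤ A * r ^ l) (hG : ∀ l, 1 ≤ l → ‖G l‖ ≤ B * r ^ l) :
    Summable fun p : ℕ × ℕ => (bilLim c p.1 p.2 : ℂ) *
      (F (2 * p.1 + 2) * G (2 * p.2 + 1) - F (2 * p.2 + 1) * G (2 * p.1 + 2)) :=
  Summable.of_norm_bounded ((summable_bilMaj hr hr1).mul_left _) fun p =>
    norm_mul_cross_le hF hG (by linarith) p (abs_bilLim_le hc p)

theorem gammaRatio_pos {c : ℝ} (hc : 0 < c) : 0 < gammaRatio c :=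
  mul_pos (by positivity) (div_pos (Real.Gamma_pos_of_pos (by linarith))
    (Real.Gamma_pos_of_pos (by linarith)))

theorem abs_gammaRatio_mul_le {c : ℝ} (hc : 0 < c) (k : ℕ) :
    |gammaRatio c * pochQ k| ≤ gammaRatio c := by
  rw [abs_of_pos (mul_pos (gammaRatio_pos hc) (pochQ_pos k))]
  exact mul_le_of_le_one_right (gammaRatio_pos hc).le (pochQ_le_one k)

theorem norm_mul_lin_le {F : ℕ → ℂ} {A r a M : ℝ} (hF : ∀ l, 1 ≤ l → ‖F l‖ ≤ A * r ^ l) (k : ℕ)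
    (ha : |a| ≤ M) : ‖(a : ℂ) * F (2 * k + 1)‖ ≤ M * A * r ^ (2 * k + 1) := by
  rw [norm_mul, Complex.norm_real, Real.norm_eq_abs, mul_assoc]
  exact mul_le_mul ha (hF _ (by omega)) (norm_nonneg _) ((abs_nonneg _).trans ha)

theorem summable_linInf {c : ℝ} (hc : 0 < c) {F : ℕ → ℂ} {A r : ℝ} (hr : 0 ≤ r) (hr1 : r < 1)
    (hF : ∀ l, 1 ≤ l → ‖F l‖ ≤ A * r ^ l) :
    Summable fun k : ℕ => ((gammaRatio c * pochQ k : ℝ) : ℂ) * F (2 * k + 1) :=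
  Summable.of_norm_bounded ((summable_linMaj hr hr1).mul_left _) fun k =>
    norm_mul_lin_le hF k (abs_gammaRatio_mul_le hc k)

theorem norm_bilHat_le {N : ℕ} {s : ℝ} (hs : (N : ℝ) < s) {F G : ℕ → ℂ} {A B r : ℝ} (hr : 0 ≤ r)
    (hr1 : r < 1) (hF : ∀ l, 1 ≤ l → ‖F l‖ ≤ A * r ^ l) (hG : ∀ l, 1 ≤ l → ‖G l‖ ≤ B * r ^ l) :
    ‖bilHat N s F G‖ ≤ (s - N + 1) * (2 * A * B) * ∑' p, bilMaj r p := by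
  rw [bilHat_eq_tsum, ← tsum_mul_left]
  exact tsum_of_norm_bounded ((summable_bilMaj hr hr1).mul_left _).hasSum fun p =>
    norm_mul_cross_le hF hG (by linarith) p (abs_bilExt_le hs p)

theorem norm_linHat_le {N : ℕ} {s : ℝ} (hs : (N : ℝ) + 1 / 2 ≤ s) {F : ℕ → ℂ} {A r : ℝ}
    (hr : 0 ≤ r) (hr1 : r < 1) (hF : ∀ l, 1 ≤ l → ‖F l‖ ≤ A * r ^ l) :
    ‖linHat N s F‖ ≤ (s - N + 1) * A * ∑' k : ℕ, r ^ (2 * k + 1) := by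
  rw [linHat_eq_tsum, ← tsum_mul_left]
  exact tsum_of_norm_bounded ((summable_linMaj hr hr1).mul_left _).hasSum fun k =>
    norm_mul_lin_le hF k (abs_linExt_le hs k)

theorem tendsto_mul_sub_mul {ι : Type*} {L : Filter ι} {f g f' g' : ι → ℂ} {A B : ℝ}
    (hf : Tendsto (fun i => f i - f' i) L (𝓝 0)) (hg : Tendsto (fun i => g i - g' i) L (𝓝 0))
    (hA : ∀ᶠ i in L, ‖g i‖ ≤ A) (hB : ∀ᶠ i in L, ‖f' i‖ ≤ B) :
    Tendsto (fun i => f i * g i - f' i * g' i) L (𝓝 0) := by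
  have h1 : Tendsto (fun i => ‖f i - f' i‖ * A + B * ‖g i - g' i‖) L (𝓝 (0 * A + B * 0)) :=
    ((tendsto_zero_iff_norm_tendsto_zero.1 hf).mul_const A).add
      ((tendsto_zero_iff_norm_tendsto_zero.1 hg).const_mul B)
  rw [zero_mul, mul_zero, add_zero] at h1
  refine squeeze_zero_norm' ?_ h1
  filter_upwards [hA, hB] with i h2 h3
  calc ‖f i * g i - f' i * g' i‖ = ‖(f i - f' i) * g i + f' i * (g i - g' i)‖ := by congr 1; ring
    _ ≤ ‖(f i - f' i) * g i‖ + ‖f' i * (g i - g' i)‖ := norm_add_le _ _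
    _ ≤ _ := by
      rw [norm_mul, norm_mul]
      exact add_le_add (mul_le_mul_of_nonneg_left h2 (norm_nonneg _))
        (mul_le_mul_of_nonneg_right h3 (norm_nonneg _))

theorem tendsto_bilExt {s : ℕ → ℝ} {c : ℝ} (hs : Tendsto (fun N => s N - N) atTop (𝓝 c))
    (p : ℕ × ℕ) : Tendsto (fun N => bilExt N (s N) p) atTop (𝓝 (bilLim c p.1 p.2)) := by
  refine (tendsto_bilCoeff hs p.1 p.2).congr' ?_
  filter_upwards [eventually_ge_atTop (2 * (p.1 + p.2 + 1))] with N hN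
  rw [bilExt, if_pos ⟨by omega, by omega⟩]

theorem tendsto_linExt {s : ℕ → ℝ} {c : ℝ} (hc : 0 < c)
    (hs : Tendsto (fun N => s N - N) atTop (𝓝 c))
    (k : ℕ) : Tendsto (fun N => linExt N (s N) k) atTop (𝓝 (gammaRatio c * pochQ k)) := by
  refine (tendsto_linCoeff hc hs k).congr' ?_
  filter_upwards [eventually_ge_atTop (2 * (k + 1))] with N hN
  rw [linExt, if_pos (by omega)]

section
variable {ι : Type*} {L : Filter ι} {n : ι → ℕ} {s : ℕ → ℝ} {c A B r : ℝ}

/-- Dominated convergence along an arbitrary filter. Only the differences F - F' are assumed to tend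
to zero, because the sequences themselves need not converge: their formula changes when the moving
point enters or leaves the real line. -/
theorem tendsto_bilHat_sub {F G F' G' : ι → ℕ → ℂ}
    (hn : Tendsto n L atTop) (hsN : ∀ N : ℕ, (N : ℝ) < s N) (hc : 0 ≤ c)
    (hs : Tendsto (fun N => s N - N) atTop (𝓝 c)) (hr : 0 ≤ r) (hr1 : r < 1)
    (hFF : ∀ l, 1 ≤ l → Tendsto (fun i => F i l - F' i l) L (𝓝 0))
    (hGG : ∀ l, 1 ≤ l → Tendsto (fun i => G i l - G' i l) L (𝓝 0))
    (hF : ∀ᶠ i in L, ∀ l, 1 ≤ l → ‖F i l‖ ≤ A * r ^ l)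
    (hG : ∀ᶠ i in L, ∀ l, 1 ≤ l → ‖G i l‖ ≤ B * r ^ l)
    (hF' : ∀ᶠ i in L, ∀ l, 1 ≤ l → ‖F' i l‖ ≤ A * r ^ l)
    (hG' : ∀ᶠ i in L, ∀ l, 1 ≤ l → ‖G' i l‖ ≤ B * r ^ l) :
    Tendsto (fun i => bilHat (n i) (s (n i)) (F i) (G i) - bilInf c (F' i) (G' i)) L (𝓝 0) := by
  have hbd : ∀ᶠ i in L, s (n i) - n i + 1 ≤ c + 2 :=
    (((hs.comp hn).add_const 1).eventually (gt_mem_nhds (by linarith : c + 1 < c + 2))).mono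
      fun i h => le_of_lt h
  have hcross : ∀ a b, 1 ≤ a → 1 ≤ b →
      Tendsto (fun i => F i a * G i b - F' i a * G' i b) L (𝓝 0) := fun a b ha hb =>
    tendsto_mul_sub_mul (hFF a ha) (hGG b hb) (hG.mono fun i h => h b hb)
      (hF'.mono fun i h => h a ha)
  have key : Tendsto (fun i => ∑' p : ℕ × ℕ,
      ((bilExt (n i) (s (n i)) p : ℂ) * (F i (2 * p.1 + 2) * G i (2 * p.2 + 1) -
        F i (2 * p.2 + 1) * G i (2 * p.1 + 2)) -
      (bilLim c p.1 p.2 : ℂ) * (F' i (2 * p.1 + 2) * G' i (2 * p.2 + 1) -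
        F' i (2 * p.2 + 1) * G' i (2 * p.1 + 2)))) L (𝓝 (∑' _ : ℕ × ℕ, 0)) := by
    refine tendsto_tsum_of_dominated_convergence
      (bound := fun p => (c + 2) * (2 * A * B) * bilMaj r p + (c + 1) * (2 * A * B) * bilMaj r p)
      (((summable_bilMaj hr hr1).mul_left _).add ((summable_bilMaj hr hr1).mul_left _))
      (fun p => ?_) ?_
    · refine tendsto_mul_sub_mul (A := 2 * A * B * (r ^ (2 * p.1 + 2) * r ^ (2 * p.2 + 1)))
        (B := |bilLim c p.1 p.2|) ?_ ?_ ?_ ?_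
      · have := (((Complex.continuous_ofReal.tendsto _).comp
          ((tendsto_bilExt hs p).comp hn)).sub_const (bilLim c p.1 p.2 : ℂ))
        rw [sub_self] at this
        exact this
      · have := (hcross (2 * p.1 + 2) (2 * p.2 + 1) (by omega) (by omega)).sub
          (hcross (2 * p.2 + 1) (2 * p.1 + 2) (by omega) (by omega))
        rw [sub_zero] at this
        exact this.congr fun i => by ring
      · filter_upwards [hF, hG] with i h1 h2
        exact norm_cross_le h1 h2 _ _
      · exact Eventually.of_forall fun i => by rw [Complex.norm_real, Real.norm_eq_abs]
    · filter_upwards [hF, hG, hF', hG', hbd] with i h1 h2 h3 h4 h5 p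
      refine (norm_sub_le _ _).trans (add_le_add ?_ ?_)
      · exact norm_mul_cross_le h1 h2 (by linarith) p ((abs_bilExt_le (hsN _) p).trans
          (mul_le_mul_of_nonneg_right h5 (by positivity)))
      · exact norm_mul_cross_le h3 h4 (by linarith) p (abs_bilLim_le hc p)
  rw [tsum_zero] at key
  refine key.congr' ?_
  filter_upwards [hF, hG, hF', hG'] with i h1 h2 h3 h4
  rw [bilHat_eq_tsum, bilInf, Summable.tsum_sub]
  · exact Summable.of_norm_bounded ((summable_bilMaj hr hr1).mul_left _) fun p =>
      norm_mul_cross_le h1 h2 (by linarith [hsN (n i)]) p (abs_bilExt_le (hsN _) p)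
  · exact summable_bilInf hc hr hr1 h3 h4

theorem tendsto_linHat_sub {F F' : ι → ℕ → ℂ}
    (hn : Tendsto n L atTop) (hc : 1 ≤ c)
    (hs : Tendsto (fun N => s N - N) atTop (𝓝 c)) (hr : 0 ≤ r) (hr1 : r < 1)
    (hFF : ∀ l, 1 ≤ l → Tendsto (fun i => F i l - F' i l) L (𝓝 0))
    (hF : ∀ᶠ i in L, ∀ l, 1 ≤ l → ‖F i l‖ ≤ A * r ^ l)
    (hF' : ∀ᶠ i in L, ∀ l, 1 ≤ l → ‖F' i l‖ ≤ A * r ^ l) :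
    Tendsto (fun i => linHat (n i) (s (n i)) (F i) - linInf c (F' i)) L (𝓝 0) := by
  have hc0 : 0 < c := by linarith
  have hbd : ∀ᶠ i in L, s (n i) - n i + 1 ≤ c + 2 :=
    (((hs.comp hn).add_const 1).eventually (gt_mem_nhds (by linarith : c + 1 < c + 2))).mono
      fun i h => le_of_lt h
  have hlow : ∀ᶠ i in L, (n i : ℝ) + 1 / 2 ≤ s (n i) :=
    ((hs.comp hn).eventually (lt_mem_nhds (by linarith : 1 / 2 < c))).mono fun i h => by
      have h : 1 / 2 < s (n i) - n i := h
      linarith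
  have key : Tendsto (fun i => ∑' k : ℕ,
      ((linExt (n i) (s (n i)) k : ℂ) * F i (2 * k + 1) -
      ((gammaRatio c * pochQ k : ℝ) : ℂ) * F' i (2 * k + 1))) L (𝓝 (∑' _ : ℕ, 0)) := by
    refine tendsto_tsum_of_dominated_convergence
      (bound := fun k => (c + 2) * A * r ^ (2 * k + 1) + gammaRatio c * A * r ^ (2 * k + 1))
      (((summable_linMaj hr hr1).mul_left _).add ((summable_linMaj hr hr1).mul_left _))
      (fun k => ?_) ?_
    · refine tendsto_mul_sub_mul (A := A * r ^ (2 * k + 1))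
        (B := |gammaRatio c * pochQ k|) ?_ (hFF _ (by omega)) ?_ ?_
      · have := (((Complex.continuous_ofReal.tendsto _).comp
          ((tendsto_linExt hc0 hs k).comp hn)).sub_const ((gammaRatio c * pochQ k : ℝ) : ℂ))
        rw [sub_self] at this
        exact this
      · exact hF.mono fun i h => h _ (by omega)
      · exact Eventually.of_forall fun i => by rw [Complex.norm_real, Real.norm_eq_abs]
    · filter_upwards [hF, hF', hbd, hlow] with i h1 h2 h3 h4 k
      refine (norm_sub_le _ _).trans (add_le_add ?_ ?_)
      · exact norm_mul_lin_le h1 k ((abs_linExt_le h4 k).trans h3)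
      · exact norm_mul_lin_le h2 k (abs_gammaRatio_mul_le hc0 k)
  rw [tsum_zero] at key
  refine key.congr' ?_
  filter_upwards [hF, hF', hlow] with i h1 h2 h3
  rw [linHat_eq_tsum, linInf, Summable.tsum_sub]
  · exact Summable.of_norm_bounded ((summable_linMaj hr hr1).mul_left _) fun k =>
      norm_mul_lin_le h1 k (abs_linExt_le h3 k)
  · exact summable_linInf hc0 hr hr1 h2

end

/- ## The generating functions -/

theorem choose_eq_pochQ (n : ℕ) : Ring.choose ((1 / 2 : ℂ) + n - 1) n = (pochQ n : ℂ) := by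
  rw [← Ring.multichoose_eq]
  have h1 := Ring.factorial_nsmul_multichoose_eq_ascPochhammer (1 / 2 : ℂ) n
  rw [Polynomial.ascPochhammer_smeval_eq_eval, nsmul_eq_mul] at h1
  have h2 : ∀ n : ℕ, (ascPochhammer ℂ n).eval (1 / 2 : ℂ) = (n.factorial : ℂ) * (pochQ n : ℂ) := by
    intro n
    induction n with
    | zero => simp [pochQ]
    | succ n ih =>
      rw [ascPochhammer_succ_eval, ih, pochQ_succ, Nat.factorial_succ]
      have : (2 * n + 2 : ℂ) ≠ 0 := by exact_mod_cast (by omega : 2 * n + 2 ≠ 0)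
      push_cast
      field_simp
      ring
  rw [h2] at h1
  exact mul_left_cancel₀ (by exact_mod_cast n.factorial_ne_zero) h1

/-- The function `(1 - x ^ 2) ^ (-1/2)`. -/
noncomputable def invSqrt (x : ℂ) : ℂ := 1 / (1 - x ^ 2) ^ (1 / 2 : ℂ)

theorem hasSum_invSqrt {x : ℂ} (hx : ‖x‖ < 1) :
    HasSum (fun k : ℕ => (pochQ k : ℂ) * x ^ (2 * k)) (invSqrt x) := by
  have h := (Complex.one_div_one_sub_cpow_hasFPowerSeriesOnBall_zero (1 / 2)).hasSum
    (y := x ^ 2) (by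
      rw [Metric.mem_eball, edist_zero_right, ← ofReal_norm, norm_pow, ← ENNReal.ofReal_one]
      exact (ENNReal.ofReal_lt_ofReal_iff zero_lt_one).2 (pow_lt_one₀ (norm_nonneg _) hx two_ne_zero))
  simp only [zero_add, FormalMultilinearSeries.ofScalars_apply_eq, choose_eq_pochQ,
    smul_eq_mul, ← pow_mul] at h
  exact h

/-- The bivariate series with coefficients `w k * p_j * q_k / (2 j - 2 k + 1)`. -/
noncomputable def biTerm (w : ℕ → ℝ) (x y : ℂ) (p : ℕ × ℕ) : ℂ :=
  ((w p.2 * (pochP p.1 * pochQ p.2 / (2 * p.1 - 2 * p.2 + 1)) : ℝ) : ℂ) *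
    (x ^ (2 * p.1 + 2) * y ^ (2 * p.2 + 1))

theorem abs_biCoeff_le {w : ℕ → ℝ} (hw : ∀ k, |w k| ≤ 2 * k + 1) (p : ℕ × ℕ) :
    |w p.2 * (pochP p.1 * pochQ p.2 / (2 * p.1 - 2 * p.2 + 1))| ≤
      (2 * p.1 + 1) * (2 * p.2 + 1) := by
  have h4 : pochP p.1 * pochQ p.2 ≤ 2 * p.1 + 1 := by
    calc _ ≤ (2 * (p.1 : ℝ) + 1) * 1 := mul_le_mul (pochP_le _) (pochQ_le_one _) (pochQ_pos _).le
          (by positivity)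
      _ = _ := mul_one _
  have h5 := abs_two_sub_ge p.1 p.2
  rw [abs_mul, abs_div, abs_of_pos (mul_pos (pochP_pos _) (pochQ_pos _)), mul_comm]
  refine mul_le_mul ?_ (hw _) (abs_nonneg _) (by positivity)
  exact (div_le_self (mul_pos (pochP_pos _) (pochQ_pos _)).le h5).trans h4

theorem summable_biTerm {w : ℕ → ℝ} (hw : ∀ k, |w k| ≤ 2 * k + 1) {x y : ℂ} (hx : ‖x‖ < 1)
    (hy : ‖y‖ < 1) : Summable (biTerm w x y) := by
  refine Summable.of_norm_bounded (summable_bilMaj (r := max ‖x‖ ‖y‖)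
    ((norm_nonneg x).trans (le_max_left _ _)) (max_lt hx hy)) fun p => ?_
  rw [biTerm, norm_mul, Complex.norm_real, Real.norm_eq_abs, norm_mul, norm_pow, norm_pow]
  calc _ ≤ ((2 * p.1 + 1) * (2 * p.2 + 1) : ℝ) *
        (max ‖x‖ ‖y‖ ^ (2 * p.1 + 2) * max ‖x‖ ‖y‖ ^ (2 * p.2 + 1)) := by
        refine mul_le_mul (abs_biCoeff_le hw p) ?_ (by positivity) (by positivity)
        exact mul_le_mul (pow_le_pow_left₀ (norm_nonneg _) (le_max_left _ _) _)
          (pow_le_pow_left₀ (norm_nonneg _) (le_max_right _ _) _) (by positivity) (by positivity)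
    _ = _ := by rw [bilMaj]; ring

theorem pochP_pred (k : ℕ) : pochP k = 2 * (k + 1) * pochQ (k + 1) := by
  rw [pochP_eq, pochQ_succ]
  have : (2 * k + 2 : ℝ) ≠ 0 := by positivity
  field_simp

/-- Splitting off the column k = 0 makes the remainder comparable, term by term, with the series in
which the variables are exchanged. -/
theorem tsum_prod_nat_succ {f : ℕ × ℕ → ℂ} (hf : Summable f) :
    ∑' p, f p = (∑' j, f (j, 0)) + ∑' p : ℕ × ℕ, f (p.1, p.2 + 1) := by
  have h1 : Summable fun p : ℕ × ℕ => f (p.1, p.2 + 1) :=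
    hf.comp_injective (i := fun p : ℕ × ℕ => (p.1, p.2 + 1)) (fun p q h => by
      simp only [Prod.mk.injEq, add_left_inj] at h
      exact Prod.ext h.1 h.2)
  rw [hf.tsum_prod, h1.tsum_prod, ← Summable.tsum_add]
  · exact tsum_congr fun j => (hf.prod_factor j).tsum_eq_zero_add
  · exact hf.comp_injective (i := fun j : ℕ => (j, 0)) (fun a b h => (Prod.mk.injEq _ _ _ _ ▸ h).1)
  · exact h1.prod

/-- The generating function with unit weights. -/
noncomputable def genOne (x y : ℂ) : ℂ := ∑' p, biTerm (fun _ => 1) x y p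

/-- The generating function with weights `2 k`. -/
noncomputable def genTwo (x y : ℂ) : ℂ := ∑' p, biTerm (fun k => 2 * k) x y p

theorem abs_one_le (k : ℕ) : |(1 : ℝ)| ≤ 2 * (k : ℝ) + 1 := by
  rw [abs_one]; linarith [(Nat.cast_nonneg k : (0 : ℝ) ≤ k)]

theorem abs_two_mul_le (k : ℕ) : |(2 * k : ℝ)| ≤ 2 * (k : ℝ) + 1 := by
  rw [abs_of_nonneg (by positivity)]; linarith

theorem tsum_swap {f : ℕ × ℕ → ℂ} : ∑' p : ℕ × ℕ, f (p.2, p.1) = ∑' p, f p :=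
  (Equiv.prodComm ℕ ℕ).tsum_eq f

theorem summable_swap {f : ℕ × ℕ → ℂ} (hf : Summable f) :
    Summable fun p : ℕ × ℕ => f (p.2, p.1) :=
  (Equiv.prodComm ℕ ℕ).summable_iff.2 hf

/-- The monomial of index (j, k+1) on the left also occurs in xy times the exchanged series, at
index (k, j), with denominator d = 2k-2j+1 against -d. By p_j = (2j+1)q_j and p_k = (2k+2)q_{k+1}
the numerators add up to d q_j q_{k+1}. The denominator thus cancels, and the product of two
binomial series remains. -/
theorem genOne_add {x y : ℂ} (hx : ‖x‖ < 1) (hy : ‖y‖ < 1) :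
    genOne x y + x * y * genOne y x = x ^ 2 * y * (invSqrt x * invSqrt y) := by
  have s1 := summable_biTerm abs_one_le hx hy
  have s2 := summable_biTerm abs_one_le hy hx
  have hA := hasSum_invSqrt hx
  have hB := hasSum_invSqrt hy
  have hprod : Summable fun p : ℕ × ℕ => x ^ 2 * y *
      (((pochQ p.1 : ℂ) * x ^ (2 * p.1)) * ((pochQ p.2 : ℂ) * y ^ (2 * p.2))) :=
    (summable_mul_of_summable_norm hA.summable.norm hB.summable.norm).mul_left _
  have e0 : x ^ 2 * y * (invSqrt x * invSqrt y) = ∑' p : ℕ × ℕ, x ^ 2 * y *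
      (((pochQ p.1 : ℂ) * x ^ (2 * p.1)) * ((pochQ p.2 : ℂ) * y ^ (2 * p.2))) := by
    rw [tsum_mul_left, ← hA.tsum_eq, ← hB.tsum_eq]
    congr 1
    exact tsum_mul_tsum_of_summable_norm hA.summable.norm hB.summable.norm
  rw [e0, tsum_prod_nat_succ hprod, genOne, tsum_prod_nat_succ s1, add_assoc]
  congr 1
  · refine tsum_congr fun j => ?_
    simp only [biTerm, pochP_eq, pochQ, Finset.range_zero, Finset.prod_empty]
    have : (2 * j + 1 : ℂ) ≠ 0 := by exact_mod_cast (by omega : 2 * j + 1 ≠ 0)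
    push_cast
    rw [mul_zero, sub_zero]
    field_simp
    ring
  · rw [genOne, ← tsum_swap (f := biTerm (fun _ => 1) y x), ← tsum_mul_left, ← Summable.tsum_add]
    · refine tsum_congr fun p => ?_
      simp only [biTerm, pochP_pred p.2, pochP_eq p.1]
      have h2 : (2 * p.2 - 2 * p.1 + 1 : ℂ) ≠ 0 := by
        exact_mod_cast (by omega : (2 * p.2 - 2 * p.1 + 1 : ℤ) ≠ 0)
      have h3 : (2 * p.1 - 2 * (p.2 + 1) + 1 : ℂ) = -(2 * p.2 - 2 * p.1 + 1) := by ring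
      have h4 : (2 * p.1 + 1 : ℂ) = 2 * (p.2 + 1) - (2 * p.2 - 2 * p.1 + 1) := by ring
      push_cast
      rw [h3, h4]
      generalize (2 * p.2 - 2 * p.1 + 1 : ℂ) = d at h2
      field_simp
      ring
    · exact s1.comp_injective (i := fun p : ℕ × ℕ => (p.1, p.2 + 1)) (fun p q h => by
        simp only [Prod.mk.injEq, add_left_inj] at h
        exact Prod.ext h.1 h.2)
    · exact (summable_swap s2).mul_left _

/-- The same comparison with weights: the numerators now combine to (2j-(2j+1))(2k+2) q_j q_{k+1},
which is minus an unweighted term, and the column k = 0 vanishes. -/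
theorem genTwo_add {x y : ℂ} (hx : ‖x‖ < 1) (hy : ‖y‖ < 1) :
    genTwo x y + x * y * genTwo y x = -(x * y * genOne y x) := by
  have s1 := summable_biTerm abs_two_mul_le hx hy
  have s2 := summable_biTerm abs_two_mul_le hy hx
  have s3 := summable_biTerm abs_one_le hy hx
  rw [genTwo, tsum_prod_nat_succ s1]
  have h0 : ∑' j, biTerm (fun k => 2 * k) x y (j, 0) = 0 := by
    simp [biTerm]
  rw [h0, zero_add, genTwo, genOne, ← tsum_swap (f := biTerm (fun k => 2 * k) y x),
    ← tsum_swap (f := biTerm (fun _ => 1) y x), ← tsum_mul_left, ← tsum_mul_left, ← tsum_neg,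
    ← Summable.tsum_add]
  · refine tsum_congr fun p => ?_
    simp only [biTerm, pochP_pred p.2, pochP_eq p.1]
    have h2 : (2 * p.2 - 2 * p.1 + 1 : ℂ) ≠ 0 := by
      exact_mod_cast (by omega : (2 * p.2 - 2 * p.1 + 1 : ℤ) ≠ 0)
    have h3 : (2 * p.1 - 2 * (p.2 + 1) + 1 : ℂ) = -(2 * p.2 - 2 * p.1 + 1) := by ring
    push_cast
    rw [h3]
    field_simp
    ring
  · exact s1.comp_injective (i := fun p : ℕ × ℕ => (p.1, p.2 + 1)) (fun p q h => by
      simp only [Prod.mk.injEq, add_left_inj] at h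
      exact Prod.ext h.1 h.2)
  · exact (summable_swap s2).mul_left _

theorem norm_inv_lt_one {z : ℂ} (hz : 1 < ‖z‖) : ‖z⁻¹‖ < 1 := by
  rw [norm_inv]; exact inv_lt_one_of_one_lt₀ hz

theorem one_sub_mul_ne_zero {x y : ℂ} (hx : ‖x‖ < 1) (hy : ‖y‖ < 1) : 1 - x * y ≠ 0 := by
  intro h
  have h1 : x * y = 1 := (sub_eq_zero.1 h).symm
  have h2 : ‖x‖ * ‖y‖ = 1 := by rw [← norm_mul, h1, norm_one]
  nlinarith [norm_nonneg x, norm_nonneg y]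

/-- With x = 1/u and y = 1/v, subtracting from each functional equation its mirror image determines
the antisymmetric part of the generating function after division by 1-xy. The weighted part is then
the unweighted one times xy/(1-xy) = 1/(uv-1), whence the bracket c + 1/(uv-1). -/
theorem bilInf_outExp {c : ℝ} {u v : ℂ} (hu : 1 < ‖u‖) (hv : 1 < ‖v‖) :
    bilInf c (fun l => outExp c l u) (fun l => outExp c l v) = kerB c u v := by
  have hx := norm_inv_lt_one hu
  have hy := norm_inv_lt_one hv
  have hu0 : u ≠ 0 := norm_pos_iff.1 (by linarith)
  have hv0 : v ≠ 0 := norm_pos_iff.1 (by linarith)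
  set x := u⁻¹ with hxd
  set y := v⁻¹ with hyd
  have s1 := summable_biTerm abs_one_le hx hy
  have s2 := summable_biTerm abs_one_le hy hx
  have s3 := summable_biTerm abs_two_mul_le hx hy
  have s4 := summable_biTerm abs_two_mul_le hy hx
  have e1 : bilInf c (fun l => outExp c l u) (fun l => outExp c l v) =
      ((‖u‖ ^ (-c) * ‖v‖ ^ (-c) * (1 / Real.pi) : ℝ) : ℂ) *
        ((c : ℂ) * (genOne x y - genOne y x) + (genTwo x y - genTwo y x)) := by
    rw [genOne, genOne, genTwo, genTwo, ← Summable.tsum_sub s1 s2, ← Summable.tsum_sub s3 s4,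
      ← tsum_mul_left, ← Summable.tsum_add ((s1.sub s2).mul_left _) (s3.sub s4), ← tsum_mul_left,
      bilInf]
    refine tsum_congr fun p => ?_
    simp only [outExp, biTerm, bilLim]
    push_cast
    ring
  have h1 := genOne_add hx hy
  have h2 := genOne_add hy hx
  have h3 := genTwo_add hx hy
  have h4 := genTwo_add hy hx
  have hne := one_sub_mul_ne_zero hx hy
  have g1 : genOne x y - genOne y x = x * y * (x - y) * (invSqrt x * invSqrt y) / (1 - x * y) := by
    rw [eq_div_iff hne]; linear_combination h1 - h2
  have g2 : genTwo x y - genTwo y x = x * y * (genOne x y - genOne y x) / (1 - x * y) := by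
    rw [eq_div_iff hne]; linear_combination h3 - h4
  have huv : u * v - 1 ≠ 0 := by
    intro h
    have : u * v = 1 := sub_eq_zero.1 h
    apply hne
    rw [hxd, hyd, ← mul_inv, this]; simp
  have hxy : 1 - x * y = (u * v - 1) / (u * v) := by
    rw [hxd, hyd]; field_simp
  rw [e1, g2, g1, kerB, sqrtOut, sqrtOut, norm_mul, Real.mul_rpow (norm_nonneg _) (norm_nonneg _),
    Real.rpow_neg (norm_nonneg _), Real.rpow_neg (norm_nonneg _), hxy, invSqrt, invSqrt, hxd, hyd,
    inv_pow, inv_pow]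
  have hpi : (Real.pi : ℂ) ≠ 0 := by exact_mod_cast Real.pi_pos.ne'
  push_cast
  simp only [mul_inv, div_eq_mul_inv, inv_inv]
  generalize ((1 - (u ^ 2)⁻¹) ^ ((2 : ℂ)⁻¹))⁻¹ = a
  generalize ((1 - (v ^ 2)⁻¹) ^ ((2 : ℂ)⁻¹))⁻¹ = b
  generalize (((‖u‖ ^ c : ℝ) : ℂ))⁻¹ = a'
  generalize (((‖v‖ ^ c : ℝ) : ℂ))⁻¹ = b'
  field_simp

/-- The binomial series of (1-x²)^{-1/2} at x = 1/u. -/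
theorem linInf_outExp {c : ℝ} {u : ℂ} (hu : 1 < ‖u‖) :
    linInf c (fun l => outExp c l u) = (gammaRatio c : ℂ) * tailFun c u := by
  have h := (hasSum_invSqrt (norm_inv_lt_one hu)).mul_left
    ((gammaRatio c : ℂ) * ((‖u‖ ^ (-c) : ℝ) : ℂ) * u⁻¹)
  have e : (gammaRatio c : ℂ) * tailFun c u =
      (gammaRatio c : ℂ) * ((‖u‖ ^ (-c) : ℝ) : ℂ) * u⁻¹ * invSqrt u⁻¹ := by
    rw [tailFun, sqrtOut, invSqrt, Real.rpow_neg (norm_nonneg _), inv_pow]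
    push_cast
    simp only [one_div, mul_inv]
    ring
  rw [e, ← h.tsum_eq, linInf]
  refine tsum_congr fun k => ?_
  rw [outExp]
  push_cast
  ring

/- ## Tail integrals of the limit series -/

theorem norm_outExp {c : ℝ} {l : ℕ} (z : ℂ) : ‖outExp c l z‖ = ‖z‖ ^ (-c) * ‖z‖⁻¹ ^ l := by
  rw [outExp, norm_mul, Complex.norm_real, norm_pow, norm_inv,
    Real.norm_of_nonneg (Real.rpow_nonneg (norm_nonneg _) _)]

theorem norm_outExp_le {c ρ : ℝ} (hc : 0 ≤ c) (hρ : 1 ≤ ρ) {z : ℂ} (hz : ρ ≤ ‖z‖) (l : ℕ) :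
    ‖outExp c l z‖ ≤ ρ ^ (-c) * ρ⁻¹ ^ l := by
  have h0 : 0 < ρ := by linarith
  rw [norm_outExp]
  exact mul_le_mul (Real.rpow_le_rpow_of_nonpos h0 hz (by linarith))
    (pow_le_pow_left₀ (by positivity) (inv_anti₀ h0 hz) l) (by positivity)
    (Real.rpow_nonneg h0.le _)

theorem norm_iota_le (z : ℂ) : ‖iota z‖ ≤ 1 := by
  rw [iota, norm_mul, Complex.norm_I, one_mul]; exact norm_sgn_le_one _

/-- On the line one power of z is lost, which costs the factor ρ, and c ≥ 1/2 keeps the denominator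
c+l-1 at least 1/2, which costs the factor 2. -/
theorem norm_outEps_le {c ρ : ℝ} (hc : 1 / 2 ≤ c) (hρ : 1 ≤ ρ) {z : ℂ} (hz : ρ ≤ ‖z‖) {l : ℕ}
    (hl : 1 ≤ l) : ‖outEps c l z‖ ≤ 2 * ρ * ρ ^ (-c) * ρ⁻¹ ^ l := by
  have h0 : 0 < ρ := by linarith
  have hl' : (1 : ℝ) ≤ l := by exact_mod_cast hl
  have hp : 0 < ρ ^ (-c) := Real.rpow_pos_of_pos h0 _
  rw [outEps]
  split_ifs with h
  · rw [norm_div, norm_mul, norm_outExp, Complex.norm_real, Real.norm_of_nonneg (by linarith),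
      div_le_iff₀ (by linarith)]
    have hz0 : 0 < ‖z‖ := by linarith
    obtain ⟨k, rfl⟩ : ∃ k, l = k + 1 := ⟨l - 1, by omega⟩
    have e1 : ‖z‖ ^ (-c) * ‖z‖⁻¹ ^ (k + 1) * ‖z‖ = ‖z‖ ^ (-c) * ‖z‖⁻¹ ^ k := by
      rw [pow_succ]; field_simp
    have e2 : ‖z‖ ^ (-c) * ‖z‖⁻¹ ^ k ≤ ρ ^ (-c) * ρ⁻¹ ^ k :=
      mul_le_mul (Real.rpow_le_rpow_of_nonpos h0 hz (by linarith))
        (pow_le_pow_left₀ (by positivity) (inv_anti₀ h0 hz) k) (by positivity) hp.le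
    rw [e1]
    refine e2.trans ?_
    have e3 : ρ ^ (-c) * ρ⁻¹ ^ k = ρ * ρ ^ (-c) * ρ⁻¹ ^ (k + 1) := by
      rw [pow_succ]; field_simp
    rw [e3]
    have h5 : 0 ≤ ρ * ρ ^ (-c) * ρ⁻¹ ^ (k + 1) := by positivity
    have h6 : 1 / 2 ≤ c + ((k + 1 : ℕ) : ℝ) - 1 := by linarith
    nlinarith
  · rw [norm_mul]
    have h1 : ‖outExp c l ((starRingEnd ℂ) z)‖ ≤ ρ ^ (-c) * ρ⁻¹ ^ l :=
      norm_outExp_le (by linarith) hρ (by rwa [RCLike.norm_conj]) l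
    calc _ ≤ 1 * (ρ ^ (-c) * ρ⁻¹ ^ l) :=
          mul_le_mul (norm_iota_le z) h1 (norm_nonneg _) zero_le_one
      _ ≤ (2 * ρ) * (ρ ^ (-c) * ρ⁻¹ ^ l) :=
          mul_le_mul_of_nonneg_right (by linarith) (by positivity)
      _ = _ := by ring

theorem outExp_neg (c : ℝ) (l : ℕ) (z : ℂ) : outExp c l (-z) = (-1) ^ l * outExp c l z := by
  rw [outExp, outExp, norm_neg, inv_neg, neg_pow]; ring

theorem outEps_neg_ofReal (c : ℝ) (l : ℕ) (y : ℝ) :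
    outEps c l ((-y : ℝ) : ℂ) = -((-1) ^ l * outEps c l y) := by
  rw [outEps, outEps, if_pos (Complex.ofReal_im _), if_pos (Complex.ofReal_im _),
    Complex.ofReal_neg, outExp_neg]
  ring

/-- The half-line joining a point to the infinity of the same sign. -/
def tailSet (y : ℝ) : Set ℝ := if 0 < y then Ioi y else Iio y

theorem tailSet_of_pos {y : ℝ} (hy : 0 < y) : tailSet y = Ioi y := if_pos hy

theorem tailSet_of_neg {y : ℝ} (hy : y < 0) : tailSet y = Iio y := if_neg hy.not_gt

theorem tailInt_of_pos (f : ℝ → ℂ) {y : ℝ} (hy : 0 < y) : tailInt f y = -∫ t in Ioi y, f t :=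
  if_pos hy

theorem tailInt_of_neg (f : ℝ → ℂ) {y : ℝ} (hy : y < 0) : tailInt f y = ∫ t in Iio y, f t :=
  if_neg hy.not_gt

theorem tailInt_neg (f : ℝ → ℂ) {y : ℝ} (hy : y < 0) :
    tailInt f y = -tailInt (fun t => f (-t)) (-y) := by
  rw [tailInt_of_neg f hy, tailInt_of_pos _ (neg_pos.2 hy), neg_neg, integral_comp_neg_Ioi, neg_neg,
    integral_Iic_eq_integral_Iio]

theorem integrableOn_tailSet_neg {f : ℝ → ℂ} {y : ℝ} (hy : y < 0)
    (h : IntegrableOn (fun t => f (-t)) (tailSet (-y))) : IntegrableOn f (tailSet y) := by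
  rw [tailSet_of_pos (neg_pos.2 hy)] at h
  rw [tailSet_of_neg hy]
  have := h.comp_neg_Iio
  simpa using this

theorem measurableSet_tailSet (y : ℝ) : MeasurableSet (tailSet y) := by
  rw [tailSet]; split_ifs
  · exact measurableSet_Ioi
  · exact measurableSet_Iio

theorem one_lt_abs_of_mem_tailSet {y t : ℝ} (hy : 1 < |y|) (ht : t ∈ tailSet y) : 1 < |t| := by
  rcases lt_abs.1 hy with h | h
  · rw [tailSet_of_pos (by linarith)] at ht
    exact lt_abs.2 (Or.inl (h.trans ht))
  · rw [tailSet_of_neg (by linarith)] at ht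
    have ht : t < y := ht
    exact lt_abs.2 (Or.inr (by linarith))

theorem tailInt_congr {f g : ℝ → ℂ} {y : ℝ} (hy : 1 < |y|) (h : ∀ t : ℝ, 1 < |t| → f t = g t) :
    tailInt f y = tailInt g y := by
  have key := setIntegral_congr_fun (μ := volume) (measurableSet_tailSet y)
    (fun t ht => h t (one_lt_abs_of_mem_tailSet hy ht))
  rw [tailSet] at key
  rw [tailInt, tailInt]
  split_ifs at key ⊢ <;> rw [key]

theorem tailInt_const_mul (a : ℂ) (f : ℝ → ℂ) (y : ℝ) :
    tailInt (fun t => a * f t) y = a * tailInt f y := by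
  rw [tailInt, tailInt]
  split_ifs <;> rw [integral_const_mul]
  ring

theorem tailInt_sub {f g : ℝ → ℂ} {y : ℝ} (hf : IntegrableOn f (tailSet y))
    (hg : IntegrableOn g (tailSet y)) :
    tailInt (fun t => f t - g t) y = tailInt f y - tailInt g y := by
  rw [tailSet] at hf hg
  rw [tailInt, tailInt, tailInt]
  split_ifs at hf hg ⊢ <;> rw [integral_sub hf hg]
  ring

theorem hasDerivAt_tailInt_of_pos {f : ℝ → ℂ} {y : ℝ} (hy : 1 < y)
    (hint : ∀ t, 1 < t → IntegrableOn f (Ioi t)) (hcont : ∀ t, 1 < t → ContinuousAt f t) :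
    HasDerivAt (tailInt f) (f y) y := by
  have hon : ContinuousOn f (Ioi 1) := fun t ht => (hcont t ht).continuousWithinAt
  have h1 : HasDerivAt (fun u => ∫ t in y..u, f t) (f y) y :=
    intervalIntegral.integral_hasDerivAt_right IntervalIntegrable.refl
      (hon.stronglyMeasurableAtFilter isOpen_Ioi y hy) (hcont y hy)
  have h2 := h1.sub_const (∫ t in Ioi y, f t)
  refine h2.congr_of_eventuallyEq ?_
  filter_upwards [Ioi_mem_nhds hy] with u hu
  have hu : 1 < u := hu
  rw [tailInt_of_pos f (by linarith),
    ← intervalIntegral.integral_interval_add_Ioi (hint y hy) (hint u hu)]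
  ring

theorem hasDerivAt_tailInt {f : ℝ → ℂ} {y : ℝ} (hy : 1 < |y|)
    (hint : ∀ t, 1 < |t| → IntegrableOn f (tailSet t))
    (hcont : ∀ t, 1 < |t| → ContinuousAt f t) :
    HasDerivAt (tailInt f) (f y) y := by
  rcases lt_abs.1 hy with h | h
  · refine hasDerivAt_tailInt_of_pos h (fun t ht => ?_) fun t ht => hcont t (lt_abs.2 (Or.inl ht))
    have := hint t (lt_abs.2 (Or.inl ht))
    rwa [tailSet_of_pos (by linarith)] at this
  · have key : HasDerivAt (tailInt fun t => f (-t)) (f (-(-y))) (-y) := by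
      refine hasDerivAt_tailInt_of_pos (f := fun t => f (-t)) h (fun t ht => ?_) fun t ht => ?_
      · have := hint (-t) (by rw [abs_neg]; exact lt_abs.2 (Or.inl ht))
        rw [tailSet_of_neg (by linarith)] at this
        have h2 := this.comp_neg_Ioi
        simpa using h2
      · exact ContinuousAt.comp (f := fun t : ℝ => -t)
          (hcont (-t) (by rw [abs_neg]; exact lt_abs.2 (Or.inl ht))) continuous_neg.continuousAt
    rw [neg_neg] at key
    have h2 := (key.scomp y (hasDerivAt_neg y)).neg
    rw [neg_smul, one_smul, neg_neg] at h2
    refine h2.congr_of_eventuallyEq ?_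
    filter_upwards [Iio_mem_nhds (show y < 0 by linarith)] with u hu
    exact tailInt_neg f hu

theorem outExp_ofReal_pos (c : ℝ) (l : ℕ) {t : ℝ} (ht : 0 < t) :
    outExp c l t = ((t ^ (-(c + l)) : ℝ) : ℂ) := by
  rw [outExp, Complex.norm_real, Real.norm_of_nonneg ht.le, neg_add, Real.rpow_add ht,
    Real.rpow_neg ht.le (l : ℝ), Real.rpow_natCast]
  push_cast
  rw [inv_pow]

theorem integrableOn_outExp {c : ℝ} (hc : 0 < c) {l : ℕ} (hl : 1 ≤ l) {y : ℝ} (hy : 1 < |y|) :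
    IntegrableOn (fun t : ℝ => outExp c l t) (tailSet y) := by
  have hl' : (1 : ℝ) ≤ l := by exact_mod_cast hl
  have key : ∀ y : ℝ, 1 < y → IntegrableOn (fun t : ℝ => outExp c l t) (Ioi y) := fun y hy =>
    IntegrableOn.congr_fun ((integrableOn_Ioi_rpow_of_lt (a := -(c + l)) (by linarith)
      (show 0 < y by linarith)).ofReal (𝕜 := ℂ)) (fun t ht => by
        have ht : y < t := ht
        exact (outExp_ofReal_pos c l (by linarith)).symm) measurableSet_Ioi
  rcases lt_abs.1 hy with h | h
  · rw [tailSet_of_pos (by linarith)]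
    exact key y h
  · refine integrableOn_tailSet_neg (by linarith) ?_
    rw [tailSet_of_pos (by linarith)]
    have := (key (-y) h).const_mul ((-1) ^ l)
    refine this.congr (Eventually.of_forall fun t => ?_)
    simp only [Complex.ofReal_neg, outExp_neg]

/-- A power is integrated to infinity; negative points are reduced to positive ones by reflection.
Hence ε on the real line is minus the tail integral, the sign built into K[A]. -/
theorem tailInt_outExp {c : ℝ} (hc : 0 < c) {l : ℕ} (hl : 1 ≤ l) {y : ℝ} (hy : 1 < |y|) :
    tailInt (fun t : ℝ => outExp c l t) y = -outEps c l y := by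
  have hl' : (1 : ℝ) ≤ l := by exact_mod_cast hl
  have key : ∀ y : ℝ, 1 < y → tailInt (fun t : ℝ => outExp c l t) y = -outEps c l y := by
    intro y hy
    have hy0 : 0 < y := by linarith
    rw [tailInt_of_pos _ hy0, setIntegral_congr_fun (g := fun t : ℝ => ((t ^ (-(c + l)) : ℝ) : ℂ))
      measurableSet_Ioi (fun t ht => outExp_ofReal_pos c l (hy0.trans ht)), integral_complex_ofReal,
      integral_Ioi_rpow_of_lt (by linarith) hy0, outEps, if_pos (Complex.ofReal_im y),
      outExp_ofReal_pos c l hy0, Real.rpow_add hy0, Real.rpow_one,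
      show -(c + l) + 1 = -(c + l - 1) by ring, neg_div_neg_eq]
    push_cast; rfl
  rcases lt_abs.1 hy with h | h
  · exact key y h
  · rw [tailInt_neg _ (by linarith)]
    simp only [Complex.ofReal_neg, outExp_neg]
    rw [tailInt_const_mul, key (-y) h, outEps_neg_ofReal]
    have : ((-1 : ℂ) ^ l) * (-1) ^ l = 1 := by rw [← mul_pow]; norm_num
    linear_combination (-outEps c l y) * this

/-- A real power keeps its sign on a half-line, so the integral of the norm is the norm of the
integral. -/
theorem integral_norm_outExp {c : ℝ} (hc : 0 < c) {l : ℕ} (hl : 1 ≤ l) {y : ℝ} (hy : 1 < |y|) :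
    ∫ t in tailSet y, ‖outExp c l t‖ = ‖outEps c l y‖ := by
  have key : ∀ y : ℝ, 1 < y → ∫ t in tailSet y, ‖outExp c l t‖ = ‖outEps c l y‖ := by
    intro y hy
    have hy0 : 0 < y := by linarith
    have h1 := tailInt_outExp hc hl (y := y) (lt_abs.2 (Or.inl hy))
    rw [tailInt_of_pos _ hy0, neg_inj] at h1
    rw [← h1, tailSet_of_pos hy0]
    have e : ∀ t ∈ Ioi y, outExp c l t = ((t ^ (-(c + l)) : ℝ) : ℂ) := fun t ht =>
      outExp_ofReal_pos c l (hy0.trans ht)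
    rw [setIntegral_congr_fun measurableSet_Ioi e, integral_complex_ofReal, Complex.norm_real,
      Real.norm_of_nonneg (setIntegral_nonneg measurableSet_Ioi fun t ht =>
        Real.rpow_nonneg (hy0.trans ht).le _)]
    refine setIntegral_congr_fun measurableSet_Ioi fun t ht => ?_
    simp only [e t ht]
    rw [Complex.norm_real, Real.norm_of_nonneg (Real.rpow_nonneg (hy0.trans ht).le _)]
  rcases lt_abs.1 hy with h | h
  · exact key y h
  · have h1 := key (-y) h
    rw [tailSet_of_pos (by linarith)] at h1
    have h2 := integral_comp_neg_Ioi (-y) fun t : ℝ => ‖outExp c l t‖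
    rw [neg_neg] at h2
    rw [tailSet_of_neg (by linarith), ← integral_Iic_eq_integral_Iio, ← h2]
    have h3 : ∫ t in Ioi (-y), ‖outExp c l ((-t : ℝ) : ℂ)‖ = ∫ t in Ioi (-y), ‖outExp c l t‖ := by
      congr 1; funext t
      rw [norm_outExp, norm_outExp]; simp
    rw [h3, h1, outEps_neg_ofReal, norm_neg, norm_mul, norm_pow, norm_neg, norm_one, one_pow,
      one_mul]

/- ## Series of functionals -/

section
variable {ι : Type*}

/-- A series in the values of a sequence. -/
noncomputable def seqSer (a b : ι → ℂ) (l m : ι → ℕ) (G : ℕ → ℂ) : ℂ :=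
  ∑' i, (a i * G (l i) - b i * G (m i))

/-- The coefficients of `seqSer` are summable against geometric sequences. -/
structure GeomSummable (a b : ι → ℂ) (l m : ι → ℕ) : Prop where
  one_le_left : ∀ i, 1 ≤ l i
  one_le_right : ∀ i, 1 ≤ m i
  summable_left : ∀ r : ℝ, 0 ≤ r → r < 1 → Summable fun i => ‖a i‖ * r ^ l i
  summable_right : ∀ r : ℝ, 0 ≤ r → r < 1 → Summable fun i => ‖b i‖ * r ^ m i

variable {a b : ι → ℂ} {l m : ι → ℕ}

theorem GeomSummable.summable_add (h : GeomSummable a b l m) {r : ℝ} (hr : 0 ≤ r) (hr1 : r < 1) :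
    Summable fun i => ‖a i‖ * r ^ l i + ‖b i‖ * r ^ m i :=
  (h.summable_left r hr hr1).add (h.summable_right r hr hr1)

theorem GeomSummable.norm_term_le (h : GeomSummable a b l m) {G : ℕ → ℂ} {A r : ℝ}
    (hG : ∀ l, 1 ≤ l → ‖G l‖ ≤ A * r ^ l) (i : ι) :
    ‖a i * G (l i) - b i * G (m i)‖ ≤ A * (‖a i‖ * r ^ l i + ‖b i‖ * r ^ m i) := by
  refine (norm_sub_le _ _).trans ?_
  rw [norm_mul, norm_mul]
  have h1 := mul_le_mul_of_nonneg_left (hG _ (h.one_le_left i)) (norm_nonneg (a i))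
  have h2 := mul_le_mul_of_nonneg_left (hG _ (h.one_le_right i)) (norm_nonneg (b i))
  calc _ ≤ _ := add_le_add h1 h2
    _ = _ := by ring

theorem GeomSummable.norm_seqSer_le (h : GeomSummable a b l m) {G : ℕ → ℂ} {A r : ℝ}
    (hr : 0 ≤ r) (hr1 : r < 1) (hG : ∀ l, 1 ≤ l → ‖G l‖ ≤ A * r ^ l) :
    ‖seqSer a b l m G‖ ≤ A * ∑' i, (‖a i‖ * r ^ l i + ‖b i‖ * r ^ m i) := by
  rw [seqSer, ← tsum_mul_left]
  exact tsum_of_norm_bounded ((h.summable_add hr hr1).mul_left A).hasSum (h.norm_term_le hG)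

theorem continuousAt_outExp (c : ℝ) (l : ℕ) {z : ℂ} (hz : z ≠ 0) :
    ContinuousAt (outExp c l) z := by
  unfold outExp
  have h1 : ContinuousAt (fun z : ℂ => ‖z‖ ^ (-c)) z :=
    continuous_norm.continuousAt.rpow_const (Or.inl (norm_ne_zero_iff.2 hz))
  exact (Complex.continuous_ofReal.continuousAt.comp h1).mul ((continuousAt_inv₀ hz).pow l)

theorem GeomSummable.continuousAt_seqSer (h : GeomSummable a b l m) {c : ℝ} (hc : 0 ≤ c) {t : ℝ}
    (ht : 1 < |t|) : ContinuousAt (fun t : ℝ => seqSer a b l m fun l => outExp c l t) t := by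
  obtain ⟨ρ, hρ, hρt⟩ := exists_between ht
  have hopen : IsOpen {t : ℝ | ρ < |t|} := isOpen_lt continuous_const continuous_abs
  refine ContinuousOn.continuousAt (s := {t : ℝ | ρ < |t|}) ?_ (hopen.mem_nhds hρt)
  have hr : (0 : ℝ) ≤ ρ⁻¹ := inv_nonneg.2 (by linarith)
  unfold seqSer
  refine continuousOn_tsum (u := fun i => ρ ^ (-c) * (‖a i‖ * ρ⁻¹ ^ l i + ‖b i‖ * ρ⁻¹ ^ m i))
    (fun i => ?_) ((h.summable_add hr (inv_lt_one_of_one_lt₀ hρ)).mul_left (ρ ^ (-c)))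
    fun i x hx => h.norm_term_le (G := fun l => outExp c l x)
      (fun l _ => norm_outExp_le hc hρ.le ?_ l) i
  · have e : ∀ l, ContinuousOn (fun t : ℝ => outExp c l t) {t : ℝ | ρ < |t|} := fun l x hx => by
      have hx : ρ < |x| := hx
      have hx0 : (x : ℂ) ≠ 0 := by
        rw [Complex.ofReal_ne_zero, ← abs_pos]; linarith
      exact ((continuousAt_outExp c l hx0).comp (f := fun t : ℝ => (t : ℂ))
        Complex.continuous_ofReal.continuousAt).continuousWithinAt
    exact (continuousOn_const.mul (e _)).sub (continuousOn_const.mul (e _))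
  · rw [Complex.norm_real]; exact le_of_lt hx

theorem GeomSummable.integrableOn_seqSer (h : GeomSummable a b l m) {c : ℝ} (hc : 0 < c) {y : ℝ}
    (hy : 1 < |y|) :
    IntegrableOn (fun t : ℝ => seqSer a b l m fun l => outExp c l t) (tailSet y) := by
  have hy0 : 0 < |y| := by linarith
  set r := |y|⁻¹ with hr
  have hr0 : 0 ≤ r := inv_nonneg.2 hy0.le
  have hr1 : r < 1 := inv_lt_one_of_one_lt₀ hy
  set C := ∑' i, (‖a i‖ * r ^ l i + ‖b i‖ * r ^ m i)
  have hmeas : AEStronglyMeasurable (fun t : ℝ => seqSer a b l m fun l => outExp c l t)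
      (volume.restrict (tailSet y)) :=
    ContinuousOn.aestronglyMeasurable (fun t ht => (h.continuousAt_seqSer hc.le
      (one_lt_abs_of_mem_tailSet hy ht)).continuousWithinAt) (measurableSet_tailSet y)
  -- One inverse power of |t| is kept to give integrability at infinity; the others are bounded by
  -- the geometric rate at the endpoint, and |y| compensates for the power withheld.
  refine Integrable.mono' (g := fun t : ℝ => ‖outExp c 1 t‖ * |y| * C)
    (((integrableOn_outExp hc le_rfl hy).norm.mul_const _).mul_const _) hmeas ?_
  refine (ae_restrict_iff' (measurableSet_tailSet y)).2 (Eventually.of_forall fun t ht => ?_)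
  have hyt : |y| ≤ |t| := by
    rw [tailSet] at ht
    split_ifs at ht with h0
    · have ht : y < t := ht
      rw [abs_of_pos h0]; exact ht.le.trans (le_abs_self t)
    · have ht : t < y := ht
      rw [abs_of_nonpos (not_lt.1 h0)]; exact (neg_lt_neg ht).le.trans (neg_le_abs t)
  refine h.norm_seqSer_le hr0 hr1 fun k hk => ?_
  obtain ⟨n, rfl⟩ : ∃ n, k = n + 1 := ⟨k - 1, by omega⟩
  rw [norm_outExp, norm_outExp, Complex.norm_real, Real.norm_eq_abs, pow_succ', pow_succ' r, pow_one]
  have h1 : |y| * (r * r ^ n) = r ^ n := by rw [hr]; field_simp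
  have h2 : |t|⁻¹ ^ n ≤ r ^ n :=
    pow_le_pow_left₀ (inv_nonneg.2 (abs_nonneg _)) (inv_anti₀ hy0 hyt) n
  calc _ = (|t| ^ (-c) * |t|⁻¹) * |t|⁻¹ ^ n := by ring
    _ ≤ (|t| ^ (-c) * |t|⁻¹) * r ^ n := by gcongr
    _ = _ := by rw [mul_assoc _ (|y|), h1]

/-- The L¹ norms of the terms are again values of `outEps`, which decay geometrically in the
exponent, so sum and integral may be interchanged. -/
theorem GeomSummable.tailInt_seqSer [Countable ι] (h : GeomSummable a b l m) {c : ℝ} (hc : 1 / 2 ≤ c)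
    {y : ℝ} (hy : 1 < |y|) :
    tailInt (fun t : ℝ => seqSer a b l m fun l => outExp c l t) y =
      -seqSer a b l m fun l => outEps c l y := by
  have hc0 : 0 < c := by linarith
  have hy0 : 0 < |y| := by linarith
  have hr0 : 0 ≤ |y|⁻¹ := inv_nonneg.2 hy0.le
  have hr1 : |y|⁻¹ < 1 := inv_lt_one_of_one_lt₀ hy
  set f : ι → ℝ → ℂ := fun i t => a i * outExp c (l i) t - b i * outExp c (m i) t with hf
  have hint1 := fun i => (integrableOn_outExp hc0 (h.one_le_left i) hy).const_mul (a i)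
  have hint2 := fun i => (integrableOn_outExp hc0 (h.one_le_right i) hy).const_mul (b i)
  have hint : ∀ i, IntegrableOn (f i) (tailSet y) := fun i => (hint1 i).sub (hint2 i)
  have hterm : ∀ i, tailInt (f i) y = -(a i * outEps c (l i) y - b i * outEps c (m i) y) := by
    intro i
    rw [hf]
    simp only
    rw [tailInt_sub (hint1 i) (hint2 i), tailInt_const_mul, tailInt_const_mul,
      tailInt_outExp hc0 (h.one_le_left i) hy, tailInt_outExp hc0 (h.one_le_right i) hy]
    ring
  have hsum : Summable fun i => ∫ t in tailSet y, ‖f i t‖ := by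
    refine Summable.of_nonneg_of_le (fun i => integral_nonneg fun _ => norm_nonneg _) (fun i => ?_)
      ((h.summable_add hr0 hr1).mul_left (2 * |y| * |y| ^ (-c)))
    have hb : ∀ l, 1 ≤ l → ‖outEps c l y‖ ≤ 2 * |y| * |y| ^ (-c) * |y|⁻¹ ^ l := fun l hl =>
      norm_outEps_le hc hy.le (by rw [Complex.norm_real, Real.norm_eq_abs]) hl
    calc ∫ t in tailSet y, ‖f i t‖
        ≤ ∫ t in tailSet y, (‖a i * outExp c (l i) t‖ + ‖b i * outExp c (m i) t‖) :=
          integral_mono (hint i).norm ((hint1 i).norm.add (hint2 i).norm) fun t => norm_sub_le _ _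
      _ = ‖a i‖ * ‖outEps c (l i) y‖ + ‖b i‖ * ‖outEps c (m i) y‖ := by
          rw [integral_add (hint1 i).norm (hint2 i).norm]
          simp only [norm_mul]
          rw [integral_const_mul, integral_const_mul,
            integral_norm_outExp hc0 (h.one_le_left i) hy,
            integral_norm_outExp hc0 (h.one_le_right i) hy]
      _ ≤ ‖a i‖ * (2 * |y| * |y| ^ (-c) * |y|⁻¹ ^ l i) +
          ‖b i‖ * (2 * |y| * |y| ^ (-c) * |y|⁻¹ ^ m i) := by
          gcongr
          · exact hb _ (h.one_le_left i)
          · exact hb _ (h.one_le_right i)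
      _ = _ := by ring
  have key := (hasSum_integral_of_summable_integral_norm hint hsum).tsum_eq
  have e1 : ∀ g : ℝ → ℂ, tailInt g y = (if 0 < y then -1 else 1) * ∫ t in tailSet y, g t := by
    intro g
    rw [tailInt, tailSet]
    split_ifs <;> ring
  have e2 : (fun t : ℝ => seqSer a b l m fun l => outExp c l t) = fun t => ∑' i, f i t := rfl
  rw [e1, e2, ← key, ← tsum_mul_left, seqSer, ← tsum_neg]
  refine tsum_congr fun i => ?_
  rw [← hterm i, e1]

/-- The series is minus the tail integral of the other one, so the fundamental theorem of calculus
replaces termwise differentiation. -/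
theorem GeomSummable.hasDerivAt_seqSer [Countable ι] (h : GeomSummable a b l m) {c : ℝ}
    (hc : 1 / 2 ≤ c) {y : ℝ} (hy : 1 < |y|) :
    HasDerivAt (fun y : ℝ => seqSer a b l m fun l => outEps c l y)
      (-seqSer a b l m fun l => outExp c l y) y := by
  have hc0 : 0 < c := by linarith
  have h1 := (hasDerivAt_tailInt hy (fun t ht => h.integrableOn_seqSer hc0 ht)
    fun t ht => h.continuousAt_seqSer hc0.le ht).neg
  refine h1.congr_of_eventuallyEq ?_
  filter_upwards [(isOpen_lt continuous_const continuous_abs).mem_nhds hy] with t ht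
  rw [Pi.neg_apply, h.tailInt_seqSer hc ht, neg_neg]

end

/- ## The forms as series -/

theorem geomSummable_bilInf {c : ℝ} (hc : 0 ≤ c) {F : ℕ → ℂ} {A r : ℝ} (hr : 0 ≤ r) (hr1 : r < 1)
    (hF : ∀ l, 1 ≤ l → ‖F l‖ ≤ A * r ^ l) :
    GeomSummable (fun p : ℕ × ℕ => (bilLim c p.1 p.2 : ℂ) * F (2 * p.1 + 2))
      (fun p => (bilLim c p.1 p.2 : ℂ) * F (2 * p.2 + 1)) (fun p => 2 * p.2 + 1)
      (fun p => 2 * p.1 + 2) := by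
  have hA : 0 ≤ A * r ^ 1 := (norm_nonneg _).trans (hF 1 le_rfl)
  have hb : ∀ x : ℝ, 0 ≤ x → x < 1 → ∀ p : ℕ × ℕ, ∀ i j : ℕ, 1 ≤ i → 1 ≤ j →
      ((i = 2 * p.1 + 2 ∧ j = 2 * p.2 + 1) ∨ (i = 2 * p.2 + 1 ∧ j = 2 * p.1 + 2)) →
      ‖(bilLim c p.1 p.2 : ℂ) * F i‖ * x ^ j ≤ (c + 1) * |A| * bilMaj (max r x) p := by
    intro x hx hx1 p i j hi hj hij
    have h1 := abs_bilLim_le hc p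
    have h2 : ‖F i‖ ≤ |A| * max r x ^ i := (hF i hi).trans (by
      gcongr
      · exact le_abs_self A
      · exact le_max_left _ _)
    have h3 : x ^ j ≤ max r x ^ j := by gcongr; exact le_max_right _ _
    have h4 : max r x ^ i * max r x ^ j = max r x ^ (2 * p.1 + 2) * max r x ^ (2 * p.2 + 1) := by
      rcases hij with ⟨rfl, rfl⟩ | ⟨rfl, rfl⟩
      · rfl
      · ring
    rw [norm_mul, Complex.norm_real, Real.norm_eq_abs]
    calc _ ≤ ((c + 1) * ((2 * p.1 + 1) * (2 * p.2 + 1))) * (|A| * max r x ^ i) * max r x ^ j := by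
          gcongr
      _ = ((c + 1) * ((2 * p.1 + 1) * (2 * p.2 + 1))) * |A| * (max r x ^ i * max r x ^ j) := by
          ring
      _ = _ := by rw [h4, bilMaj]; ring
  have hs : ∀ x : ℝ, 0 ≤ x → x < 1 → Summable fun p => (c + 1) * |A| * bilMaj (max r x) p :=
    fun x hx hx1 => (summable_bilMaj (le_max_of_le_left hr) (max_lt hr1 hx1)).mul_left _
  refine ⟨fun p => by omega, fun p => by omega, fun x hx hx1 => ?_, fun x hx hx1 => ?_⟩
  · exact Summable.of_nonneg_of_le (fun p => by positivity)
      (fun p => hb x hx hx1 p _ _ (by omega) (by omega) (Or.inl ⟨rfl, rfl⟩)) (hs x hx hx1)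
  · exact Summable.of_nonneg_of_le (fun p => by positivity)
      (fun p => hb x hx hx1 p _ _ (by omega) (by omega) (Or.inr ⟨rfl, rfl⟩)) (hs x hx hx1)

theorem bilInf_eq_seqSer (c : ℝ) (F G : ℕ → ℂ) :
    bilInf c F G = seqSer (fun p : ℕ × ℕ => (bilLim c p.1 p.2 : ℂ) * F (2 * p.1 + 2))
      (fun p => (bilLim c p.1 p.2 : ℂ) * F (2 * p.2 + 1)) (fun p => 2 * p.2 + 1)
      (fun p => 2 * p.1 + 2) G :=
  tsum_congr fun p => by ring

theorem bilInf_swap (c : ℝ) (F G : ℕ → ℂ) : bilInf c F G = -bilInf c G F := by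
  rw [bilInf, bilInf, ← tsum_neg]
  exact tsum_congr fun p => by ring

theorem geomSummable_linInf {c : ℝ} (hc : 0 < c) :
    GeomSummable (fun k : ℕ => ((gammaRatio c * pochQ k : ℝ) : ℂ)) 0 (fun k => 2 * k + 1)
      (fun k => 2 * k + 1) := by
  refine ⟨fun p => by omega, fun p => by omega, fun x hx hx1 => ?_, fun x hx hx1 => ?_⟩
  · have h := (summable_linInf (F := fun l => ((x ^ l : ℝ) : ℂ)) (A := 1) hc hx hx1
      (fun l _ => by rw [Complex.norm_real, Real.norm_of_nonneg (pow_nonneg hx l), one_mul])).norm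
    refine h.congr fun k => ?_
    rw [norm_mul, Complex.norm_real, Complex.norm_real, Real.norm_of_nonneg (pow_nonneg hx (2 * k + 1))]
  · simp

theorem linInf_eq_seqSer (c : ℝ) (F : ℕ → ℂ) :
    linInf c F = seqSer (fun k : ℕ => ((gammaRatio c * pochQ k : ℝ) : ℂ)) 0 (fun k => 2 * k + 1)
      (fun k => 2 * k + 1) F :=
  tsum_congr fun p => by rw [Pi.zero_apply]; ring

/- ## The limit kernel as a combination of series -/

theorem bilInf_const_mul_left (c : ℝ) (a : ℂ) (F G : ℕ → ℂ) :
    bilInf c (fun l => a * F l) G = a * bilInf c F G := by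
  rw [bilInf, bilInf, ← tsum_mul_left]
  exact tsum_congr fun p => by ring

theorem bilInf_const_mul_right (c : ℝ) (a : ℂ) (F G : ℕ → ℂ) :
    bilInf c F (fun l => a * G l) = a * bilInf c F G := by
  rw [bilInf, bilInf, ← tsum_mul_left]
  exact tsum_congr fun p => by ring

theorem linInf_const_mul (c : ℝ) (a : ℂ) (F : ℕ → ℂ) :
    linInf c (fun l => a * F l) = a * linInf c F := by
  rw [linInf, linInf, ← tsum_mul_left]
  exact tsum_congr fun p => by ring

theorem outEps_of_im_ne_zero (c : ℝ) {z : ℂ} (hz : z.im ≠ 0) :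
    (fun l => outEps c l z) = fun l => iota z * outExp c l ((starRingEnd ℂ) z) := by
  funext l
  rw [outEps, if_neg hz]

theorem one_lt_norm_ofReal {y : ℝ} (hy : 1 < |y|) : 1 < ‖(y : ℂ)‖ := by
  rwa [Complex.norm_real]

section
variable {c : ℝ} {F : ℕ → ℂ} {A r y : ℝ}

theorem tailInt_bilInf (hc : 1 ≤ c) (hr : 0 ≤ r) (hr1 : r < 1)
    (hF : ∀ l, 1 ≤ l → ‖F l‖ ≤ A * r ^ l) (hy : 1 < |y|) :
    tailInt (fun t : ℝ => bilInf c F fun l => outExp c l t) y =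
      -bilInf c F fun l => outEps c l y := by
  simp only [bilInf_eq_seqSer]
  exact (geomSummable_bilInf (by linarith) hr hr1 hF).tailInt_seqSer (by linarith) hy

theorem hasDerivAt_bilInf_right (hc : 1 ≤ c) (hr : 0 ≤ r) (hr1 : r < 1)
    (hF : ∀ l, 1 ≤ l → ‖F l‖ ≤ A * r ^ l) (hy : 1 < |y|) :
    HasDerivAt (fun t : ℝ => bilInf c F fun l => outEps c l t)
      (-bilInf c F fun l => outExp c l y) y := by
  simp only [bilInf_eq_seqSer]
  exact (geomSummable_bilInf (by linarith) hr hr1 hF).hasDerivAt_seqSer (by linarith) hy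

theorem hasDerivAt_bilInf_left (hc : 1 ≤ c) (hr : 0 ≤ r) (hr1 : r < 1)
    (hF : ∀ l, 1 ≤ l → ‖F l‖ ≤ A * r ^ l) (hy : 1 < |y|) :
    HasDerivAt (fun t : ℝ => bilInf c (fun l => outEps c l t) F)
      (-bilInf c (fun l => outExp c l y) F) y := by
  simp only [bilInf_swap c _ F]
  exact (hasDerivAt_bilInf_right hc hr hr1 hF hy).neg

theorem tailInt_linInf (hc : 1 ≤ c) (hy : 1 < |y|) :
    tailInt (fun t : ℝ => linInf c fun l => outExp c l t) y = -linInf c fun l => outEps c l y := by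
  simp only [linInf_eq_seqSer]
  exact (geomSummable_linInf (by linarith)).tailInt_seqSer (by linarith) hy

theorem hasDerivAt_linInf (hc : 1 ≤ c) (hy : 1 < |y|) :
    HasDerivAt (fun t : ℝ => linInf c fun l => outEps c l t) (-linInf c fun l => outExp c l y) y := by
  simp only [linInf_eq_seqSer]
  exact (geomSummable_linInf (by linarith)).hasDerivAt_seqSer (by linarith) hy

end

section
variable {c : ℝ}

theorem norm_outExp_le_self (hc : 1 ≤ c) {z : ℂ} (hz : 1 < ‖z‖) (l : ℕ) (_ : 1 ≤ l) :
    ‖outExp c l z‖ ≤ ‖z‖ ^ (-c) * ‖z‖⁻¹ ^ l :=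
  norm_outExp_le (by linarith) hz.le le_rfl l

theorem norm_outEps_le_self (hc : 1 ≤ c) {z : ℂ} (hz : 1 < ‖z‖) (l : ℕ) (hl : 1 ≤ l) :
    ‖outEps c l z‖ ≤ 2 * ‖z‖ * ‖z‖ ^ (-c) * ‖z‖⁻¹ ^ l :=
  norm_outEps_le (by linarith) hz.le le_rfl hl

theorem tailInt_kerB (hc : 1 ≤ c) {z : ℂ} (hz : 1 < ‖z‖) {y : ℝ} (hy : 1 < |y|) :
    tailInt (fun v => kerB c z v) y =
      -bilInf c (fun l => outExp c l z) fun l => outEps c l y := by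
  rw [← tailInt_bilInf hc (inv_nonneg.2 (norm_nonneg z)) (inv_lt_one_of_one_lt₀ hz)
    (norm_outExp_le_self hc hz) hy]
  exact tailInt_congr hy fun t ht => (bilInf_outExp hz (one_lt_norm_ofReal ht)).symm

/-- After the inner integration, antisymmetry brings the outer variable to the right-hand slot,
where termwise integration applies again. -/
theorem tailInt_tailInt_kerB (hc : 1 ≤ c) {x y : ℝ} (hx : 1 < |x|) (hy : 1 < |y|) :
    tailInt (fun u : ℝ => tailInt (fun v => kerB c u v) y) x =
      bilInf c (fun l => outEps c l x) fun l => outEps c l y := by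
  have hy' := one_lt_norm_ofReal hy
  rw [bilInf_swap, ← tailInt_bilInf hc (inv_nonneg.2 (norm_nonneg _)) (inv_lt_one_of_one_lt₀ hy')
    (norm_outEps_le_self hc hy') hx]
  refine tailInt_congr hx fun t ht => ?_
  rw [tailInt_kerB hc (one_lt_norm_ofReal ht) hy, bilInf_swap, neg_neg]

theorem gammaRatio_mul_tailInt (hc : 1 ≤ c) {y : ℝ} (hy : 1 < |y|) :
    (gammaRatio c : ℂ) * tailInt (fun u => tailFun c u) y = -linInf c fun l => outEps c l y := by
  rw [← tailInt_linInf hc hy, ← tailInt_const_mul]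
  exact tailInt_congr hy fun t ht => (linInf_outExp (one_lt_norm_ofReal ht)).symm

variable {C : EReal}

theorem AO_eq (hC : C ≠ ⊤) (hc : 1 ≤ C.toReal) {x y : ℝ} (hx : 1 < |x|) (hy : 1 < |y|) :
    AO C x y = bilInf C.toReal (fun l => outEps C.toReal l x) (fun l => outEps C.toReal l y) +
      (sgn y * linInf C.toReal (fun l => outEps C.toReal l x) -
        sgn x * linInf C.toReal fun l => outEps C.toReal l y) := by
  rw [AO, if_neg hC, tailInt_tailInt_kerB hc hx hy]
  linear_combination sgn x * gammaRatio_mul_tailInt hc hy - sgn y * gammaRatio_mul_tailInt hc hx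

theorem DAO_eq (hC : C ≠ ⊤) (hc : 1 ≤ C.toReal) {z : ℂ} (hz : 1 < ‖z‖) {y : ℝ} (hy : 1 < |y|) :
    DAO C z y = -bilInf C.toReal (fun l => outExp C.toReal l z) (fun l => outEps C.toReal l y) -
      sgn y * linInf C.toReal fun l => outExp C.toReal l z := by
  rw [DAO, if_neg hC, tailInt_kerB hc hz hy, linInf_outExp hz]
  ring

theorem DAOD_eq (hC : C ≠ ⊤) {u v : ℂ} (hu : 1 < ‖u‖) (hv : 1 < ‖v‖) :
    DAOD C u v = bilInf C.toReal (fun l => outExp C.toReal l u) fun l => outExp C.toReal l v := by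
  rw [DAOD, if_neg hC, bilInf_outExp hu hv]

theorem eventually_one_lt_abs {x : ℝ} (hx : 1 < |x|) : ∀ᶠ t in 𝓝 x, 1 < |t| :=
  (isOpen_lt continuous_const continuous_abs).mem_nhds hx

theorem eventually_sgn_eq {x : ℝ} (hx : 1 < |x|) : ∀ᶠ t in 𝓝 x, sgn t = sgn x := by
  rcases lt_abs.1 hx with h | h
  · filter_upwards [lt_mem_nhds (show 0 < x by linarith)] with t ht
    rw [sgn, sgn, Real.sign_of_pos ht, Real.sign_of_pos (by linarith)]
  · filter_upwards [gt_mem_nhds (show x < 0 by linarith)] with t ht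
    rw [sgn, sgn, Real.sign_of_neg ht, Real.sign_of_neg (by linarith)]

/-- Outside [-1, 1] the signs are locally constant, so only the series are differentiated. -/
theorem hasDerivAt_AO_left (hC : C ≠ ⊤) (hc : 1 ≤ C.toReal) {x y : ℝ} (hx : 1 < |x|)
    (hy : 1 < |y|) :
    HasDerivAt (fun t => AO C t y)
      (-bilInf C.toReal (fun l => outExp C.toReal l x) (fun l => outEps C.toReal l y) -
        sgn y * linInf C.toReal fun l => outExp C.toReal l x) x := by
  have hy' := one_lt_norm_ofReal hy
  have h1 := hasDerivAt_bilInf_left hc (inv_nonneg.2 (norm_nonneg _)) (inv_lt_one_of_one_lt₀ hy')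
    (norm_outEps_le_self hc hy') hx
  have h2 := (h1.add ((hasDerivAt_linInf hc hx).const_mul (sgn y))).sub_const
    (sgn x * linInf C.toReal fun l => outEps C.toReal l y)
  refine (h2.congr_of_eventuallyEq ?_).congr_deriv (by ring)
  filter_upwards [eventually_one_lt_abs hx, eventually_sgn_eq hx] with t ht hs
  rw [AO_eq hC hc ht hy, hs, Pi.add_apply]
  ring

theorem hasDerivAt_AO_right (hC : C ≠ ⊤) (hc : 1 ≤ C.toReal) {x y : ℝ} (hx : 1 < |x|)
    (hy : 1 < |y|) :
    HasDerivAt (fun t => AO C x t)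
      (-bilInf C.toReal (fun l => outEps C.toReal l x) (fun l => outExp C.toReal l y) +
        sgn x * linInf C.toReal fun l => outExp C.toReal l y) y := by
  have hx' := one_lt_norm_ofReal hx
  have h1 := hasDerivAt_bilInf_right hc (inv_nonneg.2 (norm_nonneg _)) (inv_lt_one_of_one_lt₀ hx')
    (norm_outEps_le_self hc hx') hy
  have h2 := (h1.sub ((hasDerivAt_linInf hc hy).const_mul (sgn x))).add_const
    (sgn y * linInf C.toReal fun l => outEps C.toReal l x)
  refine (h2.congr_of_eventuallyEq ?_).congr_deriv (by ring)
  filter_upwards [eventually_one_lt_abs hy, eventually_sgn_eq hy] with t ht hs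
  rw [AO_eq hC hc hx ht, hs, Pi.sub_apply]
  ring

theorem deriv_deriv_AO (hC : C ≠ ⊤) (hc : 1 ≤ C.toReal) {x y : ℝ} (hx : 1 < |x|) (hy : 1 < |y|) :
    deriv (fun t => deriv (fun r => AO C t r) y) x =
      bilInf C.toReal (fun l => outExp C.toReal l x) fun l => outExp C.toReal l y := by
  have hy' := one_lt_norm_ofReal hy
  have h1 := hasDerivAt_bilInf_left hc (inv_nonneg.2 (norm_nonneg _)) (inv_lt_one_of_one_lt₀ hy')
    (norm_outExp_le_self hc hy') hx
  have h2 := (h1.neg.add_const (sgn x * linInf C.toReal fun l => outExp C.toReal l y))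
  refine ((h2.congr_of_eventuallyEq ?_).congr_deriv (by ring)).deriv
  filter_upwards [eventually_one_lt_abs hx, eventually_sgn_eq hx] with t ht hs
  rw [(hasDerivAt_AO_right hC hc ht hy).deriv, hs, Pi.neg_apply]

/-- The limit of the renormalised kernel as a combination of series. -/
noncomputable def limForm (c : ℝ) (u v : ℂ) : Matrix (Fin 2) (Fin 2) ℂ :=
  !![bilInf c (fun l => outExp c l u) (fun l => outExp c l v),
    bilInf c (fun l => outExp c l u) (fun l => outEps c l v) +
      lineSgn v * linInf c (fun l => outExp c l u);
    bilInf c (fun l => outEps c l u) (fun l => outExp c l v) -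
      lineSgn u * linInf c (fun l => outExp c l v),
    bilInf c (fun l => outEps c l u) (fun l => outEps c l v) +
      (lineSgn v * linInf c (fun l => outEps c l u) -
      lineSgn u * linInf c (fun l => outEps c l v)) + halfSgn u v]

theorem halfSgn_swap (u v : ℂ) : halfSgn u v = -halfSgn v u := by
  rw [halfSgn, halfSgn]
  by_cases h : u.im = 0 ∧ v.im = 0
  · rw [if_pos h, if_pos h.symm, ← neg_sub, sgn_neg]; ring
  · rw [if_neg h, if_neg (fun h' => h h'.symm), neg_zero]

theorem limForm_swap (c : ℝ) (u v : ℂ) : limForm c u v = -(limForm c v u).transpose := by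
  ext i j
  fin_cases i <;> fin_cases j <;> simp [limForm]
  · exact bilInf_swap c _ _
  · rw [bilInf_swap]; ring
  · rw [bilInf_swap]; ring
  · rw [bilInf_swap, halfSgn_swap]; ring

theorem lineSgn_of_im_ne_zero {z : ℂ} (hz : z.im ≠ 0) : lineSgn z = 0 := if_neg hz

theorem lineSgn_ofReal (y : ℝ) : lineSgn y = sgn y := if_pos (Complex.ofReal_im y)

theorem halfSgn_of_left {u v : ℂ} (hu : u.im ≠ 0) : halfSgn u v = 0 := if_neg fun h => hu h.1

theorem matComplexReal_eq (hC : C ≠ ⊤) (hc : 1 ≤ C.toReal) {z : ℂ} (hz : 1 < ‖z‖) (h0 : z.im ≠ 0)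
    {y : ℝ} (hy : 1 < |y|) :
    matComplexReal (DAO C) (DAOD C) z y = limForm C.toReal z y := by
  have hz' : 1 < ‖(starRingEnd ℂ) z‖ := by rwa [RCLike.norm_conj]
  have hy' := one_lt_norm_ofReal hy
  rw [matComplexReal, limForm, DAOD_eq hC hz hy', DAOD_eq hC hz' hy', DAO_eq hC hc hz hy,
    DAO_eq hC hc hz' hy, lineSgn_of_im_ne_zero h0, lineSgn_ofReal, halfSgn_of_left h0,
    outEps_of_im_ne_zero _ h0, bilInf_const_mul_left, bilInf_const_mul_left, linInf_const_mul]
  congr! 3 <;> ring_nf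

/-- In `limForm` the distinction between real and non-real points is hidden in `outEps`, `lineSgn`
and `halfSgn`. At a non-real point the first is ι times a conjugate value and the other two vanish;
on the line they yield A and its derivatives. The mixed case follows by antisymmetry. -/
theorem limitKernel_eq (hC : C ≠ ⊤) (hc : 1 ≤ C.toReal) {u v : ℂ} (hu : 1 < ‖u‖) (hv : 1 < ‖v‖) :
    limitKernel C u v = limForm C.toReal u v := by
  rw [limitKernel, matKernel]
  have hreal : ∀ {z : ℂ}, z.im = 0 → ((z.re : ℝ) : ℂ) = z := fun h => Complex.ext rfl (by simp [h])
  split_ifs with hu0 hv0 hv0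
  · obtain ⟨x, rfl⟩ : ∃ x : ℝ, (x : ℂ) = u := ⟨u.re, hreal hu0⟩
    obtain ⟨y, rfl⟩ : ∃ y : ℝ, (y : ℂ) = v := ⟨v.re, hreal hv0⟩
    rw [Complex.norm_real, Real.norm_eq_abs] at hu hv
    rw [matRealReal, limForm, Complex.ofReal_re, Complex.ofReal_re, deriv_deriv_AO hC hc hu hv,
      (hasDerivAt_AO_left hC hc hu hv).deriv, (hasDerivAt_AO_right hC hc hu hv).deriv,
      AO_eq hC hc hu hv, lineSgn_ofReal, lineSgn_ofReal, halfSgn, if_pos ⟨hu0, hv0⟩,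
      Complex.ofReal_re, Complex.ofReal_re]
    congr! 3 <;> ring_nf
  · have hy : 1 < |u.re| := by rwa [← hreal hu0, Complex.norm_real] at hu
    rw [matComplexReal_eq hC hc hv hv0 hy, limForm_swap, hreal hu0, Matrix.transpose_neg,
      Matrix.transpose_transpose, neg_neg]
  · have hy : 1 < |v.re| := by rwa [← hreal hv0, Complex.norm_real] at hv
    rw [matComplexReal_eq hC hc hu hu0 hy, hreal hv0]
  · have hu' : 1 < ‖(starRingEnd ℂ) u‖ := by rwa [RCLike.norm_conj]
    have hv' : 1 < ‖(starRingEnd ℂ) v‖ := by rwa [RCLike.norm_conj]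
    rw [matComplexComplex, limForm, DAOD_eq hC hu hv, DAOD_eq hC hu hv', DAOD_eq hC hu' hv,
      DAOD_eq hC hu' hv', lineSgn_of_im_ne_zero hu0, lineSgn_of_im_ne_zero hv0,
      halfSgn_of_left hu0, outEps_of_im_ne_zero _ hu0, outEps_of_im_ne_zero _ hv0,
      bilInf_const_mul_left, bilInf_const_mul_left, bilInf_const_mul_right,
      bilInf_const_mul_right]
    congr! 3 <;> ring_nf

theorem limitKernel_top {u v : ℂ} : limitKernel ⊤ u v = !![0, 0; 0, halfSgn u v] := by
  rw [limitKernel, matKernel]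
  have hreal : ∀ {z : ℂ}, z.im = 0 → ((z.re : ℝ) : ℂ) = z := fun h => Complex.ext rfl (by simp [h])
  split_ifs with hu0 hv0 hv0
  · simp [matRealReal, AO, halfSgn, hu0, hv0]
  · ext i j
    fin_cases i <;> fin_cases j <;> simp [matComplexReal, DAO, DAOD, halfSgn, hv0]
  · simp [matComplexReal, DAO, DAOD, halfSgn, hu0]
  · simp [matComplexComplex, DAOD, halfSgn, hu0]

end

/- ## Convergence of the renormalised kernel -/

/-- Local uniform convergence is convergence along the product of the index filter with the
neighbourhoods of each point. Both arguments of the kernel may therefore be treated as moving along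
one filter. -/
theorem tendstoLocallyUniformlyOn_matrix {α ι : Type*} [TopologicalSpace α] {m n : Type*}
    {F : ι → α → Matrix m n ℂ} {f : α → Matrix m n ℂ} {p : Filter ι} {s : Set α}
    (h : ∀ x ∈ s, ∀ i j, Tendsto (fun q : ι × α => F q.1 q.2 i j - f q.2 i j) (p ×ˢ 𝓝[s] x) (𝓝 0)) :
    TendstoLocallyUniformlyOn F f p s := by
  rw [tendstoLocallyUniformlyOn_iff_forall_tendsto]
  intro x hx
  rw [Matrix.uniformity]
  simp only [tendsto_iInf, tendsto_comap_iff]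
  intro i j
  rw [uniformity_eq_comap_nhds_zero, tendsto_comap_iff]
  exact h x hx i j

section
variable {ι : Type*} {L : Filter ι} {d : ι → ℝ} {u : ι → ℂ} {c : ℝ} {u₀ : ℂ}

theorem tendsto_outExp (hd : Tendsto d L (𝓝 c)) (hu : Tendsto u L (𝓝 u₀)) (h0 : u₀ ≠ 0) (l : ℕ) :
    Tendsto (fun i => outExp (d i) l (u i)) L (𝓝 (outExp c l u₀)) := by
  unfold outExp
  have h1 : Tendsto (fun i => ‖u i‖ ^ (-d i)) L (𝓝 (‖u₀‖ ^ (-c))) :=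
    hu.norm.rpow hd.neg (Or.inl (norm_ne_zero_iff.2 h0))
  exact ((Complex.continuous_ofReal.tendsto _).comp h1).mul ((hu.inv₀ h0).pow l)

theorem tendsto_outExp_sub (hd : Tendsto d L (𝓝 c)) (hu : Tendsto u L (𝓝 u₀)) (h0 : u₀ ≠ 0)
    (l : ℕ) : Tendsto (fun i => outExp (d i) l (u i) - outExp c l (u i)) L (𝓝 0) := by
  rw [← sub_self (outExp c l u₀)]
  exact (tendsto_outExp hd hu h0 l).sub (tendsto_outExp tendsto_const_nhds hu h0 l)

/-- If the limit point is real, neither of the two terms need converge, but at each index both use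
the same branch; the difference is bounded by the sum of the differences for the two branches. -/
theorem tendsto_outEps_sub (hc : 1 ≤ c) (hd : Tendsto d L (𝓝 c)) (hu : Tendsto u L (𝓝 u₀))
    (h0 : u₀ ≠ 0) (l : ℕ) (hl : 1 ≤ l) :
    Tendsto (fun i => outEps (d i) l (u i) - outEps c l (u i)) L (𝓝 0) := by
  have hl' : (1 : ℝ) ≤ l := by exact_mod_cast hl
  have hne : ((c + l - 1 : ℝ) : ℂ) ≠ 0 := by exact_mod_cast (by linarith : 0 < c + l - 1).ne'
  have hden : Tendsto (fun i => ((d i + l - 1 : ℝ) : ℂ)) L (𝓝 ((c + l - 1 : ℝ) : ℂ)) :=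
    (Complex.continuous_ofReal.tendsto _).comp ((hd.add_const _).sub_const _)
  have h1 : Tendsto (fun i => outExp (d i) l (u i) * u i / ((d i + l - 1 : ℝ) : ℂ) -
      outExp c l (u i) * u i / ((c + l - 1 : ℝ) : ℂ)) L (𝓝 0) := by
    rw [← sub_self (outExp c l u₀ * u₀ / ((c + l - 1 : ℝ) : ℂ))]
    exact (((tendsto_outExp hd hu h0 l).mul hu).div hden hne).sub
      (((tendsto_outExp tendsto_const_nhds hu h0 l).mul hu).div_const _)
  have hconj : Tendsto (fun i => (starRingEnd ℂ) (u i)) L (𝓝 ((starRingEnd ℂ) u₀)) :=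
    (Complex.continuous_conj.tendsto _).comp hu
  have h2 := tendsto_outExp_sub hd hconj (by simpa using h0) l
  have h3 := h1.norm.add h2.norm
  rw [norm_zero, add_zero] at h3
  refine squeeze_zero_norm (fun i => ?_) h3
  rw [outEps, outEps]
  split_ifs
  · exact le_add_of_nonneg_right (norm_nonneg _)
  · rw [← mul_sub, norm_mul]
    calc _ ≤ 1 * ‖outExp (d i) l ((starRingEnd ℂ) (u i)) - outExp c l ((starRingEnd ℂ) (u i))‖ :=
          mul_le_mul_of_nonneg_right (norm_iota_le _) (norm_nonneg _)
      _ ≤ _ := by rw [one_mul]; exact le_add_of_nonneg_left (norm_nonneg _)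

end

theorem rpow_neg_le_one {ρ c : ℝ} (hρ : 1 ≤ ρ) (hc : 0 ≤ c) : ρ ^ (-c) ≤ 1 :=
  Real.rpow_le_one_of_one_le_of_nonpos hρ (by linarith)

theorem norm_outExp_le' {c ρ : ℝ} (hc : 0 ≤ c) (hρ : 1 ≤ ρ) {z : ℂ} (hz : ρ ≤ ‖z‖) (l : ℕ) :
    ‖outExp c l z‖ ≤ 2 * ρ * ρ ^ (-c) * ρ⁻¹ ^ l := by
  have h := norm_outExp_le hc hρ hz l
  have h0 : 0 ≤ ρ ^ (-c) * ρ⁻¹ ^ l := (norm_nonneg _).trans h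
  calc _ ≤ 1 * (ρ ^ (-c) * ρ⁻¹ ^ l) := by rwa [one_mul]
    _ ≤ (2 * ρ) * (ρ ^ (-c) * ρ⁻¹ ^ l) := mul_le_mul_of_nonneg_right (by linarith) h0
    _ = _ := by ring

theorem two_mul_rpow_mul_le {ρ c : ℝ} (hρ : 1 ≤ ρ) (hc : 0 ≤ c) (l : ℕ) :
    2 * ρ * ρ ^ (-c) * ρ⁻¹ ^ l ≤ 2 * ρ * ρ⁻¹ ^ l := by
  have h0 : 0 ≤ 2 * ρ * ρ⁻¹ ^ l := by positivity
  calc _ = 2 * ρ * ρ⁻¹ ^ l * ρ ^ (-c) := by ring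
    _ ≤ 2 * ρ * ρ⁻¹ ^ l * 1 := mul_le_mul_of_nonneg_left (rpow_neg_le_one hρ hc) h0
    _ = _ := by ring

theorem norm_lineSgn_le (z : ℂ) : ‖lineSgn z‖ ≤ 1 := by
  rw [lineSgn]
  split_ifs
  · exact norm_sgn_le_one _
  · simp

theorem tendsto_bounded_mul {ι : Type*} {L : Filter ι} {f g : ι → ℂ} (hf : ∀ i, ‖f i‖ ≤ 1)
    (hg : Tendsto g L (𝓝 0)) : Tendsto (fun i => f i * g i) L (𝓝 0) := by
  refine squeeze_zero_norm (fun i => ?_) (by simpa using hg.norm)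
  rw [norm_mul]
  exact mul_le_of_le_one_left (norm_nonneg _) (hf i)

section
variable {ι : Type*} {L : Filter ι} {n : ι → ℕ} {s : ℕ → ℝ} {u v : ι → ℂ} {u₀ v₀ : ℂ} {c : ℝ}

theorem exists_lower_bound (hu : Tendsto u L (𝓝 u₀)) (hv : Tendsto v L (𝓝 v₀)) (hu0 : 1 < ‖u₀‖)
    (hv0 : 1 < ‖v₀‖) : ∃ ρ : ℝ, 1 < ρ ∧ ∀ᶠ i in L, ρ ≤ ‖u i‖ ∧ ρ ≤ ‖v i‖ := by
  obtain ⟨ρ, h1, h2⟩ := exists_between (lt_min hu0 hv0)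
  refine ⟨ρ, h1, ?_⟩
  filter_upwards [hu.norm.eventually (lt_mem_nhds (lt_min_iff.1 h2).1),
    hv.norm.eventually (lt_mem_nhds (lt_min_iff.1 h2).2)] with i h3 h4
  exact ⟨le_of_lt h3, le_of_lt h4⟩

theorem tendsto_kernelHat_sub (hsN : ∀ N : ℕ, (N : ℝ) < s N) (hn : Tendsto n L atTop) (hc : 1 ≤ c)
    (hs : Tendsto (fun N => s N - N) atTop (𝓝 c)) (hu : Tendsto u L (𝓝 u₀))
    (hv : Tendsto v L (𝓝 v₀)) (hu0 : 1 < ‖u₀‖) (hv0 : 1 < ‖v₀‖) (i j : Fin 2) :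
    Tendsto (fun k => kernelHat (n k) (s (n k)) (u k) (v k) i j - limForm c (u k) (v k) i j) L
      (𝓝 0) := by
  obtain ⟨ρ, hρ, hb⟩ := exists_lower_bound hu hv hu0 hv0
  have hr0 : 0 ≤ ρ⁻¹ := inv_nonneg.2 (by linarith)
  have hr1 : ρ⁻¹ < 1 := inv_lt_one_of_one_lt₀ hρ
  have hd : Tendsto (fun k => s (n k) - n k) L (𝓝 c) := hs.comp hn
  have hd1 : ∀ᶠ k in L, 1 / 2 ≤ s (n k) - n k :=
    (hd.eventually (lt_mem_nhds (by linarith : 1 / 2 < c))).mono fun k h => le_of_lt h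
  have hu1 : u₀ ≠ 0 := norm_pos_iff.1 (by linarith)
  have hv1 : v₀ ≠ 0 := norm_pos_iff.1 (by linarith)
  have eU := fun l (_ : 1 ≤ l) => tendsto_outExp_sub hd hu hu1 l
  have eV := fun l (_ : 1 ≤ l) => tendsto_outExp_sub hd hv hv1 l
  have fU := fun l (hl : 1 ≤ l) => tendsto_outEps_sub hc hd hu hu1 l hl
  have fV := fun l (hl : 1 ≤ l) => tendsto_outEps_sub hc hd hv hv1 l hl
  have bexp : ∀ {d : ℝ} {z : ℂ}, 1 / 2 ≤ d → ρ ≤ ‖z‖ → ∀ l, 1 ≤ l →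
      ‖outExp d l z‖ ≤ 2 * ρ * ρ⁻¹ ^ l := fun hd hz l _ =>
    (norm_outExp_le' (by linarith) hρ.le hz l).trans (two_mul_rpow_mul_le hρ.le (by linarith) l)
  have beps : ∀ {d : ℝ} {z : ℂ}, 1 / 2 ≤ d → ρ ≤ ‖z‖ → ∀ l, 1 ≤ l →
      ‖outEps d l z‖ ≤ 2 * ρ * ρ⁻¹ ^ l := fun hd hz l hl =>
    (norm_outEps_le hd hρ.le hz hl).trans (two_mul_rpow_mul_le hρ.le (by linarith) l)
  have hc2 : 1 / 2 ≤ c := by linarith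
  have bU := hb.and hd1
  have eUb := bU.mono fun k h => bexp h.2 h.1.1
  have eVb := bU.mono fun k h => bexp h.2 h.1.2
  have fUb := bU.mono fun k h => beps h.2 h.1.1
  have fVb := bU.mono fun k h => beps h.2 h.1.2
  have eUb' := bU.mono fun k h => bexp hc2 h.1.1
  have eVb' := bU.mono fun k h => bexp hc2 h.1.2
  have fUb' := bU.mono fun k h => beps hc2 h.1.1
  have fVb' := bU.mono fun k h => beps hc2 h.1.2
  have hc0 : 0 ≤ c := by linarith
  have hform : ∀ᶠ k in L, kernelHat (n k) (s (n k)) (u k) (v k) = _ :=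
    hb.mono fun k h => kernelHat_eq (hsN (n k)) (hρ.trans_le h.1) (hρ.trans_le h.2)
  have lU := tendsto_linHat_sub hn hc hs hr0 hr1 eU eUb eUb'
  have lV := tendsto_linHat_sub hn hc hs hr0 hr1 eV eVb eVb'
  have lU' := tendsto_linHat_sub hn hc hs hr0 hr1 fU fUb fUb'
  have lV' := tendsto_linHat_sub hn hc hs hr0 hr1 fV fVb fVb'
  have su := fun k => norm_lineSgn_le (u k)
  have sv := fun k => norm_lineSgn_le (v k)
  fin_cases i <;> fin_cases j
  · have h := tendsto_bilHat_sub hn hsN hc0 hs hr0 hr1 eU eV eUb eVb eUb' eVb'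
    refine h.congr' (hform.mono fun k hk => ?_)
    beta_reduce
    rw [hk]
    simp [limForm]
  · have h := (tendsto_bilHat_sub hn hsN hc0 hs hr0 hr1 eU fV eUb fVb eUb' fVb').add
      (tendsto_bounded_mul sv lU)
    rw [add_zero] at h
    refine h.congr' (hform.mono fun k hk => ?_)
    beta_reduce
    rw [hk]
    simp [limForm]
    ring
  · have h := (tendsto_bilHat_sub hn hsN hc0 hs hr0 hr1 fU eV fUb eVb fUb' eVb').sub
      (tendsto_bounded_mul su lV)
    rw [sub_zero] at h
    refine h.congr' (hform.mono fun k hk => ?_)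
    beta_reduce
    rw [hk]
    simp [limForm]
    ring
  · have h := (tendsto_bilHat_sub hn hsN hc0 hs hr0 hr1 fU fV fUb fVb fUb' fVb').add
      ((tendsto_bounded_mul sv lU').sub (tendsto_bounded_mul su lV'))
    rw [sub_zero, add_zero] at h
    refine h.congr' (hform.mono fun k hk => ?_)
    beta_reduce
    rw [hk]
    simp [limForm]
    ring

theorem tendsto_add_one_mul_rpow_neg {ρ : ℝ} (hρ : 1 < ρ) :
    Tendsto (fun x : ℝ => (x + 1) * ρ ^ (-x)) atTop (𝓝 0) := by
  have hl := Real.log_pos hρ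
  have h1 := tendsto_rpow_mul_exp_neg_mul_atTop_nhds_zero 1 _ hl
  have h2 := tendsto_rpow_mul_exp_neg_mul_atTop_nhds_zero 0 _ hl
  have h3 := h1.add h2
  rw [add_zero] at h3
  refine h3.congr fun x => ?_
  rw [Real.rpow_one, Real.rpow_zero, Real.rpow_def_of_pos (by linarith),
    show Real.log ρ * -x = -Real.log ρ * x by ring]
  ring

/-- The coefficients grow at most like s-N+1, whereas each sequence carries a factor ρ^{-(s-N)}. In
the bilinear part this factor is used for one sequence and discarded for the other; the additional ½
sgn(u-v) is all that survives. -/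
theorem tendsto_kernelHat_sub_top (hsN : ∀ N : ℕ, (N : ℝ) < s N) (hn : Tendsto n L atTop)
    (hs : Tendsto (fun N => s N - N) atTop atTop) (hu : Tendsto u L (𝓝 u₀))
    (hv : Tendsto v L (𝓝 v₀)) (hu0 : 1 < ‖u₀‖) (hv0 : 1 < ‖v₀‖) (i j : Fin 2) :
    Tendsto (fun k => kernelHat (n k) (s (n k)) (u k) (v k) i j -
      (!![0, 0; 0, halfSgn (u k) (v k)] : Matrix (Fin 2) (Fin 2) ℂ) i j) L (𝓝 0) := by
  obtain ⟨ρ, hρ, hb⟩ := exists_lower_bound hu hv hu0 hv0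
  have hr0 : 0 ≤ ρ⁻¹ := inv_nonneg.2 (by linarith)
  have hr1 : ρ⁻¹ < 1 := inv_lt_one_of_one_lt₀ hρ
  have hd : Tendsto (fun k => s (n k) - n k) L atTop := hs.comp hn
  have hz : Tendsto (fun k => (s (n k) - n k + 1) * ρ ^ (-(s (n k) - n k))) L (𝓝 0) :=
    (tendsto_add_one_mul_rpow_neg hρ).comp hd
  have hbil : ∀ {F G : ι → ℕ → ℂ},
      (∀ᶠ k in L, ∀ l, 1 ≤ l → ‖F k l‖ ≤ 2 * ρ * ρ ^ (-(s (n k) - n k)) * ρ⁻¹ ^ l) →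
      (∀ᶠ k in L, ∀ l, 1 ≤ l → ‖G k l‖ ≤ 2 * ρ * ρ ^ (-(s (n k) - n k)) * ρ⁻¹ ^ l) →
      Tendsto (fun k => bilHat (n k) (s (n k)) (F k) (G k)) L (𝓝 0) := by
    intro F G hF hG
    have h := hz.mul_const (2 * (2 * ρ) * (2 * ρ) * ∑' p, bilMaj ρ⁻¹ p)
    rw [zero_mul] at h
    refine squeeze_zero_norm' ?_ h
    filter_upwards [hF, hG] with k h1 h2
    refine (norm_bilHat_le (hsN _) hr0 hr1 h1 fun l hl => (h2 l hl).trans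
      (two_mul_rpow_mul_le hρ.le (by linarith [hsN (n k)]) l)).trans (le_of_eq (by ring))
  have hlin : ∀ {F : ι → ℕ → ℂ},
      (∀ᶠ k in L, ∀ l, 1 ≤ l → ‖F k l‖ ≤ 2 * ρ * ρ ^ (-(s (n k) - n k)) * ρ⁻¹ ^ l) →
      Tendsto (fun k => linHat (n k) (s (n k)) (F k)) L (𝓝 0) := by
    intro F hF
    have h := hz.mul_const ((2 * ρ) * ∑' k : ℕ, ρ⁻¹ ^ (2 * k + 1))
    rw [zero_mul] at h
    refine squeeze_zero_norm' ?_ h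
    filter_upwards [hF, hd.eventually_ge_atTop (1 / 2)] with k h1 h2
    exact (norm_linHat_le (by linarith) hr0 hr1 h1).trans (le_of_eq (by ring))
  have bU := hb.and (hd.eventually_ge_atTop (1 / 2))
  have eUb := bU.mono fun k h l (_ : 1 ≤ l) => norm_outExp_le' (c := s (n k) - n k)
    (by linarith [h.2]) hρ.le h.1.1 l
  have eVb := bU.mono fun k h l (_ : 1 ≤ l) => norm_outExp_le' (c := s (n k) - n k)
    (by linarith [h.2]) hρ.le h.1.2 l
  have fUb := bU.mono fun k h l (hl : 1 ≤ l) => norm_outEps_le h.2 hρ.le h.1.1 hl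
  have fVb := bU.mono fun k h l (hl : 1 ≤ l) => norm_outEps_le h.2 hρ.le h.1.2 hl
  have hform : ∀ᶠ k in L, kernelHat (n k) (s (n k)) (u k) (v k) = _ :=
    hb.mono fun k h => kernelHat_eq (hsN (n k)) (hρ.trans_le h.1) (hρ.trans_le h.2)
  have su := fun k => norm_lineSgn_le (u k)
  have sv := fun k => norm_lineSgn_le (v k)
  fin_cases i <;> fin_cases j
  · refine (hbil eUb eVb).congr' (hform.mono fun k hk => ?_)
    beta_reduce
    rw [hk]
    simp
  · have h := (hbil eUb fVb).add (tendsto_bounded_mul sv (hlin eUb))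
    rw [add_zero] at h
    refine h.congr' (hform.mono fun k hk => ?_)
    beta_reduce
    rw [hk]
    simp
  · have h := (hbil fUb eVb).sub (tendsto_bounded_mul su (hlin eVb))
    rw [sub_zero] at h
    refine h.congr' (hform.mono fun k hk => ?_)
    beta_reduce
    rw [hk]
    simp
  · have h := (hbil fUb fVb).add
      ((tendsto_bounded_mul sv (hlin fUb)).sub (tendsto_bounded_mul su (hlin fVb)))
    rw [sub_zero, add_zero] at h
    refine h.congr' (hform.mono fun k hk => ?_)
    beta_reduce
    rw [hk]
    simp

end

theorem tendsto_toReal {s : ℕ → ℝ} {c : EReal} (hc : 1 ≤ c) (hct : c ≠ ⊤)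
    (hlim : Tendsto (fun N : ℕ => ((s N - N : ℝ) : EReal)) atTop (𝓝 c)) :
    1 ≤ c.toReal ∧ Tendsto (fun N : ℕ => s N - N) atTop (𝓝 c.toReal) := by
  have hbot : c ≠ ⊥ := fun h => by
    rw [h] at hc; exact absurd hc (by decide)
  lift c to ℝ using ⟨hct, hbot⟩
  rw [EReal.toReal_coe]
  exact ⟨by exact_mod_cast hc, EReal.tendsto_coe.1 hlim⟩

theorem tendstoLocallyUniformlyOn_kernelHat {s : ℕ → ℝ} (hs : ∀ N : ℕ, (N : ℝ) < s N) {c : EReal}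
    (hc : 1 ≤ c) (hlim : Tendsto (fun N : ℕ => ((s N - N : ℝ) : EReal)) atTop (𝓝 c)) :
    TendstoLocallyUniformlyOn (fun (N : ℕ) (p : ℂ × ℂ) => kernelHat N (s N) p.1 p.2)
      (fun p : ℂ × ℂ => limitKernel c p.1 p.2) atTop (outside ×ˢ outside) := by
  refine tendstoLocallyUniformlyOn_matrix fun x hx i j => ?_
  set L := (atTop : Filter ℕ) ×ˢ 𝓝[outside ×ˢ outside] x
  have hn : Tendsto (fun q : ℕ × ℂ × ℂ => q.1) L atTop := tendsto_fst
  have hx2 : Tendsto (fun q : ℕ × ℂ × ℂ => q.2) L (𝓝 x) :=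
    tendsto_snd.mono_right nhdsWithin_le_nhds
  have hmem : ∀ᶠ q in L, q.2 ∈ outside ×ˢ outside :=
    tendsto_snd.eventually self_mem_nhdsWithin
  have hu := (continuous_fst.tendsto x).comp hx2
  have hv := (continuous_snd.tendsto x).comp hx2
  by_cases hct : c = ⊤
  · subst hct
    have hs' : Tendsto (fun N : ℕ => s N - N) atTop atTop := by
      rw [EReal.tendsto_coe_nhds_top_iff] at hlim
      exact hlim
    refine (tendsto_kernelHat_sub_top hs hn hs' hu hv hx.1 hx.2 i j).congr fun q => ?_
    rw [limitKernel_top]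
    rfl
  · obtain ⟨hc1, hs'⟩ := tendsto_toReal hc hct hlim
    refine (tendsto_kernelHat_sub hs hn hc1 hs' hu hv hx.1 hx.2 i j).congr' ?_
    filter_upwards [hmem] with q hq
    rw [limitKernel_eq hct hc1 hq.1 hq.2]
    rfl

/- ## The one-point density -/

theorem gramInv_transpose (N : ℕ) (s : ℝ) : (gramInv N s).transpose = -gramInv N s := by
  rw [gramInv]
  ext i j
  simp only [Matrix.transpose_apply, Matrix.submatrix_apply, Matrix.neg_apply]
  rcases (parityEquiv N).symm i with a | a <;> rcases (parityEquiv N).symm j with b | b <;> simp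

theorem sum_border {N : ℕ} {g : Fin (N + N % 2) → ℂ} {F : ℕ → ℂ} {e : ℂ}
    (h1 : ∀ i : Fin (N + N % 2), (i : ℕ) < N → g i = F i)
    (h2 : ∀ i : Fin (N + N % 2), N ≤ (i : ℕ) → g i = e) :
    ∑ i, g i = ∑ a ∈ Finset.range N, F a + if Odd N then e else 0 := by
  have h3 : ∑ i, g i = ∑ i : Fin (N + N % 2), (fun a : ℕ => if a < N then F a else e) i :=
    Finset.sum_congr rfl fun i _ => by
      by_cases h : (i : ℕ) < N
      · simp only [h, if_true]; exact h1 i h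
      · simp only [h, if_false]; exact h2 i (not_lt.1 h)
  rw [h3, Fin.sum_univ_eq_sum_range (fun a : ℕ => if a < N then F a else e), Finset.sum_range_add]
  congr 1
  · exact Finset.sum_congr rfl fun a ha => if_pos (Finset.mem_range.1 ha)
  · split_ifs with h
    · rw [Nat.odd_iff.1 h]; simp
    · rw [Nat.not_odd_iff.1 h]; simp

/-- The total mass of the coefficient density. -/
noncomputable def totalMass (s : ℝ) (N : ℕ) : ℝ := ∫ p : Fin N → ℝ, polyDensity s p

section
variable {s : ℝ} {k : ℕ}

/-- By `moment_system` and `border_system` the Gram matrix sends the vector X of moments to the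
total mass times a unit vector. Since the matrix is invertible, X is the corresponding column of the
inverse times the total mass. -/
theorem totalMass_mul_gramInv (hs : (k : ℝ) + 2 < s) {i j : Fin (k + 2 + (k + 2) % 2)}
    (hj : (j : ℕ) < k + 2) :
    (totalMass s (k + 2) : ℂ) * gramInv (k + 2) s i j =
      if (i : ℕ) < k + 2 then -(coeffSkew s k i j : ℂ) else coeffMom1 s (k + 1) j := by
  have hs' : ((k + 2 : ℕ) : ℝ) < s := by push_cast; exact hs
  set X : Fin (k + 2 + (k + 2) % 2) → ℂ := fun i =>
    if (i : ℕ) < k + 2 then -(coeffSkew s k i j : ℂ) else coeffMom1 s (k + 1) j with hX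
  have hodd : Odd (k + 2) ↔ Even (k + 1) := by rw [Nat.odd_add_one, Nat.not_odd_iff_even]
  have hmul : (gram (k + 2) s).mulVec X = Pi.single j (totalMass s (k + 2) : ℂ) := by
    funext i
    rw [Matrix.mulVec, dotProduct]
    by_cases hi : (i : ℕ) < k + 2
    · rw [sum_border (F := fun a => skewForm s (fun z => z ^ (i : ℕ)) (fun z => z ^ a) *
        -(coeffSkew s k a j : ℂ)) (e := lineMom s i * coeffMom1 s (k + 1) j)]
      · have h := moment_system hs hi hj
        simp only [hodd]
        have e : (Pi.single j (totalMass s (k + 2) : ℂ) : _ → ℂ) i =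
            if (i : ℕ) = j then (totalMass s (k + 2) : ℂ) else 0 := by
          simp only [Pi.single_apply, Fin.ext_iff]
        rw [e, totalMass, h, ← Finset.sum_neg_distrib]
        congr 1
        exact Finset.sum_congr rfl fun a _ => by ring
      · intro a ha
        rw [gram_of_lt s rfl rfl hi ha, hX]
        simp only [ha, if_true]
      · intro a ha
        rw [gram_of_lt_of_le s rfl hi ha, hX]
        simp only [ha.not_gt, if_false]
    · have hk : Even (k + 1) := by
        by_contra h
        have := hodd.not.2 h
        rw [Nat.not_odd_iff] at this
        omega
      rw [sum_border (F := fun a => (coeffSkew s k a j : ℂ) * lineMom s a) (e := 0)]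
      · rw [border_system hs hk hj, Pi.single_eq_of_ne]
        · simp
        · rintro rfl; exact hi hj
      · intro a ha
        rw [gram_of_le_of_lt s (not_lt.1 hi) rfl ha, hX]
        simp only [ha, if_true]
        ring
      · intro a ha
        rw [gram_of_le s (not_lt.1 hi) ha, zero_mul]
  have h1 : (gramInv (k + 2) s).mulVec ((gram (k + 2) s).mulVec X) = X := by
    rw [Matrix.mulVec_mulVec, mul_eq_one_comm.1 (gram_mul_gramInv hs'), Matrix.one_mulVec]
  rw [hmul] at h1
  have h2 := congrFun h1 i
  rw [Matrix.mulVec_single] at h2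
  change _ = X i
  rw [← h2]
  simp [mul_comm]

theorem totalMass_pos {N : ℕ} (hs : (N : ℝ) < s) : 0 < totalMass s N := integral_polyDensity_pos hs

theorem totalMass_mul_kernel (hs : (k : ℝ) + 2 < s) (z : ℂ) :
    (totalMass s (k + 2) : ℂ) * kernel (k + 2) s z z 0 1 =
      2 * (∑ i ∈ Finset.range (k + 2), ∑ j ∈ Finset.range (k + 2),
        (coeffSkew s k i j : ℂ) * ((weight s z : ℂ) * z ^ i) *
          epsOp (fun u => (weight s u : ℂ) * u ^ j) z) +
      if Even (k + 1) ∧ z.im = 0 then (weight s z : ℂ) * mom1 s (k + 1) z else 0 := by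
  have hs' : ((k + 2 : ℕ) : ℝ) < s := by push_cast; exact hs
  have hodd : Odd (k + 2) ↔ Even (k + 1) := by rw [Nat.odd_add_one, Nat.not_odd_iff_even]
  set Z := (totalMass s (k + 2) : ℂ)
  set E : ℂ := if z.im = 0 then 1 / 2 else 0 with hE
  have hinner : ∀ i : Fin (k + 2 + (k + 2) % 2), (i : ℕ) < k + 2 →
      Z * ∑ j, gramInv (k + 2) s i j * phi (k + 2) s i z * epsPhi (k + 2) s j z =
        (weight s z : ℂ) * z ^ (i : ℕ) * (∑ j ∈ Finset.range (k + 2), -(coeffSkew s k i j : ℂ) *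
          epsOp (fun u => (weight s u : ℂ) * u ^ j) z +
          if Odd (k + 2) then -(coeffMom1 s (k + 1) i : ℂ) * E else 0) := by
    intro i hi
    have hphi : phi (k + 2) s i z = (weight s z : ℂ) * z ^ (i : ℕ) := if_pos hi
    rw [hphi, Finset.mul_sum, ← sum_border (g := fun j =>
      Z * gramInv (k + 2) s i j * epsPhi (k + 2) s j z), Finset.mul_sum]
    · exact Finset.sum_congr rfl fun j _ => by ring
    · intro j hj
      rw [totalMass_mul_gramInv hs hj, if_pos hi, epsPhi, if_pos hj]
      congr 2; funext u
      exact if_pos hj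
    · intro j hj
      -- The border column is not covered by `totalMass_mul_gramInv`; antisymmetry exchanges it for
      -- the border row.
      have h := congrFun (congrFun (gramInv_transpose (k + 2) s) i) j
      rw [Matrix.transpose_apply, Matrix.neg_apply, ← neg_eq_iff_eq_neg] at h
      rw [← h, mul_neg, totalMass_mul_gramInv hs hi, if_neg hj.not_gt, epsPhi, if_neg hj.not_gt]
  have hsum : Z * kernel (k + 2) s z z 0 1 = -2 * ∑ i : Fin (k + 2 + (k + 2) % 2),
      Z * ∑ j, gramInv (k + 2) s i j * phi (k + 2) s i z * epsPhi (k + 2) s j z := by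
    rw [kernel, ← Finset.mul_sum]
    simp only [Matrix.of_apply, Matrix.cons_val', Matrix.cons_val_zero, Matrix.cons_val_one,
      Matrix.empty_val', Matrix.cons_val_fin_one]
    rw [kernelSum, gram_inv hs']
    ring
  rw [hsum, sum_border (e := 0) (F := fun i => (weight s z : ℂ) * z ^ i *
    (∑ j ∈ Finset.range (k + 2), -(coeffSkew s k i j : ℂ) *
      epsOp (fun u => (weight s u : ℂ) * u ^ j) z +
      if Odd (k + 2) then -(coeffMom1 s (k + 1) i : ℂ) * E else 0)) hinner]
  · rw [ite_self, add_zero, show (k : ℕ) + 2 = k + 1 + 1 from rfl]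
    simp only [mul_add, Finset.sum_add_distrib]
    congr 1
    · simp only [Finset.mul_sum]
      exact Finset.sum_congr rfl fun i _ => Finset.sum_congr rfl fun j _ => by ring
    · by_cases h : Even (k + 1)
      · rw [mom1_eq_sum (by push_cast; linarith), Finset.mul_sum, Finset.mul_sum]
        simp only [hodd.2 h, h, if_true, true_and]
        split_ifs with h0
        · refine Finset.sum_congr rfl fun i _ => ?_
          rw [hE, if_pos h0]; ring
        · refine Finset.sum_eq_zero fun i _ => ?_
          rw [hE, if_neg h0]; ring
      · simp [hodd, h]
  · intro i hi
    have hphi : phi (k + 2) s i z = 0 := if_neg hi.not_gt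
    simp [hphi]

theorem iota_mul_conj_sub {z : ℂ} (hz : z.im ≠ 0) :
    iota z * ((starRingEnd ℂ) z - z) = 2 * (|z.im| : ℝ) := by
  have e1 : (starRingEnd ℂ) z - z = -(2 * z.im * Complex.I) := by
    apply Complex.ext <;> simp; ring
  have e2 : ((Real.sign z.im : ℝ) : ℂ) * z.im = (|z.im| : ℝ) := by
    rw [← Complex.ofReal_mul]
    rcases lt_or_gt_of_ne hz with h | h
    · rw [Real.sign_of_neg h, abs_of_neg h]; simp
    · rw [Real.sign_of_pos h, abs_of_pos h]; simp
  rw [e1, iota, sgn, ← e2]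
  linear_combination (-2 * (Real.sign z.im : ℂ) * z.im) * Complex.I_sq

/-- At a non-real point ε evaluates at z̄, so the double sum collapses to (z̄-z) times the second
moment at (z̄, z), the integral of |q(z)|². The identity ι(z)(z̄-z) = 2|Im z| then produces the
Jacobian 4|Im z||q(z)|². -/
theorem kernel_density_of_im_ne_zero (hs : (k : ℝ) + 2 < s) {z : ℂ} (hz : z.im ≠ 0) :
    (totalMass s (k + 2) : ℂ) * kernel (k + 2) s z z 0 1 =
      ((∫ q : Fin k → ℝ, 4 * |z.im| * Complex.normSq ((monicPoly q).eval z) *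
        polyDensity s (mulQuad z q) : ℝ) : ℂ) := by
  have h1 : ((∫ q : Fin k → ℝ, 4 * |z.im| * Complex.normSq ((monicPoly q).eval z) *
      polyDensity s (mulQuad z q) : ℝ) : ℂ) =
      (4 * |z.im| * weight s z ^ 2 : ℝ) * mom2 s k ((starRingEnd ℂ) z) z := by
    rw [← integral_complex_ofReal, mom2, ← integral_const_mul]
    congr 1; funext q
    rw [polyDensity_mulQuad]
    push_cast
    rw [normSq_eq_eval_mul]
    ring
  rw [totalMass_mul_kernel hs, if_neg (fun h => hz h.2), add_zero, h1]
  have h2 := sub_mul_mom2 hs ((starRingEnd ℂ) z) z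
  have h3 : ∑ i ∈ Finset.range (k + 2), ∑ j ∈ Finset.range (k + 2),
      (coeffSkew s k i j : ℂ) * ((weight s z : ℂ) * z ^ i) *
        epsOp (fun u => (weight s u : ℂ) * u ^ j) z =
      (weight s z : ℂ) ^ 2 * iota z * (((starRingEnd ℂ) z - z) *
        mom2 s k ((starRingEnd ℂ) z) z) := by
    rw [h2, Finset.mul_sum]
    refine Finset.sum_congr rfl fun i _ => ?_
    rw [Finset.mul_sum]
    refine Finset.sum_congr rfl fun j _ => ?_
    rw [epsOp, if_neg hz, weight_conj]
    ring
  rw [h3]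
  push_cast
  linear_combination (2 * (weight s z : ℂ) ^ 2 * mom2 s k ((starRingEnd ℂ) z) z) *
    iota_mul_conj_sub hz

/-- Here `integral_sign_eval` is read backwards at a = v = x: the sign integral comes from ε, the
first moment from the border, and together they give the integral of sgn r(x) r(x) = |r(x)|. -/
theorem kernel_density_ofReal (hs : (k : ℝ) + 2 < s) (x : ℝ) :
    (totalMass s (k + 2) : ℂ) * kernel (k + 2) s x x 0 1 =
      ((∫ q : Fin (k + 1) → ℝ, |(realPoly q).eval x| * polyDensity s (mulLin x q) : ℝ) : ℂ) := by
  have h1 : ((∫ q : Fin (k + 1) → ℝ, |(realPoly q).eval x| * polyDensity s (mulLin x q) : ℝ) : ℂ) =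
      weight s x * ∫ r : Fin (k + 1) → ℝ, (Real.sign ((realPoly r).eval x) : ℂ) *
        ((monicPoly r).eval (x : ℂ) * (polyDensity s r : ℂ)) := by
    rw [← integral_complex_ofReal, ← integral_const_mul]
    congr 1; funext q
    rw [polyDensity_mulLin, monicPoly_eval_ofReal]
    have : |(realPoly q).eval x| = Real.sign ((realPoly q).eval x) * (realPoly q).eval x := by
      rcases lt_trichotomy ((realPoly q).eval x) 0 with h | h | h
      · rw [Real.sign_of_neg h, abs_of_neg h]; ring
      · rw [h]; simp
      · rw [Real.sign_of_pos h, abs_of_pos h]; ring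
    rw [this]
    push_cast
    ring
  rw [totalMass_mul_kernel hs, h1, integral_sign_eval hs]
  have hlt : ∀ j ∈ Finset.range (k + 2), (j : ℝ) + 1 < s := fun j hj => by
    have : (j : ℝ) + 1 ≤ k + 2 := by exact_mod_cast Finset.mem_range.1 hj
    linarith
  have hterm : ∀ j ∈ Finset.range (k + 2), Integrable fun t : ℝ =>
      (weight s t : ℂ) * (t : ℂ) ^ j * sgn (t - x) := fun j hj =>
    (integrable_weight_mul_pow (hlt j hj)).mul_bdd (c := 1)
      (measurable_sgn.comp (measurable_id.sub_const x)).aestronglyMeasurable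
      (Eventually.of_forall fun t => norm_sgn_le_one _)
  have h2 : ∫ y : ℝ, (Real.sign (x - y) : ℂ) * weight s y * ((x - y) * mom2 s k x y) =
      2 * ∑ i ∈ Finset.range (k + 2), ∑ j ∈ Finset.range (k + 2),
        (coeffSkew s k i j : ℂ) * (x : ℂ) ^ i *
          epsOp (fun u => (weight s u : ℂ) * u ^ j) x := by
    have e1 : ∀ y : ℝ, (Real.sign (x - y) : ℂ) * weight s y * ((x - y) * mom2 s k x y) =
        ∑ i ∈ Finset.range (k + 2), ∑ j ∈ Finset.range (k + 2),
        (coeffSkew s k i j : ℂ) * (x : ℂ) ^ i * ((weight s y : ℂ) * (y : ℂ) ^ j * sgn (y - x)) := by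
      intro y
      have e2 : (Real.sign (x - y) : ℂ) = -sgn (y - x) := by rw [← sgn_neg, neg_sub, sgn]
      rw [e2, mom2_comm, show -sgn (y - x) * weight s y * (((x : ℂ) - y) * mom2 s k y x) =
        sgn (y - x) * weight s y * (((y : ℂ) - x) * mom2 s k y x) by ring, sub_mul_mom2 hs,
        Finset.mul_sum]
      refine Finset.sum_congr rfl fun i _ => ?_
      rw [Finset.mul_sum]
      exact Finset.sum_congr rfl fun j _ => by ring
    simp only [e1]
    rw [integral_finsetSum _ fun i _ => integrable_finsetSum _ fun j hj => (hterm j hj).const_mul _,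
      Finset.mul_sum]
    refine Finset.sum_congr rfl fun i _ => ?_
    rw [integral_finsetSum _ fun j hj => (hterm j hj).const_mul _, Finset.mul_sum]
    refine Finset.sum_congr rfl fun j _ => ?_
    rw [integral_const_mul, epsOp, if_pos (Complex.ofReal_im x), Complex.ofReal_re]
    ring
  rw [h2]
  simp only [Complex.ofReal_im, and_true]
  rw [mul_add, mul_ite, mul_zero]
  congr 1
  simp only [Finset.mul_sum]
  exact Finset.sum_congr rfl fun i _ => Finset.sum_congr rfl fun j _ => by ring

end

/- ## The expected number of roots -/

/-- The density of the real roots. -/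
noncomputable def realDens (N : ℕ) (s : ℝ) (a : ℝ) : ENNReal :=
  ENNReal.ofReal (kernel N s a a 0 1).re

/-- The density of the non-real roots. -/
noncomputable def cplxDens (N : ℕ) (s : ℝ) (z : ℂ) : ENNReal :=
  if z.im = 0 then 0 else ENNReal.ofReal (kernel N s z z 0 1).re

theorem tsum_indicator_coe {α : Type*} (A : Finset α) (f : α → ENNReal) :
    ∑' a, (A : Set α).indicator f a = ∑ a ∈ A, f a := by
  rw [← tsum_subtype]
  exact Finset.tsum_subtype' A f

theorem rootCount_eq {n : ℕ} {p : Fin n → ℝ} (h : SimpleRoots p) (S : Set ℂ) (d : ENNReal) :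
    (rootCount p S : ENNReal) * d =
      (∑' a, (simpleReal p : Set ℝ).indicator
        (fun a : ℝ => S.indicator (fun _ => (1 : ENNReal)) (a : ℂ) * d) a) +
      ∑' z, (simpleNonreal p : Set ℂ).indicator
        (fun z => S.indicator (fun _ => (1 : ENNReal)) z * d) z := by
  classical
  rw [tsum_indicator_coe, tsum_indicator_coe, ← Finset.sum_mul, ← Finset.sum_mul, ← add_mul, ← h.sum_roots (fun z => S.indicator (fun _ => (1 : ENNReal)) z)]
  congr 1
  have h1 : (monicPoly p).roots.toFinset.val = (monicPoly p).roots := by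
    rw [Multiset.toFinset_val, h.nodup.dedup]
  simp only [Set.indicator_apply, Finset.sum_boole]
  rw [rootCount, Multiset.countP_eq_card_filter]
  conv_lhs => rw [← h1]
  rfl

section
variable {s : ℝ} {k : ℕ}

theorem lintegral_coeffDensity {N : ℕ} (hs : (N : ℝ) < s) :
    ∫⁻ b : Fin N → ℝ, coeffDensity s b = ENNReal.ofReal (totalMass s N) := by
  have hi : Integrable fun b : Fin N → ℝ => polyDensity s b := by
    simpa using integrable_pow_mul_polyDensity (k := 0) (by simpa using hs)
  rw [totalMass, ofReal_integral_eq_lintegral_ofReal hi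
    (Eventually.of_forall fun b => (polyDensity_pos s b).le)]
  rfl

theorem lintegral_real_fiber (hs : (k : ℝ) + 2 < s) (a : ℝ) :
    ∫⁻ q : Fin (k + 1) → ℝ, ENNReal.ofReal |(realPoly q).eval a| *
        ENNReal.ofReal (polyDensity s (mulLin a q)) =
      ENNReal.ofReal (totalMass s (k + 2)) * realDens (k + 2) s a := by
  have hs' : ((k + 2 : ℕ) : ℝ) < s := by push_cast; exact hs
  have hi := ((integrable_eval_mul_polyDensity (s := s) (n := k + 1) (by push_cast; linarith)
    (a : ℂ)).norm.const_mul (weight s a))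
  have hi' : Integrable fun q : Fin (k + 1) → ℝ =>
      |(realPoly q).eval a| * polyDensity s (mulLin a q) := by
    refine hi.congr (Eventually.of_forall fun q => ?_)
    simp only
    rw [norm_mul, Complex.norm_real, Real.norm_of_nonneg (polyDensity_pos s q).le,
      polyDensity_mulLin, monicPoly_eval_ofReal, Complex.norm_real, Real.norm_eq_abs]
    ring
  rw [realDens, ← ENNReal.ofReal_mul (totalMass_pos hs').le, ← Complex.re_ofReal_mul,
    kernel_density_ofReal hs, Complex.ofReal_re, ofReal_integral_eq_lintegral_ofReal hi'
      (Eventually.of_forall fun q => mul_nonneg (abs_nonneg _) (polyDensity_pos s _).le)]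
  simp only [ENNReal.ofReal_mul (abs_nonneg _)]

theorem lintegral_complex_fiber (hs : (k : ℝ) + 2 < s) (z : ℂ) :
    ∫⁻ q : Fin k → ℝ, ENNReal.ofReal (4 * |z.im| * Complex.normSq ((monicPoly q).eval z)) *
        ENNReal.ofReal (polyDensity s (mulQuad z q)) =
      ENNReal.ofReal (totalMass s (k + 2)) * cplxDens (k + 2) s z := by
  have hs' : ((k + 2 : ℕ) : ℝ) < s := by push_cast; exact hs
  have h0 : ∀ q : Fin k → ℝ, 0 ≤ 4 * |z.im| * Complex.normSq ((monicPoly q).eval z) := fun q =>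
    mul_nonneg (by positivity) (Complex.normSq_nonneg _)
  rw [cplxDens]
  -- On the real line the factor |Im z| vanishes, in agreement with the value zero given to
  -- `cplxDens` there.
  split_ifs with hz
  · simp [hz]
  have hb := (integrable_pow_mul_polyDensity (s := s) (n := k) (k := 2)
    (by push_cast; linarith)).const_mul (4 * |z.im| * weight s z ^ 2 *
      ((k + 1) * (1 + ‖z‖) ^ k) ^ 2)
  have hi : Integrable fun q : Fin k → ℝ =>
      4 * |z.im| * Complex.normSq ((monicPoly q).eval z) * polyDensity s (mulQuad z q) := by
    refine hb.mono' (((measurable_const.mul (Complex.continuous_normSq.measurable.comp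
      (measurable_monicPoly_eval z))).mul ((measurable_polyDensity s _).comp
      ((continuous_mulQuad k).comp (continuous_const.prodMk continuous_id)).measurable)
        ).aestronglyMeasurable) (Eventually.of_forall fun q => ?_)
    rw [Real.norm_of_nonneg (mul_nonneg (h0 q) (polyDensity_pos s _).le), polyDensity_mulQuad,
      Complex.normSq_eq_norm_sq]
    have h1 := pow_le_pow_left₀ (norm_nonneg _) (norm_monicPoly_eval_le q z) 2
    have hF := (polyDensity_pos s q).le
    calc _ = 4 * |z.im| * weight s z ^ 2 * polyDensity s q * ‖(monicPoly q).eval z‖ ^ 2 := by ring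
      _ ≤ 4 * |z.im| * weight s z ^ 2 * polyDensity s q *
          ((1 + ‖q‖) * ((k + 1) * (1 + ‖z‖) ^ k)) ^ 2 := by gcongr
      _ = _ := by ring
  rw [← ENNReal.ofReal_mul (totalMass_pos hs').le, ← Complex.re_ofReal_mul,
    kernel_density_of_im_ne_zero hs hz, Complex.ofReal_re, ofReal_integral_eq_lintegral_ofReal hi
      (Eventually.of_forall fun q => mul_nonneg (h0 q) (polyDensity_pos s _).le)]
  simp only [ENNReal.ofReal_mul (h0 _)]

theorem measurable_real_integrand (s : ℝ) (k : ℕ) :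
    Measurable fun x : ℝ × (Fin (k + 1) → ℝ) => ENNReal.ofReal |(realPoly x.2).eval x.1| *
        ENNReal.ofReal (polyDensity s (mulLin x.1 x.2)) :=
  (ENNReal.measurable_ofReal.comp (continuous_realPoly_eval _).abs.measurable).mul
    (ENNReal.measurable_ofReal.comp ((measurable_polyDensity s _).comp
      (continuous_mulLin _).measurable))

theorem measurable_complex_integrand (s : ℝ) (k : ℕ) :
    Measurable fun x : ℂ × (Fin k → ℝ) =>
      ENNReal.ofReal (4 * |x.1.im| * Complex.normSq ((monicPoly x.2).eval x.1)) *
        ENNReal.ofReal (polyDensity s (mulQuad x.1 x.2)) :=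
  (ENNReal.measurable_ofReal.comp ((measurable_const.mul (continuous_abs.measurable.comp
    (Complex.measurable_im.comp measurable_fst))).mul
    (Complex.continuous_normSq.comp (continuous_monicPoly_eval k)).measurable)).mul
    (ENNReal.measurable_ofReal.comp ((measurable_polyDensity s _).comp
      (continuous_mulQuad _).measurable))

theorem measurable_of_ofReal_mul {α : Type*} [MeasurableSpace α] {f : α → ENNReal} {Z : ℝ}
    (hZ : 0 < Z) (h : Measurable fun x => ENNReal.ofReal Z * f x) : Measurable f := by
  have h0 : ENNReal.ofReal Z ≠ 0 := (ENNReal.ofReal_pos.2 hZ).ne'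
  have := h.const_mul (ENNReal.ofReal Z)⁻¹
  simpa only [← mul_assoc, ENNReal.inv_mul_cancel h0 ENNReal.ofReal_ne_top, one_mul] using this

theorem measurable_realDens (hs : (k : ℝ) + 2 < s) : Measurable (realDens (k + 2) s) := by
  refine measurable_of_ofReal_mul (totalMass_pos (N := k + 2) (by push_cast; exact hs)) ?_
  simp only [← lintegral_real_fiber hs]
  exact (measurable_real_integrand s k).lintegral_prod_right'

theorem measurable_cplxDens (hs : (k : ℝ) + 2 < s) : Measurable (cplxDens (k + 2) s) := by
  refine measurable_of_ofReal_mul (totalMass_pos (N := k + 2) (by push_cast; exact hs)) ?_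
  simp only [← lintegral_complex_fiber hs]
  exact (measurable_complex_integrand s k).lintegral_prod_right'

theorem lintegral_fst_mul {X Y : Type*} [MeasureSpace X] [MeasureSpace Y]
    [SFinite (volume : Measure X)] [SFinite (volume : Measure Y)] {h : X → ENNReal}
    {g : X × Y → ENNReal} (hh : Measurable h) (hg : Measurable g) :
    ∫⁻ x : X × Y, h x.1 * g x = ∫⁻ a, h a * ∫⁻ y, g (a, y) := by
  rw [Measure.volume_eq_prod]
  exact (lintegral_prod _ ((hh.comp measurable_fst).mul hg).aemeasurable).trans
    (lintegral_congr fun a => lintegral_const_mul (f := fun y => g (a, y)) (h a)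
      (hg.comp measurable_prodMk_left))

/-- Almost surely all roots are simple, so their number is a sum over simple real and simple
non-real roots. The two area formulas integrate these sums, the inner integrals are total mass times
kernel density, and the total mass cancels. -/
theorem expectedRoots_eq (hs : (k : ℝ) + 2 < s) {S : Set ℂ} (hS : MeasurableSet S) :
    expectedRoots (k + 2) s S = (∫⁻ a in Complex.ofReal ⁻¹' S, realDens (k + 2) s a) +
      ∫⁻ z in S, cplxDens (k + 2) s z := by
  have hs' : ((k + 2 : ℕ) : ℝ) < s := by push_cast; exact hs
  have hZ := totalMass_pos hs'
  have hZ0 : ENNReal.ofReal (totalMass s (k + 2)) ≠ 0 := (ENNReal.ofReal_pos.2 hZ).ne'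
  have hm : ∀ n : ℕ, Measurable fun p : Fin n → ℝ => ENNReal.ofReal (polyDensity s p) := fun n =>
    ENNReal.measurable_ofReal.comp (measurable_polyDensity s n)
  have hmS : Measurable (S.indicator fun _ => (1 : ENNReal)) := measurable_const.indicator hS
  have hSr : MeasurableSet (Complex.ofReal ⁻¹' S) := Complex.measurable_ofReal hS
  obtain ⟨r1, r2⟩ := fiber_real (k + 1) (fun a p => S.indicator (fun _ => (1 : ENNReal)) (a : ℂ) *
    ENNReal.ofReal (polyDensity s p)) (((hmS.comp Complex.measurable_ofReal).comp
      measurable_fst).mul ((hm _).comp measurable_snd))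
  obtain ⟨c1, c2⟩ := fiber_complex k (fun a p => S.indicator (fun _ => (1 : ENNReal)) a *
    ENNReal.ofReal (polyDensity s p)) ((hmS.comp measurable_fst).mul ((hm _).comp measurable_snd))
  have hnum : ∫⁻ b : Fin (k + 2) → ℝ, (rootCount b S : ENNReal) * coeffDensity s b =
      ENNReal.ofReal (totalMass s (k + 2)) *
        ((∫⁻ a in Complex.ofReal ⁻¹' S, realDens (k + 2) s a) +
          ∫⁻ z in S, cplxDens (k + 2) s z) := by
    rw [lintegral_congr_ae ((ae_simpleRoots (k + 1)).mono fun p hp => rootCount_eq hp S _)]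
    have e := lintegral_add_left (μ := volume) r1 fun p : Fin (k + 2) → ℝ =>
      ∑' z, (simpleNonreal p : Set ℂ).indicator (fun z =>
        S.indicator (fun _ => (1 : ENNReal)) z * ENNReal.ofReal (polyDensity s p)) z
    refine e.trans ?_
    rw [← r2, ← c2, mul_add, ← lintegral_const_mul' _ _ ENNReal.ofReal_ne_top,
      ← lintegral_const_mul' _ _ ENNReal.ofReal_ne_top, ← lintegral_indicator hSr,
      ← lintegral_indicator hS]
    congr 1
    · simp only [mul_left_comm _ (S.indicator _ _)]
      refine (lintegral_fst_mul (hmS.comp Complex.measurable_ofReal)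
        (measurable_real_integrand s k)).trans (lintegral_congr fun a => ?_)
      rw [Function.comp_apply, lintegral_real_fiber hs]
      by_cases h : (a : ℂ) ∈ S <;> simp [h]
    · simp only [mul_left_comm _ (S.indicator _ _)]
      rw [lintegral_fst_mul hmS (measurable_complex_integrand s k)]
      refine lintegral_congr fun a => ?_
      rw [lintegral_complex_fiber hs]
      by_cases h : a ∈ S <;> simp [h]
  rw [expectedRoots, hnum, lintegral_coeffDensity hs', mul_comm,
    ENNReal.mul_div_cancel_right hZ0 ENNReal.ofReal_ne_top]

end

/- ## The limit of the expected number of roots -/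

theorem kernel_self_eq_kernelHat (N : ℕ) (s : ℝ) {z : ℂ} (hz : 1 < ‖z‖) :
    kernel N s z z 0 1 = kernelHat N s z z 0 1 := by
  have h : (((‖z * z‖ : ℝ) : ℂ) / (z * (starRingEnd ℂ) z)) = 1 := by
    have h0 : ‖z‖ ^ 2 ≠ 0 := by positivity
    rw [Complex.mul_conj, Complex.normSq_eq_norm_sq, norm_mul, ← sq,
      div_self (by exact_mod_cast h0)]
  have e : kernelHat N s z z 0 1 =
      (((‖z * z‖ : ℝ) : ℂ) / (z * (starRingEnd ℂ) z)) ^ N * kernel N s z z 0 1 := rfl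
  rw [e, h, one_pow, one_mul]

/-- From the total exponent c+l at least 3/2 is kept as decay in |z|, and the remaining l-1 powers
supply the geometric rate. Two such factors give |z|^{-3}, integrable at infinity in the plane; one
gives |x|^{-3/2}, integrable on the line. -/
theorem norm_outExp_le_decay {c ρ : ℝ} (hc : 1 / 2 ≤ c) (hρ : 1 ≤ ρ) {z : ℂ} (hz : ρ ≤ ‖z‖) {l : ℕ}
    (hl : 1 ≤ l) : ‖outExp c l z‖ ≤ ρ * ‖z‖ ^ (-(3 / 2) : ℝ) * ρ⁻¹ ^ l := by
  obtain ⟨n, rfl⟩ : ∃ n, l = n + 1 := ⟨l - 1, by omega⟩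
  have h0 : 0 < ρ := by linarith
  have hz0 : 0 < ‖z‖ := by linarith
  have h1 : ‖z‖ ^ (-c) * ‖z‖⁻¹ ≤ ‖z‖ ^ (-(3 / 2) : ℝ) := by
    rw [← Real.rpow_neg_one, ← Real.rpow_add hz0]
    exact Real.rpow_le_rpow_of_exponent_le (hρ.trans hz) (by linarith)
  have h2 : ‖z‖⁻¹ ^ n ≤ ρ⁻¹ ^ n := pow_le_pow_left₀ (by positivity) (inv_anti₀ h0 hz) n
  have h3 : ρ * ρ⁻¹ ^ (n + 1) = ρ⁻¹ ^ n := by rw [pow_succ]; field_simp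
  rw [norm_outExp, pow_succ']
  calc _ = (‖z‖ ^ (-c) * ‖z‖⁻¹) * ‖z‖⁻¹ ^ n := by ring
    _ ≤ ‖z‖ ^ (-(3 / 2) : ℝ) * ρ⁻¹ ^ n := mul_le_mul h1 h2 (by positivity) (by positivity)
    _ = _ := by rw [← h3]; ring

theorem norm_kernel_le_of_im_ne_zero {N : ℕ} {s M ρ : ℝ} (hs : (N : ℝ) + 1 / 2 ≤ s)
    (hM : s - N + 1 ≤ M) (hρ : 1 < ρ) {z : ℂ} (hz : ρ ≤ ‖z‖) (h0 : z.im ≠ 0) :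
    ‖kernel N s z z 0 1‖ ≤ M * (2 * ρ * ρ) * (∑' p, bilMaj ρ⁻¹ p) * ‖z‖ ^ (-3 : ℝ) := by
  have hz1 : 1 < ‖z‖ := hρ.trans_le hz
  have hz0 : 0 < ‖z‖ := by linarith
  have hr0 : 0 ≤ ρ⁻¹ := inv_nonneg.2 (by linarith)
  have hr1 : ρ⁻¹ < 1 := inv_lt_one_of_one_lt₀ hρ
  have hc : 1 / 2 ≤ s - N := by linarith
  have hE : ∀ l, 1 ≤ l → ‖outEps (s - N) l z‖ ≤ ρ * ‖z‖ ^ (-(3 / 2) : ℝ) * ρ⁻¹ ^ l := by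
    intro l hl
    rw [outEps, if_neg h0, norm_mul]
    have h := norm_outExp_le_decay hc hρ.le (z := (starRingEnd ℂ) z) (by rwa [RCLike.norm_conj]) hl
    rw [RCLike.norm_conj] at h
    calc _ ≤ 1 * _ := mul_le_mul (norm_iota_le z) h (norm_nonneg _) zero_le_one
      _ = _ := one_mul _
  have h := norm_bilHat_le (N := N) (s := s) (by linarith) hr0 hr1
    (fun l hl => norm_outExp_le_decay hc hρ.le hz hl) hE
  have e : kernelHat N s z z 0 1 = bilHat N s (fun l => outExp (s - N) l z)
      (fun l => outEps (s - N) l z) := by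
    rw [kernelHat_eq (by linarith) hz1 hz1]
    simp [lineSgn_of_im_ne_zero h0]
  have h3 : ‖z‖ ^ (-(3 / 2) : ℝ) * ‖z‖ ^ (-(3 / 2) : ℝ) = ‖z‖ ^ (-3 : ℝ) := by
    rw [← Real.rpow_add hz0]; norm_num
  have hT : 0 ≤ ∑' p, bilMaj ρ⁻¹ p := tsum_nonneg fun p => bilMaj_nonneg hr0 p
  rw [kernel_self_eq_kernelHat N s hz1, e]
  refine h.trans ?_
  rw [← h3]
  calc _ ≤ M * (2 * (ρ * ‖z‖ ^ (-(3 / 2) : ℝ)) * (ρ * ‖z‖ ^ (-(3 / 2) : ℝ))) *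
        ∑' p, bilMaj ρ⁻¹ p := by gcongr
    _ = _ := by ring

/-- On the line ε costs a power, so only the first variable supplies decay while the second is
merely bounded; for one-dimensional integration this is enough. -/
theorem norm_kernel_le_of_im_eq_zero {N : ℕ} {s M ρ : ℝ} (hs : (N : ℝ) + 1 / 2 ≤ s)
    (hM : s - N + 1 ≤ M) (hρ : 1 < ρ) {z : ℂ} (hz : ρ ≤ ‖z‖) :
    ‖kernel N s z z 0 1‖ ≤ (M * (2 * ρ * (2 * ρ)) * (∑' p, bilMaj ρ⁻¹ p) +
      M * ρ * ∑' k : ℕ, ρ⁻¹ ^ (2 * k + 1)) * ‖z‖ ^ (-(3 / 2) : ℝ) := by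
  have hz1 : 1 < ‖z‖ := hρ.trans_le hz
  have hr0 : 0 ≤ ρ⁻¹ := inv_nonneg.2 (by linarith)
  have hr1 : ρ⁻¹ < 1 := inv_lt_one_of_one_lt₀ hρ
  have hc : 1 / 2 ≤ s - N := by linarith
  have hF := fun l (hl : 1 ≤ l) => norm_outExp_le_decay hc hρ.le hz hl
  have hE := fun l (hl : 1 ≤ l) => (norm_outEps_le hc hρ.le hz hl).trans
    (two_mul_rpow_mul_le hρ.le (by linarith) l)
  have h1 := norm_bilHat_le (N := N) (s := s) (by linarith) hr0 hr1 hF hE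
  have h2 := norm_linHat_le hs hr0 hr1 hF
  have hT : 0 ≤ ∑' p, bilMaj ρ⁻¹ p := tsum_nonneg fun p => bilMaj_nonneg hr0 p
  have hT' : 0 ≤ ∑' k : ℕ, ρ⁻¹ ^ (2 * k + 1) := tsum_nonneg fun k => pow_nonneg hr0 _
  rw [kernel_self_eq_kernelHat N s hz1, kernelHat_eq (by linarith) hz1 hz1]
  simp only [Matrix.of_apply, Matrix.cons_val', Matrix.cons_val_zero, Matrix.cons_val_one,
    Matrix.cons_val_fin_one]
  refine (norm_add_le _ _).trans ?_
  rw [norm_mul]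
  calc _ ≤ _ := add_le_add h1 (mul_le_of_le_one_left (norm_nonneg _) (norm_lineSgn_le z) |>.trans h2)
    _ ≤ M * (2 * (ρ * ‖z‖ ^ (-(3 / 2) : ℝ)) * (2 * ρ)) * (∑' p, bilMaj ρ⁻¹ p) +
        M * (ρ * ‖z‖ ^ (-(3 / 2) : ℝ)) * ∑' k : ℕ, ρ⁻¹ ^ (2 * k + 1) := by gcongr
    _ = _ := by ring

theorem lintegral_rpow_neg_lt_top {E : Type*} [NormedAddCommGroup E] [NormedSpace ℝ E]
    [FiniteDimensional ℝ E] [MeasurableSpace E] [BorelSpace E] (μ : Measure E)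
    [μ.IsAddHaarMeasure] {r : ℝ} (hr : (Module.finrank ℝ E : ℝ) < r) (C : ℝ) {S : Set E}
    (hS : MeasurableSet S) (h1 : ∀ z ∈ S, 1 ≤ ‖z‖) :
    ∫⁻ z in S, ENNReal.ofReal (C * ‖z‖ ^ (-r)) ∂μ < ⊤ := by
  have hr0 : 0 ≤ r := le_trans (Nat.cast_nonneg _) hr.le
  have hi := (integrable_one_add_norm (μ := μ) hr).const_mul (|C| * 2 ^ r)
  refine lt_of_le_of_lt (setLIntegral_mono' hS fun z hz => ENNReal.ofReal_le_ofReal ?_)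
    (hi.integrableOn (s := S)).lintegral_lt_top
  have h := h1 z hz
  have e : (2 : ℝ) ^ r * (1 + ‖z‖) ^ (-r) = ((1 + ‖z‖) / 2) ^ (-r) := by
    rw [Real.div_rpow (by positivity) (by norm_num), Real.rpow_neg (by norm_num : (0:ℝ) ≤ 2)]
    field_simp
  rw [mul_assoc, e]
  refine mul_le_mul (le_abs_self C) ?_ (by positivity) (abs_nonneg C)
  exact Real.rpow_le_rpow_of_nonpos (by linarith) (by linarith) (by linarith)

section
variable {s : ℕ → ℝ} {c : ℝ}

theorem tendsto_kernel_self (hsN : ∀ N : ℕ, (N : ℝ) < s N) (hc : 1 ≤ c)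
    (hs : Tendsto (fun N => s N - N) atTop (𝓝 c)) {z : ℂ} (hz : 1 < ‖z‖) :
    Tendsto (fun N => kernel N (s N) z z 0 1) atTop (𝓝 (limForm c z z 0 1)) := by
  have h := (tendsto_kernelHat_sub hsN tendsto_id hc hs (tendsto_const_nhds (x := z))
    (tendsto_const_nhds (x := z)) hz hz 0 1).add_const (limForm c z z 0 1)
  rw [zero_add] at h
  refine h.congr fun N => ?_
  rw [sub_add_cancel, kernel_self_eq_kernelHat N _ hz]
  rfl

/-- For |z| > 1 the number 1 - z⁻² has positive real part, so the power is taken off its cut and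
commutes with conjugation. -/
theorem sqrtOut_conj {z : ℂ} (hz : 1 < ‖z‖) :
    sqrtOut z * sqrtOut ((starRingEnd ℂ) z) = ((‖sqrtOut z‖ ^ 2 : ℝ) : ℂ) ∧ 0 < ‖sqrtOut z‖ := by
  have h1 : ‖(z ^ 2)⁻¹‖ < 1 := by
    rw [norm_inv, norm_pow]
    exact inv_lt_one_of_one_lt₀ (one_lt_pow₀ hz two_ne_zero)
  have h2 : 1 - (z ^ 2)⁻¹ ∈ Complex.slitPlane := by
    left
    have := (Complex.re_le_norm _).trans_lt h1
    simp only [Complex.sub_re, Complex.one_re]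
    linarith
  have harg : (1 - (z ^ 2)⁻¹).arg ≠ Real.pi := (Complex.mem_slitPlane_iff_arg.1 h2).1
  have e : sqrtOut ((starRingEnd ℂ) z) = (starRingEnd ℂ) (sqrtOut z) := by
    rw [sqrtOut, sqrtOut, map_mul, ← map_pow, ← map_inv₀,
      show (1 : ℂ) - (starRingEnd ℂ) ((z ^ 2)⁻¹) = (starRingEnd ℂ) (1 - (z ^ 2)⁻¹) by simp,
      Complex.conj_cpow _ _ harg, map_div₀, map_one, Complex.conj_ofNat]
  refine ⟨by rw [e, Complex.mul_conj, Complex.normSq_eq_norm_sq], norm_pos_iff.2 ?_⟩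
  rw [sqrtOut]
  refine mul_ne_zero (norm_pos_iff.1 (by linarith)) ?_
  rw [Complex.cpow_ne_zero_iff]
  exact Or.inl (Complex.slitPlane_ne_zero h2)

/-- On the diagonal the entry is ι(z)B(z, z̄), in which uv = |z|² > 1, the two square roots multiply
to a squared modulus, and ι(z)(z̄-z) = 2|Im z|. Every factor is positive. -/
theorem limForm_self_re_pos (hc : 1 ≤ c) {z : ℂ} (hz : 1 < ‖z‖) (h0 : z.im ≠ 0) :
    0 < (limForm c z z 0 1).re := by
  have hz' : 1 < ‖(starRingEnd ℂ) z‖ := by rwa [RCLike.norm_conj]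
  have e : limForm c z z 0 1 = iota z * kerB c z ((starRingEnd ℂ) z) := by
    rw [← bilInf_outExp hz hz', ← bilInf_const_mul_right, ← outEps_of_im_ne_zero c h0]
    simp [limForm, lineSgn_of_im_ne_zero h0]
  obtain ⟨h1, h2⟩ := sqrtOut_conj hz
  have h3 : z * (starRingEnd ℂ) z = ((‖z‖ ^ 2 : ℝ) : ℂ) := by
    rw [Complex.mul_conj, Complex.normSq_eq_norm_sq]
  have h4 : 0 < ‖z‖ ^ 2 - 1 := by nlinarith
  have h5 : limForm c z z 0 1 = ((1 / Real.pi * (c + 1 / (‖z‖ ^ 2 - 1)) *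
      (1 / ‖z * (starRingEnd ℂ) z‖ ^ c) * (1 / (‖z‖ ^ 2 - 1)) *
      (2 * |z.im| / ‖sqrtOut z‖ ^ 2) : ℝ) : ℂ) := by
    have h6 := iota_mul_conj_sub h0
    rw [e, kerB, h1]
    push_cast
    rw [← h6, h3]
    push_cast
    ring
  rw [h5, Complex.ofReal_re]
  have h7 : 0 < ‖z * (starRingEnd ℂ) z‖ := by rw [norm_mul]; positivity
  have h8 := abs_pos.2 h0
  have h9 := Real.pi_pos
  positivity

theorem volume_im_eq_zero : volume {z : ℂ | z.im = 0} = 0 := by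
  have h := Measure.addHaar_submodule (volume : Measure ℂ) (LinearMap.ker Complex.imLm) (by
    intro h
    have : Complex.I ∈ LinearMap.ker Complex.imLm := by rw [h]; trivial
    simp at this)
  exact h

theorem tendsto_expectedRoots (hsN : ∀ N : ℕ, (N : ℝ) < s N) (hc : 1 ≤ c)
    (hs : Tendsto (fun N => s N - N) atTop (𝓝 c)) {S : Set ℂ} (hS : MeasurableSet S) {ρ : ℝ}
    (hρ : 1 < ρ) (hSρ : ∀ z ∈ S, ρ ≤ ‖z‖) (hpos : 0 < volume S) :
    ∃ L : ℝ, 0 < L ∧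
      Tendsto (fun N => expectedRoots N (s N) S) atTop (𝓝 (ENNReal.ofReal L)) := by
  have hSr : MeasurableSet (Complex.ofReal ⁻¹' S) := Complex.measurable_ofReal hS
  have hbd : ∀ᶠ N : ℕ in atTop, (N : ℝ) + 1 / 2 ≤ s N ∧ s N - N + 1 ≤ c + 2 := by
    filter_upwards [hs.eventually (lt_mem_nhds (by linarith : 1 / 2 < c)),
      hs.eventually (gt_mem_nhds (by linarith : c < c + 1))] with N h1 h2
    constructor <;> linarith
  -- The moment identities reduce the degree by two, so the densities are identified for N ≥ 2,
  -- which suffices for the limit.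
  have htwo : ∀ᶠ N : ℕ in atTop, ∃ k : ℕ, N = k + 2 ∧ (k : ℝ) + 2 < s (k + 2) := by
    filter_upwards [eventually_ge_atTop 2] with N hN
    obtain ⟨k, rfl⟩ : ∃ k, N = k + 2 := ⟨N - 2, by omega⟩
    exact ⟨k, rfl, by have := hsN (k + 2); push_cast at this; exact this⟩
  have hlim : ∀ z : ℂ, 1 < ‖z‖ → Tendsto (fun N => ENNReal.ofReal (kernel N (s N) z z 0 1).re) atTop
      (𝓝 (ENNReal.ofReal (limForm c z z 0 1).re)) := fun z hz =>
    ENNReal.tendsto_ofReal ((Complex.continuous_re.tendsto _).comp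
      (tendsto_kernel_self hsN hc hs hz))
  have hre : ∀ {z : ℂ} {B : ℝ}, ‖z‖ ≤ B → ENNReal.ofReal z.re ≤ ENNReal.ofReal B := fun h =>
    ENNReal.ofReal_le_ofReal ((Complex.re_le_norm _).trans h)
  -- Eventually s-N+1 ≤ c+2, which makes the majorants independent of N.
  set C₁ := (c + 2) * (2 * ρ * ρ) * ∑' p, bilMaj ρ⁻¹ p
  set C₂ := (c + 2) * (2 * ρ * (2 * ρ)) * (∑' p, bilMaj ρ⁻¹ p) +
    (c + 2) * ρ * ∑' k : ℕ, ρ⁻¹ ^ (2 * k + 1)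
  set f₁ : ℂ → ENNReal := fun z => if z.im = 0 then 0 else ENNReal.ofReal (limForm c z z 0 1).re
  set f₂ : ℝ → ENNReal := fun a => ENNReal.ofReal (limForm c a a 0 1).re
  have fin₁ : ∫⁻ z in S, ENNReal.ofReal (C₁ * ‖z‖ ^ (-3 : ℝ)) < ⊤ :=
    lintegral_rpow_neg_lt_top volume (by simp; norm_num) C₁ hS
      fun z hz => hρ.le.trans (hSρ z hz)
  have fin₂ : ∫⁻ a in Complex.ofReal ⁻¹' S, ENNReal.ofReal (C₂ * ‖a‖ ^ (-(3 / 2) : ℝ)) < ⊤ :=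
    lintegral_rpow_neg_lt_top volume (by simp; norm_num) C₂ hSr
      fun a ha => by have := hSρ _ ha; rw [Complex.norm_real] at this; linarith
  have lim₁ : ∀ z ∈ S, Tendsto (fun N => cplxDens N (s N) z) atTop (𝓝 (f₁ z)) := by
    intro z hz
    simp only [cplxDens, f₁]
    split_ifs
    · exact tendsto_const_nhds
    · exact hlim z (hρ.trans_le (hSρ z hz))
  have T₁ : Tendsto (fun N => ∫⁻ z in S, cplxDens N (s N) z) atTop (𝓝 (∫⁻ z in S, f₁ z)) := by
    refine tendsto_lintegral_filter_of_dominated_convergence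
      (fun z => ENNReal.ofReal (C₁ * ‖z‖ ^ (-3 : ℝ))) ?_ ?_ fin₁.ne
      ((ae_restrict_iff' hS).2 (Eventually.of_forall lim₁))
    · filter_upwards [htwo] with N hN
      obtain ⟨k, rfl, hk⟩ := hN
      exact measurable_cplxDens hk
    · filter_upwards [hbd] with N hN
      refine (ae_restrict_iff' hS).2 (Eventually.of_forall fun z hz => ?_)
      rw [cplxDens]
      split_ifs with h0
      · exact zero_le
      · exact hre (norm_kernel_le_of_im_ne_zero hN.1 hN.2 hρ (hSρ z hz) h0)
  have T₂ : Tendsto (fun N => ∫⁻ a in Complex.ofReal ⁻¹' S, realDens N (s N) a) atTop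
      (𝓝 (∫⁻ a in Complex.ofReal ⁻¹' S, f₂ a)) := by
    refine tendsto_lintegral_filter_of_dominated_convergence
      (fun a => ENNReal.ofReal (C₂ * ‖a‖ ^ (-(3 / 2) : ℝ))) ?_ ?_ fin₂.ne
      ((ae_restrict_iff' hSr).2 (Eventually.of_forall fun a ha =>
        hlim a (hρ.trans_le (hSρ _ ha))))
    · filter_upwards [htwo] with N hN
      obtain ⟨k, rfl, hk⟩ := hN
      exact measurable_realDens hk
    · filter_upwards [hbd] with N hN
      refine (ae_restrict_iff' hSr).2 (Eventually.of_forall fun a ha => ?_)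
      rw [← Complex.norm_real a]
      exact hre (norm_kernel_le_of_im_eq_zero hN.1 hN.2 hρ (hSρ _ ha))
  -- The limiting density inherits the integrable majorant, so the limit of the expectations is
  -- finite.
  have le₁ : ∫⁻ z in S, f₁ z ≤ ∫⁻ z in S, ENNReal.ofReal (C₁ * ‖z‖ ^ (-3 : ℝ)) := by
    refine setLIntegral_mono' hS fun z hz => le_of_tendsto (lim₁ z hz) ?_
    filter_upwards [hbd] with N hN
    rw [cplxDens]
    split_ifs with h0
    · exact zero_le
    · exact hre (norm_kernel_le_of_im_ne_zero hN.1 hN.2 hρ (hSρ z hz) h0)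
  have le₂ : ∫⁻ a in Complex.ofReal ⁻¹' S, f₂ a ≤
      ∫⁻ a in Complex.ofReal ⁻¹' S, ENNReal.ofReal (C₂ * ‖a‖ ^ (-(3 / 2) : ℝ)) := by
    refine setLIntegral_mono' hSr fun a ha => le_of_tendsto (hlim a (hρ.trans_le (hSρ _ ha))) ?_
    filter_upwards [hbd] with N hN
    rw [← Complex.norm_real a]
    exact hre (norm_kernel_le_of_im_eq_zero hN.1 hN.2 hρ (hSρ _ ha))
  -- The limiting density is positive off the real line, which is a null set; a zero integral would
  -- force S to be null.
  have pos₁ : ∫⁻ z in S, f₁ z ≠ 0 := by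
    intro h
    have hmeas : AEMeasurable f₁ (volume.restrict S) := by
      refine aemeasurable_of_tendsto_metrizable_ae atTop
        (f := fun k => cplxDens (k + 2) (s (k + 2))) (fun k => ?_)
        ((ae_restrict_iff' hS).2 (Eventually.of_forall fun z hz =>
          (lim₁ z hz).comp (tendsto_add_atTop_nat 2)))
      have := hsN (k + 2)
      push_cast at this
      exact (measurable_cplxDens this).aemeasurable
    rw [lintegral_eq_zero_iff' hmeas] at h
    have h1 := (ae_restrict_iff' hS).1 h
    have h2 : ∀ᵐ z : ℂ, z.im ≠ 0 := by
      rw [ae_iff]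
      simpa using volume_im_eq_zero
    refine hpos.ne' (measure_mono_null (fun z hz => ?_) (ae_iff.1 (h1.and h2)))
    rintro ⟨h3, h4⟩
    have h5 : f₁ z = 0 := h3 hz
    simp only [f₁, if_neg h4, ENNReal.ofReal_eq_zero] at h5
    exact h5.not_gt (limForm_self_re_pos hc (hρ.trans_le (hSρ z hz)) h4)
  set I := (∫⁻ a in Complex.ofReal ⁻¹' S, f₂ a) + ∫⁻ z in S, f₁ z with hI
  have hItop : I ≠ ⊤ := ENNReal.add_ne_top.2 ⟨(le₂.trans_lt fin₂).ne, (le₁.trans_lt fin₁).ne⟩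
  have hI0 : I ≠ 0 := fun h => pos₁ (add_eq_zero.1 h).2
  refine ⟨I.toReal, ENNReal.toReal_pos hI0 hItop, ?_⟩
  rw [ENNReal.ofReal_toReal hItop]
  refine (T₂.add T₁).congr' ?_
  filter_upwards [htwo] with N hN
  obtain ⟨k, rfl, hk⟩ := hN
  exact (expectedRoots_eq hk hS).symm

end

end MahlerEnsemble

theorem theorem2p7 (s : ℕ → ℝ) (hs : ∀ N : ℕ, (N : ℝ) < s N)
    (c : EReal) (hc : 1 ≤ c)
    (hlim : Tendsto (fun N : ℕ => ((s N - N : ℝ) : EReal)) atTop (𝓝 c)) :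
    TendstoLocallyUniformlyOn
      (fun (N : ℕ) (p : ℂ × ℂ) => MahlerEnsemble.kernelHat N (s N) p.1 p.2)
      (fun p : ℂ × ℂ => MahlerEnsemble.limitKernel c p.1 p.2)
      atTop (MahlerEnsemble.outside ×ˢ MahlerEnsemble.outside) ∧
    (c < ⊤ →
      ∀ S : Set ℂ, MeasurableSet S → (∃ ε : ℝ, 0 < ε ∧ ∀ z ∈ S, 1 + ε ≤ ‖z‖) →
        0 < (volume S : ENNReal) →
        ∃ L : ℝ, 0 < L ∧
          Tendsto (fun N : ℕ => MahlerEnsemble.expectedRoots N (s N) S) atTop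
            (𝓝 (ENNReal.ofReal L))) := by
  refine ⟨MahlerEnsemble.tendstoLocallyUniformlyOn_kernelHat hs hc hlim, ?_⟩
  rintro hct S hS ⟨ε, hε, hSε⟩ hpos
  obtain ⟨hc1, hs'⟩ := MahlerEnsemble.tendsto_toReal hc hct.ne hlim
  exact MahlerEnsemble.tendsto_expectedRoots hs hc1 hs' hS (by linarith) hSε hpos
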